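/- Let $m>2$. Write $g'=\sum_j|dz_j|^2$, $\omega'=\frac i2\sum_j dz_j\wedge d\bar z_j$, $\Omega'=dz_1\wedge\cdots\wedge dz_m$ on $\mathbb C^m$, and $B_R$ for the open ball of radius $R$ about $0$ in $\mathbb C^m$. Let $(M,J,\omega,\Omega)$ be an almost Calabi--Yau $m$-fold: $(M,J)$ is a compact complex $m$-manifold, $\omega$ is the Kähler form of a Kähler metric on $M$, and $\Omega$ is a non-vanishing holomorphic $(m,0)$-form. Let $\psi:M\to(0,\infty)$ be defined by $\psi^{2m}\omega^m/m!=(-1)^{m(m-1)/2}(i/2)^m\,\Omega\wedge\bar\Omega$. A submanifold $N\subset M$ of real dimension $m$ is special Lagrangian (SL) if $\omega|_N\equiv\mathrm{Im}\,\Omega|_N\equiv0$. An SL cone $C$ in $\mathbb C^m$ with isolated singularity at $0$ is a closed set $C\subset\mathbb C^m$ with $tC=C$ for all $t>0$ such that $C\setminus\{0\}$ is a nonempty embedded $m$-submanifold calibrated, for some orientation, by $\mathrm{Re}\,\Omega'$. Its link is $\Sigma=C\cap\mathcal S^{2m-1}$, and $\mathcal D_\Sigma$ is the set of $\alpha\in\mathbb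 R$ such that $\alpha(\alpha+m-2)$ is an eigenvalue of the Laplacian $\Delta_\Sigma=d^*d$ of the metric induced by $g'$ on $\Sigma$. Let $X\subset M$ be compact, let $x_1,\dots,x_n\in X$ be distinct, and suppose that $X'=X\setminus\{x_1,\dots,x_n\}$ is an embedded SL $m$-fold. Let $\upsilon_i:\mathbb C^m\to T_{x_i}M$ be isomorphisms with $\upsilon_i^*(\omega)=\omega'$ and $\upsilon_i^*(\Omega)=\psi(x_i)^m\Omega'$, let $C_1,\dots,C_n$ be SL cones in $\mathbb C^m$ with isolated singularities at $0$ and links $\Sigma_i$, and let $\mu_i\in(2,3)$ with $(2,\mu_i]\cap\mathcal D_{\Sigma_i}=\emptyset$. For $R>0$, call embeddings $\Upsilon_i:B_R\to M$ $(i=1,\dots,n)$ *admissible* if $\Upsilon_i(0)=x_i$, $d\Upsilon_i|_0=\upsilon_i$ and $\Upsilon_i^*(\omega)=\omega'$. Put $\iota_i(\sigma,r)=r\sigma$. Given $R$, admissible $\Upsilon_i$ and $R'\in(0,R]$, we say that $(\phi_i,S_i)_{i=1}^n$ satisfies condition $(*)$ if * $S_1,\dots,S_n$ are open subsets of $X'$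 with $S_i\subset\Upsilon_i(B_R)$, their closures are pairwise disjoint, and $X'\setminus K=S_1\cup\dots\cup S_n$ for some compact $K\subset X'$; * each $\phi_i:\Sigma_i\times(0,R')\to B_R$ is smooth, and $\Upsilon_i\circ\phi_i$ is a diffeomorphism of $\Sigma_i\times(0,R')$ onto $S_i$; * $|\nabla^k(\phi_i-\iota_i)|=O(r^{\mu_i-1-k})$ as $r\to0$ for $k=0,1$, with $\nabla$ and $|\cdot|$ computed using the cone metric $\iota_i^*(g')$. Suppose that $X$ has conical singularities at $x_1,\dots,x_n$ with identifications $\upsilon_i$, cones $C_i$ and rates $\mu_i$, i.e. for some $R>0$, some admissible $\Upsilon_i$ and some $R'\in(0,R]$ there exists $(\phi_i,S_i)_{i=1}^n$ satisfying $(*)$. **Theorem.** Let $R>0$ and admissible $\Upsilon_i:B_R\to M$ be arbitrary. Then there is $R_0\in(0,R]$ such that for every $R'\in(0,R_0]$ there exists a unique $(\phi_i,S_i)_{i=1}^n$ which satisfies $(*)$ and $$(\phi_i-\iota_i)(\sigma,r)\perp T_{\iota_i(\sigma,r)}C_i\quad\text{in }\mathbb C^m\text{ for all }(\sigma,r)\in\Sigma_i\times(0,R'),\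 i=1,\dots,n.$$ -/

import Mathlib

open Set
open scoped Manifold ContDiff

noncomputable section

/-- `ℂ^m`; its real inner product is the metric `g' = ∑ |dz_j|²`. -/
abbrev CSpace (m : ℕ) : Type := EuclideanSpace ℂ (Fin m)

/-! ### Submanifolds -/

/-- `N` is an embedded smooth `k`-dimensional submanifold (without boundary, not necessarily closed)
of `M`: around each of its points there is a smooth chart of `M` in which `N` is a `k`-dimensional
linear subspace. -/
def IsEmbeddedSubmanifold {F : Type*} [NormedAddCommGroup F] [NormedSpace ℝ F]
    {M : Type*} [TopologicalSpace M] [ChartedSpace F M] (k : ℕ) (N : Set M) : Prop :=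
  ∀ p ∈ N, ∃ e ∈ IsManifold.maximalAtlas 𝓘(ℝ, F) ∞ M, p ∈ e.source ∧
    ∃ W : Submodule ℝ F, Module.finrank ℝ W = k ∧ ∀ q ∈ e.source, q ∈ N ↔ e q ∈ W

/-- The tangent space at `p` of a submanifold `A` of a normed space: the span of its tangent cone. -/
def tangentSubspace {F : Type*} [NormedAddCommGroup F] [NormedSpace ℝ F]
    (A : Set F) (p : F) : Submodule ℝ F :=
  Submodule.span ℝ (tangentConeAt ℝ A p)

/-- The tangent space `T_x N ⊆ T_x M` of a submanifold `N` of a manifold `M`, computed in the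
preferred chart at `x`, through which `T_x M` is identified with the model space. -/
def submanifoldTangent {F : Type*} [NormedAddCommGroup F] [NormedSpace ℝ F]
    {M : Type*} [TopologicalSpace M] [ChartedSpace F M] (N : Set M) (x : M) :
    Submodule ℝ (TangentSpace 𝓘(ℝ, F) x) :=
  tangentSubspace (F := F) ((chartAt F x) '' (N ∩ (chartAt F x).source)) (chartAt F x x)

/-! ### The standard forms on `ℂ^m` -/

/-- `ω' = ∑ dx_j ∧ dy_j = (i/2) ∑ dz_j ∧ dz̄_j`. -/
def stdOmega {m : ℕ} (u v : CSpace m) : ℝ :=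
  ∑ j, ((u j).re * (v j).im - (u j).im * (v j).re)

/-- `Ω' = dz_1 ∧ ⋯ ∧ dz_m`. -/
def stdVol {m : ℕ} (v : Fin m → CSpace m) : ℂ :=
  Matrix.det (Matrix.of fun i j => v i j)

/-! ### Almost Calabi–Yau manifolds -/

/-- The value of `ω^m = ω ∧ ⋯ ∧ ω` on `2m` vectors, for a 2-form `ω`. -/
def wedgePow {V : Type*} (m : ℕ) (w : V → V → ℝ) (v : Fin (2 * m) → V) : ℝ :=
  ((2 : ℝ) ^ m)⁻¹ * ∑ s : Equiv.Perm (Fin (2 * m)), ((Equiv.Perm.sign s : ℤ) : ℝ) *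
    ∏ j : Fin m, w (v (s ⟨2 * j, by omega⟩)) (v (s ⟨2 * j + 1, by omega⟩))

/-- The value of `Ω ∧ Ω̄` on `2m` vectors, for a complex-valued `m`-form `Ω`. -/
def wedgeConj {V : Type*} (m : ℕ) (Om : (Fin m → V) → ℂ) (v : Fin (2 * m) → V) : ℂ :=
  ((m.factorial : ℂ) * (m.factorial : ℂ))⁻¹ *
    ∑ s : Equiv.Perm (Fin (2 * m)), ((Equiv.Perm.sign s : ℤ) : ℂ) *
      (Om (fun i => v (s ⟨i, by omega⟩)) *
        (starRingEnd ℂ) (Om (fun i => v (s ⟨m + i, by omega⟩))))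

section ACY

variable {m : ℕ} {M : Type*} [TopologicalSpace M] [ChartedSpace (CSpace m) M]

/-- The complex structure `J` on `T_x M`. -/
def tangentJ (x : M) (v : TangentSpace 𝓘(ℝ, CSpace m) x) : TangentSpace 𝓘(ℝ, CSpace m) x :=
  let w : CSpace m := v
  Complex.I • w

/-- The representation in a chart `e` of a real 2-form on `M`, i.e. its pullback by `e⁻¹`. -/
def chartForm (w : ∀ x : M, TangentSpace 𝓘(ℝ, CSpace m) x [⋀^Fin 2]→L[ℝ] ℝ)
    (e : OpenPartialHomeomorph M (CSpace m)) (y : CSpace m) : CSpace m [⋀^Fin 2]→L[ℝ] ℝ :=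
  (w (e.symm y)).compContinuousLinearMap
    (mfderiv 𝓘(ℝ, CSpace m) 𝓘(ℝ, CSpace m) e.symm y)

/-- The representation in a holomorphic chart `e` of an `(m,0)`-form on `M`. -/
def chartVol (Om : ∀ x : M, TangentSpace 𝓘(ℂ, CSpace m) x [⋀^Fin m]→L[ℂ] ℂ)
    (e : OpenPartialHomeomorph M (CSpace m)) (y : CSpace m) : CSpace m [⋀^Fin m]→L[ℂ] ℂ :=
  (Om (e.symm y)).compContinuousLinearMap
    (mfderiv 𝓘(ℂ, CSpace m) 𝓘(ℂ, CSpace m) e.symm y)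

end ACY

/-- The data `(ω, Ω)` making a compact complex `m`-manifold `M` an almost Calabi–Yau `m`-fold: `ω`
is the Kähler form of a Kähler metric `g`, `g(u,v) = ω(u,Jv)`, and `Ω` is a non-vanishing
holomorphic `(m,0)`-form. -/
structure AlmostCalabiYau (m : ℕ) (M : Type*) [TopologicalSpace M] [T2Space M] [CompactSpace M]
    [ChartedSpace (CSpace m) M] [IsManifold 𝓘(ℂ, CSpace m) ω M] where
  two_le : 2 ≤ m
  /-- the Kähler form `ω` -/
  kahler : ∀ x : M, TangentSpace 𝓘(ℝ, CSpace m) x [⋀^Fin 2]→L[ℝ] ℝ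
  /-- the holomorphic volume form `Ω` -/
  vol : ∀ x : M, TangentSpace 𝓘(ℂ, CSpace m) x [⋀^Fin m]→L[ℂ] ℂ
  kahler_smooth : ∀ e ∈ atlas (CSpace m) M, ContDiffOn ℝ ∞ (chartForm kahler e) e.target
  kahler_closed : ∀ e ∈ atlas (CSpace m) M, ∀ y ∈ e.target, extDeriv (chartForm kahler e) y = 0
  kahler_compat : ∀ (x : M) (u v : TangentSpace 𝓘(ℝ, CSpace m) x),
    kahler x ![tangentJ x u, tangentJ x v] = kahler x ![u, v]
  kahler_pos : ∀ (x : M) (v : TangentSpace 𝓘(ℝ, CSpace m) x), v ≠ 0 →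
    0 < kahler x ![v, tangentJ x v]
  vol_holomorphic : ∀ e ∈ atlas (CSpace m) M, DifferentiableOn ℂ (chartVol vol e) e.target
  vol_ne_zero : ∀ x : M, vol x ≠ 0

section Conical

variable {m : ℕ} {M : Type*} [TopologicalSpace M] [T2Space M] [CompactSpace M]
    [ChartedSpace (CSpace m) M] [IsManifold 𝓘(ℂ, CSpace m) ω M]

/-- `Ω` evaluated on tangent vectors of the underlying real manifold. -/
def AlmostCalabiYau.volReal (Y : AlmostCalabiYau m M) (x : M)
    (v : Fin m → TangentSpace 𝓘(ℝ, CSpace m) x) : ℂ :=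
  Y.vol x v

/-- `ψ : M → (0,∞)` satisfies `ψ^{2m} ω^m / m! = (-1)^{m(m-1)/2} (i/2)^m Ω ∧ Ω̄`. -/
def AlmostCalabiYau.IsConformalFactor (Y : AlmostCalabiYau m M) (ψ : M → ℝ) : Prop :=
  (∀ x, 0 < ψ x) ∧
  ∀ (x : M) (v : Fin (2 * m) → TangentSpace 𝓘(ℝ, CSpace m) x),
    (((ψ x) ^ (2 * m) * (wedgePow m (fun a b => Y.kahler x ![a, b]) v / m.factorial) : ℝ) : ℂ) =
      (-1) ^ (m * (m - 1) / 2) * (Complex.I / 2) ^ m * wedgeConj m (Y.volReal x) v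

/-- A (nonsingular, embedded) special Lagrangian `m`-fold in an almost Calabi–Yau `m`-fold:
`ω|_N = 0` and `Im Ω|_N = 0`. -/
def AlmostCalabiYau.IsSLFold (Y : AlmostCalabiYau m M) (N : Set M) : Prop :=
  IsEmbeddedSubmanifold (F := CSpace m) m N ∧
  ∀ x ∈ N,
    (∀ u ∈ submanifoldTangent (F := CSpace m) N x, ∀ v ∈ submanifoldTangent (F := CSpace m) N x,
      Y.kahler x ![u, v] = 0) ∧
    (∀ v : Fin m → TangentSpace 𝓘(ℝ, CSpace m) x,
      (∀ i, v i ∈ submanifoldTangent (F := CSpace m) N x) → (Y.volReal x v).im = 0)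

end Conical

/-! ### Special Lagrangian cones and the set `𝒟_Σ` -/

/-- A nonsingular SL `m`-fold in `ℂ^m`, i.e. one that is calibrated by `Re Ω'`: every tangent space
has an orthonormal basis on which `Re Ω'` is `1`. (The orientation in which `Re Ω'` is the volume
form is thus the one in which `Re Ω'` is positive.) -/
def IsSLFoldFlat {m : ℕ} (N : Set (CSpace m)) : Prop :=
  IsEmbeddedSubmanifold (F := CSpace m) m N ∧
  ∀ p ∈ N, ∃ b : Fin m → CSpace m, Orthonormal ℝ b ∧
    Submodule.span ℝ (range b) = tangentSubspace N p ∧ (stdVol b).re = 1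

/-- A closed SL cone in `ℂ^m` with (at most) an isolated singularity at `0`. -/
structure IsSLCone {m : ℕ} (C : Set (CSpace m)) : Prop where
  closed : IsClosed C
  cone : ∀ t : ℝ, 0 < t → (fun y => t • y) '' C = C
  nontrivial : (C \ {0}).Nonempty
  slFold : IsSLFoldFlat (C \ {0})

/-- The link `Σ = C ∩ 𝒮^{2m-1}`. -/
def link {m : ℕ} (C : Set (CSpace m)) : Set (CSpace m) := C ∩ Metric.sphere 0 1

section Laplace

variable {F : Type*} [NormedAddCommGroup F] [InnerProductSpace ℝ F] [FiniteDimensional ℝ F]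

/-- The gradient at `p`, for the induced metric, of a function `v` on a submanifold `A` of a
Euclidean space. Only the restriction of `v` to `A` matters. -/
def tangentialGradient (A : Set F) (v : F → ℝ) (p : F) : F :=
  letI := FiniteDimensional.complete ℝ F
  (tangentSubspace A p).starProjection (gradientWithin v A p)

/-- The Laplacian `Δ v = d^* d v = - div (grad v)` at `p` of a function on a submanifold `A` of a
Euclidean space with the induced metric; the divergence of a tangent field `X` is the trace over
`T_p A` of the tangential part of `D X`. -/
def submanifoldLaplacian (A : Set F) (v : F → ℝ) (p : F) : ℝ :=
  let P : F →L[ℝ] F := (tangentSubspace A p).starProjection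
  let D : F →L[ℝ] F := fderivWithin ℝ (tangentialGradient A v) A p
  (-1) * LinearMap.trace ℝ F ((P ∘L D ∘L P : F →L[ℝ] F) : F →ₗ[ℝ] F)

/-- `l` is an eigenvalue of the Laplacian on smooth functions on `A`. -/
def IsLaplaceEigenvalue (A : Set F) (l : ℝ) : Prop :=
  ∃ v : F → ℝ, ContDiffOn ℝ ∞ v A ∧ (∃ p ∈ A, v p ≠ 0) ∧
    ∀ p ∈ A, submanifoldLaplacian A v p = l * v p

end Laplace

/-- `𝒟_Σ`, the set of `α` such that `α(α+m-2)` is an eigenvalue of the Laplacian of `Σ`. -/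
def critRates (m : ℕ) (Sg : Set (CSpace m)) : Set ℝ :=
  {a | IsLaplaceEigenvalue Sg (a * (a + m - 2))}

/-! ### Conical singularities -/

section Conical

variable {m : ℕ} {M : Type*} [TopologicalSpace M] [T2Space M] [CompactSpace M]
    [ChartedSpace (CSpace m) M] [IsManifold 𝓘(ℂ, CSpace m) ω M]

/-- An isomorphism `υ : ℂ^m → T_x M` with `υ^* ω = ω'` and `υ^* Ω = ψ(x)^m Ω'`. -/
def AlmostCalabiYau.IsIdentification (Y : AlmostCalabiYau m M) (ψ : M → ℝ) (x : M)
    (υ : CSpace m ≃L[ℝ] TangentSpace 𝓘(ℝ, CSpace m) x) : Prop :=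
  (∀ u v : CSpace m, Y.kahler x ![υ u, υ v] = stdOmega u v) ∧
  ∀ v : Fin m → CSpace m, Y.volReal x (fun i => υ (v i)) = ((ψ x ^ m : ℝ) : ℂ) * stdVol v

/-- `Υ : B_R → M` is a smooth embedding with `Υ(0) = x`, `dΥ|_0 = υ` and `Υ^* ω = ω'`. -/
structure AlmostCalabiYau.IsDarbouxEmbedding (Y : AlmostCalabiYau m M) (x : M)
    (υ : CSpace m ≃L[ℝ] TangentSpace 𝓘(ℝ, CSpace m) x) (R : ℝ) (Υ : CSpace m → M) : Prop where
  smooth : ContMDiffOn 𝓘(ℝ, CSpace m) 𝓘(ℝ, CSpace m) ∞ Υ (Metric.ball 0 R)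
  embedding : Topology.IsEmbedding fun y : Metric.ball (0 : CSpace m) R => Υ y
  immersion : ∀ y ∈ Metric.ball (0 : CSpace m) R,
    Function.Injective (mfderiv 𝓘(ℝ, CSpace m) 𝓘(ℝ, CSpace m) Υ y)
  map_zero : Υ 0 = x
  deriv_zero : ∀ v : CSpace m,
    (mfderiv 𝓘(ℝ, CSpace m) 𝓘(ℝ, CSpace m) Υ 0 v : CSpace m) = (υ v : CSpace m)
  symplectic : ∀ y ∈ Metric.ball (0 : CSpace m) R, ∀ u v : CSpace m,
    Y.kahler (Υ y) ![mfderiv 𝓘(ℝ, CSpace m) 𝓘(ℝ, CSpace m) Υ y u,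
      mfderiv 𝓘(ℝ, CSpace m) 𝓘(ℝ, CSpace m) Υ y v] = stdOmega u v

/-- `f` restricts to a diffeomorphism of `A` onto `S`, for submanifolds `A` of a normed space and
`S` of `M`. (For a map on a submanifold, `ContMDiffOn` is smoothness along the submanifold.) -/
def IsDiffeoOnto {G : Type*} [NormedAddCommGroup G] [NormedSpace ℝ G]
    (f : G → M) (A : Set G) (S : Set M) : Prop :=
  BijOn f A S ∧ ContMDiffOn 𝓘(ℝ, G) 𝓘(ℝ, CSpace m) ∞ f A ∧
  ∃ h : M → G, InvOn h f A S ∧ ContMDiffOn 𝓘(ℝ, CSpace m) 𝓘(ℝ, G) ∞ h S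

/-- `|∇^k (φ - ι)| = O(r^{μ-1-k})` as `r → 0` for `k = 0, 1`, where `ι(σ,r) = rσ` on `Σ × (0,R')`.
The cone metric is `dr² + r² g_Σ`, so the length of the tangent vector `(s,t)` at `(σ,r)` is
`√(t² + r²|s|²)`. -/
def ConicalDecay (Sg : Set (CSpace m)) (μ R' : ℝ) (φ : CSpace m × ℝ → CSpace m) : Prop :=
  ∃ c > 0, ∃ ε > 0, ∀ σ ∈ Sg, ∀ r ∈ Ioo 0 R', r < ε →
    ‖φ (σ, r) - r • σ‖ ≤ c * r ^ (μ - 1) ∧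
    ∀ s ∈ tangentSubspace Sg σ, ∀ t : ℝ,
      ‖fderivWithin ℝ (fun q : CSpace m × ℝ => φ q - q.2 • q.1) (Sg ×ˢ Ioo 0 R') (σ, r) (s, t)‖
        ≤ c * r ^ (μ - 2) * √(t ^ 2 + r ^ 2 * ‖s‖ ^ 2)

/-- The conditions on `φ_i : Σ_i × (0,R') → B_R` and `S_i ⊆ X' = X \ {x_1,…,x_n}` in the definition
of conical singularities of `X` at `x_i` with cones `C_i` and rates `μ_i`. The maps `φ_i` are
represented by total functions, of which only the restrictions to `Σ_i × (0,R')` matter. -/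
structure IsConicalParametrization {n : ℕ} (X : Set M) (x : Fin n → M)
    (C : Fin n → Set (CSpace m)) (μ : Fin n → ℝ) (R : ℝ) (Υ : Fin n → CSpace m → M) (R' : ℝ)
    (φ : Fin n → CSpace m × ℝ → CSpace m) (S : Fin n → Set M) : Prop where
  exists_compact : ∃ K ⊆ X \ range x, IsCompact K ∧ (X \ range x) \ K = ⋃ i, S i
  isOpen : ∀ i, ∃ U : Set M, IsOpen U ∧ S i = (X \ range x) ∩ U
  subset_image : ∀ i, S i ⊆ Υ i '' Metric.ball 0 R
  disjoint_closure : Pairwise fun i j => Disjoint (closure (S i)) (closure (S j))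
  smooth : ∀ i, ContDiffOn ℝ ∞ (φ i) (link (C i) ×ˢ Ioo 0 R')
  mapsTo : ∀ i, MapsTo (φ i) (link (C i) ×ˢ Ioo 0 R') (Metric.ball 0 R)
  diffeo : ∀ i, IsDiffeoOnto (m := m) (Υ i ∘ φ i) (link (C i) ×ˢ Ioo 0 R') (S i)
  decay : ∀ i, ConicalDecay (link (C i)) (μ i) R' (φ i)

/-- `X` is a compact SL `m`-fold in `M` whose only singularities are conical singularities at the
distinct points `x_1,…,x_n`, with identifications `υ_i`, cones `C_i` and rates `μ_i`. -/
structure AlmostCalabiYau.HasConicalSingularities (Y : AlmostCalabiYau m M) (ψ : M → ℝ) {n : ℕ}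
    (X : Set M) (x : Fin n → M) (υ : ∀ i, CSpace m ≃L[ℝ] TangentSpace 𝓘(ℝ, CSpace m) (x i))
    (C : Fin n → Set (CSpace m)) (μ : Fin n → ℝ) : Prop where
  compact : IsCompact X
  injective : Function.Injective x
  mem : ∀ i, x i ∈ X
  slFold : Y.IsSLFold (X \ range x)
  identification : ∀ i, Y.IsIdentification ψ (x i) (υ i)
  cone : ∀ i, IsSLCone (C i)
  rate_mem : ∀ i, μ i ∈ Ioo (2 : ℝ) 3
  rate_disjoint : ∀ i, Ioc 2 (μ i) ∩ critRates m (link (C i)) = ∅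
  exists_param : ∃ R > 0, ∃ Υ : Fin n → CSpace m → M,
    (∀ i, Y.IsDarbouxEmbedding (x i) (υ i) R (Υ i)) ∧
    ∃ R' ∈ Ioc 0 R, ∃ φ S, IsConicalParametrization X x C μ R Υ R' φ S

/-- `(φ - ι)(σ,r)` is orthogonal to `T_{ι(σ,r)} C` for all `(σ,r) ∈ Σ × (0,R')`. -/
def IsNormalToCone (C : Set (CSpace m)) (R' : ℝ) (φ : CSpace m × ℝ → CSpace m) : Prop :=
  ∀ σ ∈ link C, ∀ r ∈ Ioo 0 R', ∀ v ∈ tangentSubspace (C \ {0}) (r • σ),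
    inner ℝ (φ (σ, r) - r • σ) v = 0

end Conical

end

/-!
# Normal parametrizations of conical singularities

Let `π` be the nearest point projection onto the cone `C`, defined on a conical neighbourhood of
`C ∖ {0}` (`IsConeTube`, `exists_isConeTube`). A map `φ` on `Σ × (0, R')` is normal to the cone when
`π (φ (σ, r)) = r σ`, so a normal parametrization of the end of `X` at `x_i` is a section of `π` over
the cone with values in the preimage of `X`. This makes it unique for small `r`, where `φ` is close
to the cone, and then on each whole ray, by continuity (`IsNormalEnd.eqOn`).

For existence, the two given Darboux embeddings differ by a diffeomorphism tangent to the identity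
(`exists_transition`), which preserves asymptotics of rate `μ ≤ 3`. The end of `X` is therefore the
image of a map `f` on the cone asymptotic to the inclusion, together with its first derivatives
(`IsConePerturbation`). In scale-invariant terms `π ∘ f` is `C¹`-close to the identity near the apex,
hence invertible there by the contraction principle and the inverse function theorem, and
`f ∘ (π ∘ f)⁻¹` is the required section (`IsConeTube.exists_normal_reparam`).

This identifies the new ends with pieces of `X` only if `X` has no points near `x_i` besides those
with small `r`. The definition of conical singularities restricts the behaviour of `φ` at `r → 0`
only, and one has to exclude that the opposite end `r → R'` returns to `x_i`
(`IsConicalParametrization.exists_nhds_end`). If it did, a part of `X`, seen in the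
Darboux ball, would be a submanifold `Q` whose union with `{0}` is compact
(`closed_end_or_exists_double_end`). Let `η = Υ^* Ω`. The form `β = ι_{Iz} Im η` has two properties:
* `d(|z|²/2) ∧ β` is nonnegative on `Q` for the orientation given by `Re η`, by linear algebra on
  Lagrangian subspaces (`sum_mul_im_mul_re_nonneg`), so cutting `β` off near `0` has the right sign;
* `β / m` agrees to first order at `0` with a primitive `α` of `Re η` (`exists_potentials`), so that
  the error made in interpolating between `β / m` and `α` at a small radius is small.

The resulting form `Γ` has compact support on `Q`, with `dΓ` nonnegative and not identically zero,
which contradicts Stokes' theorem (`extDeriv_eq_zero_of_nonneg`, `not_isCompact_of_calibrated`).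
-/

open Set Filter Topology Metric
open scoped Manifold ContDiff

set_option linter.unusedSectionVars false

noncomputable section

/-! ### Calculus -/

/-- The inverse function theorem for smooth maps, with a single neighbourhood on which the inverse is
`C^∞` (and not merely `C^n` on a neighbourhood depending on `n`). -/
theorem exists_localInverse {E F : Type*} [NormedAddCommGroup E] [NormedSpace ℝ E]
    [NormedAddCommGroup F] [NormedSpace ℝ F] [CompleteSpace E] {f : E → F} {s : Set E} {a : E}
    (hs : IsOpen s) (has : a ∈ s) (hf : ContDiffOn ℝ ∞ f s) (f' : E ≃L[ℝ] F)
    (hf' : HasFDerivAt f (f' : E →L[ℝ] F) a) :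
    ∃ e : OpenPartialHomeomorph E F, a ∈ e.source ∧ e.source ⊆ s ∧ (∀ x, e x = f x) ∧
      ContDiffOn ℝ ∞ e.symm e.target := by
  have hfa : ContDiffAt ℝ ∞ f a := hf.contDiffAt (hs.mem_nhds has)
  let e₀ := hfa.toOpenPartialHomeomorph f hf' (by simp)
  have hcont : ContinuousOn (fderiv ℝ f) s := hf.continuousOn_fderiv_of_isOpen hs (by simp)
  let s' := s ∩ fderiv ℝ f ⁻¹' range ((↑) : (E ≃L[ℝ] F) → (E →L[ℝ] F))
  have hs' : IsOpen s' := hcont.isOpen_inter_preimage hs ContinuousLinearEquiv.isOpen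
  have has' : a ∈ s' := ⟨has, f', hf'.fderiv.symm⟩
  refine ⟨e₀.restrOpen s' hs', ?_, ?_, fun x => rfl, ?_⟩
  · exact ⟨hfa.mem_toOpenPartialHomeomorph_source hf' (by simp), has'⟩
  · intro x hx
    exact hx.2.1
  · intro y hy
    have hy1 : (e₀.restrOpen s' hs').symm y ∈ (e₀.restrOpen s' hs').source :=
      (e₀.restrOpen s' hs').map_target hy
    obtain ⟨g, hg⟩ := hy1.2.2
    have hsn : s ∈ 𝓝 ((e₀.restrOpen s' hs').symm y) := hs.mem_nhds hy1.2.1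
    have hd : ContDiffAt ℝ ∞ f ((e₀.restrOpen s' hs').symm y) := hf.contDiffAt hsn
    refine ((e₀.restrOpen s' hs').contDiffAt_symm (f₀' := g) hy ?_ hd).contDiffWithinAt
    rw [hg]
    exact (hd.differentiableAt (by simp)).hasFDerivAt

/-- An injective linear map between spaces of the same finite dimension is a continuous linear
equivalence. -/
theorem ContinuousLinearMap.exists_equiv_of_injective {E F : Type*} [NormedAddCommGroup E]
    [NormedSpace ℝ E] [NormedAddCommGroup F] [NormedSpace ℝ F] [FiniteDimensional ℝ E]
    [FiniteDimensional ℝ F] (D : E →L[ℝ] F) (hD : Function.Injective D)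
    (h : Module.finrank ℝ E = Module.finrank ℝ F) :
    ∃ D' : E ≃L[ℝ] F, (D' : E →L[ℝ] F) = D :=
  ⟨(LinearEquiv.ofBijective (D : E →ₗ[ℝ] F) ⟨hD,
    (LinearMap.injective_iff_surjective_of_finrank_eq_finrank h).1 hD⟩).toContinuousLinearEquiv,
    ContinuousLinearMap.ext fun _ => rfl⟩

section TangentSubspace

variable {E F : Type*} [NormedAddCommGroup E] [NormedSpace ℝ E] [NormedAddCommGroup F]
  [NormedSpace ℝ F]

theorem tangentSubspace_map {f : E → F} {f' : E →L[ℝ] F} {s : Set E} {t : Set F} {x : E}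
    (hf : HasFDerivWithinAt f f' s x) (hst : MapsTo f s t) {v : E}
    (hv : v ∈ tangentSubspace s x) : f' v ∈ tangentSubspace t (f x) := by
  have h : Submodule.span ℝ (tangentConeAt ℝ s x) ≤
      (tangentSubspace t (f x)).comap (f' : E →ₗ[ℝ] F) := by
    refine Submodule.span_le.2 fun w hw => ?_
    exact Submodule.subset_span
      (tangentConeAt_mono hst.image_subset (hf.mapsTo_tangent_cone hw))
  exact h hv

theorem tangentSubspace_univ_of_mem_nhds {s : Set E} {x : E} (hs : s ∈ 𝓝 x) (v : E) :
    v ∈ tangentSubspace s x :=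
  Submodule.subset_span (by rw [tangentConeAt_of_mem_nhds hs]; trivial)

theorem tangentSubspace_mono {s t : Set E} (h : s ⊆ t) (x : E) :
    tangentSubspace s x ≤ tangentSubspace t x :=
  Submodule.span_mono (tangentConeAt_mono h)

/-- A derivative within `s` is determined on the tangent space of `s`. -/
theorem HasFDerivWithinAt.eqOn_tangentSubspace {f : E → F} {f' f'' : E →L[ℝ] F} {s : Set E} {x : E}
    (h : HasFDerivWithinAt f f' s x) (h' : HasFDerivWithinAt f f'' s x) {v : E}
    (hv : v ∈ tangentSubspace s x) : f' v = f'' v := by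
  have : Submodule.span ℝ (tangentConeAt ℝ s x) ≤
      LinearMap.eqLocus (f' : E →ₗ[ℝ] F) (f'' : E →ₗ[ℝ] F) :=
    Submodule.span_le.2 fun w hw => h.unique_on h' hw
  exact this hv

theorem tangentSubspace_inter_nhds {s t : Set E} {x : E} (ht : t ∈ 𝓝 x) :
    tangentSubspace (s ∩ t) x = tangentSubspace s x := by
  rw [tangentSubspace, tangentConeAt_inter_nhds ht, tangentSubspace]

end TangentSubspace

/-! ### Local parametrizations of submanifolds -/

/-- `g : O → N ∩ U` is a smooth parametrization, with smooth inverse `H`, of the open piece `N ∩ U` of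
a `k`-dimensional submanifold `N` by an open set `O` of `ℝ^k`. -/
structure IsLocalParam {F : Type*} [NormedAddCommGroup F] [NormedSpace ℝ F] {k : ℕ}
    (N : Set F) (O : Set (EuclideanSpace ℝ (Fin k))) (g : EuclideanSpace ℝ (Fin k) → F)
    (U : Set F) (H : F → EuclideanSpace ℝ (Fin k)) : Prop where
  isOpen_source : IsOpen O
  isOpen_target : IsOpen U
  smooth : ContDiffOn ℝ ∞ g O
  smooth_inv : ContDiffOn ℝ ∞ H (N ∩ U)
  mapsTo : MapsTo g O (N ∩ U)
  mapsTo_inv : MapsTo H (N ∩ U) O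
  leftInv : LeftInvOn H g O
  rightInv : LeftInvOn g H (N ∩ U)

namespace IsLocalParam

variable {F : Type*} [NormedAddCommGroup F] [NormedSpace ℝ F] {k : ℕ} {N : Set F}
  {O : Set (EuclideanSpace ℝ (Fin k))} {g : EuclideanSpace ℝ (Fin k) → F}
  {U : Set F} {H : F → EuclideanSpace ℝ (Fin k)}

theorem contDiffAt (h : IsLocalParam N O g U H) {w} (hw : w ∈ O) : ContDiffAt ℝ ∞ g w :=
  h.smooth.contDiffAt (h.isOpen_source.mem_nhds hw)

theorem hasFDerivAt (h : IsLocalParam N O g U H) {w} (hw : w ∈ O) :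
    HasFDerivAt g (fderiv ℝ g w) w :=
  ((h.contDiffAt hw).differentiableAt (by simp)).hasFDerivAt

theorem hasFDerivWithinAt_inv (h : IsLocalParam N O g U H) {p} (hp : p ∈ N ∩ U) :
    HasFDerivWithinAt H (fderivWithin ℝ H (N ∩ U) p) (N ∩ U) p :=
  ((h.smooth_inv p hp).differentiableWithinAt (by simp)).hasFDerivWithinAt

theorem fderiv_inv_apply (h : IsLocalParam N O g U H) {w} (hw : w ∈ O)
    (e : EuclideanSpace ℝ (Fin k)) :
    fderivWithin ℝ H (N ∩ U) (g w) (fderiv ℝ g w e) = e := by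
  have h1 : HasFDerivWithinAt (H ∘ g) ((fderivWithin ℝ H (N ∩ U) (g w)).comp (fderiv ℝ g w)) O w :=
    (h.hasFDerivWithinAt_inv (h.mapsTo hw)).comp w (h.hasFDerivAt hw).hasFDerivWithinAt h.mapsTo
  have h2 : HasFDerivAt (H ∘ g) ((fderivWithin ℝ H (N ∩ U) (g w)).comp (fderiv ℝ g w)) w :=
    h1.hasFDerivAt (h.isOpen_source.mem_nhds hw)
  have h3 : HasFDerivAt (H ∘ g) (ContinuousLinearMap.id ℝ _) w :=
    (hasFDerivAt_id w).congr_of_eventuallyEq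
      (Filter.eventuallyEq_of_mem (h.isOpen_source.mem_nhds hw) h.leftInv)
  exact DFunLike.congr_fun (h2.unique h3) e

theorem fderiv_injective (h : IsLocalParam N O g U H) {w} (hw : w ∈ O) :
    Function.Injective (fderiv ℝ g w) :=
  Function.LeftInverse.injective (h.fderiv_inv_apply hw)

theorem mem_tangentSubspace (h : IsLocalParam N O g U H) {w} (hw : w ∈ O)
    (e : EuclideanSpace ℝ (Fin k)) : fderiv ℝ g w e ∈ tangentSubspace N (g w) :=
  tangentSubspace_map (s := O) (h.hasFDerivAt hw).hasFDerivWithinAt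
    (fun _ hx => (h.mapsTo hx).1)
    (tangentSubspace_univ_of_mem_nhds (h.isOpen_source.mem_nhds hw) e)

theorem fderiv_apply_inv (h : IsLocalParam N O g U H) {p} (hp : p ∈ N ∩ U) {v : F}
    (hv : v ∈ tangentSubspace N p) :
    fderiv ℝ g (H p) (fderivWithin ℝ H (N ∩ U) p v) = v := by
  have h1 : HasFDerivWithinAt (g ∘ H) ((fderiv ℝ g (H p)).comp (fderivWithin ℝ H (N ∩ U) p))
      (N ∩ U) p :=
    (h.hasFDerivAt (h.mapsTo_inv hp)).comp_hasFDerivWithinAt p (h.hasFDerivWithinAt_inv hp)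
  have h3 : HasFDerivWithinAt (g ∘ H) (ContinuousLinearMap.id ℝ _) (N ∩ U) p :=
    (hasFDerivWithinAt_id p _).congr (fun x hx => h.rightInv hx) (h.rightInv hp)
  have hv' : v ∈ tangentSubspace (N ∩ U) p := by
    rwa [tangentSubspace_inter_nhds (h.isOpen_target.mem_nhds hp.2)]
  exact h1.eqOn_tangentSubspace h3 hv'

/-- The tangent space of a submanifold is the image of the differential of a parametrization. -/
theorem tangentSubspace_eq (h : IsLocalParam N O g U H) {w} (hw : w ∈ O) {v : F} :
    v ∈ tangentSubspace N (g w) ↔ ∃ e, fderiv ℝ g w e = v := by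
  refine ⟨fun hv => ⟨fderivWithin ℝ H (N ∩ U) (g w) v, ?_⟩, ?_⟩
  · have := h.fderiv_apply_inv (h.mapsTo hw) hv
    rwa [h.leftInv hw] at this
  · rintro ⟨e, rfl⟩
    exact h.mem_tangentSubspace hw e

end IsLocalParam

/-- An embedded submanifold of a vector space has local parametrizations, whose inverses moreover
extend smoothly to open sets of the ambient space. -/
theorem IsEmbeddedSubmanifold.exists_localParam {F : Type*} [NormedAddCommGroup F] [NormedSpace ℝ F]
    [FiniteDimensional ℝ F] {k : ℕ} {N : Set F} (hN : IsEmbeddedSubmanifold (F := F) k N) {p : F}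
    (hp : p ∈ N) :
    ∃ (O : Set (EuclideanSpace ℝ (Fin k))) (g : EuclideanSpace ℝ (Fin k) → F) (U : Set F)
      (H : F → EuclideanSpace ℝ (Fin k)), IsLocalParam N O g U H ∧ ContDiffOn ℝ ∞ H U ∧ p ∈ U := by
  obtain ⟨e, he, hpe, W, hW, heW⟩ := hN p hp
  have h1 : ContDiffOn ℝ ∞ e e.source :=
    contMDiffOn_iff_contDiffOn.1 (contMDiffOn_of_mem_maximalAtlas he)
  have h2 : ContDiffOn ℝ ∞ e.symm e.target :=
    contMDiffOn_iff_contDiffOn.1 (contMDiffOn_symm_of_mem_maximalAtlas he)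
  let L : EuclideanSpace ℝ (Fin k) ≃L[ℝ] W :=
    ContinuousLinearEquiv.ofFinrankEq (by simp [hW])
  obtain ⟨P, hP⟩ := W.subtype.exists_leftInverse_of_injective (LinearMap.ker_eq_bot.2
    W.injective_subtype)
  let P' : F →L[ℝ] W := LinearMap.toContinuousLinearMap P
  have hP' : ∀ w : W, P' w = w := fun w => LinearMap.congr_fun hP w
  let i : EuclideanSpace ℝ (Fin k) →L[ℝ] F := W.subtypeL.comp (L : EuclideanSpace ℝ (Fin k) →L[ℝ] W)
  have hi : ∀ w, i w ∈ W := fun w => (L w).2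
  refine ⟨i ⁻¹' e.target, fun w => e.symm (i w), e.source, fun y => L.symm (P' (e y)), ⟨?_, ?_, ?_,
    ?_, ?_, ?_, ?_, ?_⟩, ?_, hpe⟩
  · exact e.open_target.preimage i.continuous
  · exact e.open_source
  · exact h2.comp i.contDiff.contDiffOn (fun w hw => hw)
  · exact ((L.symm.contDiff.comp P'.contDiff).comp_contDiffOn h1).mono inter_subset_right
  · intro w hw
    have h3 : e.symm (i w) ∈ e.source := e.map_target hw
    refine ⟨(heW _ h3).2 ?_, h3⟩
    rw [e.right_inv hw]
    exact hi w
  · rintro y ⟨hy, hye⟩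
    have h3 : e y ∈ W := (heW y hye).1 hy
    have h4 : i (L.symm (P' (e y))) = e y := by
      have := hP' ⟨e y, h3⟩
      simp only [i, ContinuousLinearMap.comp_apply, ContinuousLinearEquiv.coe_coe,
        ContinuousLinearEquiv.apply_symm_apply, Submodule.subtypeL_apply]
      rw [this]
    change i _ ∈ e.target
    rw [h4]
    exact e.map_source hye
  · intro w hw
    have h3 : e (e.symm (i w)) = i w := e.right_inv hw
    simp only [h3]
    have := hP' (L w)
    rw [show i w = (L w : F) from rfl, this, L.symm_apply_apply]
  · rintro y ⟨hy, hye⟩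
    have h3 : e y ∈ W := (heW y hye).1 hy
    have h4 : i (L.symm (P' (e y))) = e y := by
      have := hP' ⟨e y, h3⟩
      simp only [i, ContinuousLinearMap.comp_apply, ContinuousLinearEquiv.coe_coe,
        ContinuousLinearEquiv.apply_symm_apply, Submodule.subtypeL_apply]
      rw [this]
    simp only [h4]
    exact e.left_inv hye
  · exact (L.symm.contDiff.comp P'.contDiff).comp_contDiffOn h1

end

noncomputable section

/-! ### The nearest point projection near a cone -/

section Tube

variable {F : Type*} [NormedAddCommGroup F] [InnerProductSpace ℝ F] [FiniteDimensional ℝ F]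

/-- Near a point of a submanifold there is a smooth retraction onto it along the normal spaces. -/
theorem IsLocalParam.exists_normal_retraction {k : ℕ} {N : Set F}
    {O : Set (EuclideanSpace ℝ (Fin k))} {g : EuclideanSpace ℝ (Fin k) → F} {U : Set F}
    {H : F → EuclideanSpace ℝ (Fin k)} (h : IsLocalParam N O g U H) {p : F} (hp : p ∈ N ∩ U) :
    ∃ r > 0, ∃ π : F → F, ContDiffOn ℝ ∞ π (ball p r) ∧
      (∀ y ∈ ball p r, π y ∈ N ∧ ∀ v ∈ tangentSubspace N (π y), inner ℝ (y - π y) v = 0) ∧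
      ∀ q ∈ N ∩ ball p r, π q = q := by
  let b := EuclideanSpace.basisFun (Fin k) ℝ
  set w₀ := H p with hw₀
  have hw₀O : w₀ ∈ O := h.mapsTo_inv hp
  have hgw₀ : g w₀ = p := h.rightInv hp
  -- `y - g w` is normal to `N` at `g w` exactly when the second component of `Θ (y, w)` vanishes.
  let Θ : F × EuclideanSpace ℝ (Fin k) → F × (Fin k → ℝ) := fun z =>
    (z.1, fun j => inner ℝ (z.1 - g z.2) (fderiv ℝ g z.2 (b j)))
  have hop : IsOpen (univ ×ˢ O : Set (F × EuclideanSpace ℝ (Fin k))) :=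
    isOpen_univ.prod h.isOpen_source
  have hg2 : ContDiffOn ℝ ∞ (fun z : F × EuclideanSpace ℝ (Fin k) => g z.2) (univ ×ˢ O) :=
    h.smooth.comp contDiffOn_snd (fun z hz => hz.2)
  have hdg : ContDiffOn ℝ ∞ (fderiv ℝ g) O := h.smooth.fderiv_of_isOpen h.isOpen_source (by simp)
  have hdg2 : ∀ j, ContDiffOn ℝ ∞ (fun z : F × EuclideanSpace ℝ (Fin k) => fderiv ℝ g z.2 (b j))
      (univ ×ˢ O) := fun j =>
    (hdg.comp contDiffOn_snd (fun z hz => hz.2)).clm_apply contDiffOn_const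
  have hΘ : ContDiffOn ℝ ∞ Θ (univ ×ˢ O) := by
    refine contDiffOn_fst.prodMk (contDiffOn_pi.2 fun j => ?_)
    exact (contDiffOn_fst.sub hg2).inner ℝ (hdg2 j)
  have hmem : ((p, w₀) : F × EuclideanSpace ℝ (Fin k)) ∈
      (univ ×ˢ O : Set (F × EuclideanSpace ℝ (Fin k))) := ⟨trivial, hw₀O⟩
  let A : F × EuclideanSpace ℝ (Fin k) →L[ℝ] F :=
    ContinuousLinearMap.fst ℝ F (EuclideanSpace ℝ (Fin k)) -
      (fderiv ℝ g w₀).comp (ContinuousLinearMap.snd ℝ F (EuclideanSpace ℝ (Fin k)))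
  have hA : HasFDerivAt (fun z : F × EuclideanSpace ℝ (Fin k) => z.1 - g z.2) A (p, w₀) :=
    hasFDerivAt_fst.sub ((h.hasFDerivAt hw₀O).comp (p, w₀) hasFDerivAt_snd)
  let B : Fin k → (F × EuclideanSpace ℝ (Fin k) →L[ℝ] F) := fun j =>
    fderiv ℝ (fun z : F × EuclideanSpace ℝ (Fin k) => fderiv ℝ g z.2 (b j)) (p, w₀)
  have hB : ∀ j, HasFDerivAt (fun z : F × EuclideanSpace ℝ (Fin k) => fderiv ℝ g z.2 (b j)) (B j)
      (p, w₀) := fun j =>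
    (((hdg2 j).contDiffAt (hop.mem_nhds hmem)).differentiableAt (by simp)).hasFDerivAt
  let D : F × EuclideanSpace ℝ (Fin k) →L[ℝ] F × (Fin k → ℝ) :=
    (ContinuousLinearMap.fst ℝ F (EuclideanSpace ℝ (Fin k))).prod (ContinuousLinearMap.pi fun j =>
      (fderivInnerCLM ℝ (p - g w₀, fderiv ℝ g w₀ (b j))).comp (A.prod (B j)))
  have hD : HasFDerivAt Θ D (p, w₀) :=
    hasFDerivAt_fst.prodMk (hasFDerivAt_pi.2 fun j => hA.inner ℝ (hB j))
  -- a vector `(0, e)` in the kernel of `D` has `dg e` normal as well as tangent to `N`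
  have hDinj : Function.Injective D := by
    rw [injective_iff_map_eq_zero]
    rintro ⟨u, e⟩ hz
    have hu : u = 0 := congrArg Prod.fst hz
    subst hu
    have h2 : ∀ j, inner ℝ (fderiv ℝ g w₀ e) (fderiv ℝ g w₀ (b j)) = 0 := by
      intro j
      have := congrFun (congrArg Prod.snd hz) j
      simpa [D, A, hgw₀] using this
    have h3 : ∀ e', inner ℝ (fderiv ℝ g w₀ e) (fderiv ℝ g w₀ e') = 0 := by
      intro e'
      rw [← b.sum_repr e', map_sum, inner_sum]
      refine Finset.sum_eq_zero fun j _ => ?_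
      rw [map_smul, inner_smul_right, h2, mul_zero]
    have h4 : fderiv ℝ g w₀ e = 0 := inner_self_eq_zero.1 (h3 e)
    have h5 : e = 0 := h.fderiv_injective hw₀O (by rw [h4, map_zero])
    rw [h5]; rfl
  have hfin : Module.finrank ℝ (F × EuclideanSpace ℝ (Fin k)) =
      Module.finrank ℝ (F × (Fin k → ℝ)) := by
    simp
  obtain ⟨D', hD'⟩ := D.exists_equiv_of_injective hDinj hfin
  rw [← hD'] at hD
  obtain ⟨e, hes, hesub, heq, hesm⟩ := exists_localInverse hop hmem hΘ D' hD
  have hΘ0 : ∀ q ∈ N ∩ U, Θ (q, H q) = (q, 0) := by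
    intro q hq
    have : g (H q) = q := h.rightInv hq
    ext1
    · rfl
    · ext j
      simp [Θ, this]
  have htgt : (p, (0 : Fin k → ℝ)) ∈ e.target := by
    rw [← hΘ0 p hp, ← heq]
    exact e.map_source hes
  let j : F → F × (Fin k → ℝ) := fun y => (y, 0)
  have hj : ContDiff ℝ ∞ j := contDiff_id.prodMk contDiff_const
  obtain ⟨r₁, hr₁, hr₁s⟩ := Metric.isOpen_iff.1 (e.open_target.preimage hj.continuous) p htgt
  -- points of `N` near `p` are reached through the local inverse
  have hcH : ContinuousWithinAt (fun q => ((q, H q) : F × EuclideanSpace ℝ (Fin k))) (N ∩ U) p :=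
    continuousWithinAt_id.prodMk (h.smooth_inv.continuousOn p hp)
  have hev : ∀ᶠ q in 𝓝[N ∩ U] p, ((q, H q) : F × EuclideanSpace ℝ (Fin k)) ∈ e.source :=
    hcH (e.open_source.mem_nhds hes)
  rw [nhdsWithin_inter_of_mem' (mem_nhdsWithin_of_mem_nhds (h.isOpen_target.mem_nhds hp.2)),
    eventually_nhdsWithin_iff] at hev
  obtain ⟨r₂, hr₂, hr₂s⟩ := Metric.eventually_nhds_iff_ball.1 hev
  obtain ⟨r₃, hr₃, hr₃s⟩ := Metric.isOpen_iff.1 h.isOpen_target p hp.2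
  refine ⟨min r₁ (min r₂ r₃), by positivity, fun y => g (e.symm (j y)).2, ?_, ?_, ?_⟩
  · have h1 : ContDiffOn ℝ ∞ (fun y => e.symm (j y)) (ball p (min r₁ (min r₂ r₃))) :=
      hesm.comp hj.contDiffOn fun y hy => hr₁s (ball_subset_ball (min_le_left _ _) hy)
    refine h.smooth.comp (contDiff_snd.comp_contDiffOn h1) fun y hy => ?_
    exact (hesub (e.map_target (hr₁s (ball_subset_ball (min_le_left _ _) hy)))).2
  · intro y hy
    have hy1 : j y ∈ e.target := hr₁s (ball_subset_ball (min_le_left _ _) hy)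
    have hO : (e.symm (j y)).2 ∈ O := (hesub (e.map_target hy1)).2
    refine ⟨(h.mapsTo hO).1, fun v hv => ?_⟩
    obtain ⟨e', rfl⟩ := (h.tangentSubspace_eq hO).1 hv
    have h1 : Θ (e.symm (j y)) = j y := by rw [← heq]; exact e.right_inv hy1
    have h2 : (e.symm (j y)).1 = y := congrArg Prod.fst h1
    rw [← b.sum_repr e', map_sum, inner_sum]
    refine Finset.sum_eq_zero fun i _ => ?_
    have h3 := congrFun (congrArg Prod.snd h1) i
    simp only [Θ, h2, j] at h3
    rw [map_smul, inner_smul_right, h3, Pi.zero_apply, mul_zero]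
  · rintro q ⟨hqN, hq⟩
    have hq2 := hr₂s q (ball_subset_ball ((min_le_right _ _).trans (min_le_left _ _)) hq) hqN
    have hqU := hr₃s (ball_subset_ball ((min_le_right _ _).trans (min_le_right _ _)) hq)
    have h1 : e (q, H q) = j q := by rw [heq]; exact hΘ0 q ⟨hqN, hqU⟩
    have h2 : e.symm (j q) = (q, H q) := by rw [← h1]; exact e.left_inv hq2
    simp only [h2]
    exact h.rightInv ⟨hqN, hqU⟩

/-- A chord of a submanifold is tangent to it up to second order. -/
theorem IsLocalParam.exists_chord_estimate {k : ℕ} {N : Set F}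
    {O : Set (EuclideanSpace ℝ (Fin k))} {g : EuclideanSpace ℝ (Fin k) → F} {U : Set F}
    {H : F → EuclideanSpace ℝ (Fin k)} (h : IsLocalParam N O g U H) (hH : ContDiffOn ℝ ∞ H U)
    {p₀ : F} (hp₀ : p₀ ∈ N ∩ U) :
    ∃ r > 0, ∃ K > 0, ∀ p ∈ N ∩ ball p₀ r, ∀ q ∈ N ∩ ball p₀ r, ∀ n : F,
      (∀ v ∈ tangentSubspace N p, inner ℝ n v = 0) →
        |inner ℝ n (q - p)| ≤ K * ‖n‖ * ‖q - p‖ ^ 2 := by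
  have hw₀O : H p₀ ∈ O := h.mapsTo_inv hp₀
  have hUn : U ∈ 𝓝 p₀ := h.isOpen_target.mem_nhds hp₀.2
  have hHat : ContDiffAt ℝ ∞ H p₀ := hH.contDiffAt hUn
  obtain ⟨KH, tH, htH, hKH⟩ := (hHat.of_le (by simp : (1 : ℕ∞ω) ≤ ∞)).exists_lipschitzOnWith
  have hdg : ContDiffOn ℝ ∞ (fderiv ℝ g) O := h.smooth.fderiv_of_isOpen h.isOpen_source (by simp)
  obtain ⟨Kg, tg, htg, hKg⟩ := ((hdg.contDiffAt (h.isOpen_source.mem_nhds hw₀O)).of_le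
    (by simp : (1 : ℕ∞ω) ≤ ∞)).exists_lipschitzOnWith
  obtain ⟨ρ, hρ, hρs⟩ := Metric.mem_nhds_iff.1 (inter_mem htg (h.isOpen_source.mem_nhds hw₀O))
  obtain ⟨r, hr, hrs⟩ := Metric.mem_nhds_iff.1 (inter_mem (inter_mem htH hUn)
    (hHat.continuousAt (ball_mem_nhds _ hρ)))
  refine ⟨r, hr, Kg * KH ^ 2 + 1, by positivity, ?_⟩
  rintro p ⟨hpN, hp⟩ q ⟨hqN, hq⟩ n hn
  have hpU : p ∈ N ∩ U := ⟨hpN, (hrs hp).1.2⟩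
  have hqU : q ∈ N ∩ U := ⟨hqN, (hrs hq).1.2⟩
  set w := H p
  set w' := H q
  have hgw : g w = p := h.rightInv hpU
  have hgw' : g w' = q := h.rightInv hqU
  have hwb : w ∈ ball (H p₀) ρ := (hrs hp).2
  have hwb' : w' ∈ ball (H p₀) ρ := (hrs hq).2
  have hL : ‖w' - w‖ ≤ KH * ‖q - p‖ := by
    have := hKH.dist_le_mul q (hrs hq).1.1 p (hrs hp).1.1
    rwa [dist_eq_norm, dist_eq_norm] at this
  have hT : ‖g w' - g w - fderiv ℝ g w (w' - w)‖ ≤ Kg * ‖w' - w‖ * ‖w' - w‖ := by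
    refine ((convex_ball (H p₀) ρ).inter
      (convex_closedBall w ‖w' - w‖)).norm_image_sub_le_of_norm_hasFDerivWithin_le'
      (f := g) (f' := fderiv ℝ g) (φ := fderiv ℝ g w) (C := Kg * ‖w' - w‖) ?_ ?_ ?_ ?_
    · intro x hx
      exact (h.hasFDerivAt (hρs hx.1).2).hasFDerivWithinAt
    · intro x hx
      have := hKg.dist_le_mul x (hρs hx.1).1 w (hρs hwb).1
      rw [dist_eq_norm] at this
      exact this.trans (mul_le_mul_of_nonneg_left (mem_closedBall.1 hx.2) Kg.2)
    · exact ⟨hwb, mem_closedBall_self (norm_nonneg _)⟩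
    · exact ⟨hwb', by rw [mem_closedBall, dist_eq_norm]⟩
  have hzero : inner ℝ n (fderiv ℝ g w (w' - w)) = 0 := by
    refine hn _ ?_
    have := h.mem_tangentSubspace (h.mapsTo_inv hpU) (w' - w)
    rwa [hgw] at this
  have h1 : inner ℝ n (q - p) = inner ℝ n (g w' - g w - fderiv ℝ g w (w' - w)) := by
    rw [inner_sub_right _ (g w' - g w), hzero, sub_zero, hgw, hgw']
  rw [h1]
  calc |inner ℝ n (g w' - g w - fderiv ℝ g w (w' - w))|
      ≤ ‖n‖ * (Kg * ‖w' - w‖ * ‖w' - w‖) :=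
        (abs_real_inner_le_norm _ _).trans (mul_le_mul_of_nonneg_left hT (norm_nonneg _))
    _ ≤ ‖n‖ * (Kg * (KH * ‖q - p‖) * (KH * ‖q - p‖)) := by gcongr
    _ = (Kg * KH ^ 2) * ‖n‖ * ‖q - p‖ ^ 2 := by ring
    _ ≤ (Kg * KH ^ 2 + 1) * ‖n‖ * ‖q - p‖ ^ 2 := by gcongr; linarith

/-- A local property that persists at smaller scales holds at a uniform scale on a compact set. -/
theorem IsCompact.exists_uniform_scale {S : Set F} (hS : IsCompact S) {P : ℝ → F → Prop}
    (mono : ∀ p δ δ', 0 < δ' → δ' ≤ δ → P δ p → P δ' p)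
    (loc : ∀ p₀ ∈ S, ∃ δ > 0, ∀ p ∈ S ∩ ball p₀ δ, P δ p) : ∃ δ > 0, ∀ p ∈ S, P δ p := by
  refine hS.induction_on (p := fun T => ∃ δ > 0, ∀ p ∈ T, P δ p) ⟨1, one_pos, by simp⟩ ?_ ?_ ?_
  · rintro s t hst ⟨δ, hδ, h⟩
    exact ⟨δ, hδ, fun p hp => h p (hst hp)⟩
  · rintro s t ⟨δ, hδ, h⟩ ⟨δ', hδ', h'⟩
    refine ⟨min δ δ', by positivity, ?_⟩
    rintro p (hp | hp)
    · exact mono p δ _ (by positivity) (min_le_left _ _) (h p hp)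
    · exact mono p δ' _ (by positivity) (min_le_right _ _) (h' p hp)
  · intro p₀ hp₀
    obtain ⟨δ, hδ, h⟩ := loc p₀ hp₀
    exact ⟨S ∩ ball p₀ δ, inter_mem_nhdsWithin _ (ball_mem_nhds _ hδ), δ, hδ, h⟩

/-- The local estimates near a point `p` of a submanifold `N` on a ball of radius `δ`: chords are
tangent up to second order, and there is a normal retraction onto `N` with controlled
derivatives. -/
structure HasTubeAt (N : Set F) (δ : ℝ) (p : F) : Prop where
  chord : ∀ q ∈ N, ‖q - p‖ < δ → ∀ n : F, (∀ v ∈ tangentSubspace N p, inner ℝ n v = 0) →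
    |inner ℝ n (q - p)| ≤ δ⁻¹ * ‖n‖ * ‖q - p‖ ^ 2
  retraction : ∃ π : F → F, ContDiffOn ℝ ∞ π (ball p δ) ∧ ∀ y ∈ ball p δ, π y ∈ N ∧
    (∀ v ∈ tangentSubspace N (π y), inner ℝ (y - π y) v = 0) ∧ ‖y - π y‖ ≤ δ⁻¹ * ‖y - p‖ ∧
    ‖fderiv ℝ π y‖ ≤ δ⁻¹ ∧ ∀ y' ∈ ball p δ, ‖fderiv ℝ π y - fderiv ℝ π y'‖ ≤ δ⁻¹ * ‖y - y'‖

theorem HasTubeAt.mono {N : Set F} {δ δ' : ℝ} {p : F} (h : HasTubeAt N δ p) (hδ' : 0 < δ')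
    (hle : δ' ≤ δ) : HasTubeAt N δ' p := by
  have hinv : δ⁻¹ ≤ δ'⁻¹ := inv_anti₀ hδ' hle
  refine ⟨fun q hq hqp n hn => (h.chord q hq (hqp.trans_le hle) n hn).trans (by gcongr), ?_⟩
  obtain ⟨π, h1, h2⟩ := h.retraction
  refine ⟨π, h1.mono (ball_subset_ball hle), fun y hy => ?_⟩
  obtain ⟨a, b, c, d, e⟩ := h2 y (ball_subset_ball hle hy)
  refine ⟨a, b, c.trans (by gcongr), d.trans hinv, fun y' hy' => ?_⟩
  exact (e y' (ball_subset_ball hle hy')).trans (by gcongr)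

/-- The local estimates hold at a uniform scale near each point of a submanifold. -/
theorem IsEmbeddedSubmanifold.exists_hasTubeAt {k : ℕ} {N : Set F}
    (hN : IsEmbeddedSubmanifold (F := F) k N) {p₀ : F} (hp₀ : p₀ ∈ N) :
    ∃ δ > 0, ∀ p ∈ N ∩ ball p₀ δ, HasTubeAt N δ p := by
  obtain ⟨O, g, U, H, h, hH, hpU⟩ := hN.exists_localParam hp₀
  obtain ⟨r₁, hr₁, π, hπ, hπN, hπq⟩ := h.exists_normal_retraction ⟨hp₀, hpU⟩
  obtain ⟨r₂, hr₂, K, hK, hch⟩ := h.exists_chord_estimate hH ⟨hp₀, hpU⟩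
  have hdπ : ContDiffOn ℝ ∞ (fderiv ℝ π) (ball p₀ r₁) := hπ.fderiv_of_isOpen isOpen_ball (by simp)
  have hdat : ContDiffAt ℝ ∞ (fderiv ℝ π) p₀ := hdπ.contDiffAt (ball_mem_nhds _ hr₁)
  obtain ⟨L, t, ht, hL⟩ := (hdat.of_le (by simp : (1 : ℕ∞ω) ≤ ∞)).exists_lipschitzOnWith
  have hbd : ∀ᶠ y in 𝓝 p₀, ‖fderiv ℝ π y‖ < ‖fderiv ℝ π p₀‖ + 1 :=
    hdat.continuousAt.norm.eventually_lt continuousAt_const (lt_add_one _)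
  obtain ⟨r₃, hr₃, hr₃s⟩ := Metric.mem_nhds_iff.1 (inter_mem ht hbd)
  set M := ‖fderiv ℝ π p₀‖ + 1 with hM
  have hM1 : 1 ≤ M := by rw [hM]; linarith [norm_nonneg (fderiv ℝ π p₀)]
  set δ := min (min (r₁ / 2) (r₂ / 2)) (min (r₃ / 2) (min K⁻¹ (min (L + 1 : ℝ)⁻¹ (1 + M)⁻¹)))
    with hδdef
  have hδ : 0 < δ := by positivity
  have d1 : δ ≤ r₁ / 2 := (min_le_left _ _).trans (min_le_left _ _)
  have d2 : δ ≤ r₂ / 2 := (min_le_left _ _).trans (min_le_right _ _)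
  have d3 : δ ≤ r₃ / 2 := (min_le_right _ _).trans (min_le_left _ _)
  have d4 : K ≤ δ⁻¹ := by
    rw [le_inv_comm₀ hK hδ]
    exact (min_le_right _ _).trans ((min_le_right _ _).trans (min_le_left _ _))
  have d5 : (L + 1 : ℝ) ≤ δ⁻¹ := by
    rw [le_inv_comm₀ (by positivity) hδ]
    exact (min_le_right _ _).trans ((min_le_right _ _).trans ((min_le_right _ _).trans
      (min_le_left _ _)))
  have d6 : 1 + M ≤ δ⁻¹ := by
    rw [le_inv_comm₀ (by positivity) hδ]
    exact (min_le_right _ _).trans ((min_le_right _ _).trans ((min_le_right _ _).trans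
      (min_le_right _ _)))
  refine ⟨δ, hδ, ?_⟩
  rintro p ⟨hpN, hp⟩
  have hsub : ∀ r, δ ≤ r / 2 → ball p δ ⊆ ball p₀ r := by
    intro r hr
    refine ball_subset_ball' ?_
    have := mem_ball.1 hp
    linarith
  refine ⟨fun q hq hqp n hn => ?_, π, hπ.mono (hsub _ d1), fun y hy => ?_⟩
  · refine (hch p ⟨hpN, ?_⟩ q ⟨hq, hsub _ d2 (by rwa [mem_ball, dist_eq_norm])⟩ n hn).trans ?_
    · exact hsub _ d2 (mem_ball_self hδ)
    · gcongr
  · have hnorm : ∀ z ∈ ball p δ, ‖fderiv ℝ π z‖ ≤ M := fun z hz => (hr₃s (hsub _ d3 hz)).2.le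
    have hdiff : ∀ z ∈ ball p δ, DifferentiableAt ℝ π z := fun z hz =>
      (hπ.contDiffAt (isOpen_ball.mem_nhds (hsub _ d1 hz))).differentiableAt (by simp)
    have hpp : π p = p := hπq p ⟨hpN, hsub _ d1 (mem_ball_self hδ)⟩
    refine ⟨(hπN y (hsub _ d1 hy)).1, (hπN y (hsub _ d1 hy)).2, ?_, ?_, fun y' hy' => ?_⟩
    · have h1 := (convex_ball p δ).norm_image_sub_le_of_norm_fderiv_le hdiff hnorm
        (mem_ball_self hδ) hy
      rw [hpp] at h1
      calc ‖y - π y‖ = ‖(y - p) - (π y - p)‖ := by congr 1; abel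
        _ ≤ ‖y - p‖ + M * ‖y - p‖ := (norm_sub_le _ _).trans (by gcongr)
        _ = (1 + M) * ‖y - p‖ := by ring
        _ ≤ δ⁻¹ * ‖y - p‖ := by gcongr
    · exact (hnorm y hy).trans (by linarith)
    · have := hL.dist_le_mul y (hr₃s (hsub _ d3 hy)).1 y' (hr₃s (hsub _ d3 hy')).1
      rw [dist_eq_norm, dist_eq_norm] at this
      exact this.trans (by gcongr; linarith)

end Tube

end

noncomputable section

section ConeTube

variable {F : Type*} [NormedAddCommGroup F] [InnerProductSpace ℝ F] [FiniteDimensional ℝ F]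

/-- `π` is the nearest point projection onto a cone `N` (without its apex), on the conical
neighbourhood of `N` made of the balls `B(p, δ|p|)`, `p ∈ N`, with scale-invariant bounds on its
first two derivatives. -/
structure IsConeTube (N : Set F) (δ K : ℝ) (π : F → F) : Prop where
  δ_pos : 0 < δ
  δ_le : δ ≤ 1 / 4
  one_le : 1 ≤ K
  smooth : ∀ p ∈ N, ContDiffOn ℝ ∞ π (ball p (δ * ‖p‖))
  mem : ∀ p ∈ N, ∀ y ∈ ball p (δ * ‖p‖), π y ∈ N
  normal : ∀ p ∈ N, ∀ y ∈ ball p (δ * ‖p‖), ∀ v ∈ tangentSubspace N (π y),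
    inner ℝ (y - π y) v = 0
  dist_le : ∀ p ∈ N, ∀ y ∈ ball p (δ * ‖p‖), ‖y - π y‖ ≤ K * ‖y - p‖
  unique : ∀ q ∈ N, ∀ y ∈ ball q (δ * ‖q‖), (∀ v ∈ tangentSubspace N q, inner ℝ (y - q) v = 0) →
    π y = q
  fderiv_le : ∀ p ∈ N, ∀ y ∈ ball p (δ * ‖p‖), ‖fderiv ℝ π y‖ ≤ K
  fderiv_lip : ∀ p ∈ N, ∀ y ∈ ball p (δ * ‖p‖), ∀ y' ∈ ball p (δ * ‖p‖),
    ‖fderiv ℝ π y - fderiv ℝ π y'‖ ≤ K / ‖p‖ * ‖y - y'‖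

theorem mem_tangentSubspace_smul {N : Set F} (hcone : ∀ t : ℝ, 0 < t → ∀ p ∈ N, t • p ∈ N) {t : ℝ}
    (ht : 0 < t) {p v : F} (hv : v ∈ tangentSubspace N p) : v ∈ tangentSubspace N (t • p) := by
  have h : HasFDerivWithinAt (fun y : F => t • y) (t • ContinuousLinearMap.id ℝ F) N p :=
    (hasFDerivWithinAt_id p N).const_smul t
  have h2 := tangentSubspace_map h (fun q hq => hcone t ht q hq) hv
  have h3 := (tangentSubspace N (t • p)).smul_mem t⁻¹ h2
  simpa [smul_smul, inv_mul_cancel₀ ht.ne'] using h3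

/-- The chord estimate at `p`, obtained from the one at the rescaled point `s⁻¹ p`. -/
theorem HasTubeAt.scaled_chord {N : Set F} (hcone : ∀ t : ℝ, 0 < t → ∀ p ∈ N, t • p ∈ N) {δ s : ℝ}
    (hs : 0 < s) {p : F} (h : HasTubeAt N δ (s⁻¹ • p)) {q : F} (hq : q ∈ N)
    (hqp : ‖q - p‖ < δ * s) {n : F} (hn : ∀ v ∈ tangentSubspace N p, inner ℝ n v = 0) :
    |inner ℝ n (q - p)| ≤ δ⁻¹ / s * ‖n‖ * ‖q - p‖ ^ 2 := by
  have hs' : 0 < s⁻¹ := inv_pos.2 hs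
  have h1 : ‖s⁻¹ • q - s⁻¹ • p‖ = s⁻¹ * ‖q - p‖ := by
    rw [← smul_sub, norm_smul, Real.norm_of_nonneg hs'.le]
  have h2 := h.chord (s⁻¹ • q) (hcone _ hs' q hq)
    (by rw [h1, inv_mul_lt_iff₀ hs, mul_comm]; exact hqp) n (fun v hv => hn v (by
      have := mem_tangentSubspace_smul hcone hs hv
      rwa [smul_smul, mul_inv_cancel₀ hs.ne', one_smul] at this))
  rw [h1, ← smul_sub, inner_smul_right, abs_mul, abs_of_pos hs'] at h2
  have h3 : |inner ℝ n (q - p)| = s * (s⁻¹ * |inner ℝ n (q - p)|) := by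
    rw [← mul_assoc, mul_inv_cancel₀ hs.ne', one_mul]
  rw [h3]
  refine (mul_le_mul_of_nonneg_left h2 hs.le).trans (le_of_eq ?_)
  field_simp

/-- The normal retraction near `p`, obtained from the one near the rescaled point `s⁻¹ p`. -/
theorem HasTubeAt.scaled_retraction {N : Set F} (hcone : ∀ t : ℝ, 0 < t → ∀ p ∈ N, t • p ∈ N)
    {δ s : ℝ} (hs : 0 < s) {p : F} (h : HasTubeAt N δ (s⁻¹ • p)) :
    ∃ π : F → F, ContDiffOn ℝ ∞ π (ball p (δ * s)) ∧ ∀ y ∈ ball p (δ * s), π y ∈ N ∧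
    (∀ v ∈ tangentSubspace N (π y), inner ℝ (y - π y) v = 0) ∧ ‖y - π y‖ ≤ δ⁻¹ * ‖y - p‖ ∧
    ‖fderiv ℝ π y‖ ≤ δ⁻¹ ∧
    ∀ y' ∈ ball p (δ * s), ‖fderiv ℝ π y - fderiv ℝ π y'‖ ≤ δ⁻¹ / s * ‖y - y'‖ := by
  have hs' : 0 < s⁻¹ := inv_pos.2 hs
  obtain ⟨π, hπ, hπ'⟩ := h.retraction
  have hn : ∀ y z : F, ‖s⁻¹ • y - s⁻¹ • z‖ = s⁻¹ * ‖y - z‖ := fun y z => by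
    rw [← smul_sub, norm_smul, Real.norm_of_nonneg hs'.le]
  have hb : ∀ y ∈ ball p (δ * s), s⁻¹ • y ∈ ball (s⁻¹ • p) δ := by
    intro y hy
    rw [mem_ball, dist_eq_norm] at hy ⊢
    rw [hn, inv_mul_lt_iff₀ hs, mul_comm]
    exact hy
  have hd : ∀ y ∈ ball p (δ * s), fderiv ℝ (fun y => s • π (s⁻¹ • y)) y = fderiv ℝ π (s⁻¹ • y) := by
    intro y hy
    have h1 : HasFDerivAt π (fderiv ℝ π (s⁻¹ • y)) (s⁻¹ • y) :=
      ((hπ.contDiffAt (isOpen_ball.mem_nhds (hb y hy))).differentiableAt (by simp)).hasFDerivAt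
    have h2 : HasFDerivAt (fun y : F => s⁻¹ • y) (s⁻¹ • ContinuousLinearMap.id ℝ F) y :=
      (hasFDerivAt_id y).const_smul s⁻¹
    have h3 := (h1.comp y h2).const_smul s
    refine h3.fderiv.trans ?_
    ext v
    simp [smul_smul, mul_inv_cancel₀ hs.ne']
  refine ⟨fun y => s • π (s⁻¹ • y), ?_, fun y hy => ?_⟩
  · exact (hπ.comp (contDiff_id.const_smul s⁻¹).contDiffOn hb).const_smul s
  · obtain ⟨h1, h2, h3, h4, h5⟩ := hπ' _ (hb y hy)
    have h6 : y - s • π (s⁻¹ • y) = s • (s⁻¹ • y - π (s⁻¹ • y)) := by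
      rw [smul_sub, smul_smul, mul_inv_cancel₀ hs.ne', one_smul]
    refine ⟨hcone s hs _ h1, fun v hv => ?_, ?_, ?_, fun y' hy' => ?_⟩
    · rw [h6, inner_smul_left]
      have := mem_tangentSubspace_smul hcone hs' hv
      rw [smul_smul, inv_mul_cancel₀ hs.ne', one_smul] at this
      rw [h2 v this, mul_zero]
    · rw [h6, norm_smul, Real.norm_of_nonneg hs.le]
      refine (mul_le_mul_of_nonneg_left h3 hs.le).trans (le_of_eq ?_)
      rw [hn]
      field_simp
    · rw [hd y hy]; exact h4
    · rw [hd y hy, hd y' hy']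
      refine (h5 _ (hb y' hy')).trans (le_of_eq ?_)
      rw [hn]
      ring

/-- A cone with smooth compact link has a conical tubular neighbourhood. -/
theorem exists_isConeTube {k : ℕ} {N : Set F} (hN : IsEmbeddedSubmanifold (F := F) k N)
    (hcone : ∀ t : ℝ, 0 < t → ∀ p ∈ N, t • p ∈ N) (h0 : (0 : F) ∉ N)
    (hcomp : IsCompact (N ∩ sphere 0 1)) : ∃ δ K π, IsConeTube N δ K π := by
  obtain ⟨δ₀, hδ₀, hT₀⟩ := hcomp.exists_uniform_scale (P := HasTubeAt N)
    (fun p δ δ' h1 h2 h3 => h3.mono h1 h2) (fun p₀ hp₀ => by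
      obtain ⟨δ, hδ, h⟩ := hN.exists_hasTubeAt hp₀.1
      exact ⟨δ, hδ, fun p hp => h p ⟨hp.1.1, hp.2⟩⟩)
  set ε := min δ₀ 1 with hε
  have hεpos : 0 < ε := by positivity
  have hε1 : ε ≤ 1 := min_le_right _ _
  have hpos : ∀ p ∈ N, 0 < ‖p‖ := fun p hp => norm_pos_iff.2 (fun h => h0 (h ▸ hp))
  have hT : ∀ p ∈ N, HasTubeAt N ε (‖p‖⁻¹ • p) := by
    intro p hp
    refine (hT₀ _ ⟨hcone _ (inv_pos.2 (hpos p hp)) p hp, ?_⟩).mono hεpos (min_le_left _ _)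
    rw [mem_sphere_zero_iff_norm, norm_smul, norm_inv, norm_norm, inv_mul_cancel₀ (hpos p hp).ne']
  set η := ε / 16 with hη
  have hηpos : 0 < η := by positivity
  have hηε : ε⁻¹ * η = 1 / 16 := by rw [hη]; field_simp
  -- by the chord estimates, the chord `q₁ - q₂` between two feet of perpendiculars from `y` has
  -- small inner products with both normals `y - qᵢ`, whose difference is the chord itself
  have huniq : ∀ y, ∀ q₁ ∈ N, ∀ q₂ ∈ N, ‖y - q₁‖ < η * ‖q₁‖ → ‖y - q₂‖ < η * ‖q₂‖ →
      (∀ v ∈ tangentSubspace N q₁, inner ℝ (y - q₁) v = 0) →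
      (∀ v ∈ tangentSubspace N q₂, inner ℝ (y - q₂) v = 0) → q₁ = q₂ := by
    intro y q₁ hq₁ q₂ hq₂ h₁ h₂ hn₁ hn₂
    have hd : ‖q₁ - q₂‖ ≤ η * ‖q₁‖ + η * ‖q₂‖ := by
      calc ‖q₁ - q₂‖ = ‖(y - q₂) - (y - q₁)‖ := by congr 1; abel
        _ ≤ ‖y - q₂‖ + ‖y - q₁‖ := norm_sub_le _ _
        _ ≤ _ := by linarith
    have hp₁ := hpos q₁ hq₁
    have hp₂ := hpos q₂ hq₂
    have t1 : ‖q₂‖ ≤ ‖q₁‖ + ‖q₁ - q₂‖ := by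
      have := norm_sub_le q₁ (q₁ - q₂); rwa [sub_sub_cancel] at this
    have t2 : ‖q₁‖ ≤ ‖q₂‖ + ‖q₁ - q₂‖ := by
      have := norm_add_le q₂ (q₁ - q₂); rwa [add_sub_cancel] at this
    have hη16 : η ≤ 1 / 16 := by rw [hη]; linarith
    have m1 : η * ‖q₁‖ ≤ 1 / 16 * ‖q₁‖ := by gcongr
    have m2 : η * ‖q₂‖ ≤ 1 / 16 * ‖q₂‖ := by gcongr
    have s1 : ‖q₂‖ ≤ 2 * ‖q₁‖ := by linarith
    have s2 : ‖q₁‖ ≤ 2 * ‖q₂‖ := by linarith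
    have b1 : ‖q₂ - q₁‖ < ε * ‖q₁‖ := by
      rw [norm_sub_rev]
      have : η * ‖q₂‖ ≤ η * (2 * ‖q₁‖) := by gcongr
      have e1 : η * ‖q₁‖ = ε * ‖q₁‖ / 16 := by rw [hη]; ring
      nlinarith [mul_pos hεpos hp₁]
    have b2 : ‖q₁ - q₂‖ < ε * ‖q₂‖ := by
      have : η * ‖q₁‖ ≤ η * (2 * ‖q₂‖) := by gcongr
      have e1 : η * ‖q₂‖ = ε * ‖q₂‖ / 16 := by rw [hη]; ring
      nlinarith [mul_pos hεpos hp₂]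
    have c1 := (hT q₁ hq₁).scaled_chord hcone hp₁ hq₂ b1 hn₁
    have c2 := (hT q₂ hq₂).scaled_chord hcone hp₂ hq₁ b2 hn₂
    have c1' : |inner ℝ (y - q₁) (q₂ - q₁)| ≤ 1 / 16 * ‖q₁ - q₂‖ ^ 2 := by
      refine c1.trans ?_
      rw [norm_sub_rev q₂ q₁]
      calc ε⁻¹ / ‖q₁‖ * ‖y - q₁‖ * ‖q₁ - q₂‖ ^ 2
          ≤ ε⁻¹ / ‖q₁‖ * (η * ‖q₁‖) * ‖q₁ - q₂‖ ^ 2 := by gcongr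
        _ = (ε⁻¹ * η) * ‖q₁ - q₂‖ ^ 2 := by field_simp
        _ = _ := by rw [hηε]
    have c2' : |inner ℝ (y - q₂) (q₁ - q₂)| ≤ 1 / 16 * ‖q₁ - q₂‖ ^ 2 := by
      refine c2.trans ?_
      calc ε⁻¹ / ‖q₂‖ * ‖y - q₂‖ * ‖q₁ - q₂‖ ^ 2
          ≤ ε⁻¹ / ‖q₂‖ * (η * ‖q₂‖) * ‖q₁ - q₂‖ ^ 2 := by gcongr
        _ = (ε⁻¹ * η) * ‖q₁ - q₂‖ ^ 2 := by field_simp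
        _ = _ := by rw [hηε]
    have c3 : ‖q₁ - q₂‖ ^ 2 = inner ℝ (y - q₂) (q₁ - q₂) + inner ℝ (y - q₁) (q₂ - q₁) := by
      rw [← real_inner_self_eq_norm_sq, ← neg_sub q₁ q₂, inner_neg_right, ← sub_eq_add_neg,
        ← inner_sub_left]
      congr 1; abel
    have c4 : ‖q₁ - q₂‖ ^ 2 ≤ 0 := by
      have := le_abs_self (inner ℝ (y - q₁) (q₂ - q₁))
      have := le_abs_self (inner ℝ (y - q₂) (q₁ - q₂))
      nlinarith [sq_nonneg ‖q₁ - q₂‖]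
    have c5 : ‖q₁ - q₂‖ = 0 := by
      have := sq_nonneg ‖q₁ - q₂‖
      exact pow_eq_zero_iff (two_ne_zero) |>.1 (le_antisymm c4 this)
    exact sub_eq_zero.1 (norm_eq_zero.1 c5)
  -- `π y` is the unique point of `N` close to `y` such that `y - π y` is normal to `N` there
  let Pr : F → F → Prop := fun y q => q ∈ N ∧ ‖y - q‖ < η * ‖q‖ ∧
    ∀ v ∈ tangentSubspace N q, inner ℝ (y - q) v = 0
  let π : F → F := fun y => Classical.epsilon (Pr y)
  have hπ : ∀ y q, Pr y q → π y = q := by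
    intro y q hq
    have hs : Pr y (π y) := Classical.epsilon_spec ⟨q, hq⟩
    exact huniq y _ hs.1 _ hq.1 hs.2.1 hq.2.1 hs.2.2 hq.2.2
  set δ := ε * η / 4 with hδ
  have hδpos : 0 < δ := by positivity
  have hδη : δ ≤ η := by rw [hδ]; nlinarith
  have hδε : δ ≤ ε := by rw [hδ]; nlinarith
  have hη16 : η ≤ 1 / 16 := by rw [hη]; linarith
  have hδε' : ε⁻¹ * δ = η / 4 := by rw [hδ]; field_simp
  -- near `p` the projection is the rescaled local retraction
  have hloc : ∀ p ∈ N, ∃ π' : F → F, ContDiffOn ℝ ∞ π' (ball p (δ * ‖p‖)) ∧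
      ∀ y ∈ ball p (δ * ‖p‖), π y = π' y ∧ π' y ∈ N ∧
      (∀ v ∈ tangentSubspace N (π' y), inner ℝ (y - π' y) v = 0) ∧ ‖y - π' y‖ ≤ ε⁻¹ * ‖y - p‖ ∧
      ‖fderiv ℝ π' y‖ ≤ ε⁻¹ ∧
      ∀ y' ∈ ball p (δ * ‖p‖), ‖fderiv ℝ π' y - fderiv ℝ π' y'‖ ≤ ε⁻¹ / ‖p‖ * ‖y - y'‖ := by
    intro p hp
    obtain ⟨π', h1, h2⟩ := (hT p hp).scaled_retraction hcone (hpos p hp)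
    have hsub : ball p (δ * ‖p‖) ⊆ ball p (ε * ‖p‖) := ball_subset_ball (by gcongr)
    refine ⟨π', h1.mono hsub, fun y hy => ?_⟩
    obtain ⟨a, b, c, d, e⟩ := h2 y (hsub hy)
    refine ⟨hπ y _ ⟨a, ?_, b⟩, a, b, c, d, fun y' hy' => e y' (hsub hy')⟩
    rw [mem_ball, dist_eq_norm] at hy
    have c' : ‖y - π' y‖ ≤ η / 4 * ‖p‖ := by
      calc _ ≤ _ := c
        _ ≤ ε⁻¹ * (δ * ‖p‖) := by gcongr
        _ = _ := by rw [← mul_assoc, hδε']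
    have hpp := hpos p hp
    have t : ‖p‖ ≤ ‖π' y‖ + ‖y - π' y‖ + ‖y - p‖ := by
      calc ‖p‖ = ‖π' y + (y - π' y) - (y - p)‖ := by congr 1; abel
        _ ≤ _ := (norm_sub_le _ _).trans (by gcongr; exact norm_add_le _ _)
    have m1 : δ * ‖p‖ ≤ 1 / 16 * ‖p‖ := by gcongr; linarith
    have m2 : η / 4 * ‖p‖ ≤ 1 / 16 * ‖p‖ :=
      mul_le_mul_of_nonneg_right (by linarith) hpp.le
    have m3 : 1 / 2 * ‖p‖ ≤ ‖π' y‖ := by linarith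
    have m4 : η * (1 / 2 * ‖p‖) ≤ η * ‖π' y‖ := by gcongr
    nlinarith [mul_pos hηpos hpp]
  have hfd : ∀ p ∈ N, ∀ π' : F → F, (∀ y ∈ ball p (δ * ‖p‖), π y = π' y) →
      ∀ y ∈ ball p (δ * ‖p‖), fderiv ℝ π y = fderiv ℝ π' y := by
    intro p hp π' h y hy
    exact (Filter.eventuallyEq_of_mem (isOpen_ball.mem_nhds hy) h).fderiv_eq
  refine ⟨δ, ε⁻¹, π, hδpos, by linarith, (one_le_inv₀ hεpos).2 hε1, ?_, ?_, ?_, ?_, ?_, ?_, ?_⟩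
  · intro p hp
    obtain ⟨π', h1, h2⟩ := hloc p hp
    exact h1.congr fun y hy => (h2 y hy).1
  · intro p hp y hy
    obtain ⟨π', h1, h2⟩ := hloc p hp
    rw [(h2 y hy).1]; exact (h2 y hy).2.1
  · intro p hp y hy
    obtain ⟨π', h1, h2⟩ := hloc p hp
    rw [(h2 y hy).1]; exact (h2 y hy).2.2.1
  · intro p hp y hy
    obtain ⟨π', h1, h2⟩ := hloc p hp
    rw [(h2 y hy).1]; exact (h2 y hy).2.2.2.1
  · intro q hq y hy hn
    refine hπ y q ⟨hq, ?_, hn⟩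
    rw [mem_ball, dist_eq_norm] at hy
    exact hy.trans_le (by gcongr)
  · intro p hp y hy
    obtain ⟨π', h1, h2⟩ := hloc p hp
    rw [hfd p hp π' (fun y hy => (h2 y hy).1) y hy]
    exact (h2 y hy).2.2.2.2.1
  · intro p hp y hy y' hy'
    obtain ⟨π', h1, h2⟩ := hloc p hp
    rw [hfd p hp π' (fun y hy => (h2 y hy).1) y hy, hfd p hp π' (fun y hy => (h2 y hy).1) y' hy']
    exact (h2 y hy).2.2.2.2.2 y' hy'

namespace IsConeTube

variable {N : Set F} {δ K : ℝ} {π : F → F}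

theorem apply_self (h : IsConeTube N δ K π) {p : F} (hp : p ∈ N) (hp0 : p ≠ 0) : π p = p :=
  h.unique p hp p (mem_ball_self (mul_pos h.δ_pos (norm_pos_iff.2 hp0))) (by simp)

theorem contDiffAt (h : IsConeTube N δ K π) {p y : F} (hp : p ∈ N)
    (hy : y ∈ ball p (δ * ‖p‖)) : ContDiffAt ℝ ∞ π y :=
  (h.smooth p hp).contDiffAt (isOpen_ball.mem_nhds hy)

theorem hasFDerivAt (h : IsConeTube N δ K π) {p y : F} (hp : p ∈ N)
    (hy : y ∈ ball p (δ * ‖p‖)) : HasFDerivAt π (fderiv ℝ π y) y :=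
  ((h.contDiffAt hp hy).differentiableAt (by simp)).hasFDerivAt

theorem lipschitz (h : IsConeTube N δ K π) {p y y' : F} (hp : p ∈ N)
    (hy : y ∈ ball p (δ * ‖p‖)) (hy' : y' ∈ ball p (δ * ‖p‖)) : ‖π y' - π y‖ ≤ K * ‖y' - y‖ :=
  (convex_ball p _).norm_image_sub_le_of_norm_fderiv_le
    (fun _ hz => (h.hasFDerivAt hp hz).differentiableAt) (h.fderiv_le p hp) hy hy'

end IsConeTube

end ConeTube

end

noncomputable section

/-! ### Normal reparametrization of a perturbed cone -/

section Perturbation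

variable {F : Type*} [NormedAddCommGroup F] [InnerProductSpace ℝ F] [FiniteDimensional ℝ F]

/-- `f : N → F` is asymptotic to the inclusion of the cone `N` at rate `1 + ν` with one derivative.
The derivative of `f` along `N` is that of `f ∘ π`, for `π` the projection onto `N`. -/
structure IsConePerturbation (N : Set F) (π : F → F) (ν c ε : ℝ) (f : F → F) : Prop where
  smooth : ∀ p ∈ N, ‖p‖ < ε → ContDiffAt ℝ ∞ (f ∘ π) p
  dist_le : ∀ p ∈ N, ‖p‖ < ε → ‖f p - p‖ ≤ c * ‖p‖ ^ ν * ‖p‖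
  fderiv_le : ∀ p ∈ N, ‖p‖ < ε → ‖fderiv ℝ (f ∘ π) p - fderiv ℝ π p‖ ≤ c * ‖p‖ ^ ν

namespace IsConeTube

variable {N : Set F} {δ K : ℝ} {π : F → F}

/-- The derivative of the projection kills normal vectors. -/
theorem fderiv_normal (h : IsConeTube N δ K π) {q n : F} (hq : q ∈ N) (hq0 : q ≠ 0)
    (hn : ∀ v ∈ tangentSubspace N q, inner ℝ n v = 0) : fderiv ℝ π q n = 0 := by
  have hpos : 0 < δ * ‖q‖ := mul_pos h.δ_pos (norm_pos_iff.2 hq0)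
  have h1 : HasFDerivAt π (fderiv ℝ π q) (q + (0 : ℝ) • n) := by
    simpa using h.hasFDerivAt hq (mem_ball_self hpos)
  have h2 : HasDerivAt (fun t : ℝ => q + t • n) n 0 := by
    simpa using ((hasDerivAt_id (0 : ℝ)).smul_const n).const_add q
  have h3 := h1.comp_hasDerivAt (0 : ℝ) h2
  have h4 : (fun t : ℝ => π (q + t • n)) =ᶠ[𝓝 0] fun _ => q := by
    have : ∀ᶠ t in 𝓝 (0 : ℝ), q + t • n ∈ ball q (δ * ‖q‖) :=
      h2.continuousAt.eventually (isOpen_ball.mem_nhds (by simpa using hpos))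
    filter_upwards [this] with t ht
    refine h.unique q hq _ ht fun v hv => ?_
    rw [add_sub_cancel_left, inner_smul_left, hn v hv, mul_zero]
  exact (h3.unique ((hasDerivAt_const (0 : ℝ) q).congr_of_eventuallyEq h4))

theorem fderiv_tangent (h : IsConeTube N δ K π) (h0 : (0 : F) ∉ N) {q u : F} (hq : q ∈ N)
    (hu : u ∈ tangentSubspace N q) : fderiv ℝ π q u = u := by
  have hq0 : q ≠ 0 := fun h => h0 (h ▸ hq)
  have hpos : 0 < δ * ‖q‖ := mul_pos h.δ_pos (norm_pos_iff.2 hq0)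
  have h1 : HasFDerivWithinAt π (fderiv ℝ π q) N q :=
    (h.hasFDerivAt hq (mem_ball_self hpos)).hasFDerivWithinAt
  have h2 : HasFDerivWithinAt π (ContinuousLinearMap.id ℝ F) N q :=
    (hasFDerivWithinAt_id q N).congr
      (fun x hx => h.apply_self hx (fun h' => h0 (h' ▸ hx))) (h.apply_self hq hq0)
  exact h1.eqOn_tangentSubspace h2 hu

/-- The local estimates for the perturbation `f ∘ π` and for `ζ = π ∘ f ∘ π - π` on a ball around a
point of the cone. -/
theorem perturbation_estimates (h : IsConeTube N δ K π) (h0 : (0 : F) ∉ N) {ν c ε : ℝ} {f : F → F}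
    (hν : 0 ≤ ν) (hc : 0 ≤ c) (hf : IsConePerturbation N π ν c ε f) {a t : ℝ}
    (ha : a = δ / (8 * K)) {p : F} (hp : p ∈ N) (hpε : 2 * ‖p‖ < ε) (ht : t = c * (2 * ‖p‖) ^ ν)
    (hta : t ≤ a / (16 * K ^ 3)) {x : F} (hx : x ∈ ball p (2 * a * ‖p‖)) :
    (x ∈ ball p (δ * ‖p‖) ∧ π x ∈ N ∧ ‖π x‖ < ε ∧ ‖π x‖ ≤ 2 * ‖p‖ ∧ ‖π x - p‖ ≤ K * ‖x - p‖) ∧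
    (π x ∈ ball p (δ * ‖p‖) ∧ f (π x) ∈ ball p (δ * ‖p‖) ∧ ‖f (π x) - π x‖ ≤ 2 * t * ‖p‖) ∧
    ContDiffAt ℝ ∞ (f ∘ π) x ∧ ‖fderiv ℝ (f ∘ π) x - fderiv ℝ π x‖ ≤ K * t ∧
    ‖π (f (π x)) - π x‖ ≤ 2 * K * t * ‖p‖ ∧
    ContDiffAt ℝ ∞ (fun y => π (f (π y)) - π y) x ∧
    ‖fderiv ℝ (fun y => π (f (π y)) - π y) x‖ ≤ 5 * K ^ 2 * t := by
  have hδ := h.δ_pos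
  have hδ4 := h.δ_le
  have hK := h.one_le
  have hK0 : 0 < K := by linarith
  have hp0 : p ≠ 0 := fun h => h0 (h ▸ hp)
  have hpn : 0 < ‖p‖ := norm_pos_iff.2 hp0
  have haK : a * K = δ / 8 := by rw [ha]; field_simp
  have hapos : 0 < a := by rw [ha]; positivity
  have haδ : a ≤ δ / 8 := by rw [← haK]; nlinarith
  have ht0 : 0 ≤ t := by rw [ht]; positivity
  have hK3 : 1 ≤ K ^ 3 := one_le_pow₀ hK
  have hta' : t ≤ a / 16 := hta.trans (by gcongr; linarith)
  have hxδ : x ∈ ball p (δ * ‖p‖) := by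
    refine ball_subset_ball ?_ hx
    gcongr; linarith
  have hpδ : p ∈ ball p (δ * ‖p‖) := mem_ball_self (by positivity)
  have hπp : π p = p := h.apply_self hp hp0
  have hq : π x ∈ N := h.mem p hp x hxδ
  have hq0 : π x ≠ 0 := fun h => h0 (h ▸ hq)
  have hqp : ‖π x - p‖ ≤ K * ‖x - p‖ := by
    have := h.lipschitz hp hpδ hxδ
    rwa [hπp] at this
  have hxn : ‖x - p‖ < 2 * a * ‖p‖ := by rwa [mem_ball, dist_eq_norm] at hx
  have hqp' : ‖π x - p‖ ≤ δ / 4 * ‖p‖ := by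
    calc _ ≤ _ := hqp
      _ ≤ K * (2 * a * ‖p‖) := by gcongr
      _ = 2 * (a * K) * ‖p‖ := by ring
      _ = _ := by rw [haK]; ring
  have hq2 : ‖π x‖ ≤ 2 * ‖p‖ := by
    have h1 : ‖π x‖ ≤ ‖π x - p‖ + ‖p‖ := by
      have := norm_add_le (π x - p) p; rwa [sub_add_cancel] at this
    nlinarith
  have hqε : ‖π x‖ < ε := by linarith
  have hqδ : π x ∈ ball p (δ * ‖p‖) := by
    rw [mem_ball, dist_eq_norm]
    refine hqp'.trans_lt ?_
    gcongr; linarith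
  have htq : c * ‖π x‖ ^ ν ≤ t := by rw [ht]; gcongr
  have hfq : ‖f (π x) - π x‖ ≤ 2 * t * ‖p‖ := by
    calc _ ≤ _ := hf.dist_le _ hq hqε
      _ ≤ t * (2 * ‖p‖) := by gcongr
      _ = _ := by ring
  have hfδ : f (π x) ∈ ball p (δ * ‖p‖) := by
    rw [mem_ball, dist_eq_norm]
    have h1 : ‖f (π x) - p‖ ≤ ‖f (π x) - π x‖ + ‖π x - p‖ := by
      have := norm_add_le (f (π x) - π x) (π x - p); rwa [sub_add_sub_cancel] at this
    have : 2 * t * ‖p‖ ≤ δ / 4 * ‖p‖ := by gcongr; linarith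
    have : 0 < δ * ‖p‖ := by positivity
    linarith
  have hqself : π x ∈ ball (π x) (δ * ‖π x‖) := mem_ball_self (mul_pos hδ (norm_pos_iff.2 hq0))
  -- all derivatives are computed from `π = π ∘ π`, which holds near `x`
  have hππ : π =ᶠ[𝓝 x] π ∘ π := by
    filter_upwards [isOpen_ball.mem_nhds hxδ] with y hy
    have := h.mem p hp y hy
    exact (h.apply_self this (fun h => h0 (h ▸ this))).symm
  have hfππ : f ∘ π =ᶠ[𝓝 x] (f ∘ π) ∘ π := hππ.fun_comp f
  have hπd := h.hasFDerivAt hp hxδ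
  have hfs : ContDiffAt ℝ ∞ (f ∘ π) x :=
    ((hf.smooth _ hq hqε).comp x (h.contDiffAt hp hxδ)).congr_of_eventuallyEq hfππ
  have hfd : HasFDerivAt (f ∘ π) (fderiv ℝ (f ∘ π) x) x :=
    (hfs.differentiableAt (by simp)).hasFDerivAt
  have e1 : fderiv ℝ (f ∘ π) x = (fderiv ℝ (f ∘ π) (π x)).comp (fderiv ℝ π x) := by
    refine hfππ.fderiv_eq.trans ?_
    exact (((hf.smooth _ hq hqε).differentiableAt (by simp)).hasFDerivAt.comp x hπd).fderiv
  have e2 : fderiv ℝ π x = (fderiv ℝ π (π x)).comp (fderiv ℝ π x) := by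
    refine hππ.fderiv_eq.trans ?_
    exact ((h.hasFDerivAt hq hqself).comp x hπd).fderiv
  have hDx : ‖fderiv ℝ π x‖ ≤ K := h.fderiv_le p hp x hxδ
  have e3 : ‖fderiv ℝ (f ∘ π) x - fderiv ℝ π x‖ ≤ K * t := by
    have e4 : fderiv ℝ (f ∘ π) x - fderiv ℝ π x =
        (fderiv ℝ (f ∘ π) (π x) - fderiv ℝ π (π x)).comp (fderiv ℝ π x) := by
      rw [ContinuousLinearMap.sub_comp, ← e1, ← e2]
    rw [e4]
    refine (ContinuousLinearMap.opNorm_comp_le _ _).trans ?_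
    calc _ ≤ t * K := mul_le_mul ((hf.fderiv_le _ hq hqε).trans htq) hDx (norm_nonneg _) ht0
      _ = _ := mul_comm _ _
  have e5 : ‖π (f (π x)) - π x‖ ≤ 2 * K * t * ‖p‖ := by
    have := h.lipschitz hp hqδ hfδ
    rw [h.apply_self hq hq0] at this
    calc _ ≤ _ := this
      _ ≤ K * (2 * t * ‖p‖) := by gcongr
      _ = _ := by ring
  have hπf : HasFDerivAt π (fderiv ℝ π (f (π x))) ((f ∘ π) x) := h.hasFDerivAt hp hfδ
  have e6 : HasFDerivAt (fun y => π (f (π y)) - π y)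
      ((fderiv ℝ π (f (π x))).comp (fderiv ℝ (f ∘ π) x) - fderiv ℝ π x) x :=
    (hπf.comp x hfd).sub hπd
  have e7 : ContDiffAt ℝ ∞ (fun y => π (f (π y)) - π y) x :=
    (ContDiffAt.comp (f := f ∘ π) x (h.contDiffAt hp hfδ) hfs).sub (h.contDiffAt hp hxδ)
  refine ⟨⟨hxδ, hq, hqε, hq2, hqp⟩, ⟨hqδ, hfδ, hfq⟩, hfs, e3, e5, e7, ?_⟩
  rw [e6.fderiv]
  -- `dζ` is small because `dπ` varies little between `π x` and `f (π x)`, and `d(f ∘ π)` is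
  -- close to `dπ`
  have e8 : (fderiv ℝ π (f (π x))).comp (fderiv ℝ (f ∘ π) x) - fderiv ℝ π x =
      (fderiv ℝ π (f (π x)) - fderiv ℝ π (π x)).comp (fderiv ℝ (f ∘ π) x) +
      (fderiv ℝ π (π x)).comp (fderiv ℝ (f ∘ π) x - fderiv ℝ π x) := by
    rw [ContinuousLinearMap.sub_comp, ContinuousLinearMap.comp_sub, ← e2]
    abel
  have hfx : ‖fderiv ℝ (f ∘ π) x‖ ≤ 2 * K := by
    calc ‖fderiv ℝ (f ∘ π) x‖ = ‖(fderiv ℝ (f ∘ π) x - fderiv ℝ π x) + fderiv ℝ π x‖ := by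
          rw [sub_add_cancel]
      _ ≤ K * t + K := (norm_add_le _ _).trans (add_le_add e3 hDx)
      _ ≤ 2 * K := by nlinarith
  have hl : ‖fderiv ℝ π (f (π x)) - fderiv ℝ π (π x)‖ ≤ 2 * K * t := by
    calc _ ≤ _ := h.fderiv_lip p hp _ hfδ _ hqδ
      _ ≤ K / ‖p‖ * (2 * t * ‖p‖) := by gcongr
      _ = _ := by field_simp
  rw [e8]
  calc _ ≤ ‖fderiv ℝ π (f (π x)) - fderiv ℝ π (π x)‖ * ‖fderiv ℝ (f ∘ π) x‖ +
        ‖fderiv ℝ π (π x)‖ * ‖fderiv ℝ (f ∘ π) x - fderiv ℝ π x‖ :=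
      (norm_add_le _ _).trans (add_le_add (ContinuousLinearMap.opNorm_comp_le _ _)
        (ContinuousLinearMap.opNorm_comp_le _ _))
    _ ≤ (2 * K * t) * (2 * K) + K * (K * t) := by
      gcongr
      exact h.fderiv_le p hp _ hqδ
    _ = _ := by ring

end IsConeTube

end Perturbation

end

noncomputable section

section Perturbation

variable {F : Type*} [NormedAddCommGroup F] [InnerProductSpace ℝ F] [FiniteDimensional ℝ F]

/-- A map that differs from the identity by a contraction of a ball hits the centre. -/
theorem exists_add_eq_of_contraction {ζ : F → F} {p : F} {ρ : ℝ} (hρ : 0 ≤ ρ)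
    (hζ : ∀ x ∈ closedBall p ρ, ‖ζ x‖ ≤ ρ)
    (hL : ∀ x ∈ closedBall p ρ, ∀ y ∈ closedBall p ρ, ‖ζ x - ζ y‖ ≤ 1 / 2 * ‖x - y‖) :
    ∃ x ∈ closedBall p ρ, x + ζ x = p := by
  let T : F → F := fun x => p - ζ x
  have hT : MapsTo T (closedBall p ρ) (closedBall p ρ) := by
    intro x hx
    rw [mem_closedBall, dist_eq_norm]
    simpa [T] using hζ x hx
  have hcon : ContractingWith (1 / 2) (hT.restrict T _ _) := by
    refine ⟨by norm_num, LipschitzWith.of_dist_le_mul ?_⟩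
    rintro ⟨x, hx⟩ ⟨y, hy⟩
    have := hL x hx y hy
    simp only [Subtype.dist_eq, MapsTo.val_restrict_apply, T, dist_eq_norm]
    rw [sub_sub_sub_cancel_left, norm_sub_rev]
    simpa using this
  obtain ⟨x, hx, hfix, -⟩ := hcon.exists_fixedPoint' isClosed_closedBall.isComplete hT
    (mem_closedBall_self hρ) (edist_ne_top _ _)
  refine ⟨x, hx, ?_⟩
  have : p - ζ x = x := hfix
  rw [← eq_sub_iff_add_eq]
  exact this.symm

theorem eventually_mul_rpow_le {c ν t₀ : ℝ} (hν : 0 < ν) (ht₀ : 0 < t₀) :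
    ∃ r > 0, ∀ s, 0 ≤ s → s < r → c * s ^ ν ≤ t₀ := by
  have h : Tendsto (fun s : ℝ => c * s ^ ν) (𝓝 0) (𝓝 (c * 0 ^ ν)) :=
    ((Real.continuousAt_rpow_const 0 ν (Or.inr hν.le)).const_mul c)
  rw [Real.zero_rpow hν.ne', mul_zero] at h
  obtain ⟨r, hr, hr'⟩ := Metric.eventually_nhds_iff_ball.1 (h.eventually (gt_mem_nhds ht₀))
  refine ⟨r, hr, fun s hs hsr => (hr' s ?_).le⟩
  rw [mem_ball_zero_iff, Real.norm_of_nonneg hs]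
  exact hsr

set_option maxHeartbeats 2000000 in
/-- A perturbed cone is a normal graph over the cone near the apex: `Φ p` is the point of the image
of `f` whose projection to the cone is `p`. -/
theorem IsConeTube.exists_normal_reparam {N : Set F} {δ K : ℝ} {π : F → F}
    (h : IsConeTube N δ K π) (h0 : (0 : F) ∉ N) {ν c ε : ℝ} {f : F → F} (hν : 0 < ν) (hν1 : ν ≤ 1)
    (hc : 0 ≤ c) (hε : 0 < ε) (hf : IsConePerturbation N π ν c ε f) :
    ∃ ε' > 0, ∃ C > 0, ∃ Φ : F → F,
      (∀ p ∈ N, ‖p‖ < ε' → ContDiffAt ℝ ∞ Φ p ∧ ‖Φ p - p‖ ≤ C * ‖p‖ ^ ν * ‖p‖ ∧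
        (∀ u ∈ tangentSubspace N p, ‖fderiv ℝ Φ p u - u‖ ≤ C * ‖p‖ ^ ν * ‖u‖) ∧
        Φ p ∈ ball p (δ * ‖p‖) ∧ π (Φ p) = p ∧ ∃ q ∈ N, ‖q‖ < ε ∧ Φ p = f q) ∧
      ∀ q ∈ N, ‖q‖ < ε' → f q ∈ ball q (δ * ‖q‖) ∧
        (‖π (f q)‖ < ε' → Φ (π (f q)) = f q) := by
  have hδ := h.δ_pos
  have hδ4 := h.δ_le
  have hK := h.one_le
  have hK0 : 0 < K := by linarith
  set a := δ / (8 * K) with ha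
  have haK : a * K = δ / 8 := by rw [ha]; field_simp
  have hapos : 0 < a := by rw [ha]; positivity
  have haδ : a ≤ δ / 8 := by rw [← haK]; nlinarith
  set t₀ := a / (16 * K ^ 3) with ht₀
  have hK1 : K ≤ K ^ 3 := le_self_pow₀ hK (by norm_num)
  have hK2 : K ^ 2 ≤ K ^ 3 := pow_le_pow_right₀ hK (by norm_num)
  have hK3 : 1 ≤ K ^ 3 := one_le_pow₀ hK
  have ht₀K : t₀ * K ^ 3 = a / 16 := by rw [ht₀]; field_simp
  have ht₀pos : 0 < t₀ := by positivity
  obtain ⟨r, hr, hrt⟩ := eventually_mul_rpow_le (c := c) hν ht₀pos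
  set ε' := min (ε / 2) (r / 2) with hε'
  have hε'pos : 0 < ε' := by positivity
  have hε'1 : ε' ≤ ε / 2 := min_le_left _ _
  have hε'2 : ε' ≤ r / 2 := min_le_right _ _
  -- `x + ζ x = π (f x)` for `x` on the cone, so that the point of the image of `f` lying over
  -- `p` is `f x` for the solution `x` of `x + ζ x = p`
  let ζ : F → F := fun y => π (f (π y)) - π y
  have hpos : ∀ p ∈ N, 0 < ‖p‖ := fun p hp => norm_pos_iff.2 (fun h => h0 (h ▸ hp))
  let tt : F → ℝ := fun p => c * (2 * ‖p‖) ^ ν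
  have htt0 : ∀ p, 0 ≤ tt p := fun p => by positivity
  have htt : ∀ p, ‖p‖ < ε' → tt p ≤ t₀ := fun p hp => hrt _ (by positivity) (by linarith)
  have httC : ∀ p, tt p ≤ 2 * c * ‖p‖ ^ ν := by
    intro p
    have h1 : (2 * ‖p‖) ^ ν = 2 ^ ν * ‖p‖ ^ ν := Real.mul_rpow (by norm_num) (norm_nonneg _)
    have h2 : (2 : ℝ) ^ ν ≤ 2 ^ (1 : ℝ) := Real.rpow_le_rpow_of_exponent_le (by norm_num) hν1
    rw [Real.rpow_one] at h2
    calc tt p = c * (2 ^ ν * ‖p‖ ^ ν) := by simp only [tt, h1]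
      _ ≤ c * (2 * ‖p‖ ^ ν) := by gcongr
      _ = _ := by ring
  have est : ∀ p ∈ N, ‖p‖ < ε' → ∀ x ∈ ball p (2 * a * ‖p‖), _ := fun p hp hpε x hx =>
    h.perturbation_estimates h0 hν.le hc hf ha hp (by linarith : 2 * ‖p‖ < ε)
      (rfl : tt p = c * (2 * ‖p‖) ^ ν) (htt p hpε) hx
  -- numerical consequences of the smallness of `t₀`
  have n1 : ∀ p, ‖p‖ < ε' → 2 * K * tt p ≤ a / 4 := by
    intro p hp
    have := htt p hp
    nlinarith [htt0 p, mul_le_mul_of_nonneg_right this (by positivity : (0:ℝ) ≤ K ^ 3),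
      mul_le_mul_of_nonneg_right hK1 (htt0 p)]
  have n2 : ∀ p, ‖p‖ < ε' → 5 * K ^ 2 * tt p ≤ 1 / 2 := by
    intro p hp
    have := htt p hp
    nlinarith [htt0 p, mul_le_mul_of_nonneg_right this (by positivity : (0:ℝ) ≤ K ^ 3),
      mul_le_mul_of_nonneg_right hK2 (htt0 p)]
  have n3 : ∀ p, ‖p‖ < ε' → 2 * K ^ 3 * tt p ≤ 1 / 2 := by
    intro p hp
    have := htt p hp
    nlinarith [htt0 p, mul_le_mul_of_nonneg_right this (by positivity : (0:ℝ) ≤ K ^ 3)]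
  have hLip : ∀ p ∈ N, ‖p‖ < ε' → ∀ x ∈ ball p (2 * a * ‖p‖), ∀ y ∈ ball p (2 * a * ‖p‖),
      ‖ζ x - ζ y‖ ≤ 1 / 2 * ‖x - y‖ := by
    intro p hp hpε x hx y hy
    refine (convex_ball p _).norm_image_sub_le_of_norm_fderiv_le (𝕜 := ℝ)
      (fun z hz => ?_) (fun z hz => ?_) hy hx
    · exact (est p hp hpε z hz).2.2.2.2.2.1.differentiableAt (by simp)
    · exact (est p hp hpε z hz).2.2.2.2.2.2.trans (n2 p hpε)
  have huniq : ∀ p ∈ N, ‖p‖ < ε' → ∀ x ∈ ball p (2 * a * ‖p‖), ∀ y ∈ ball p (2 * a * ‖p‖),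
      x + ζ x = y + ζ y → x = y := by
    intro p hp hpε x hx y hy hxy
    have h1 := hLip p hp hpε x hx y hy
    have h2 : x - y = -(ζ x - ζ y) := by
      rw [neg_sub, sub_eq_sub_iff_add_eq_add, add_comm (ζ y), ← hxy]
    rw [h2, norm_neg] at h1
    have h3 : ‖ζ x - ζ y‖ = 0 := by linarith [norm_nonneg (ζ x - ζ y)]
    rw [← sub_eq_zero, h2, norm_eq_zero.1 h3, neg_zero]
  -- the solution of `x + ζ x = p` exists and lies on the cone
  have hex : ∀ p ∈ N, ‖p‖ < ε' → ∃ x ∈ N, x + ζ x = p ∧ ‖x - p‖ ≤ 2 * K * tt p * ‖p‖ := by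
    intro p hp hpε
    have hpn := hpos p hp
    have hsub : closedBall p (a * ‖p‖) ⊆ ball p (2 * a * ‖p‖) := by
      refine closedBall_subset_ball ?_
      nlinarith [mul_pos hapos hpn]
    obtain ⟨x, hx, hxp⟩ := exists_add_eq_of_contraction (ζ := ζ) (p := p) (ρ := a * ‖p‖)
      (by positivity)
      (fun x hx => (est p hp hpε x (hsub hx)).2.2.2.2.1.trans (by
        have := n1 p hpε
        gcongr
        linarith))
      (fun x hx y hy => hLip p hp hpε x (hsub hx) y (hsub hy))
    obtain ⟨⟨hxδ, hq, hqε, hq2, hqp⟩, ⟨hqδ, hfδ, hfq⟩, -, -, hζx, -⟩ := est p hp hpε x (hsub hx)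
    have hxp' : x - p = -ζ x := by rw [← hxp]; abel
    have hxn : ‖x - p‖ ≤ 2 * K * tt p * ‖p‖ := by rw [hxp', norm_neg]; exact hζx
    set q := π x with hqdef
    have hq0 : q ≠ 0 := fun h => h0 (h ▸ hq)
    set b := π (f q) with hb
    have hnb : x - q = p - b := by
      have : x + (b - q) = p := hxp
      rw [← this]; abel
    have hpδ : p ∈ ball p (δ * ‖p‖) := mem_ball_self (by positivity)
    have hbN : b ∈ N := h.mem p hp _ hfδ
    have hπb : π b = b := h.apply_self hbN (fun h => h0 (h ▸ hbN))
    have hπp : π p = p := h.apply_self hp (fun h => h0 (h ▸ hp))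
    -- `x - q` is normal at `q`, but equals a short chord `p - b` of the cone near `q`
    have hker : fderiv ℝ π q (p - b) = 0 := by
      rw [← hnb]
      exact h.fderiv_normal hq hq0 (h.normal p hp x hxδ)
    set ρ := 2 * K ^ 2 * tt p * ‖p‖ with hρ
    have r1 : ‖p - q‖ ≤ ρ := by
      rw [norm_sub_rev]
      calc _ ≤ K * ‖x - p‖ := hqp
        _ ≤ K * (2 * K * tt p * ‖p‖) := by gcongr
        _ = ρ := by rw [hρ]; ring
    have r2 : ‖b - q‖ ≤ ρ := by
      calc _ ≤ _ := hζx
        _ ≤ ρ := by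
          rw [hρ]
          have : K ≤ K ^ 2 := le_self_pow₀ hK (by norm_num)
          have := htt0 p
          gcongr
    have hqq : ‖x - p‖ < 2 * a * ‖p‖ := by
      have := hsub hx; rwa [mem_ball, dist_eq_norm] at this
    have r3 : ρ < δ * ‖p‖ := by
      rw [hρ]
      refine mul_lt_mul_of_pos_right ?_ hpn
      nlinarith [htt p hpε, mul_le_mul_of_nonneg_right (htt p hpε)
        (by positivity : (0:ℝ) ≤ K ^ 3), mul_le_mul_of_nonneg_right hK2 (htt0 p)]
    have hbδ : b ∈ ball p (2 * (δ * ‖p‖)) := by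
      rw [mem_ball, dist_eq_norm]
      have : ‖b - p‖ ≤ ‖b - q‖ + ‖q - p‖ := by
        have := norm_add_le (b - q) (q - p); rwa [sub_add_sub_cancel] at this
      have : ‖q - p‖ ≤ ρ := by rw [norm_sub_rev]; exact r1
      linarith
    have hρδ : ρ ≤ δ / 4 * ‖p‖ := by
      rw [hρ]
      refine mul_le_mul_of_nonneg_right ?_ hpn.le
      nlinarith [htt p hpε, mul_le_mul_of_nonneg_right (htt p hpε)
        (by positivity : (0:ℝ) ≤ K ^ 3), mul_le_mul_of_nonneg_right hK2 (htt0 p)]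
    have hsubq : closedBall q ρ ⊆ ball p (δ * ‖p‖) := by
      intro z hz
      rw [mem_closedBall, dist_eq_norm] at hz
      rw [mem_ball, dist_eq_norm]
      have : ‖z - p‖ ≤ ‖z - q‖ + ‖q - p‖ := by
        have := norm_add_le (z - q) (q - p); rwa [sub_add_sub_cancel] at this
      have : ‖q - p‖ ≤ ρ := by rw [norm_sub_rev]; exact r1
      have : 0 < δ * ‖p‖ := by positivity
      linarith
    have hmv : ‖π p - π b - fderiv ℝ π q (p - b)‖ ≤ K / ‖p‖ * ρ * ‖p - b‖ := by
      refine (convex_closedBall q ρ).norm_image_sub_le_of_norm_hasFDerivWithin_le' (f := π)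
        (f' := fderiv ℝ π) (φ := fderiv ℝ π q) ?_ ?_ ?_ ?_
      · intro z hz
        exact (h.hasFDerivAt hp (hsubq hz)).hasFDerivWithinAt
      · intro z hz
        refine (h.fderiv_lip p hp z (hsubq hz) q hqδ).trans ?_
        gcongr
        rwa [mem_closedBall, dist_eq_norm] at hz
      · rwa [mem_closedBall, dist_eq_norm]
      · rwa [mem_closedBall, dist_eq_norm]
    rw [hker, sub_zero, hπp, hπb] at hmv
    have hKρ : K / ‖p‖ * ρ ≤ 1 / 2 := by
      have : K / ‖p‖ * ρ = 2 * K ^ 3 * tt p := by rw [hρ]; field_simp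
      rw [this]; exact n3 p hpε
    have hz : ‖p - b‖ = 0 := by
      have := mul_le_mul_of_nonneg_right hKρ (norm_nonneg (p - b))
      linarith [norm_nonneg (p - b)]
    have hxq : x = q := by
      rw [← sub_eq_zero, hnb, norm_eq_zero.1 hz]
    refine ⟨x, by rw [hxq]; exact hq, hxp, hxn⟩
  -- `κ z` is the solution of `x + ζ x = z` near `z`, for `z` near the cone
  let Pr : F → F → Prop := fun z x => ‖x - z‖ ≤ a / 2 * ‖z‖ ∧ x + ζ x = z
  let κ : F → F := fun z => Classical.epsilon (Pr z)
  have ha32 : a ≤ 1 / 32 := by linarith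
  have hκ : ∀ p ∈ N, ‖p‖ < ε' → ∀ z ∈ ball p (a / 4 * ‖p‖), ∀ x, Pr z x → κ z = x := by
    intro p hp hpε z hz x hx
    have hs : Pr z (κ z) := Classical.epsilon_spec ⟨x, hx⟩
    have hpn := hpos p hp
    rw [mem_ball, dist_eq_norm] at hz
    have hzn : ‖z‖ ≤ 2 * ‖p‖ := by
      have : ‖z‖ ≤ ‖z - p‖ + ‖p‖ := by
        have := norm_add_le (z - p) p; rwa [sub_add_cancel] at this
      nlinarith
    have hin : ∀ y, Pr z y → y ∈ ball p (2 * a * ‖p‖) := by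
      intro y hy
      rw [mem_ball, dist_eq_norm]
      have h1 : ‖y - p‖ ≤ ‖y - z‖ + ‖z - p‖ := by
        have := norm_add_le (y - z) (z - p); rwa [sub_add_sub_cancel] at this
      have h2 : a / 2 * ‖z‖ ≤ a / 2 * (2 * ‖p‖) := by gcongr
      have := hy.1
      nlinarith [mul_pos hapos hpn]
    exact huniq p hp hpε _ (hin _ hs) _ (hin _ hx) (hs.2.trans hx.2.symm)
  have hκp : ∀ p ∈ N, ‖p‖ < ε' → ∀ x, Pr p x → κ p = x := fun p hp hpε =>
    hκ p hp hpε p (mem_ball_self (by have := hpos p hp; positivity))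
  set C := 28 * K ^ 3 * (c + 1) with hC
  refine ⟨ε', hε'pos, C, by positivity, fun z => (f ∘ π) (κ z), ?_, ?_⟩
  · intro p hp hpε
    have hpn := hpos p hp
    have ht := htt0 p
    obtain ⟨x, hxN, hxp, hxd⟩ := hex p hp hpε
    have hx0 : x ≠ 0 := fun h => h0 (h ▸ hxN)
    have hxd' : ‖x - p‖ ≤ a / 4 * ‖p‖ := hxd.trans (by gcongr; exact n1 p hpε)
    have hκx : κ p = x := hκp p hp hpε x ⟨hxd'.trans (by gcongr; norm_num), hxp⟩
    have hxb : x ∈ ball p (2 * a * ‖p‖) := by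
      rw [mem_ball, dist_eq_norm]
      nlinarith [mul_pos hapos hpn]
    have hπx : π x = x := h.apply_self hxN hx0
    obtain ⟨⟨hxδ, hq, hqε, hq2, hqp⟩, ⟨hqδ, hfδ, hfq⟩, hfs, hfd, hζx, hζs, hζd⟩ :=
      est p hp hpε x hxb
    rw [hπx] at hfδ hfq hqε
    -- smoothness of `κ` at `p` by the inverse function theorem
    have hΨs : ContDiffOn ℝ ∞ (fun y => y + ζ y) (ball p (2 * a * ‖p‖)) := fun y hy =>
      (contDiffAt_id.add (est p hp hpε y hy).2.2.2.2.2.1).contDiffWithinAt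
    have hζD : HasFDerivAt ζ (fderiv ℝ ζ x) x := (hζs.differentiableAt (by simp)).hasFDerivAt
    have hD : HasFDerivAt (fun y => y + ζ y) (ContinuousLinearMap.id ℝ F + fderiv ℝ ζ x) x :=
      (hasFDerivAt_id x).add hζD
    have hζ2 : ∀ v, ‖fderiv ℝ ζ x v‖ ≤ 5 * K ^ 2 * tt p * ‖v‖ := fun v =>
      (ContinuousLinearMap.le_opNorm _ _).trans (by gcongr)
    have hζ3 : ∀ v, ‖fderiv ℝ ζ x v‖ ≤ 1 / 2 * ‖v‖ := fun v =>
      (hζ2 v).trans (by gcongr; exact n2 p hpε)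
    have hinj : Function.Injective (ContinuousLinearMap.id ℝ F + fderiv ℝ ζ x) := by
      rw [injective_iff_map_eq_zero]
      intro v hv
      have h1 : v = -fderiv ℝ ζ x v := by
        rw [eq_neg_iff_add_eq_zero]; exact hv
      have h2 := hζ3 v
      have h3 : ‖v‖ = ‖fderiv ℝ ζ x v‖ := by conv_lhs => rw [h1, norm_neg]
      exact norm_eq_zero.1 (by linarith [norm_nonneg v])
    obtain ⟨D', hD'⟩ := ContinuousLinearMap.exists_equiv_of_injective _ hinj rfl
    rw [← hD'] at hD
    obtain ⟨e, hes, hesub, heq, hesm⟩ := exists_localInverse isOpen_ball hxb hΨs D' hD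
    have hex' : e x = p := by rw [heq]; exact hxp
    have hpt : p ∈ e.target := by rw [← hex']; exact e.map_source hes
    have hep : e.symm p = x := by rw [← hex']; exact e.left_inv hes
    have hesat : ContDiffAt ℝ ∞ e.symm p := hesm.contDiffAt (e.open_target.mem_nhds hpt)
    have hκe : κ =ᶠ[𝓝 p] e.symm := by
      have hcont : ContinuousAt (fun z => a / 2 * ‖z‖ - ‖e.symm z - z‖) p :=
        (continuousAt_id.norm.const_mul _).sub ((hesat.continuousAt.sub continuousAt_id).norm)
      have hpos' : 0 < a / 2 * ‖p‖ - ‖e.symm p - p‖ := by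
        rw [hep]
        nlinarith [mul_pos hapos hpn]
      filter_upwards [hcont.eventually (lt_mem_nhds hpos'), e.open_target.mem_nhds hpt,
        isOpen_ball.mem_nhds (mem_ball_self (by positivity) : p ∈ ball p (a / 4 * ‖p‖))]
        with z h1 h2 h3
      refine hκ p hp hpε z h3 _ ⟨by linarith, ?_⟩
      have := e.right_inv h2
      rwa [heq] at this
    have hκs : ContDiffAt ℝ ∞ κ p := hesat.congr_of_eventuallyEq hκe
    have hκD : HasFDerivAt κ (fderiv ℝ κ p) p := (hκs.differentiableAt (by simp)).hasFDerivAt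
    have hκid : ∀ v, fderiv ℝ κ p v + fderiv ℝ ζ x (fderiv ℝ κ p v) = v := by
      intro v
      rw [← hκx] at hζD
      have h1 : HasFDerivAt (fun z => κ z + ζ (κ z))
          (fderiv ℝ κ p + (fderiv ℝ ζ (κ p)).comp (fderiv ℝ κ p)) p :=
        hκD.add (hζD.comp p hκD)
      have h2 : (fun z => κ z + ζ (κ z)) =ᶠ[𝓝 p] id := by
        filter_upwards [hκe, e.open_target.mem_nhds hpt] with z h1 h2
        rw [h1]
        have := e.right_inv h2
        rwa [heq] at this
      have h3 := h1.unique ((hasFDerivAt_id p).congr_of_eventuallyEq h2)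
      have := DFunLike.congr_fun h3 v
      rwa [hκx] at this
    have hA : ∀ v, ‖fderiv ℝ κ p v‖ ≤ 2 * ‖v‖ := by
      intro v
      have h1 := hζ3 (fderiv ℝ κ p v)
      have h2 : fderiv ℝ κ p v = v - fderiv ℝ ζ x (fderiv ℝ κ p v) :=
        eq_sub_of_add_eq (hκid v)
      have h3 : ‖fderiv ℝ κ p v‖ ≤ ‖v‖ + ‖fderiv ℝ ζ x (fderiv ℝ κ p v)‖ := by
        conv_lhs => rw [h2]
        exact norm_sub_le _ _
      linarith
    -- the derivative of `κ` is close to the identity since that of `ζ` is small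
    have hA' : ∀ v, ‖fderiv ℝ κ p v - v‖ ≤ 10 * K ^ 2 * tt p * ‖v‖ := by
      intro v
      have h2 : fderiv ℝ κ p v - v = - fderiv ℝ ζ x (fderiv ℝ κ p v) := by
        rw [sub_eq_iff_eq_add, neg_add_eq_sub]
        exact eq_sub_of_add_eq (hκid v)
      rw [h2, norm_neg]
      calc _ ≤ _ := hζ2 _
        _ ≤ 5 * K ^ 2 * tt p * (2 * ‖v‖) := by gcongr; exact hA v
        _ = _ := by ring
    have hfsκ : ContDiffAt ℝ ∞ (f ∘ π) (κ p) := by rw [hκx]; exact hfs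
    have hΦs : ContDiffAt ℝ ∞ (fun z => (f ∘ π) (κ z)) p := hfsκ.comp p hκs
    have hΦp : (f ∘ π) (κ p) = f x := by rw [hκx]; simp [hπx]
    have hCt : 14 * K ^ 3 * tt p ≤ C * ‖p‖ ^ ν := by
      have h1 := httC p
      have h2 : 0 ≤ ‖p‖ ^ ν := by positivity
      calc 14 * K ^ 3 * tt p ≤ 14 * K ^ 3 * (2 * c * ‖p‖ ^ ν) := by gcongr
        _ ≤ 28 * K ^ 3 * (c + 1) * ‖p‖ ^ ν := by
          have : 0 ≤ 28 * K ^ 3 * ‖p‖ ^ ν := by positivity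
          nlinarith
    refine ⟨hΦs, ?_, ?_, ?_, ?_, x, hxN, hqε, hΦp⟩
    · simp only [hΦp]
      have h1 : ‖f x - p‖ ≤ ‖f x - x‖ + ‖x - p‖ := by
        have := norm_add_le (f x - x) (x - p); rwa [sub_add_sub_cancel] at this
      calc _ ≤ 2 * tt p * ‖p‖ + 2 * K * tt p * ‖p‖ := by linarith
        _ = (2 + 2 * K) * (tt p * ‖p‖) := by ring
        _ ≤ (14 * K ^ 3) * (tt p * ‖p‖) := by gcongr; nlinarith
        _ = 14 * K ^ 3 * tt p * ‖p‖ := by ring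
        _ ≤ _ := by gcongr
    · intro u hu
      have hfD : HasFDerivAt (f ∘ π) (fderiv ℝ (f ∘ π) x) (κ p) := by
        rw [hκx]; exact (hfs.differentiableAt (by simp)).hasFDerivAt
      have hΦD : fderiv ℝ (fun z => (f ∘ π) (κ z)) p = (fderiv ℝ (f ∘ π) x).comp (fderiv ℝ κ p) :=
        (hfD.comp p hκD).fderiv
      have hDu : fderiv ℝ π p u = u := h.fderiv_tangent h0 hp hu
      rw [hΦD, ContinuousLinearMap.comp_apply]
      have hsplit : fderiv ℝ (f ∘ π) x (fderiv ℝ κ p u) - u =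
          (fderiv ℝ (f ∘ π) x - fderiv ℝ π x) (fderiv ℝ κ p u) +
          fderiv ℝ π x (fderiv ℝ κ p u - u) + (fderiv ℝ π x - fderiv ℝ π p) u := by
        rw [sub_apply, sub_apply, map_sub, hDu]
        abel
      rw [hsplit]
      have hpδ : p ∈ ball p (δ * ‖p‖) := mem_ball_self (by positivity)
      have b1 : ‖(fderiv ℝ (f ∘ π) x - fderiv ℝ π x) (fderiv ℝ κ p u)‖ ≤ K * tt p * (2 * ‖u‖) :=
        (ContinuousLinearMap.le_opNorm _ _).trans (by gcongr; exact hA u)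
      have b2 : ‖fderiv ℝ π x (fderiv ℝ κ p u - u)‖ ≤ K * (10 * K ^ 2 * tt p * ‖u‖) :=
        (ContinuousLinearMap.le_opNorm _ _).trans
          (mul_le_mul (h.fderiv_le p hp x hxδ) (hA' u) (norm_nonneg _) hK0.le)
      have b3 : ‖(fderiv ℝ π x - fderiv ℝ π p) u‖ ≤ 2 * K ^ 2 * tt p * ‖u‖ := by
        refine (ContinuousLinearMap.le_opNorm _ _).trans ?_
        gcongr
        calc _ ≤ _ := h.fderiv_lip p hp x hxδ p hpδ
          _ ≤ K / ‖p‖ * (2 * K * tt p * ‖p‖) := by gcongr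
          _ = _ := by field_simp
      calc _ ≤ K * tt p * (2 * ‖u‖) + K * (10 * K ^ 2 * tt p * ‖u‖) + 2 * K ^ 2 * tt p * ‖u‖ :=
            (norm_add₃_le).trans (add_le_add (add_le_add b1 b2) b3)
        _ = (2 * K + 10 * K ^ 3 + 2 * K ^ 2) * (tt p * ‖u‖) := by ring
        _ ≤ (14 * K ^ 3) * (tt p * ‖u‖) := by gcongr; linarith
        _ = 14 * K ^ 3 * tt p * ‖u‖ := by ring
        _ ≤ _ := by gcongr
    · simp only [hΦp]; exact hfδ
    · simp only [hΦp]
      have h1 : x + (π (f (π x)) - π x) = p := hxp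
      rw [hπx] at h1
      rw [← h1]; abel
  · intro q hq hqε
    have hqn := hpos q hq
    have hq0 : q ≠ 0 := fun h => h0 (h ▸ hq)
    have hπq : π q = q := h.apply_self hq hq0
    obtain ⟨-, ⟨-, hfδ, hfq⟩, -, -, hζq, -⟩ := est q hq hqε q (mem_ball_self (by positivity))
    rw [hπq] at hfδ hfq hζq
    refine ⟨hfδ, fun hp' => ?_⟩
    have hp : π (f q) ∈ N := h.mem q hq _ hfδ
    have h1 : ‖π (f q) - q‖ ≤ a / 4 * ‖q‖ := hζq.trans (by gcongr; exact n1 q hqε)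
    have h2 : ‖q‖ ≤ 2 * ‖π (f q)‖ := by
      have : ‖q‖ ≤ ‖q - π (f q)‖ + ‖π (f q)‖ := by
        have := norm_add_le (q - π (f q)) (π (f q)); rwa [sub_add_cancel] at this
      rw [norm_sub_rev] at this
      nlinarith
    have hκq : κ (π (f q)) = q := by
      refine hκp _ hp hp' q ⟨?_, ?_⟩
      · rw [norm_sub_rev]
        calc _ ≤ _ := h1
          _ ≤ a / 4 * (2 * ‖π (f q)‖) := by gcongr
          _ = _ := by ring
      · change q + (π (f (π q)) - π q) = _
        rw [hπq]; abel
    simp [hκq, hπq]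

end Perturbation

end

noncomputable section

/-! ### Maps on `Σ × (0, R)` and maps on the cone -/

section Polar

variable {F : Type*} [NormedAddCommGroup F] [InnerProductSpace ℝ F]

/-- Polar coordinates `p ↦ (p/|p|, |p|)`, the inverse of `ι (σ, r) = rσ`. -/
def polar (p : F) : F × ℝ := (‖p‖⁻¹ • p, ‖p‖)

theorem polar_smul {p : F} (hp : p ≠ 0) : (polar p).2 • (polar p).1 = p := by
  simp [polar, smul_smul, norm_ne_zero_iff.2 hp]

theorem norm_polar_fst {p : F} (hp : p ≠ 0) : ‖(polar p).1‖ = 1 := by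
  simp [polar, norm_smul, norm_ne_zero_iff.2 hp]

theorem polar_of_norm_one {σ : F} (hσ : ‖σ‖ = 1) {r : ℝ} (hr : 0 < r) : polar (r • σ) = (σ, r) := by
  simp [polar, norm_smul, hσ, abs_of_pos hr, smul_smul, hr.ne']

theorem contDiffAt_polar {p : F} (hp : p ≠ 0) : ContDiffAt ℝ ∞ polar p := by
  have h1 : ContDiffAt ℝ ∞ (fun p : F => ‖p‖) p := contDiffAt_norm ℝ hp
  exact ((h1.inv (norm_ne_zero_iff.2 hp)).smul contDiffAt_id).prodMk h1

/-- The Pythagorean theorem for the cone metric: if `σ(y)` is a unit vector and `r(y) σ(y) = f(y)`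
then `|df|² = dr² + r² |dσ|²`. -/
theorem norm_sq_polar_derivative {E : Type*} [NormedAddCommGroup E] [NormedSpace ℝ E]
    {P : E → F × ℝ} {P' : E →L[ℝ] F × ℝ} {f : E → F} {f' : E →L[ℝ] F} {x : E}
    (hP : HasFDerivAt P P' x) (hf : HasFDerivAt f f' x) (h1 : ∀ᶠ y in 𝓝 x, ‖(P y).1‖ = 1)
    (h2 : ∀ᶠ y in 𝓝 x, (P y).2 • (P y).1 = f y) (v : E) :
    (P' v).2 ^ 2 + (P x).2 ^ 2 * ‖(P' v).1‖ ^ 2 = ‖f' v‖ ^ 2 := by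
  have hP1 : HasFDerivAt (fun y => (P y).1) ((ContinuousLinearMap.fst ℝ F ℝ).comp P') x := hP.fst
  have hP2 : HasFDerivAt (fun y => (P y).2) ((ContinuousLinearMap.snd ℝ F ℝ).comp P') x := hP.snd
  have e1 := ((hP2.smul hP1).congr_of_eventuallyEq (h2.mono fun y hy => hy.symm)).unique hf
  have e1v : (P x).2 • (P' v).1 + (P' v).2 • (P x).1 = f' v := by
    have := DFunLike.congr_fun e1 v
    simpa using this
  have e2 : HasFDerivAt (fun y => ‖(P y).1‖ ^ 2) (0 : E →L[ℝ] ℝ) x :=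
    (hasFDerivAt_const (1 : ℝ) x).congr_of_eventuallyEq (h1.mono fun y hy => by simp [hy])
  have e3 := DFunLike.congr_fun (hP1.norm_sq.unique e2) v
  have e3v : inner ℝ (P x).1 (P' v).1 = 0 := by simpa using e3
  have hx : ‖(P x).1‖ = 1 := h1.self_of_nhds
  rw [← e1v, norm_add_sq_real, inner_smul_left, inner_smul_right, real_inner_comm, e3v,
    norm_smul, norm_smul, hx, mul_pow, mul_pow, Real.norm_eq_abs, Real.norm_eq_abs, sq_abs, sq_abs]
  simp only [mul_zero]
  ring

end Polar

namespace IsSLCone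

variable {m : ℕ} {C : Set (CSpace m)}

theorem smul_mem (hC : IsSLCone C) (t : ℝ) (ht : 0 < t) (p : CSpace m) (hp : p ∈ C \ {0}) :
    t • p ∈ C \ {0} := by
  refine ⟨?_, ?_⟩
  · rw [← hC.cone t ht]
    exact ⟨p, hp.1, rfl⟩
  · simpa [ht.ne'] using hp.2

theorem smul_link_mem (hC : IsSLCone C) {σ : CSpace m} (hσ : σ ∈ link C) {r : ℝ} (hr : 0 < r) :
    r • σ ∈ C \ {0} :=
  hC.smul_mem r hr σ ⟨hσ.1, fun h => by
    have := hσ.2; rw [mem_singleton_iff.1 h] at this; simp at this⟩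

theorem norm_of_mem_link {σ : CSpace m} (hσ : σ ∈ link C) : ‖σ‖ = 1 := by
  simpa [link] using hσ.2

theorem norm_smul_link {σ : CSpace m} (hσ : σ ∈ link C) {r : ℝ} (hr : 0 < r) : ‖r • σ‖ = r := by
  rw [norm_smul, norm_of_mem_link hσ, mul_one, Real.norm_of_nonneg hr.le]

theorem polar_mem (hC : IsSLCone C) {p : CSpace m} (hp : p ∈ C \ {0}) : (polar p).1 ∈ link C :=
  ⟨(hC.smul_mem _ (inv_pos.2 (norm_pos_iff.2 hp.2)) p hp).1, by
    rw [mem_sphere_zero_iff_norm]; exact norm_polar_fst hp.2⟩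

theorem isCompact_link (hC : IsSLCone C) : IsCompact (link C) :=
  (isCompact_sphere 0 1).inter_left hC.closed

theorem link_nonempty (hC : IsSLCone C) : (link C).Nonempty := by
  obtain ⟨p, hp⟩ := hC.nontrivial
  exact ⟨_, hC.polar_mem hp⟩

theorem exists_tube (hC : IsSLCone C) : ∃ δ K π, IsConeTube (C \ {0}) δ K π := by
  have hl : (C \ {0}) ∩ sphere 0 1 = link C := by
    ext p
    simp only [link, mem_inter_iff, Set.mem_sdiff, mem_singleton_iff, mem_sphere_zero_iff_norm]
    refine ⟨fun h => ⟨h.1.1, h.2⟩, fun h => ⟨⟨h.1, fun h0 => ?_⟩, h.2⟩⟩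
    rw [h0, norm_zero] at h
    exact zero_ne_one h.2
  exact exists_isConeTube hC.slFold.1 hC.smul_mem (by simp) (hl ▸ hC.isCompact_link)

/-- The tangent space of the cone at `rσ` contains `r s + t σ` for `s` tangent to the link. -/
theorem tangent_mem (hC : IsSLCone C) {σ : CSpace m} (hσ : σ ∈ link C) {r : ℝ} (hr : 0 < r)
    {s : CSpace m} (hs : s ∈ tangentSubspace (link C) σ) (t : ℝ) :
    r • s + t • σ ∈ tangentSubspace (C \ {0}) (r • σ) := by
  have h1 : link C ⊆ C \ {0} := fun x hx => by
    have := hC.smul_link_mem hx one_pos; rwa [one_smul] at this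
  have h2 : s ∈ tangentSubspace (C \ {0}) (r • σ) :=
    mem_tangentSubspace_smul hC.smul_mem hr (tangentSubspace_mono h1 _ hs)
  have h3 : HasFDerivWithinAt (fun t : ℝ => t • σ)
      ((ContinuousLinearMap.id ℝ ℝ).smulRight σ) (Ioi 0) r :=
    ((ContinuousLinearMap.id ℝ ℝ).smulRight σ).hasFDerivWithinAt
  have h4 := tangentSubspace_map (t := C \ {0}) h3 (fun t ht => hC.smul_link_mem hσ ht)
    (tangentSubspace_univ_of_mem_nhds (Ioi_mem_nhds hr) t)
  exact Submodule.add_mem _ (Submodule.smul_mem _ _ h2) (by simpa using h4)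

theorem inner_tangent_link {σ : CSpace m} (hσ : σ ∈ link C) {s : CSpace m}
    (hs : s ∈ tangentSubspace (link C) σ) : inner ℝ σ s = 0 := by
  have h1 : HasFDerivWithinAt (fun y : CSpace m => ‖y‖ ^ 2) _ (link C) σ :=
    ((hasFDerivAt_id σ).norm_sq).hasFDerivWithinAt
  have h2 : HasFDerivWithinAt (fun y : CSpace m => ‖y‖ ^ 2) (0 : CSpace m →L[ℝ] ℝ) (link C) σ :=
    (hasFDerivWithinAt_const (1 : ℝ) σ _).congr
      (fun y hy => by rw [norm_of_mem_link hy, one_pow]) (by rw [norm_of_mem_link hσ, one_pow])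
  have := h1.eqOn_tangentSubspace h2 hs
  simpa using this

end IsSLCone

section Conversion

variable {m : ℕ} {C : Set (CSpace m)} {δ K : ℝ} {π : CSpace m → CSpace m}

/-- A conically decaying map on `Σ × (0, R')` is a perturbation of the inclusion of the cone. -/
theorem ConicalDecay.isConePerturbation (hC : IsSLCone C) (h : IsConeTube (C \ {0}) δ K π)
    {μ R' : ℝ} (hR' : 0 < R') {φ : CSpace m × ℝ → CSpace m}
    (hφ : ContDiffOn ℝ ∞ φ (link C ×ˢ Ioo 0 R')) (hd : ConicalDecay (link C) μ R' φ) :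
    ∃ c ≥ 0, ∃ ε > 0, ε ≤ R' ∧ 
      IsConePerturbation (C \ {0}) π (μ - 2) c ε (fun p => φ (polar p)) := by
  obtain ⟨c, hc, ε, hε, hd⟩ := hd
  have hK := h.one_le
  have hmem : ∀ p ∈ C \ {0}, ‖p‖ < min ε R' → polar p ∈ link C ×ˢ Ioo 0 R' := fun p hp hpε =>
    ⟨hC.polar_mem hp, norm_pos_iff.2 hp.2, hpε.trans_le (min_le_right _ _)⟩
  -- `φ ∘ polar` is defined only on the cone; composing it with `π` extends it to a neighbourhood
  have hev : ∀ p ∈ C \ {0}, ‖p‖ < min ε R' →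
      ∃ U ∈ 𝓝 p, ∀ y ∈ U, π y ∈ C \ {0} ∧ polar (π y) ∈ link C ×ˢ Ioo 0 R' := by
    intro p hp hpε
    have hb : p ∈ ball p (δ * ‖p‖) := mem_ball_self (mul_pos h.δ_pos (norm_pos_iff.2 hp.2))
    have hcont : ContinuousAt (fun y => ‖π y‖) p := (h.contDiffAt hp hb).continuousAt.norm
    have h1 : ∀ᶠ y in 𝓝 p, ‖π y‖ < min ε R' :=
      hcont.eventually (gt_mem_nhds (by simpa only [h.apply_self hp hp.2] using hpε))
    refine ⟨_, inter_mem h1 (isOpen_ball.mem_nhds hb), fun y hy => ?_⟩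
    have := h.mem p hp y hy.2
    exact ⟨this, hmem _ this hy.1⟩
  refine ⟨c * K, by positivity, min ε R', by positivity, min_le_right _ _, ?_, ?_, ?_⟩
  · intro p hp hpε
    obtain ⟨U, hU, hUm⟩ := hev p hp hpε
    have hb : p ∈ ball p (δ * ‖p‖) := mem_ball_self (mul_pos h.δ_pos (norm_pos_iff.2 hp.2))
    have hπp := h.apply_self hp hp.2
    have h1 : ContDiffAt ℝ ∞ (fun y => polar (π y)) p :=
      (contDiffAt_polar (by rw [hπp]; exact hp.2)).comp p (h.contDiffAt hp hb)
    have h2 : ContDiffWithinAt ℝ ∞ (fun y => φ (polar (π y))) U p :=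
      (hφ _ (hUm p (mem_of_mem_nhds hU)).2).comp p h1.contDiffWithinAt (fun y hy => (hUm y hy).2)
    exact h2.contDiffAt hU
  · intro p hp hpε
    have h1 := (hd (polar p).1 (hmem p hp hpε).1 (polar p).2 (hmem p hp hpε).2
      (hpε.trans_le (min_le_left _ _))).1
    rw [polar_smul hp.2] at h1
    have hpos : 0 < ‖p‖ := norm_pos_iff.2 hp.2
    refine h1.trans ?_
    have h2 : (polar p).2 ^ (μ - 1) = ‖p‖ ^ (μ - 2) * ‖p‖ := by
      change ‖p‖ ^ (μ - 1) = _
      rw [← Real.rpow_add_one hpos.ne']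
      congr 1; ring
    rw [h2, ← mul_assoc]
    gcongr
    nlinarith
  · intro p hp hpε
    obtain ⟨U, hU, hUm⟩ := hev p hp hpε
    have hpos : 0 < ‖p‖ := norm_pos_iff.2 hp.2
    have hb : p ∈ ball p (δ * ‖p‖) := mem_ball_self (mul_pos h.δ_pos hpos)
    have hπp := h.apply_self hp hp.2
    set ψ : CSpace m × ℝ → CSpace m := fun q => φ q - q.2 • q.1 with hψ
    have h1 : ContDiffAt ℝ ∞ (fun y => polar (π y)) p :=
      (contDiffAt_polar (by rw [hπp]; exact hp.2)).comp p (h.contDiffAt hp hb)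
    have hB := (h1.differentiableAt (by simp)).hasFDerivAt
    set B := fderiv ℝ (fun y => polar (π y)) p with hBdef
    have hpm := hmem p hp hpε
    have hψd : HasFDerivWithinAt ψ (fderivWithin ℝ ψ (link C ×ˢ Ioo 0 R') (polar (π p)))
        (link C ×ˢ Ioo 0 R') (polar (π p)) := by
      rw [hπp]
      have : ContDiffOn ℝ ∞ ψ (link C ×ˢ Ioo 0 R') :=
        hφ.sub (contDiffOn_snd.smul contDiffOn_fst)
      exact ((this _ hpm).differentiableWithinAt (by simp)).hasFDerivWithinAt
    have h2 : HasFDerivAt (fun y => ψ (polar (π y)))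
        ((fderivWithin ℝ ψ (link C ×ˢ Ioo 0 R') (polar (π p))).comp B) p :=
      (HasFDerivWithinAt.comp (g := ψ) (f := fun y => polar (π y)) (s := U) p hψd
        hB.hasFDerivWithinAt (fun y hy => (hUm y hy).2)).hasFDerivAt hU
    have h3 : HasFDerivAt ((fun p => φ (polar p)) ∘ π)
        ((fderivWithin ℝ ψ (link C ×ˢ Ioo 0 R') (polar (π p))).comp B + fderiv ℝ π p) p := by
      refine (h2.add (h.hasFDerivAt hp hb)).congr_of_eventuallyEq ?_
      filter_upwards [hU] with y hy
      simp only [Function.comp, hψ]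
      have h5 := polar_smul (p := π y) (hUm y hy).1.2
      change _ = φ (polar (π y)) - (polar (π y)).2 • (polar (π y)).1 + π y
      rw [h5, sub_add_cancel]
    rw [h3.fderiv, add_sub_cancel_right]
    refine ContinuousLinearMap.opNorm_le_bound _ (by positivity) fun v => ?_
    rw [ContinuousLinearMap.comp_apply, hπp]
    have hs : (B v).1 ∈ tangentSubspace (link C) (polar p).1 := by
      have h4 := tangentSubspace_map (t := link C) (s := U) hB.fst.hasFDerivWithinAt
        (fun y hy => (hUm y hy).2.1) (tangentSubspace_univ_of_mem_nhds hU v)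
      rw [hπp] at h4
      exact h4
    have h5 := (hd (polar p).1 hpm.1 (polar p).2 hpm.2 (hpε.trans_le (min_le_left _ _))).2 _ hs
      (B v).2
    -- the length of `B v` in the cone metric is that of `dπ v`
    have h6 := norm_sq_polar_derivative hB (h.hasFDerivAt hp hb)
      (by filter_upwards [hU] with y hy using norm_polar_fst (hUm y hy).1.2)
      (by filter_upwards [hU] with y hy using polar_smul (hUm y hy).1.2) v
    rw [hπp] at h6
    rw [h6, Real.sqrt_sq (norm_nonneg _)] at h5
    calc _ ≤ _ := h5
      _ ≤ c * ‖p‖ ^ (μ - 2) * (K * ‖v‖) := by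
        have := (fderiv ℝ π p).le_of_opNorm_le (h.fderiv_le p hp p hb) v
        exact mul_le_mul_of_nonneg_left this (by positivity)
      _ = _ := by ring

/-- Perturbations of a cone are preserved by local diffeomorphisms tangent to the identity. -/
theorem IsConePerturbation.comp_tangent_id {N : Set (CSpace m)} (h : IsConeTube N δ K π)
    (h0 : (0 : CSpace m) ∉ N) {ν c ε ρ : ℝ}
    (hν : 0 < ν) (hν1 : ν ≤ 1) (hc : 0 ≤ c) (hε : 0 < ε) (hρ : 0 < ρ) {f g : CSpace m → CSpace m}
    (hf : IsConePerturbation N π ν c ε f) (hg : ContDiffOn ℝ ∞ g (ball 0 ρ)) (hg0 : g 0 = 0)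
    (hg1 : fderiv ℝ g 0 = ContinuousLinearMap.id ℝ _) :
    ∃ c' ≥ 0, ∃ ε' > 0, ε' ≤ ε ∧ (∀ p ∈ N, ‖p‖ < ε' → f p ∈ ball 0 ρ) ∧
      IsConePerturbation N π ν c' ε' (g ∘ f) := by
  have hK := h.one_le
  have hdg : ContDiffOn ℝ ∞ (fderiv ℝ g) (ball 0 ρ) := hg.fderiv_of_isOpen isOpen_ball (by simp)
  obtain ⟨L, t, ht, hL⟩ := ((hdg.contDiffAt (ball_mem_nhds _ hρ)).of_le
    (by simp : (1 : ℕ∞ω) ≤ ∞)).exists_lipschitzOnWith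
  obtain ⟨ρ', hρ', hρt⟩ := Metric.mem_nhds_iff.1 (inter_mem ht (ball_mem_nhds _ hρ))
  have hg2 : ∀ z ∈ ball (0 : CSpace m) ρ',
      ‖fderiv ℝ g z - ContinuousLinearMap.id ℝ _‖ ≤ L * ‖z‖ := by
    intro z hz
    have := hL.dist_le_mul z (hρt hz).1 0 (hρt (mem_ball_self hρ')).1
    rwa [dist_eq_norm, dist_zero_right, hg1] at this
  have hgd : ∀ z ∈ ball (0 : CSpace m) ρ', HasFDerivAt g (fderiv ℝ g z) z := fun z hz =>
    ((hg.contDiffAt (isOpen_ball.mem_nhds (hρt hz).2)).differentiableAt (by simp)).hasFDerivAt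
  -- `g` agrees with the identity up to second order
  have hg3 : ∀ z ∈ ball (0 : CSpace m) ρ', ‖g z - z‖ ≤ L * ‖z‖ * ‖z‖ := by
    intro z hz
    have hzr : ‖z‖ < ρ' := by rwa [mem_ball_zero_iff] at hz
    have hsub : closedBall (0 : CSpace m) ‖z‖ ⊆ ball 0 ρ' := closedBall_subset_ball hzr
    have := (convex_closedBall (0 : CSpace m) ‖z‖).norm_image_sub_le_of_norm_hasFDerivWithin_le'
      (f := g) (f' := fderiv ℝ g) (φ := ContinuousLinearMap.id ℝ _) (C := L * ‖z‖)
      (x := 0) (y := z)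
      (fun w hw => (hgd w (hsub hw)).hasFDerivWithinAt)
      (fun w hw => (hg2 w (hsub hw)).trans (by
        have : ‖w‖ ≤ ‖z‖ := by rwa [mem_closedBall_zero_iff] at hw
        gcongr))
      (by simp) (by simp)
    simpa [hg0] using this
  obtain ⟨r, hr, hrt⟩ := eventually_mul_rpow_le (c := c) hν one_pos
  set ε' := min (min ε r) (min 1 (ρ' / 2)) with hε'
  have e1 : ε' ≤ ε := (min_le_left _ _).trans (min_le_left _ _)
  have e2 : ε' ≤ r := (min_le_left _ _).trans (min_le_right _ _)
  have e3 : ε' ≤ 1 := (min_le_right _ _).trans (min_le_left _ _)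
  have e4 : ε' ≤ ρ' / 2 := (min_le_right _ _).trans (min_le_right _ _)
  have hf2 : ∀ p ∈ N, ‖p‖ < ε' → ‖f p‖ ≤ 2 * ‖p‖ := by
    intro p hp hpε
    have h1 := hf.dist_le p hp (hpε.trans_le e1)
    have h2 := hrt ‖p‖ (norm_nonneg _) (hpε.trans_le e2)
    have h3 : ‖f p‖ ≤ ‖f p - p‖ + ‖p‖ := by
      have := norm_add_le (f p - p) p; rwa [sub_add_cancel] at this
    have h4 := mul_le_mul_of_nonneg_right h2 (norm_nonneg p)
    linarith
  have hfb : ∀ p ∈ N, ‖p‖ < ε' → f p ∈ ball 0 ρ' := by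
    intro p hp hpε
    rw [mem_ball_zero_iff]
    linarith [hf2 p hp hpε]
  have hpν : ∀ p : CSpace m, ‖p‖ < ε' → ‖p‖ ≤ ‖p‖ ^ ν := by
    intro p hpε
    rcases (norm_nonneg p).eq_or_lt with h | h
    · rw [← h]; positivity
    · have := Real.rpow_le_rpow_of_exponent_ge h (by linarith) hν1
      rwa [Real.rpow_one] at this
  refine ⟨4 * L + 2 * L * (K + c) + c, by positivity, ε', by positivity, e1,
    fun p hp hpε => (hρt (hfb p hp hpε)).2, ?_, ?_, ?_⟩
  all_goals
    intro p hp hpε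
    have hp0 : p ≠ 0 := fun h => h0 (h ▸ hp)
    have hpos : 0 < ‖p‖ := norm_pos_iff.2 hp0
    have hb : p ∈ ball p (δ * ‖p‖) := mem_ball_self (mul_pos h.δ_pos hpos)
    have hπp := h.apply_self hp hp0
    have hfs := hf.smooth p hp (hpε.trans_le e1)
  · have hgs : ContDiffAt ℝ ∞ g ((f ∘ π) p) := by
      rw [Function.comp, hπp]
      exact hg.contDiffAt (isOpen_ball.mem_nhds (hρt (hfb p hp hpε)).2)
    exact hgs.comp p hfs
  · have h1 : ‖g (f p) - p‖ ≤ ‖g (f p) - f p‖ + ‖f p - p‖ := by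
      have := norm_add_le (g (f p) - f p) (f p - p); rwa [sub_add_sub_cancel] at this
    have h2 := hf2 p hp hpε
    have h3 := hpν p hpε
    calc ‖g (f p) - p‖ ≤ L * (2 * ‖p‖) * (2 * ‖p‖) + c * ‖p‖ ^ ν * ‖p‖ :=
          h1.trans (add_le_add ((hg3 _ (hfb p hp hpε)).trans (by gcongr))
            (hf.dist_le p hp (hpε.trans_le e1)))
      _ = 4 * L * ‖p‖ * ‖p‖ + c * ‖p‖ ^ ν * ‖p‖ := by ring
      _ ≤ 4 * L * ‖p‖ ^ ν * ‖p‖ + c * ‖p‖ ^ ν * ‖p‖ := by gcongr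
      _ = (4 * L + 0 + c) * ‖p‖ ^ ν * ‖p‖ := by ring
      _ ≤ _ := by gcongr; positivity
  · have hgD : HasFDerivAt g (fderiv ℝ g (f p)) ((f ∘ π) p) := by
      rw [Function.comp, hπp]; exact hgd _ (hfb p hp hpε)
    have hfD := (hfs.differentiableAt (by simp)).hasFDerivAt
    have hD : fderiv ℝ ((g ∘ f) ∘ π) p = (fderiv ℝ g (f p)).comp (fderiv ℝ (f ∘ π) p) :=
      (hgD.comp p hfD).fderiv
    have hsplit : fderiv ℝ ((g ∘ f) ∘ π) p - fderiv ℝ π p =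
        (fderiv ℝ g (f p) - ContinuousLinearMap.id ℝ _).comp (fderiv ℝ (f ∘ π) p) +
        (fderiv ℝ (f ∘ π) p - fderiv ℝ π p) := by
      rw [hD, ContinuousLinearMap.sub_comp, ContinuousLinearMap.id_comp]; abel
    have h1 := hf.fderiv_le p hp (hpε.trans_le e1)
    have h2 : ‖fderiv ℝ (f ∘ π) p‖ ≤ K + c * ‖p‖ ^ ν := by
      have := norm_add_le (fderiv ℝ π p) (fderiv ℝ (f ∘ π) p - fderiv ℝ π p)
      rw [add_sub_cancel] at this
      exact this.trans (add_le_add (h.fderiv_le p hp p hb) h1)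
    have h2' : ‖fderiv ℝ (f ∘ π) p‖ ≤ K + c := by
      have : ‖p‖ ^ ν ≤ 1 := Real.rpow_le_one (norm_nonneg _) (by linarith) hν.le
      nlinarith
    have h3 := hpν p hpε
    rw [hsplit]
    calc _ ≤ L * (2 * ‖p‖) * (K + c) + c * ‖p‖ ^ ν := by
          refine (norm_add_le _ _).trans (add_le_add ?_ h1)
          refine (ContinuousLinearMap.opNorm_comp_le _ _).trans ?_
          have := hf2 p hp hpε
          have := hg2 _ (hfb p hp hpε)
          gcongr
          exact this.trans (by gcongr)
      _ = 2 * L * (K + c) * ‖p‖ + c * ‖p‖ ^ ν := by ring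
      _ ≤ 2 * L * (K + c) * ‖p‖ ^ ν + c * ‖p‖ ^ ν := by gcongr
      _ = (0 + 2 * L * (K + c) + c) * ‖p‖ ^ ν := by ring
      _ ≤ _ := by gcongr; positivity

/-- A map on the cone that is asymptotic to the inclusion gives a conically decaying map. -/
theorem conicalDecay_of_bounds (hC : IsSLCone C) {μ R' c : ℝ} (hc : 0 < c)
    (hR' : 0 < R') {Φ : CSpace m → CSpace m}
    (hs : ∀ p ∈ C \ {0}, ‖p‖ < R' → ContDiffAt ℝ ∞ Φ p)
    (hd : ∀ p ∈ C \ {0}, ‖p‖ < R' → ‖Φ p - p‖ ≤ c * ‖p‖ ^ (μ - 2) * ‖p‖)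
    (hd1 : ∀ p ∈ C \ {0}, ‖p‖ < R' → ∀ u ∈ tangentSubspace (C \ {0}) p,
      ‖fderiv ℝ Φ p u - u‖ ≤ c * ‖p‖ ^ (μ - 2) * ‖u‖) :
    ContDiffOn ℝ ∞ (fun q : CSpace m × ℝ => Φ (q.2 • q.1)) (link C ×ˢ Ioo 0 R') ∧
    ConicalDecay (link C) μ R' (fun q => Φ (q.2 • q.1)) := by
  have hmem : ∀ q ∈ link C ×ˢ Ioo 0 R', q.2 • q.1 ∈ C \ {0} ∧ ‖q.2 • q.1‖ < R' := fun q hq =>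
    ⟨hC.smul_link_mem hq.1 hq.2.1, by rw [IsSLCone.norm_smul_link hq.1 hq.2.1]; exact hq.2.2⟩
  have hsm : ContDiff ℝ ∞ (fun q : CSpace m × ℝ => q.2 • q.1) := contDiff_snd.smul contDiff_fst
  refine ⟨fun q hq => ?_, c, hc, R', hR', fun σ hσ r hr _ => ⟨?_, ?_⟩⟩
  · have h1 := hs _ (hmem q hq).1 (hmem q hq).2
    exact (h1.comp q hsm.contDiffAt).contDiffWithinAt
  · have h1 := hd _ (hmem (σ, r) ⟨hσ, hr⟩).1 (hmem (σ, r) ⟨hσ, hr⟩).2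
    simp only [IsSLCone.norm_smul_link hσ hr.1] at h1
    refine h1.trans (le_of_eq ?_)
    rw [mul_assoc, ← Real.rpow_add_one hr.1.ne']
    congr 2; ring
  · intro s hsT t
    obtain ⟨hp, hpR⟩ := hmem (σ, r) ⟨hσ, hr⟩
    have h1 : HasFDerivAt Φ (fderiv ℝ Φ (r • σ)) (r • σ) :=
      ((hs _ hp hpR).differentiableAt (by simp)).hasFDerivAt
    have h2 : HasFDerivAt (fun q : CSpace m × ℝ => q.2 • q.1)
        (r • ContinuousLinearMap.fst ℝ (CSpace m) ℝ +
          (ContinuousLinearMap.snd ℝ (CSpace m) ℝ).smulRight σ) (σ, r) :=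
      (hasFDerivAt_snd (𝕜 := ℝ) (p := ((σ, r) : CSpace m × ℝ))).smul hasFDerivAt_fst
    have h3 : HasFDerivAt (fun q : CSpace m × ℝ => Φ (q.2 • q.1) - q.2 • q.1)
        _ (σ, r) := (h1.comp (σ, r) h2).sub h2
    have hw := h3.hasFDerivWithinAt (s := link C ×ˢ Ioo 0 R')
    have hmemT : ((s, t) : CSpace m × ℝ) ∈ tangentSubspace (link C ×ˢ Ioo 0 R') (σ, r) := by
      have a1 : tangentSubspace (link C) σ ≤ (tangentSubspace (link C ×ˢ Ioo 0 R') (σ, r)).comap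
          (LinearMap.inl ℝ (CSpace m) ℝ) := by
        refine Submodule.span_le.2 fun w hw => ?_
        exact Submodule.subset_span
          (subset_tangentConeAt_prod_left (subset_closure hr) ⟨w, hw, rfl⟩)
      have a2 : ((0, t) : CSpace m × ℝ) ∈ tangentSubspace (link C ×ˢ Ioo 0 R') (σ, r) :=
        Submodule.subset_span
          (subset_tangentConeAt_prod_right (subset_closure hσ) ⟨t, by
            rw [tangentConeAt_of_mem_nhds (Ioo_mem_nhds hr.1 hr.2)]; trivial, rfl⟩)
      have a3 : ((s, 0) : CSpace m × ℝ) ∈ tangentSubspace (link C ×ˢ Ioo 0 R') (σ, r) := a1 hsT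
      have := Submodule.add_mem _ a3 a2
      simpa using this
    have h4 := hw.differentiableWithinAt.hasFDerivWithinAt.eqOn_tangentSubspace hw hmemT
    rw [h4]
    have hu := hC.tangent_mem hσ hr.1 hsT t
    have h5 := hd1 _ hp hpR _ hu
    rw [IsSLCone.norm_smul_link hσ hr.1] at h5
    have h6 : ‖r • s + t • σ‖ = √(t ^ 2 + r ^ 2 * ‖s‖ ^ 2) := by
      rw [eq_comm, Real.sqrt_eq_iff_eq_sq (by positivity) (norm_nonneg _), norm_add_sq_real,
        inner_smul_left, inner_smul_right, real_inner_comm, IsSLCone.inner_tangent_link hσ hsT,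
        norm_smul, norm_smul, IsSLCone.norm_of_mem_link hσ, mul_pow, mul_pow, Real.norm_eq_abs,
        Real.norm_eq_abs, sq_abs, sq_abs]
      simp only [mul_zero]
      ring
    rw [h6] at h5
    simpa using h5

end Conversion

end

noncomputable section

/-! ### Darboux embeddings and transition maps -/

section RealManifold

variable {E : Type*} [NormedAddCommGroup E] [NormedSpace ℂ E] [NormedSpace ℝ E]
  [IsScalarTower ℝ ℂ E]

/-- The underlying smooth structure of a complex manifold. -/
theorem isManifold_real_of_complex {M : Type*} [TopologicalSpace M] [ChartedSpace E M]
    [IsManifold 𝓘(ℂ, E) ω M] : IsManifold 𝓘(ℝ, E) ∞ M := by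
  refine isManifold_of_contDiffOn _ _ _ fun e e' he he' => ?_
  have h := (contMDiffOn_of_mem_contDiffGroupoid
    (HasGroupoid.compatible (G := contDiffGroupoid ω 𝓘(ℂ, E)) he he')).contDiffOn
  have h2 := (h.restrict_scalars ℝ).of_le (m := ∞) (by simp)
  simpa using h2

end RealManifold

section LocalDiffeo

variable {F : Type*} [NormedAddCommGroup F] [NormedSpace ℝ F] [FiniteDimensional ℝ F]
  {M : Type*} [TopologicalSpace M] [ChartedSpace F M] [IsManifold 𝓘(ℝ, F) ∞ M]

theorem hasFDerivAt_chart_comp {Υ : F → M} {y : F} (h : ContMDiffAt 𝓘(ℝ, F) 𝓘(ℝ, F) ∞ Υ y) :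
    HasFDerivAt (fun z => chartAt F (Υ y) (Υ z)) (mfderiv 𝓘(ℝ, F) 𝓘(ℝ, F) Υ y : F →L[ℝ] F) y := by
  have h1 := (h.mdifferentiableAt (by simp)).hasMFDerivAt.2
  rw [modelWithCornersSelf_coe, range_id] at h1
  have h2 : HasFDerivWithinAt (fun z => chartAt F (Υ y) (Υ z))
    (mfderiv 𝓘(ℝ, F) 𝓘(ℝ, F) Υ y : F →L[ℝ] F) univ y := h1
  exact hasFDerivWithinAt_univ.1 h2

/-- An injective immersion of an open set into a manifold of the same dimension is locally
inverted by smooth maps. -/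
theorem exists_chart_inverse {Υ : F → M} {s : Set F} (hs : IsOpen s)
    (hΥ : ContMDiffOn 𝓘(ℝ, F) 𝓘(ℝ, F) ∞ Υ s)
    {y : F} (hy : y ∈ s) (himm : Function.Injective (mfderiv 𝓘(ℝ, F) 𝓘(ℝ, F) Υ y)) :
    ∃ e : OpenPartialHomeomorph F M, y ∈ e.source ∧ e.source ⊆ s ∧ (∀ z ∈ e.source, e z = Υ z) ∧
      ContMDiffOn 𝓘(ℝ, F) 𝓘(ℝ, F) ∞ e.symm e.target := by
  have : CompleteSpace F := FiniteDimensional.complete ℝ F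
  set ch := chartAt F (Υ y) with hch
  have hso : IsOpen (s ∩ Υ ⁻¹' ch.source) := hΥ.continuousOn.isOpen_inter_preimage hs ch.open_source
  have hys : y ∈ s ∩ Υ ⁻¹' ch.source := ⟨hy, mem_chart_source F (Υ y)⟩
  have hG : ContDiffOn ℝ ∞ (fun z => ch (Υ z)) (s ∩ Υ ⁻¹' ch.source) := by
    rw [← contMDiffOn_iff_contDiffOn]
    exact (contMDiffOn_chart (I := 𝓘(ℝ, F)) (n := ∞) (x := Υ y)).comp (hΥ.mono inter_subset_left)
      (fun z hz => hz.2)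
  have hD := hasFDerivAt_chart_comp (hΥ.contMDiffAt (hs.mem_nhds hy))
  obtain ⟨D', hD'⟩ := ContinuousLinearMap.exists_equiv_of_injective
    (E := F) (F := F) (mfderiv 𝓘(ℝ, F) 𝓘(ℝ, F) Υ y : F →L[ℝ] F) himm rfl
  rw [← hD'] at hD
  obtain ⟨e, he, hes, hee, hesymm⟩ := exists_localInverse hso hys hG D' hD
  refine ⟨e.trans ch.symm, ?_, ?_, ?_, ?_⟩
  · simp only [OpenPartialHomeomorph.trans_source, OpenPartialHomeomorph.symm_source, mem_inter_iff,
      mem_preimage, hee]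
    exact ⟨he, ch.map_source hys.2⟩
  · exact fun z hz => (hes hz.1).1
  · intro z hz
    simp only [OpenPartialHomeomorph.coe_trans, Function.comp, hee]
    exact ch.left_inv (hes hz.1).2
  · have h1 : ContMDiffOn 𝓘(ℝ, F) 𝓘(ℝ, F) ∞ e.symm e.target :=
      contMDiffOn_iff_contDiffOn.2 hesymm
    have h2 : ContMDiffOn 𝓘(ℝ, F) 𝓘(ℝ, F) ∞ ch ch.source := contMDiffOn_chart
    have h2' : ContMDiffOn 𝓘(ℝ, F) 𝓘(ℝ, F) ∞ ch (ch.source ∩ ch ⁻¹' e.target) :=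
      h2.mono inter_subset_left
    have h3 := h1.comp h2' (fun z hz => hz.2)
    refine h3.mono fun z hz => ?_
    simpa using hz

/-- An injective immersion `Υ` of an open set `s` into a manifold of the same dimension is open and
has a smooth inverse. -/
theorem isOpen_image_of_immersion {Υ : F → M} {s : Set F} (hs : IsOpen s)
    (hΥ : ContMDiffOn 𝓘(ℝ, F) 𝓘(ℝ, F) ∞ Υ s)
    (himm : ∀ y ∈ s, Function.Injective (mfderiv 𝓘(ℝ, F) 𝓘(ℝ, F) Υ y))
    {U : Set F} (hU : IsOpen U) (hUs : U ⊆ s) : IsOpen (Υ '' U) := by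
  rw [isOpen_iff_mem_nhds]
  rintro _ ⟨y, hy, rfl⟩
  obtain ⟨e, hye, hes, hee, -⟩ := exists_chart_inverse hs hΥ (hUs hy) (himm y (hUs hy))
  have h1 : IsOpen (e '' (e.source ∩ U)) :=
    e.isOpen_image_of_subset_source (e.open_source.inter hU) inter_subset_left
  refine mem_of_superset (h1.mem_nhds ⟨y, ⟨hye, hy⟩, hee y hye⟩) ?_
  rintro _ ⟨z, hz, rfl⟩
  exact ⟨z, hz.2, (hee z hz.1).symm⟩

theorem contMDiffOn_invFunOn {Υ : F → M} {s : Set F} (hs : IsOpen s)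
    (hΥ : ContMDiffOn 𝓘(ℝ, F) 𝓘(ℝ, F) ∞ Υ s) (hinj : InjOn Υ s)
    (himm : ∀ y ∈ s, Function.Injective (mfderiv 𝓘(ℝ, F) 𝓘(ℝ, F) Υ y)) :
    ContMDiffOn 𝓘(ℝ, F) 𝓘(ℝ, F) ∞ (Function.invFunOn Υ s) (Υ '' s) := by
  rintro _ ⟨y, hy, rfl⟩
  obtain ⟨e, hye, hes, hee, hsm⟩ := exists_chart_inverse hs hΥ hy (himm y hy)
  have hmem : Υ y ∈ e.target := hee y hye ▸ e.map_source hye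
  refine ((hsm.contMDiffAt (e.open_target.mem_nhds hmem)).congr_of_eventuallyEq
    ?_).contMDiffWithinAt
  filter_upwards [e.open_target.mem_nhds hmem] with p hp
  have h1 := e.map_target hp
  have h2 : Υ (e.symm p) = p := by rw [← hee _ h1, e.right_inv hp]
  have h3 := hinj.leftInvOn_invFunOn (hes h1)
  rwa [h2] at h3

end LocalDiffeo

section Darboux

variable {m : ℕ} {M : Type*} [TopologicalSpace M] [T2Space M] [CompactSpace M]
    [ChartedSpace (CSpace m) M] [IsManifold 𝓘(ℂ, CSpace m) ω M] [IsManifold 𝓘(ℝ, CSpace m) ∞ M]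
  {Y : AlmostCalabiYau m M} {x : M} {υ : CSpace m ≃L[ℝ] TangentSpace 𝓘(ℝ, CSpace m) x} {R : ℝ}
  {Υ : CSpace m → M}

namespace AlmostCalabiYau.IsDarbouxEmbedding

theorem injOn (h : Y.IsDarbouxEmbedding x υ R Υ) : InjOn Υ (ball 0 R) :=
  injOn_iff_injective.2 h.embedding.injective

theorem isOpen_image (h : Y.IsDarbouxEmbedding x υ R Υ) {U : Set (CSpace m)} (hU : IsOpen U)
    (hUs : U ⊆ ball 0 R) : IsOpen (Υ '' U) :=
  isOpen_image_of_immersion isOpen_ball h.smooth h.immersion hU hUs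

theorem exists_inverse (h : Y.IsDarbouxEmbedding x υ R Υ) : ∃ Z : M → CSpace m,
    (∀ y ∈ ball 0 R, Z (Υ y) = y) ∧
    ContMDiffOn 𝓘(ℝ, CSpace m) 𝓘(ℝ, CSpace m) ∞ Z (Υ '' ball 0 R) :=
  ⟨_, h.injOn.leftInvOn_invFunOn, contMDiffOn_invFunOn isOpen_ball h.smooth h.injOn h.immersion⟩

theorem hasFDerivAt_zero (h : Y.IsDarbouxEmbedding x υ R Υ) (hR : 0 < R) :
    HasFDerivAt (fun z => chartAt (CSpace m) x (Υ z))
      ((υ : CSpace m →L[ℝ] TangentSpace 𝓘(ℝ, CSpace m) x) : CSpace m →L[ℝ] CSpace m) 0 := by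
  have h1 := hasFDerivAt_chart_comp (h.smooth.contMDiffAt (ball_mem_nhds _ hR))
  rw [h.map_zero] at h1
  have h2 : (mfderiv 𝓘(ℝ, CSpace m) 𝓘(ℝ, CSpace m) Υ 0 : CSpace m →L[ℝ] CSpace m) =
      ((υ : CSpace m →L[ℝ] TangentSpace 𝓘(ℝ, CSpace m) x) : CSpace m →L[ℝ] CSpace m) :=
    ContinuousLinearMap.ext h.deriv_zero
  exact h2 ▸ h1

/-- Two Darboux embeddings at `x` with the same identification of `T_x M` differ by a local
diffeomorphism of `ℂ^m` that is tangent to the identity at `0`. -/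
theorem exists_transition (h : Y.IsDarbouxEmbedding x υ R Υ) (hR : 0 < R) {R₁ : ℝ}
    {Υ₁ : CSpace m → M} (h₁ : Y.IsDarbouxEmbedding x υ R₁ Υ₁) (hR₁ : 0 < R₁) :
    ∃ g : CSpace m → CSpace m, ∃ ρ > 0, ρ ≤ R₁ ∧ ContDiffOn ℝ ∞ g (ball 0 ρ) ∧ g 0 = 0 ∧
      fderiv ℝ g 0 = ContinuousLinearMap.id ℝ _ ∧
      ∀ y ∈ ball 0 ρ, g y ∈ ball 0 R ∧ Υ (g y) = Υ₁ y := by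
  obtain ⟨Z, hZ, hZs⟩ := h.exists_inverse
  have hopen := h.isOpen_image isOpen_ball (Subset.refl _)
  have hx : x ∈ Υ '' ball 0 R := ⟨0, mem_ball_self hR, h.map_zero⟩
  have h1 : ∀ᶠ y in 𝓝 (0 : CSpace m), Υ₁ y ∈ Υ '' ball 0 R := by
    have := (h₁.smooth.contMDiffAt (ball_mem_nhds _ hR₁)).continuousAt
    refine this.eventually_mem ?_
    rw [h₁.map_zero]
    exact hopen.mem_nhds hx
  obtain ⟨ρ, hρ, hρs⟩ := Metric.mem_nhds_iff.1 h1
  have hsub : ball (0 : CSpace m) (min ρ R₁) ⊆ ball 0 R₁ := ball_subset_ball (min_le_right _ _)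
  have hsub' : ball (0 : CSpace m) (min ρ R₁) ⊆ ball 0 ρ := ball_subset_ball (min_le_left _ _)
  have hpos : 0 < min ρ R₁ := lt_min hρ hR₁
  have hg : ContDiffOn ℝ ∞ (fun y => Z (Υ₁ y)) (ball 0 (min ρ R₁)) := by
    rw [← contMDiffOn_iff_contDiffOn]
    exact hZs.comp (h₁.smooth.mono hsub) fun y hy => hρs (hsub' hy)
  have hgy : ∀ y ∈ ball (0 : CSpace m) (min ρ R₁), Z (Υ₁ y) ∈ ball 0 R ∧ Υ (Z (Υ₁ y)) = Υ₁ y := by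
    intro y hy
    obtain ⟨w, hw, hwy⟩ := hρs (hsub' hy)
    rw [← hwy, hZ w hw]
    exact ⟨hw, rfl⟩
  have hg0 : Z (Υ₁ 0) = 0 := by
    rw [h₁.map_zero, ← h.map_zero, hZ 0 (mem_ball_self hR)]
  refine ⟨fun y => Z (Υ₁ y), min ρ R₁, hpos, min_le_right _ _, hg, hg0, ?_, hgy⟩
  have hgd := ((hg.contDiffAt (ball_mem_nhds _ hpos)).differentiableAt (by simp)).hasFDerivAt
  set D := fderiv ℝ (fun y => Z (Υ₁ y)) 0
  have hd := h.hasFDerivAt_zero hR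
  have hd₁ := h₁.hasFDerivAt_zero hR₁
  rw [← hg0] at hd
  have hc := (HasFDerivAt.comp (0 : CSpace m) (f := fun y => Z (Υ₁ y)) hd hgd).congr_of_eventuallyEq
    (f₁ := fun z => chartAt (CSpace m) x (Υ₁ z)) (by
      filter_upwards [ball_mem_nhds _ hpos] with y hy
      simp only [Function.comp, (hgy y hy).2])
  have hu := hc.unique hd₁
  ext1 v
  have := DFunLike.congr_fun hu v
  exact υ.injective this

end AlmostCalabiYau.IsDarbouxEmbedding

end Darboux

end

noncomputable section

/-! ### Normal graphs over the end of a cone -/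

section NormalEnd

variable {m : ℕ} {M : Type*} [TopologicalSpace M] [ChartedSpace (CSpace m) M]
  {C : Set (CSpace m)} {δ K : ℝ} {π : CSpace m → CSpace m}
  {Υ : CSpace m → M} {x : M} {X' : Set M} {R μ ρ : ℝ} {Φ : CSpace m → CSpace m}

/-- The map `Φ`, defined on `{p ∈ C \ {0} : |p| < ρ}`, exhibits the part of `X'` near `x` as the
image under `Υ : B_R → M` of a normal graph over the cone `C`, asymptotic to `C` with rate `μ`. -/
structure IsNormalEnd (C : Set (CSpace m)) (δ : ℝ) (π : CSpace m → CSpace m) (Υ : CSpace m → M)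
    (x : M) (X' : Set M) (R μ ρ : ℝ) (Φ : CSpace m → CSpace m) : Prop where
  smooth : ∀ p ∈ C \ {0}, ‖p‖ < ρ → ContDiffAt ℝ ∞ Φ p
  mem_ball : ∀ p ∈ C \ {0}, ‖p‖ < ρ → Φ p ∈ ball p (δ * ‖p‖)
  proj : ∀ p ∈ C \ {0}, ‖p‖ < ρ → π (Φ p) = p
  mem_domain : ∀ p ∈ C \ {0}, ‖p‖ < ρ → Φ p ∈ ball 0 R
  decay : ∃ c > 0, ∀ p ∈ C \ {0}, ‖p‖ < ρ → ‖Φ p - p‖ ≤ c * ‖p‖ ^ (μ - 2) * ‖p‖ ∧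
    ∀ u ∈ tangentSubspace (C \ {0}) p, ‖fderiv ℝ Φ p u - u‖ ≤ c * ‖p‖ ^ (μ - 2) * ‖u‖
  isOpen : ∀ R' ≤ ρ, ∃ U, IsOpen U ∧ (fun p => Υ (Φ p)) '' {p ∈ C \ {0} | ‖p‖ < R'} = X' ∩ U
  covers : ∀ R' > 0, ∃ V ∈ 𝓝 x, X' ∩ V ⊆ (fun p => Υ (Φ p)) '' {p ∈ C \ {0} | ‖p‖ < R'}

namespace IsNormalEnd

theorem mono (h : IsNormalEnd C δ π Υ x X' R μ ρ Φ) {ρ' : ℝ} (hρ : ρ' ≤ ρ) :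
    IsNormalEnd C δ π Υ x X' R μ ρ' Φ where
  smooth p hp hpr := h.smooth p hp (hpr.trans_le hρ)
  mem_ball p hp hpr := h.mem_ball p hp (hpr.trans_le hρ)
  proj p hp hpr := h.proj p hp (hpr.trans_le hρ)
  mem_domain p hp hpr := h.mem_domain p hp (hpr.trans_le hρ)
  decay := by
    obtain ⟨c, hc, h⟩ := h.decay
    exact ⟨c, hc, fun p hp hpr => h p hp (hpr.trans_le hρ)⟩
  isOpen R' hR' := h.isOpen R' (hR'.trans hρ)
  covers := h.covers

end IsNormalEnd

theorem image_polar_eq (hC : IsSLCone C) {R' : ℝ} {β : Type*} (f : CSpace m → β) :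
    (fun q : CSpace m × ℝ => f (q.2 • q.1)) '' (link C ×ˢ Ioo 0 R') =
      f '' {p ∈ C \ {0} | ‖p‖ < R'} := by
  ext y
  constructor
  · rintro ⟨⟨σ, r⟩, ⟨hσ, hr⟩, rfl⟩
    exact ⟨r • σ, ⟨hC.smul_link_mem hσ hr.1, by
      rw [IsSLCone.norm_smul_link hσ hr.1]; exact hr.2⟩, rfl⟩
  · rintro ⟨p, ⟨hp, hpR⟩, rfl⟩
    refine ⟨polar p, ⟨hC.polar_mem hp, norm_pos_iff.2 hp.2, hpR⟩, ?_⟩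
    simp only [polar_smul hp.2]

end NormalEnd

section Uniqueness

variable {m : ℕ} {M : Type*} [TopologicalSpace M] [T2Space M] [CompactSpace M]
    [ChartedSpace (CSpace m) M] [IsManifold 𝓘(ℂ, CSpace m) ω M] [IsManifold 𝓘(ℝ, CSpace m) ∞ M]
  {Y : AlmostCalabiYau m M} {C : Set (CSpace m)} {δ K : ℝ} {π : CSpace m → CSpace m}
  {Υ : CSpace m → M} {x : M} {X' : Set M} {R μ ρ : ℝ} {Φ : CSpace m → CSpace m}
  {υ : CSpace m ≃L[ℝ] TangentSpace 𝓘(ℝ, CSpace m) x}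

/-- A normal parametrization of an end agrees with the one given by the normal graph: they agree
for small `r`, and then on each ray by continuity. -/
theorem IsNormalEnd.eqOn (hC : IsSLCone C) (ht : IsConeTube (C \ {0}) δ K π)
    (hΥ : Y.IsDarbouxEmbedding x υ R Υ)
    {R' : ℝ} (h : IsNormalEnd C δ π Υ x X' R μ R' Φ) (hR' : 0 < R') (hμ : 2 < μ)
    {φ : CSpace m × ℝ → CSpace m} (hφ : ContinuousOn φ (link C ×ˢ Ioo 0 R'))
    (hmaps : MapsTo φ (link C ×ˢ Ioo 0 R') (ball 0 R))
    (hX : ∀ q ∈ link C ×ˢ Ioo 0 R', Υ (φ q) ∈ X') (hdec : ConicalDecay (link C) μ R' φ)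
    (hnor : IsNormalToCone C R' φ) :
    EqOn φ (fun q => Φ (q.2 • q.1)) (link C ×ˢ Ioo 0 R') := by
  obtain ⟨U, hU, hUS⟩ := h.isOpen R' le_rfl
  -- a point of the first parametrization that lies on the second one and in the tube
  have key : ∀ σ ∈ link C, ∀ r ∈ Ioo 0 R', φ (σ, r) ∈ ball (r • σ) (δ * r) → Υ (φ (σ, r)) ∈ U →
      φ (σ, r) = Φ (r • σ) := by
    intro σ hσ r hr hb hu
    obtain ⟨p, ⟨hp, hpR⟩, hpe⟩ : Υ (φ (σ, r)) ∈ (fun p => Υ (Φ p)) '' {p ∈ C \ {0} | ‖p‖ < R'} := by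
      rw [hUS]; exact ⟨hX _ ⟨hσ, hr⟩, hu⟩
    have h1 : Φ p = φ (σ, r) :=
      hΥ.injOn (h.mem_domain p hp hpR) (hmaps ⟨hσ, hr⟩) hpe
    have h2 := ht.unique _ (hC.smul_link_mem hσ hr.1) (φ (σ, r))
      (by rwa [IsSLCone.norm_smul_link hσ hr.1]) (hnor σ hσ r hr)
    have h3 := h.proj p hp hpR
    rw [h1, h2] at h3
    rw [h3, h1]
  rintro ⟨σ, r₁⟩ ⟨hσ, hr₁⟩
  have hφr : ContinuousOn (fun r => φ (σ, r)) (Ioo 0 R') :=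
    hφ.comp (by fun_prop) fun r hr => ⟨hσ, hr⟩
  have hΦr : ContinuousOn (fun r : ℝ => Φ (r • σ)) (Ioo 0 R') := fun r hr => by
    have h1 := (h.smooth _ (hC.smul_link_mem hσ hr.1)
      (by rw [IsSLCone.norm_smul_link hσ hr.1]; exact hr.2)).continuousAt
    exact (ContinuousAt.comp (f := fun r : ℝ => r • σ) h1 (by fun_prop)).continuousWithinAt
  have hΥφ : ContinuousOn (fun r => Υ (φ (σ, r))) (Ioo 0 R') :=
    hΥ.smooth.continuousOn.comp hφr fun r hr => hmaps ⟨hσ, hr⟩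
  -- the set of radii where the two maps agree on the ray through `σ` is open, nonempty and
  -- closed in the interval
  set G : Set ℝ := {r ∈ Ioo 0 R' | φ (σ, r) = Φ (r • σ)} with hG
  have hGo : IsOpen G := by
    rw [isOpen_iff_mem_nhds]
    rintro r ⟨hr, hre⟩
    have hn := hC.smul_link_mem hσ hr.1
    have hnr := IsSLCone.norm_smul_link hσ hr.1
    have hI : Ioo 0 R' ∈ 𝓝 r := Ioo_mem_nhds hr.1 hr.2
    have h1 : ∀ᶠ r' in 𝓝 r, dist (φ (σ, r')) (r' • σ) < δ * r' := by
      refine ContinuousAt.eventually_lt ?_ (by fun_prop) ?_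
      · exact (hφr.continuousAt hI).dist (continuous_id.smul continuous_const).continuousAt
      · rw [hre]
        have := h.mem_ball _ hn (by rw [hnr]; exact hr.2)
        rwa [hnr] at this
    have h2 : ∀ᶠ r' in 𝓝 r, Υ (φ (σ, r')) ∈ U := by
      refine (hΥφ.continuousAt hI).eventually_mem (hU.mem_nhds ?_)
      have : Υ (Φ (r • σ)) ∈ X' ∩ U := by
        rw [← hUS]; exact ⟨_, ⟨hn, by rw [hnr]; exact hr.2⟩, rfl⟩
      rw [hre]; exact this.2
    filter_upwards [h1, h2, hI] with r' h1 h2 h3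
    exact ⟨h3, key σ hσ r' h3 h1 h2⟩
  have hGne : (Ioo 0 R' ∩ G).Nonempty := by
    obtain ⟨c, hc, ε, hε, hd⟩ := hdec
    obtain ⟨V, hV, hVS⟩ := h.covers R' hR'
    obtain ⟨t, ht0, htt⟩ := eventually_mul_rpow_le (c := c) (sub_pos.2 hμ) (half_pos ht.δ_pos)
    have hR : 0 < R := by
      have := hmaps (x := (σ, r₁)) ⟨hσ, hr₁⟩
      rw [mem_ball_zero_iff] at this
      exact (norm_nonneg _).trans_lt this
    have hcont : ContinuousAt Υ 0 := (hΥ.smooth.contMDiffAt (ball_mem_nhds _ hR)).continuousAt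
    have hev : ∀ᶠ y in 𝓝 (0 : CSpace m), Υ y ∈ V := hcont.eventually_mem (by rwa [hΥ.map_zero])
    obtain ⟨η, hη, hηV⟩ := Metric.mem_nhds_iff.1 hev
    have hδ4 := ht.δ_le
    set r := min (min (ε / 2) (t / 2)) (min (η / 2) (R' / 2)) with hr
    have hr0 : 0 < r := by positivity
    have hrε : r ≤ ε / 2 := (min_le_left _ _).trans (min_le_left _ _)
    have hrt : r ≤ t / 2 := (min_le_left _ _).trans (min_le_right _ _)
    have hrη : r ≤ η / 2 := (min_le_right _ _).trans (min_le_left _ _)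
    have hrR : r ≤ R' / 2 := (min_le_right _ _).trans (min_le_right _ _)
    have hrm : r ∈ Ioo 0 R' := ⟨hr0, by linarith⟩
    have h1 := (hd σ hσ r hrm (by linarith)).1
    have h2 : c * r ^ (μ - 1) = c * r ^ (μ - 2) * r := by
      rw [mul_assoc, ← Real.rpow_add_one hr0.ne']; congr 2; ring
    have h3 := mul_le_mul_of_nonneg_right (htt r hr0.le (by linarith)) hr0.le
    rw [h2] at h1
    have h4 : φ (σ, r) ∈ ball (r • σ) (δ * r) := by
      rw [Metric.mem_ball, dist_eq_norm]
      nlinarith [ht.δ_pos]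
    have h5 : ‖φ (σ, r)‖ < η := by
      have := norm_add_le (φ (σ, r) - r • σ) (r • σ)
      rw [sub_add_cancel, IsSLCone.norm_smul_link hσ hr0] at this
      nlinarith
    have h6 : Υ (φ (σ, r)) ∈ X' ∩ U := by
      rw [← hUS]
      exact hVS ⟨hX _ ⟨hσ, hrm⟩, hηV (by rwa [mem_ball_zero_iff])⟩
    exact ⟨r, hrm, hrm, key σ hσ r hrm h4 h6.2⟩
  have hcl : closure G ∩ Ioo 0 R' ⊆ G := by
    rintro r ⟨hrc, hr⟩
    refine ⟨hr, ?_⟩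
    have hI : Ioo 0 R' ∈ 𝓝 r := Ioo_mem_nhds hr.1 hr.2
    have h1 : (𝓝[G] r).NeBot := mem_closure_iff_nhdsWithin_neBot.1 hrc
    refine tendsto_nhds_unique (f := fun r => φ (σ, r)) (l := 𝓝[G] r)
      ((hφr.continuousAt hI).tendsto.mono_left nhdsWithin_le_nhds)
      (((hΦr.continuousAt hI).tendsto.mono_left nhdsWithin_le_nhds).congr' ?_)
    filter_upwards [self_mem_nhdsWithin] with s hs using hs.2.symm
  exact (isPreconnected_Ioo.subset_of_closure_inter_subset hGo hGne hcl hr₁).2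

end Uniqueness

section Existence

variable {m : ℕ} {M : Type*} [TopologicalSpace M] [T2Space M] [CompactSpace M]
    [ChartedSpace (CSpace m) M] [IsManifold 𝓘(ℂ, CSpace m) ω M] [IsManifold 𝓘(ℝ, CSpace m) ∞ M]
  {Y : AlmostCalabiYau m M} {C : Set (CSpace m)} {δ K : ℝ} {π : CSpace m → CSpace m}
  {Υ : CSpace m → M} {x : M} {X' : Set M} {R μ ρ : ℝ} {Φ : CSpace m → CSpace m}
  {υ : CSpace m ≃L[ℝ] TangentSpace 𝓘(ℝ, CSpace m) x}

/-- The normal graph is diffeomorphic to the end of the cone; the inverse is given by the projection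
to the cone. -/
theorem IsNormalEnd.isDiffeoOnto (hC : IsSLCone C) (ht : IsConeTube (C \ {0}) δ K π)
    (hΥ : Y.IsDarbouxEmbedding x υ R Υ) {R' : ℝ} (h : IsNormalEnd C δ π Υ x X' R μ R' Φ) :
    IsDiffeoOnto (m := m) (Υ ∘ fun q : CSpace m × ℝ => Φ (q.2 • q.1)) (link C ×ˢ Ioo 0 R')
      ((fun p => Υ (Φ p)) '' {p ∈ C \ {0} | ‖p‖ < R'}) := by
  obtain ⟨Z, hZ, hZs⟩ := hΥ.exists_inverse
  have hinv : LeftInvOn (fun y => polar (π (Z y))) (Υ ∘ fun q : CSpace m × ℝ => Φ (q.2 • q.1))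
      (link C ×ˢ Ioo 0 R') := by
    rintro ⟨σ, r⟩ ⟨hσ, hr⟩
    have hp := hC.smul_link_mem hσ hr.1
    have hn := IsSLCone.norm_smul_link hσ hr.1
    have hpR : ‖r • σ‖ < R' := by rw [hn]; exact hr.2
    simp only [Function.comp]
    rw [hZ _ (h.mem_domain _ hp hpR), h.proj _ hp hpR,
      polar_of_norm_one (IsSLCone.norm_of_mem_link hσ) hr.1]
  have himg := image_polar_eq (R' := R') hC (fun p => Υ (Φ p))
  have hbij : BijOn (Υ ∘ fun q : CSpace m × ℝ => Φ (q.2 • q.1)) (link C ×ˢ Ioo 0 R')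
      ((fun p => Υ (Φ p)) '' {p ∈ C \ {0} | ‖p‖ < R'}) := by
    rw [← himg]
    exact hinv.injOn.bijOn_image
  refine ⟨hbij, ?_, _, ⟨hinv, ?_⟩, ?_⟩
  · rintro ⟨σ, r⟩ ⟨hσ, hr⟩
    have hp := hC.smul_link_mem hσ hr.1
    have hpR : ‖r • σ‖ < R' := by rw [IsSLCone.norm_smul_link hσ hr.1]; exact hr.2
    have h1 := hΥ.smooth.contMDiffAt (isOpen_ball.mem_nhds (h.mem_domain _ hp hpR))
    have h2 : ContDiffAt ℝ ∞ (fun q : CSpace m × ℝ => Φ (q.2 • q.1)) (σ, r) :=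
      ContDiffAt.comp (σ, r) (g := Φ) (f := fun q : CSpace m × ℝ => q.2 • q.1) (h.smooth _ hp hpR)
        (contDiff_snd.smul contDiff_fst).contDiffAt
    exact (ContMDiffAt.comp (σ, r) (g := Υ) (f := fun q : CSpace m × ℝ => Φ (q.2 • q.1))
      h1 h2.contMDiffAt).contMDiffWithinAt
  · intro y hy
    obtain ⟨q, hq, rfl⟩ := hbij.surjOn hy
    rw [hinv hq]
  · rintro _ ⟨p, ⟨hp, hpR⟩, rfl⟩
    have hd := h.mem_domain p hp hpR
    have h1 : ContMDiffAt 𝓘(ℝ, CSpace m) 𝓘(ℝ, CSpace m) ∞ Z (Υ (Φ p)) :=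
      hZs.contMDiffAt ((hΥ.isOpen_image isOpen_ball (Subset.refl _)).mem_nhds ⟨_, hd, rfl⟩)
    have h2 : ContDiffAt ℝ ∞ (fun z => polar (π z)) (Φ p) := by
      refine (contDiffAt_polar ?_).comp _ (ht.contDiffAt hp (h.mem_ball p hp hpR))
      rw [h.proj p hp hpR]; exact hp.2
    rw [← hZ _ hd] at h2
    exact (ContMDiffAt.comp (Υ (Φ p)) (g := fun z => polar (π z))
      h2.contMDiffAt h1).contMDiffWithinAt

/-- The end of `X'` at `x`, known to be conically parametrized through the Darboux embedding `Υ₁`, is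
a normal graph over the cone in any other Darboux embedding `Υ`. -/
theorem exists_isNormalEnd (hC : IsSLCone C) (ht : IsConeTube (C \ {0}) δ K π)
    (hΥ : Y.IsDarbouxEmbedding x υ R Υ) (hR : 0 < R) (hμ : μ ∈ Ioo (2 : ℝ) 3)
    {R₁ R₁' : ℝ} (hR₁ : 0 < R₁) (hR₁' : 0 < R₁') {Υ₁ : CSpace m → M}
    (hΥ₁ : Y.IsDarbouxEmbedding x υ R₁ Υ₁)
    {φ : CSpace m × ℝ → CSpace m} {S : Set M} (hS : ∃ U, IsOpen U ∧ S = X' ∩ U)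
    (hφ : ContDiffOn ℝ ∞ φ (link C ×ˢ Ioo 0 R₁'))
    (hdif : IsDiffeoOnto (m := m) (Υ₁ ∘ φ) (link C ×ˢ Ioo 0 R₁') S)
    (hdec : ConicalDecay (link C) μ R₁' φ)
    (hend : ∀ ε > 0, ∃ V ∈ 𝓝 x, ∀ y ∈ X' ∩ V, ∃ σ ∈ link C, ∃ r ∈ Ioo 0 R₁', r < ε ∧
      y = Υ₁ (φ (σ, r))) :
    ∃ ρ > 0, ∃ Φ, IsNormalEnd C δ π Υ x X' R μ ρ Φ := by
  have h0 : (0 : CSpace m) ∉ C \ {0} := by simp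
  have hδ := ht.δ_pos
  have hδ4 := ht.δ_le
  have hK := ht.one_le
  have hν : 0 < μ - 2 := sub_pos.2 hμ.1
  have hν1 : μ - 2 ≤ 1 := by linarith [hμ.2]
  obtain ⟨g, ρ₀, hρ₀, hρ₀R, hg, hg0, hg1, hgΥ⟩ := hΥ.exists_transition hR hΥ₁ hR₁
  obtain ⟨c₁, hc₁, ε₁, hε₁, hε₁R, hf₁⟩ := hdec.isConePerturbation hC ht hR₁' hφ
  obtain ⟨c, hc, ε₂, hε₂, hε₂₁, hfb, hf⟩ :=
    hf₁.comp_tangent_id ht h0 hν hν1 hc₁ hε₁ hρ₀ hg hg0 hg1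
  set f : CSpace m → CSpace m := g ∘ fun p => φ (polar p) with hfdef
  obtain ⟨t, ht0, htt⟩ := eventually_mul_rpow_le (c := c) hν (by norm_num : (0 : ℝ) < 1 / 4)
  set ε := min ε₂ t with hε
  have hεpos : 0 < ε := lt_min hε₂ ht0
  have hεε₂ : ε ≤ ε₂ := min_le_left _ _
  have hfε : IsConePerturbation (C \ {0}) π (μ - 2) c ε f :=
    ⟨fun p hp h => hf.smooth p hp (h.trans_le hεε₂), 
      fun p hp h => hf.dist_le p hp (h.trans_le hεε₂),
      fun p hp h => hf.fderiv_le p hp (h.trans_le hεε₂)⟩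
  obtain ⟨ε', hε', c', hc', Φ, hΦ, hΦf⟩ := ht.exists_normal_reparam h0 hν hν1 hc hεpos hfε
  -- `f` describes the given end in the embedding `Υ`
  have hfΥ : ∀ p ∈ C \ {0}, ‖p‖ < ε → f p ∈ ball 0 R ∧ Υ (f p) = Υ₁ (φ (polar p)) :=
    fun p hp hpε => hgΥ _ (hfb p hp (hpε.trans_le hεε₂))
  have hfq : ∀ q ∈ C \ {0}, ‖q‖ < ε → ‖q‖ ≤ 4 / 3 * ‖f q‖ := by
    intro q hq hqε
    have h1 := hfε.dist_le q hq hqε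
    have h2 := mul_le_mul_of_nonneg_right
      (htt ‖q‖ (norm_nonneg _) (hqε.trans_le (min_le_right _ _))) (norm_nonneg q)
    have h3 := norm_sub_norm_le q (f q)
    rw [norm_sub_rev] at h3
    linarith
  have hpolar : ∀ q ∈ C \ {0}, ‖q‖ < ε → polar q ∈ link C ×ˢ Ioo 0 R₁' := fun q hq hqε =>
    ⟨hC.polar_mem hq, norm_pos_iff.2 hq.2, hqε.trans_le (hεε₂.trans (hε₂₁.trans hε₁R))⟩
  obtain ⟨Z, hZ, hZs⟩ := hΥ.exists_inverse
  set ρ := min (ε' / 2) (R / 2) with hρ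
  have hρpos : 0 < ρ := by positivity
  have hρε : ρ ≤ ε' / 2 := min_le_left _ _
  have hρR : ρ ≤ R / 2 := min_le_right _ _
  have hρε' : ρ ≤ ε' := by linarith
  have hnΦ : ∀ p ∈ C \ {0}, ‖p‖ < ρ → ‖Φ p‖ ≤ 5 / 4 * ‖p‖ := by
    intro p hp hpρ
    have h1 := (hΦ p hp (hpρ.trans_le hρε')).2.2.2.1
    rw [mem_ball, dist_eq_norm] at h1
    have h2 := norm_add_le (Φ p - p) p
    rw [sub_add_cancel] at h2
    nlinarith [norm_nonneg p]
  have hdom : ∀ p ∈ C \ {0}, ‖p‖ < ρ → Φ p ∈ ball 0 R := by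
    intro p hp hpρ
    rw [mem_ball_zero_iff]
    linarith [hnΦ p hp hpρ]
  refine ⟨ρ, hρpos, Φ, fun p hp hpρ => (hΦ p hp (hpρ.trans_le hρε')).1,
    fun p hp hpρ => (hΦ p hp (hpρ.trans_le hρε')).2.2.2.1,
    fun p hp hpρ => (hΦ p hp (hpρ.trans_le hρε')).2.2.2.2.1, hdom,
    ⟨c', hc', fun p hp hpρ => ⟨(hΦ p hp (hpρ.trans_le hρε')).2.1,
      (hΦ p hp (hpρ.trans_le hρε')).2.2.1⟩⟩, fun R' hR' => ?_, fun R' hR' => ?_⟩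
  · obtain ⟨U₁, hU₁, hSU⟩ := hS
    obtain ⟨hbij, -, h, hinv, hh⟩ := hdif
    -- the image is a neighbourhood, in `X'`, of each of its points
    have hloc : ∀ p ∈ C \ {0}, ‖p‖ < R' → ∃ U, IsOpen U ∧ Υ (Φ p) ∈ X' ∩ U ∧
        X' ∩ U ⊆ (fun p => Υ (Φ p)) '' {p ∈ C \ {0} | ‖p‖ < R'} := by
      intro p hp hpR
      have hpρ : ‖p‖ < ρ := hpR.trans_le hR'
      obtain ⟨-, -, -, hpb, hπp, q, hq, hqε, hpq⟩ := hΦ p hp (hpρ.trans_le hρε')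
      obtain ⟨hfR, hfe⟩ := hfΥ q hq hqε
      have hyS : Υ (Φ p) ∈ S := by
        rw [hpq, hfe]
        exact hbij.mapsTo (hpolar q hq hqε)
      have hqε' : ‖q‖ < ε' := by
        have h1 := hfq q hq hqε
        have h2 := hnΦ p hp hpρ
        rw [hpq] at h2
        linarith [norm_nonneg p]
      have hhy : h (Υ (Φ p)) = polar q := by
        rw [hpq, hfe]
        exact hinv.1 (hpolar q hq hqε)
      have hhc : ContinuousWithinAt h S (Υ (Φ p)) := (hh _ hyS).continuousWithinAt
      have e1 : ∀ᶠ y in 𝓝[S] (Υ (Φ p)), (h y).2 < min ε ε' := by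
        have h1 : Tendsto (fun y => (h y).2) (𝓝[S] (Υ (Φ p))) (𝓝 (h (Υ (Φ p))).2) := hhc.snd
        refine h1.eventually (gt_mem_nhds ?_)
        rw [hhy]
        exact lt_min hqε hqε'
      have hZy : Z (Υ (Φ p)) = Φ p := hZ _ (hdom p hp hpρ)
      have e2 : ∀ᶠ y in 𝓝[S] (Υ (Φ p)), ‖π (Z y)‖ < R' := by
        have h1 : ContinuousAt Z (Υ (Φ p)) := (hZs.contMDiffAt
          ((hΥ.isOpen_image isOpen_ball (Subset.refl _)).mem_nhds
            ⟨_, hdom p hp hpρ, rfl⟩)).continuousAt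
        have h2 : ContinuousAt π (Z (Υ (Φ p))) := by
          rw [hZy]; exact (ht.contDiffAt hp hpb).continuousAt
        have h3 : ContinuousAt (fun y => ‖π (Z y)‖) (Υ (Φ p)) := (ContinuousAt.comp h2 h1).norm
        refine nhdsWithin_le_nhds (h3.eventually (gt_mem_nhds ?_))
        simpa only [hZy, hπp] using hpR
      obtain ⟨U₂, hU₂, hyU₂, hU₂s⟩ := mem_nhdsWithin.1 (e1.and e2)
      refine ⟨U₁ ∩ U₂, hU₁.inter hU₂, ⟨?_, ?_, hyU₂⟩, ?_⟩
      · exact (hSU ▸ hyS).1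
      · exact (hSU ▸ hyS).2
      · rintro y ⟨hyX, hyU₁, hyU₂'⟩
        have hyS' : y ∈ S := by rw [hSU]; exact ⟨hyX, hyU₁⟩
        obtain ⟨hy1, hy2⟩ := hU₂s ⟨hyU₂', hyS'⟩
        obtain ⟨⟨σ, r⟩, ⟨hσ, hr⟩, rfl⟩ := hbij.surjOn hyS'
        rw [hinv.1 ⟨hσ, hr⟩] at hy1
        have hq' := hC.smul_link_mem hσ hr.1
        have hn := IsSLCone.norm_smul_link hσ hr.1
        have hpo := polar_of_norm_one (IsSLCone.norm_of_mem_link hσ) hr.1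
        have hb := hfΥ (r • σ) hq' (by rw [hn]; exact hy1.trans_le (min_le_left _ _))
        rw [hpo] at hb
        simp only [Function.comp] at hy2 ⊢
        rw [← hb.2, hZ _ hb.1] at hy2
        have hc2 := hΦf (r • σ) hq' (by rw [hn]; exact hy1.trans_le (min_le_right _ _))
        refine ⟨π (f (r • σ)), ⟨ht.mem _ hq' _ hc2.1, hy2⟩, ?_⟩
        simp only
        rw [hc2.2 (hy2.trans_le (hR'.trans hρε')), hb.2]
    choose! U hUo hUm hUs using hloc
    refine ⟨⋃ p ∈ {p ∈ C \ {0} | ‖p‖ < R'}, U p, isOpen_biUnion fun p hp => hUo p hp.1 hp.2, ?_⟩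
    ext y
    constructor
    · rintro ⟨p, hp, rfl⟩
      have := hUm p hp.1 hp.2
      exact ⟨this.1, mem_biUnion hp this.2⟩
    · rintro ⟨hyX, hy⟩
      obtain ⟨p, hp, hyp⟩ := mem_iUnion₂.1 hy
      exact hUs p hp.1 hp.2 ⟨hyX, hyp⟩
  · obtain ⟨V, hV, hVe⟩ := hend (min ε (min ε' (min R' ε' / (2 + K)))) (by positivity)
    refine ⟨V, hV, fun y hy => ?_⟩
    obtain ⟨σ, hσ, r, hr, hrε, rfl⟩ := hVe y hy
    have hq' := hC.smul_link_mem hσ hr.1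
    have hn := IsSLCone.norm_smul_link hσ hr.1
    have hpo := polar_of_norm_one (IsSLCone.norm_of_mem_link hσ) hr.1
    have hb := hfΥ (r • σ) hq' (by rw [hn]; exact hrε.trans_le (min_le_left _ _))
    rw [hpo] at hb
    have hc2 := hΦf (r • σ) hq'
      (by rw [hn]; exact hrε.trans_le ((min_le_right _ _).trans (min_le_left _ _)))
    have hy2 : ‖π (f (r • σ))‖ < min R' ε' := by
      have h1 := ht.dist_le _ hq' _ hc2.1
      have h2 := hc2.1
      rw [mem_ball, dist_eq_norm, hn] at h2
      have h3 : ‖π (f (r • σ))‖ ≤ ‖f (r • σ) - π (f (r • σ))‖ + ‖f (r • σ) - r • σ‖ + ‖r • σ‖ := by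
        have e : π (f (r • σ)) = -(f (r • σ) - π (f (r • σ))) + (f (r • σ) - r • σ) + r • σ := by
          abel
        calc _ = ‖-(f (r • σ) - π (f (r • σ))) + (f (r • σ) - r • σ) + r • σ‖ := by rw [← e]
          _ ≤ _ := (norm_add_le _ _).trans (by
            gcongr
            refine (norm_add_le _ _).trans ?_
            rw [norm_neg])
      have h4 : r < min R' ε' / (2 + K) :=
        hrε.trans_le ((min_le_right _ _).trans (min_le_right _ _))
      rw [lt_div_iff₀ (by linarith)] at h4
      rw [hn] at h3
      have h5 : δ * r ≤ 1 * r := by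
        have := hr.1
        gcongr; linarith
      have h6 : K * ‖f (r • σ) - r • σ‖ ≤ K * r := by gcongr; linarith
      linarith
    refine ⟨π (f (r • σ)), ⟨ht.mem _ hq' _ hc2.1, hy2.trans_le (min_le_left _ _)⟩, ?_⟩
    simp only
    rw [hc2.2 (hy2.trans_le (min_le_right _ _)), hb.2]

end Existence

end

noncomputable section

/-! ### Joining the normal ends -/

section Joining

variable {m : ℕ} {M : Type*} [TopologicalSpace M] [T2Space M] [CompactSpace M]
    [ChartedSpace (CSpace m) M] [IsManifold 𝓘(ℂ, CSpace m) ω M] [IsManifold 𝓘(ℝ, CSpace m) ∞ M]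

/-- A normal end lies in a prescribed neighbourhood of `x` after shrinking it. -/
theorem IsNormalEnd.eventually_subset {C : Set (CSpace m)} {δ : ℝ} {π : CSpace m → CSpace m}
    {Υ : CSpace m → M} {x : M} {X' : Set M} {R μ ρ : ℝ} {Φ : CSpace m → CSpace m}
    (h : IsNormalEnd C δ π Υ x X' R μ ρ Φ) (hδ : δ ≤ 1 / 4) (hρ : 0 < ρ) (hΥ : ContinuousAt Υ 0)
    (hΥ0 : Υ 0 = x) {W : Set M} (hW : W ∈ 𝓝 x) :
    ∀ᶠ r in 𝓝[>] (0 : ℝ), r ≤ ρ ∧ (fun p => Υ (Φ p)) '' {p ∈ C \ {0} | ‖p‖ < r} ⊆ W := by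
  have hev : ∀ᶠ y in 𝓝 (0 : CSpace m), Υ y ∈ W := hΥ.eventually_mem (by rwa [hΥ0])
  obtain ⟨η, hη, hηW⟩ := Metric.mem_nhds_iff.1 hev
  filter_upwards [Ioo_mem_nhdsGT (show 0 < min ρ (η / 2) by positivity)] with r hr
  have h1 : r ≤ ρ := hr.2.le.trans (min_le_left _ _)
  have h2 : r ≤ η / 2 := hr.2.le.trans (min_le_right _ _)
  refine ⟨h1, ?_⟩
  rintro _ ⟨p, ⟨hp, hpr⟩, rfl⟩
  refine hηW ?_
  have h3 := h.mem_ball p hp (hpr.trans_le h1)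
  rw [Metric.mem_ball, dist_eq_norm] at h3
  have h4 := norm_add_le (Φ p - p) p
  rw [sub_add_cancel] at h4
  rw [mem_ball_zero_iff]
  nlinarith [norm_nonneg p]

theorem exists_disjoint_closed_nhds {n : ℕ} {x : Fin n → M} (hx : Function.Injective x) :
    ∃ W : Fin n → Set M, (∀ i, W i ∈ 𝓝 (x i) ∧ IsClosed (W i)) ∧
      Pairwise fun i j => Disjoint (W i) (W j) := by
  obtain ⟨U, hU, hd⟩ := (finite_range x).t2_separation
  have h : ∀ i, ∃ W ∈ 𝓝 (x i), IsClosed W ∧ W ⊆ U (x i) := fun i =>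
    exists_mem_nhds_isClosed_subset ((hU (x i)).2.mem_nhds (hU (x i)).1)
  choose W hW hWc hWU using h
  exact ⟨W, fun i => ⟨hW i, hWc i⟩, fun i j hij =>
    (hd (mem_range_self i) (mem_range_self j) (hx.ne hij)).mono (hWU i) (hWU j)⟩

/-- Existence and uniqueness of the normal parametrization, provided that near each `x i` the set
`X` consists of the conical end `r < ε` only. -/
theorem exists_unique_normal_parametrization
    {Y : AlmostCalabiYau m M} {n : ℕ} {X : Set M} {x : Fin n → M}
    {υ : ∀ i, CSpace m ≃L[ℝ] TangentSpace 𝓘(ℝ, CSpace m) (x i)}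
    {C : Fin n → Set (CSpace m)} {μ : Fin n → ℝ}
    (hXc : IsCompact X) (hx : Function.Injective x) (hC : ∀ i, IsSLCone (C i))
    (hμ : ∀ i, μ i ∈ Ioo (2 : ℝ) 3)
    {R : ℝ} (hR : 0 < R) {Υ : Fin n → CSpace m → M}
    (hΥ : ∀ i, Y.IsDarbouxEmbedding (x i) (υ i) R (Υ i))
    {R₁ R₁' : ℝ} (hR₁ : 0 < R₁) (hR₁' : 0 < R₁') {Υ₁ : Fin n → CSpace m → M}
    (hΥ₁ : ∀ i, Y.IsDarbouxEmbedding (x i) (υ i) R₁ (Υ₁ i))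
    {φ₁ : Fin n → CSpace m × ℝ → CSpace m} {S₁ : Fin n → Set M}
    (hφ₁ : IsConicalParametrization X x C μ R₁ Υ₁ R₁' φ₁ S₁)
    (hend : ∀ i, ∀ ε > 0, ∃ V ∈ 𝓝 (x i), ∀ y ∈ (X \ range x) ∩ V, ∃ σ ∈ link (C i),
      ∃ r ∈ Ioo 0 R₁', r < ε ∧ y = Υ₁ i (φ₁ i (σ, r))) :
    ∃ R₀ ∈ Ioc 0 R, ∀ R' ∈ Ioc 0 R₀,
      ∃ (φ : Fin n → CSpace m × ℝ → CSpace m) (S : Fin n → Set M),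
        (IsConicalParametrization X x C μ R Υ R' φ S ∧ ∀ i, IsNormalToCone (C i) R' (φ i)) ∧
        ∀ (φ' : Fin n → CSpace m × ℝ → CSpace m) (S' : Fin n → Set M),
          IsConicalParametrization X x C μ R Υ R' φ' S' →
          (∀ i, IsNormalToCone (C i) R' (φ' i)) →
          ∀ i, EqOn (φ' i) (φ i) (link (C i) ×ˢ Ioo 0 R') ∧ S' i = S i := by
  choose δ K π ht using fun i => (hC i).exists_tube
  choose ρ hρ Φ hΦ using fun i => exists_isNormalEnd (hC i) (ht i) (hΥ i) hR (hμ i) hR₁ hR₁' (hΥ₁ i)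
    (hφ₁.isOpen i) (hφ₁.smooth i) (hφ₁.diffeo i) (hφ₁.decay i) (hend i)
  obtain ⟨W, hW, hWd⟩ := exists_disjoint_closed_nhds hx
  have hcont : ∀ i, ContinuousAt (Υ i) 0 := fun i =>
    ((hΥ i).smooth.contMDiffAt (ball_mem_nhds _ hR)).continuousAt
  have hev : ∀ᶠ r in 𝓝[>] (0 : ℝ), ∀ i, r ≤ ρ i ∧
      (fun p => Υ i (Φ i p)) '' {p ∈ C i \ {0} | ‖p‖ < r} ⊆ W i :=
    eventually_all.2 fun i => (hΦ i).eventually_subset (ht i).δ_le (hρ i) (hcont i)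
      (hΥ i).map_zero (hW i).1
  obtain ⟨R₀, hR₀, hR₀R⟩ := (hev.and (Ioc_mem_nhdsGT hR)).exists
  refine ⟨R₀, hR₀R, fun R' hR' => ?_⟩
  have hΦ' : ∀ i, IsNormalEnd (C i) (δ i) (π i) (Υ i) (x i) (X \ range x) R (μ i) R' (Φ i) :=
    fun i => (hΦ i).mono (hR'.2.trans (hR₀ i).1)
  set φ : Fin n → CSpace m × ℝ → CSpace m := fun i q => Φ i (q.2 • q.1) with hφ
  set S : Fin n → Set M := fun i => (fun p => Υ i (Φ i p)) '' {p ∈ C i \ {0} | ‖p‖ < R'} with hS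
  have hmem : ∀ i, ∀ q ∈ link (C i) ×ˢ Ioo 0 R', q.2 • q.1 ∈ C i \ {0} ∧ ‖q.2 • q.1‖ < R' :=
    fun i q hq => ⟨(hC i).smul_link_mem hq.1 hq.2.1, by
      rw [IsSLCone.norm_smul_link hq.1 hq.2.1]; exact hq.2.2⟩
  have hSW : ∀ i, S i ⊆ W i := by
    rintro i _ ⟨p, ⟨hp, hpR⟩, rfl⟩
    exact (hR₀ i).2 ⟨p, ⟨hp, hpR.trans_le hR'.2⟩, rfl⟩
  have hdec : ∀ i, ContDiffOn ℝ ∞ (φ i) (link (C i) ×ˢ Ioo 0 R') ∧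
      ConicalDecay (link (C i)) (μ i) R' (φ i) := fun i => by
    obtain ⟨c, hc, h⟩ := (hΦ' i).decay
    exact conicalDecay_of_bounds (hC i) hc hR'.1 (hΦ' i).smooth (fun p hp hpR => (h p hp hpR).1)
      fun p hp hpR => (h p hp hpR).2
  choose U hU hSU using fun i => (hΦ' i).isOpen R' le_rfl
  choose V hV hVS using fun i => (hΦ' i).covers R' hR'.1
  refine ⟨φ, S, ⟨?_, ?_⟩, ?_⟩
  · refine ⟨?_, fun i => ⟨U i, hU i, hSU i⟩, ?_, fun i j hij => ?_, fun i => (hdec i).1,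
      fun i q hq => (hΦ' i).mem_domain _ (hmem i q hq).1 (hmem i q hq).2,
      fun i => (hΦ' i).isDiffeoOnto (hC i) (ht i) (hΥ i), fun i => (hdec i).2⟩
    · have hK : (X \ range x) \ ⋃ i, S i = X \ ⋃ i, (U i ∪ interior (V i)) := by
        ext y
        constructor
        · rintro ⟨⟨hyX, hyx⟩, hyS⟩
          refine ⟨hyX, fun hy => hyS ?_⟩
          obtain ⟨i, hy | hy⟩ := mem_iUnion.1 hy
          · exact mem_iUnion.2 ⟨i, by rw [hS]; simp only; rw [hSU]; exact ⟨⟨hyX, hyx⟩, hy⟩⟩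
          · exact mem_iUnion.2 ⟨i, hVS i ⟨⟨hyX, hyx⟩, interior_subset hy⟩⟩
        · rintro ⟨hyX, hy⟩
          simp only [mem_iUnion, not_exists, mem_union, not_or] at hy
          refine ⟨⟨hyX, ?_⟩, fun hyS => ?_⟩
          · rintro ⟨i, rfl⟩
            exact (hy i).2 (mem_interior_iff_mem_nhds.2 (hV i))
          · obtain ⟨i, hyi⟩ := mem_iUnion.1 hyS
            have : y ∈ (X \ range x) ∩ U i := hSU i ▸ hyi
            exact (hy i).1 this.2
      refine ⟨(X \ range x) \ ⋃ i, S i, sdiff_subset, ?_, ?_⟩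
      · rw [hK]
        exact hXc.diff (isOpen_iUnion fun i => (hU i).union isOpen_interior)
      · rw [sdiff_sdiff_right_self]
        refine inter_eq_right.2 (iUnion_subset fun i => ?_)
        have : S i = (X \ range x) ∩ U i := hSU i
        rw [this]
        exact inter_subset_left
    · rintro i _ ⟨p, ⟨hp, hpR⟩, rfl⟩
      exact ⟨Φ i p, (hΦ' i).mem_domain p hp hpR, rfl⟩
    · exact (hWd hij).mono (closure_minimal (hSW i) (hW i).2) (closure_minimal (hSW j) (hW j).2)
  · intro i σ hσ r hr v hv
    have hq := hmem i (σ, r) ⟨hσ, hr⟩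
    have h1 := (hΦ' i).proj _ hq.1 hq.2
    have h2 := (ht i).normal _ hq.1 _ ((hΦ' i).mem_ball _ hq.1 hq.2)
    rw [h1] at h2
    exact h2 v hv
  · intro φ' S' hφ' hnor i
    have hX : ∀ q ∈ link (C i) ×ˢ Ioo 0 R', Υ i (φ' i q) ∈ X \ range x := fun q hq => by
      obtain ⟨U', -, hU'⟩ := hφ'.isOpen i
      have := (hφ'.diffeo i).1.mapsTo hq
      rw [hU'] at this
      exact this.1
    have heq := (hΦ' i).eqOn (hC i) (ht i) (hΥ i) hR'.1 (hμ i).1 (hφ'.smooth i).continuousOn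
      (hφ'.mapsTo i) hX (hφ'.decay i) (hnor i)
    refine ⟨heq, ?_⟩
    rw [← (hφ'.diffeo i).1.image_eq, hS]
    simp only
    rw [← image_polar_eq (hC i) (fun p => Υ i (Φ i p))]
    exact image_congr fun q hq => by simp only [Function.comp, heq hq]

end Joining

end

noncomputable section

/-! ### Stokes' theorem on a submanifold of a vector space -/

section Stokes

open MeasureTheory

variable {F : Type*} [NormedAddCommGroup F] [NormedSpace ℝ F] {k : ℕ} {Q : Set F}

theorem integral_fderiv_apply_eq_zero {E : Type*} [NormedAddCommGroup E] [NormedSpace ℝ E]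
    [FiniteDimensional ℝ E] [MeasurableSpace E] [BorelSpace E] (μ : Measure E)
    [μ.IsAddHaarMeasure] {f : E → ℝ} (hf : ContDiff ℝ 1 f) (hc : HasCompactSupport f) (v : E) :
    ∫ x, fderiv ℝ f x v ∂μ = 0 := by
  have hi : Integrable (fun x => fderiv ℝ f x v) μ := by
    refine Continuous.integrable_of_hasCompactSupport ?_ ?_
    · exact (hf.continuous_fderiv (by simp)).clm_apply continuous_const
    · exact hc.fderiv_apply ℝ v
  have := integral_mul_fderiv_eq_neg_fderiv_mul_of_integrable (μ := μ) (f := fun _ : E => (1 : ℝ))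
    (g := f) (v := v) (by simp) (by simpa using hi) (by
      simpa using hf.continuous.integrable_of_hasCompactSupport hc) (fun _ _ => by fun_prop)
      (fun x _ => hf.differentiable (by simp) x)
  simpa using this

/-- The integral of an exact compactly supported form of top degree vanishes. -/
theorem integral_extDeriv_eq_zero {ζ : EuclideanSpace ℝ (Fin (k + 1)) →
      EuclideanSpace ℝ (Fin (k + 1)) [⋀^Fin k]→L[ℝ] ℝ}
    (hζ : ContDiff ℝ 1 ζ) (hc : HasCompactSupport ζ)
    (v : Fin (k + 1) → EuclideanSpace ℝ (Fin (k + 1))) :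
    ∫ x, extDeriv ζ x v = 0 := by
  have h1 : ∀ x, extDeriv ζ x v =
      ∑ i, (-1 : ℝ) ^ i.val • fderiv ℝ (fun y => ζ y (i.removeNth v)) x (v i) := fun x => by
    simpa using extDeriv_apply (hζ.differentiable (by simp) x) v
  have h2 : ∀ i : Fin (k + 1), ContDiff ℝ 1 fun y => ζ y (i.removeNth v) := fun i =>
    (ContinuousAlternatingMap.apply ℝ _ ℝ (i.removeNth v)).contDiff.comp hζ
  have h3 : ∀ i : Fin (k + 1), HasCompactSupport fun y => ζ y (i.removeNth v) := fun i =>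
    hc.comp_left (g := fun f : EuclideanSpace ℝ (Fin (k + 1)) [⋀^Fin k]→L[ℝ] ℝ => f (i.removeNth v))
      rfl
  simp_rw [h1]
  rw [integral_finsetSum]
  · refine Finset.sum_eq_zero fun i _ => ?_
    rw [integral_smul, integral_fderiv_apply_eq_zero _ (h2 i) (h3 i), smul_zero]
  · intro i _
    refine (Continuous.integrable_of_hasCompactSupport ?_ ((h3 i).fderiv_apply ℝ _)).smul
      ((-1 : ℝ) ^ i.val)
    exact ((h2 i).continuous_fderiv (by simp)).clm_apply continuous_const

/-- The coefficient of the pullback of a top degree form under a parametrization `g`. -/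
def pullCoeff (g : EuclideanSpace ℝ (Fin k) → F) (η : F → F [⋀^Fin k]→L[ℝ] ℝ)
    (w : EuclideanSpace ℝ (Fin k)) : ℝ :=
  η (g w) fun a => fderiv ℝ g w (EuclideanSpace.single a 1)

theorem alternating_comp_eq_det_mul (f : EuclideanSpace ℝ (Fin k) [⋀^Fin k]→L[ℝ] ℝ)
    (A : EuclideanSpace ℝ (Fin k) →L[ℝ] EuclideanSpace ℝ (Fin k)) :
    (f fun a => A (EuclideanSpace.single a 1)) = A.det * f fun a => EuclideanSpace.single a 1 := by
  set b := (EuclideanSpace.basisFun (Fin k) ℝ).toBasis with hb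
  have hbe : (b : Fin k → EuclideanSpace ℝ (Fin k)) = fun a => EuclideanSpace.single a 1 := by
    ext1 a; simp [hb]
  have h1 := f.toAlternatingMap.eq_smul_basis_det b
  have h2 : ∀ v, f v = f b * b.det v := fun v => by
    have := DFunLike.congr_fun h1 v
    simpa using this
  have h3 : b.det (fun a => A (b a)) = A.det := by
    have := b.det_comp (A : EuclideanSpace ℝ (Fin k) →ₗ[ℝ] EuclideanSpace ℝ (Fin k)) b
    rw [b.det_self, mul_one] at this
    exact this
  rw [← hbe, h2, mul_comm, ← h3]
  congr 2
  ext1 a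
  rw [← congrFun hbe a]

/-- A local parametrization together with the sign of the top degree form `θ` in it. -/
structure IsOrientedParam (Q : Set F) (θ : F → F [⋀^Fin k]→L[ℝ] ℝ)
    (O : Set (EuclideanSpace ℝ (Fin k))) (g : EuclideanSpace ℝ (Fin k) → F)
    (U : Set F) (H : F → EuclideanSpace ℝ (Fin k)) (c : ℝ) : Prop where
  param : IsLocalParam Q O g U H
  sign : c * c = 1
  pos : ∀ w ∈ O, 0 < c * pullCoeff g θ w

namespace IsOrientedParam

variable {θ : F → F [⋀^Fin k]→L[ℝ] ℝ}
    {O : Set (EuclideanSpace ℝ (Fin k))} {g : EuclideanSpace ℝ (Fin k) → F}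
    {U : Set F} {H : F → EuclideanSpace ℝ (Fin k)} {c : ℝ}
    {O' : Set (EuclideanSpace ℝ (Fin k))} {g' : EuclideanSpace ℝ (Fin k) → F}
    {U' : Set F} {H' : F → EuclideanSpace ℝ (Fin k)} {c' : ℝ}

theorem isOpen_overlap (h : IsLocalParam Q O g U H) (hU' : IsOpen U') : IsOpen (O ∩ g ⁻¹' U') :=
  h.smooth.continuousOn.isOpen_inter_preimage h.isOpen_source hU'

/-- Change of variables: the integral of a form supported in the overlap of two oriented
parametrizations can be computed in either of them. -/
theorem integral_eq (h : IsOrientedParam Q θ O g U H c) (h' : IsOrientedParam Q θ O' g' U' H' c')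
    {η : F → F [⋀^Fin k]→L[ℝ] ℝ} (hη : ∀ y ∈ Q, y ∉ U ∨ y ∉ U' → η y = 0) :
    ∫ w in O, c * pullCoeff g η w = ∫ w in O', c' * pullCoeff g' η w := by
  have hV := isOpen_overlap h.param h'.param.isOpen_target
  have hV' := isOpen_overlap h'.param h.param.isOpen_target
  have e1 : ∫ w in O, c * pullCoeff g η w = ∫ w in O ∩ g ⁻¹' U', c * pullCoeff g η w := by
    refine setIntegral_eq_of_subset_of_forall_sdiff_eq_zero h.param.isOpen_source.measurableSet
      inter_subset_left fun w hw => ?_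
    have : g w ∉ U' := fun hu => hw.2 ⟨hw.1, hu⟩
    rw [pullCoeff, hη _ (h.param.mapsTo hw.1).1 (Or.inr this)]
    simp
  have e2 : ∫ w in O', c' * pullCoeff g' η w = ∫ w in O' ∩ g' ⁻¹' U, c' * pullCoeff g' η w := by
    refine setIntegral_eq_of_subset_of_forall_sdiff_eq_zero h'.param.isOpen_source.measurableSet
      inter_subset_left fun w hw => ?_
    have : g' w ∉ U := fun hu => hw.2 ⟨hw.1, hu⟩
    rw [pullCoeff, hη _ (h'.param.mapsTo hw.1).1 (Or.inl this)]
    simp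
  -- the transition map between the two parametrizations
  set T : EuclideanSpace ℝ (Fin k) → EuclideanSpace ℝ (Fin k) := fun w => H' (g w) with hT
  have hTO : ∀ w ∈ O ∩ g ⁻¹' U', T w ∈ O' ∧ g' (T w) = g w := fun w hw =>
    ⟨h'.param.mapsTo_inv ⟨(h.param.mapsTo hw.1).1, hw.2⟩,
      h'.param.rightInv ⟨(h.param.mapsTo hw.1).1, hw.2⟩⟩
  have himg : T '' (O ∩ g ⁻¹' U') = O' ∩ g' ⁻¹' U := by
    ext w
    constructor
    · rintro ⟨w, hw, rfl⟩
      obtain ⟨h1, h2⟩ := hTO w hw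
      exact ⟨h1, by rw [mem_preimage, h2]; exact (h.param.mapsTo hw.1).2⟩
    · rintro ⟨hw, hwU⟩
      have h1 : g' w ∈ Q ∩ U := ⟨(h'.param.mapsTo hw).1, hwU⟩
      have h2 : g (H (g' w)) = g' w := h.param.rightInv h1
      refine ⟨H (g' w), ⟨h.param.mapsTo_inv h1, ?_⟩, ?_⟩
      · rw [mem_preimage, h2]; exact (h'.param.mapsTo hw).2
      · rw [hT]; simp only; rw [h2, h'.param.leftInv hw]
  have hTd : ContDiffOn ℝ ∞ T (O ∩ g ⁻¹' U') :=
    h'.param.smooth_inv.comp (h.param.smooth.mono inter_subset_left)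
      fun w hw => ⟨(h.param.mapsTo hw.1).1, hw.2⟩
  have hTf : ∀ w ∈ O ∩ g ⁻¹' U', HasFDerivAt T (fderiv ℝ T w) w := fun w hw =>
    ((hTd.contDiffAt (hV.mem_nhds hw)).differentiableAt (by simp)).hasFDerivAt
  have hinj : InjOn T (O ∩ g ⁻¹' U') := fun a ha b hb hab => by
    have h1 : g a = g b := by rw [← (hTO a ha).2, ← (hTO b hb).2, hab]
    rw [← h.param.leftInv ha.1, ← h.param.leftInv hb.1, h1]
  have hD : ∀ w ∈ O ∩ g ⁻¹' U', fderiv ℝ g w = (fderiv ℝ g' (T w)).comp (fderiv ℝ T w) := by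
    intro w hw
    have h1 := (h'.param.hasFDerivAt (hTO w hw).1).comp w (hTf w hw)
    refine (h1.congr_of_eventuallyEq ?_).fderiv
    filter_upwards [hV.mem_nhds hw] with z hz using (hTO z hz).2.symm
  have hpull : ∀ ξ : F → F [⋀^Fin k]→L[ℝ] ℝ, ∀ w ∈ O ∩ g ⁻¹' U',
      pullCoeff g ξ w = (fderiv ℝ T w).det * pullCoeff g' ξ (T w) := by
    intro ξ w hw
    have h1 := alternating_comp_eq_det_mul
      ((ξ (g w)).compContinuousLinearMap (fderiv ℝ g' (T w))) (fderiv ℝ T w)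
    simp only [ContinuousAlternatingMap.compContinuousLinearMap_apply] at h1
    rw [pullCoeff, pullCoeff, hD w hw, (hTO w hw).2]
    exact h1
  rw [e1, e2, ← himg, integral_image_eq_integral_abs_det_fderiv_smul _ hV.measurableSet
    (fun w hw => (hTf w hw).hasFDerivWithinAt) hinj]
  refine setIntegral_congr_fun hV.measurableSet fun w hw => ?_
  have h1 := h.pos w hw.1
  have h2 := h'.pos (T w) (hTO w hw).1
  rw [hpull θ w hw] at h1
  -- the signs `c` and `c'` of `θ` detect the sign of the Jacobian of the transition map
  have h3 : 0 < (c * c') * (fderiv ℝ T w).det := by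
    have h4 : 0 < (c * c' * (fderiv ℝ T w).det) * (c' * pullCoeff g' θ (T w)) := by
      have : (c * c' * (fderiv ℝ T w).det) * (c' * pullCoeff g' θ (T w)) =
        (c' * c') * (c * ((fderiv ℝ T w).det * pullCoeff g' θ (T w))) := by ring
      rw [this, h'.sign, one_mul]; exact h1
    exact pos_of_mul_pos_left h4 h2.le
  have h5 : |(fderiv ℝ T w).det| = (c * c') * (fderiv ℝ T w).det := by
    have h6 : |c * c'| = 1 := by
      have : (c * c') * (c * c') = 1 := by
        rw [mul_mul_mul_comm, h.sign, h'.sign, one_mul]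
      rcases mul_self_eq_one_iff.1 this with h | h <;> rw [h] <;> simp
    rw [← abs_of_pos h3, abs_mul, h6, one_mul]
  simp only [smul_eq_mul]
  rw [h5, hpull η w hw]
  linear_combination (-c * (fderiv ℝ T w).det * pullCoeff g' η (T w)) * h'.sign

theorem continuousOn_pullCoeff (h : IsLocalParam Q O g U H) {η : F → F [⋀^Fin k]→L[ℝ] ℝ}
    {W : Set F} (hη : ContinuousOn η W) (hQW : Q ⊆ W) : ContinuousOn (pullCoeff g η) O := by
  have h1 : ContinuousOn (fun w => η (g w)) O :=
    hη.comp h.smooth.continuousOn fun w hw => hQW (h.mapsTo hw).1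
  have h2 : ContinuousOn (fderiv ℝ g) O :=
    h.smooth.continuousOn_fderiv_of_isOpen h.isOpen_source (by simp)
  have h3 : ContinuousOn (fun w => fun a : Fin k => fderiv ℝ g w (EuclideanSpace.single a 1)) O :=
    continuousOn_pi.2 fun a => h2.clm_apply continuousOn_const
  exact h1.eval h3

theorem integrableOn_pullCoeff (h : IsLocalParam Q O g U H) {η : F → F [⋀^Fin k]→L[ℝ] ℝ}
    {W : Set F} (hη : ContinuousOn η W) (hQW : Q ⊆ W) {D : Set F} (hD : IsCompact D)
    (hDU : D ⊆ Q ∩ U) (hηD : ∀ y ∈ Q, y ∉ D → η y = 0) : IntegrableOn (pullCoeff g η) O := by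
  have h1 := continuousOn_pullCoeff h hη hQW
  have hc : IsCompact (H '' D) := hD.image_of_continuousOn (h.smooth_inv.continuousOn.mono hDU)
  have hs : H '' D ⊆ O := by rintro _ ⟨y, hy, rfl⟩; exact h.mapsTo_inv (hDU hy)
  refine ((h1.mono hs).integrableOn_compact hc).of_forall_sdiff_eq_zero
    h.isOpen_source.measurableSet fun w hw => ?_
  have : g w ∉ D := fun hd => hw.2 ⟨g w, hd, h.leftInv hw.1⟩
  rw [pullCoeff, hηD _ (h.mapsTo hw.1).1 this]
  simp

end IsOrientedParam

end Stokes

end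

noncomputable section

section AlternatingSmooth

variable {E F G X : Type*} [NormedAddCommGroup E] [NormedSpace ℝ E] [FiniteDimensional ℝ E]
  [NormedAddCommGroup F] [NormedSpace ℝ F] [FiniteDimensional ℝ F]
  [NormedAddCommGroup G] [NormedSpace ℝ G] [FiniteDimensional ℝ G]
  [NormedAddCommGroup X] [NormedSpace ℝ X] {k : ℕ}

instance finiteDimensional_continuousMultilinearMap :
    FiniteDimensional ℝ (ContinuousMultilinearMap ℝ (fun _ : Fin k => E) G) :=
  Module.Finite.of_injective
    ({ toFun := fun f => f.toMultilinearMap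
       map_add' := fun _ _ => rfl
       map_smul' := fun _ _ => rfl } :
      ContinuousMultilinearMap ℝ (fun _ : Fin k => E) G →ₗ[ℝ]
        MultilinearMap ℝ (fun _ : Fin k => E) G)
    ContinuousMultilinearMap.toMultilinearMap_injective

/-- In finite dimension the inclusion of alternating maps into multilinear maps has a bounded linear
left inverse, which reduces smoothness statements to multilinear maps. -/
theorem exists_leftInverse_toContinuousMultilinearMap :
    ∃ P : ContinuousMultilinearMap ℝ (fun _ : Fin k => E) G →L[ℝ] E [⋀^Fin k]→L[ℝ] G,
      ∀ f : E [⋀^Fin k]→L[ℝ] G, P f.toContinuousMultilinearMap = f := by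
  obtain ⟨P, hP⟩ := (ContinuousAlternatingMap.toContinuousMultilinearMapCLM ℝ :
    E [⋀^Fin k]→L[ℝ] G →L[ℝ] _).toLinearMap.exists_leftInverse_of_injective
    (LinearMap.ker_eq_bot.2 ContinuousAlternatingMap.toContinuousMultilinearMap_injective)
  exact ⟨LinearMap.toContinuousLinearMap P, fun f => LinearMap.congr_fun hP f⟩

theorem ContDiffWithinAt.continuousAlternatingMap_compContinuousLinearMap {n : ℕ∞ω}
    {f : X → F [⋀^Fin k]→L[ℝ] G} {A : X → E →L[ℝ] F} {s : Set X} {x : X}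
    (hf : ContDiffWithinAt ℝ n f s x) (hA : ContDiffWithinAt ℝ n A s x) :
    ContDiffWithinAt ℝ n (fun y => (f y).compContinuousLinearMap (A y)) s x := by
  obtain ⟨P, hP⟩ := exists_leftInverse_toContinuousMultilinearMap (E := E) (G := G) (k := k)
  have h1 : ContDiffWithinAt ℝ n (fun y => (f y).toContinuousMultilinearMap) s x :=
    (ContinuousAlternatingMap.toContinuousMultilinearMapCLM (𝕜 := ℝ) (E := F) (F := G)
      (ι := Fin k) ℝ).contDiff.comp_contDiffWithinAt hf
  have h2 : ContDiffWithinAt ℝ n (fun y => fun _ : Fin k => A y) s x :=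
    contDiffWithinAt_pi.2 fun _ => hA
  have h3 := ((ContinuousMultilinearMap.compContinuousLinearMapContinuousMultilinear ℝ
    (fun _ : Fin k => E) (fun _ : Fin k => F) G).contDiff (n := n)).comp_contDiffWithinAt h2
  have h4 := P.contDiff.comp_contDiffWithinAt (h3.clm_apply h1)
  have h5 : (fun y => (f y).compContinuousLinearMap (A y)) = fun y =>
      P (ContinuousMultilinearMap.compContinuousLinearMapContinuousMultilinear ℝ
        (fun _ : Fin k => E) (fun _ : Fin k => F) G (fun _ => A y)
          (f y).toContinuousMultilinearMap) := by
    ext1 y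
    exact (hP _).symm
  rw [h5]
  exact h4

end AlternatingSmooth

section Stokes

open MeasureTheory

variable {F : Type*} [NormedAddCommGroup F] [NormedSpace ℝ F] [FiniteDimensional ℝ F] {k : ℕ}
  {Q : Set F}

theorem extDeriv_zero_form {E : Type*} [NormedAddCommGroup E] [NormedSpace ℝ E] (y : E) :
    extDeriv (0 : E → E [⋀^Fin k]→L[ℝ] ℝ) y = 0 := by
  ext v
  have h : DifferentiableAt ℝ (0 : E → E [⋀^Fin k]→L[ℝ] ℝ) y := differentiableAt_const _
  rw [extDeriv_apply h]
  simp

/-- Stokes' theorem for a form supported in one local parametrization. -/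
theorem IsLocalParam.integral_extDeriv_eq_zero {O : Set (EuclideanSpace ℝ (Fin (k + 1)))}
    {g : EuclideanSpace ℝ (Fin (k + 1)) → F} {U : Set F} {H : F → EuclideanSpace ℝ (Fin (k + 1))}
    (h : IsLocalParam Q O g U H) {W : Set F} (hW : IsOpen W) (hQW : Q ⊆ W)
    {γ : F → F [⋀^Fin k]→L[ℝ] ℝ} (hγ : ContDiffOn ℝ 1 γ W) {D : Set F} (hD : IsCompact D)
    (hDU : D ⊆ Q ∩ U) (hγD : ∀ y ∈ Q, y ∉ D → γ y = 0) :
    ∫ w in O, pullCoeff g (extDeriv γ) w = 0 := by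
  classical
  have hc : IsCompact (H '' D) := hD.image_of_continuousOn (h.smooth_inv.continuousOn.mono hDU)
  have hs : H '' D ⊆ O := by rintro _ ⟨y, hy, rfl⟩; exact h.mapsTo_inv (hDU hy)
  set ζ₀ : EuclideanSpace ℝ (Fin (k + 1)) → EuclideanSpace ℝ (Fin (k + 1)) [⋀^Fin k]→L[ℝ] ℝ :=
    fun w => (γ (g w)).compContinuousLinearMap (fderiv ℝ g w) with hζ₀
  set ζ := O.indicator ζ₀ with hζ
  have hζ0 : ∀ w ∉ H '' D, ζ w = 0 := by
    intro w hw
    by_cases hwO : w ∈ O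
    · have : g w ∉ D := fun hd => hw ⟨g w, hd, h.leftInv hwO⟩
      rw [hζ, indicator_of_mem hwO, hζ₀]
      simp only [hγD _ (h.mapsTo hwO).1 this]
      rfl
    · rw [hζ, indicator_of_notMem hwO]
  have hev : ∀ w ∈ O, ζ =ᶠ[𝓝 w] ζ₀ := fun w hw => by
    filter_upwards [h.isOpen_source.mem_nhds hw] with z hz
    rw [hζ, indicator_of_mem hz]
  have hev0 : ∀ w ∉ O, ζ =ᶠ[𝓝 w] 0 := fun w hw => by
    filter_upwards [hc.isClosed.isOpen_compl.mem_nhds fun h' => hw (hs h')] with z hz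
    exact hζ0 z hz
  have hsm : ContDiff ℝ 1 ζ := by
    rw [contDiff_iff_contDiffAt]
    intro w
    by_cases hw : w ∈ O
    · refine ContDiffAt.congr_of_eventuallyEq ?_ (hev w hw)
      have h1 : ContDiffAt ℝ 1 (fun w => γ (g w)) w :=
        (hγ.contDiffAt (hW.mem_nhds (hQW (h.mapsTo hw).1))).comp w
          ((h.contDiffAt hw).of_le (by simp))
      have h2 : ContDiffAt ℝ 1 (fderiv ℝ g) w := 
        ((h.contDiffAt hw).fderiv_right (m := ∞) (by simp)).of_le (by simp)
      exact ContDiffWithinAt.continuousAlternatingMap_compContinuousLinearMap h1 h2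
    · exact contDiffAt_const.congr_of_eventuallyEq (hev0 w hw)
  have hsupp : HasCompactSupport ζ := HasCompactSupport.intro hc hζ0
  have hint := _root_.integral_extDeriv_eq_zero hsm hsupp (fun a => EuclideanSpace.single a 1)
  rw [← setIntegral_univ,
    setIntegral_eq_of_subset_of_forall_sdiff_eq_zero MeasurableSet.univ (subset_univ O)] at hint
  · rw [← hint]
    refine setIntegral_congr_fun h.isOpen_source.measurableSet fun w hw => ?_
    rw [(hev w hw).extDeriv_eq, hζ₀, extDeriv_pullback (r := ∞)
      ((hγ.contDiffAt (hW.mem_nhds (hQW (h.mapsTo hw).1))).differentiableAt (by simp))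
      (h.contDiffAt hw)
      (by rw [minSmoothness_of_isRCLikeNormedField]
          exact WithTop.coe_le_coe.2 (le_top (a := (2 : ℕ∞))))]
    rfl
  · intro w hw
    rw [(hev0 w hw.2).extDeriv_eq, extDeriv_zero_form]
    rfl

/-- Restriction of a parametrization to an open set. -/
theorem IsLocalParam.restrict {O : Set (EuclideanSpace ℝ (Fin k))}
    {g : EuclideanSpace ℝ (Fin k) → F} {U : Set F} {H : F → EuclideanSpace ℝ (Fin k)}
    (h : IsLocalParam Q O g U H) {V : Set (EuclideanSpace ℝ (Fin k))} (hV : IsOpen V) :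
    ∃ U' ⊆ U, IsLocalParam Q (O ∩ V) g U' H ∧ ∀ y ∈ Q ∩ U, H y ∈ V → y ∈ U' := by
  obtain ⟨U', hU', hUe⟩ := (_root_.continuousOn_iff'.1 h.smooth_inv.continuousOn) V hV
  have hmem : ∀ y ∈ Q ∩ U, H y ∈ V ↔ y ∈ U' := fun y hy =>
    ⟨fun hv => (hUe.subset ⟨hv, hy⟩).1, fun hu => (hUe.symm.subset ⟨hu, hy⟩).1⟩
  refine ⟨U ∩ U', inter_subset_left, ⟨h.isOpen_source.inter hV, h.isOpen_target.inter hU',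
    h.smooth.mono inter_subset_left, h.smooth_inv.mono fun y hy => ⟨hy.1, hy.2.1⟩, ?_, ?_,
    fun w hw => h.leftInv hw.1, fun y hy => h.rightInv ⟨hy.1, hy.2.1⟩⟩,
    fun y hy hv => ⟨hy.2, (hmem y hy).1 hv⟩⟩
  · intro w hw
    have h1 := h.mapsTo hw.1
    exact ⟨h1.1, h1.2, (hmem _ h1).1 (by rw [h.leftInv hw.1]; exact hw.2)⟩
  · intro y hy
    exact ⟨h.mapsTo_inv ⟨hy.1, hy.2.1⟩, (hmem y ⟨hy.1, hy.2.1⟩).2 hy.2.2⟩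

theorem IsLocalParam.linearIndependent {O : Set (EuclideanSpace ℝ (Fin k))}
    {g : EuclideanSpace ℝ (Fin k) → F} {U : Set F} {H : F → EuclideanSpace ℝ (Fin k)}
    (h : IsLocalParam Q O g U H) {w} (hw : w ∈ O) :
    LinearIndependent ℝ fun a : Fin k => fderiv ℝ g w (EuclideanSpace.single a 1) := by
  have h1 := (EuclideanSpace.basisFun (Fin k) ℝ).toBasis.linearIndependent
  have h2 := h1.map' (fderiv ℝ g w : EuclideanSpace ℝ (Fin k) →ₗ[ℝ] F)
    (LinearMap.ker_eq_bot.2 (h.fderiv_injective hw))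
  have h3 : (fderiv ℝ g w : EuclideanSpace ℝ (Fin k) →ₗ[ℝ] F) ∘
      (EuclideanSpace.basisFun (Fin k) ℝ).toBasis =
        fun a => fderiv ℝ g w (EuclideanSpace.single a 1) := by
    ext1 a
    simp
  rw [h3] at h2
  exact h2

/-- Around each point, a parametrization can be restricted so that the sign of `θ` is constant in
it. -/
theorem exists_isOrientedParam {W : Set F} (hQW : Q ⊆ W) {θ : F → F [⋀^Fin k]→L[ℝ] ℝ}
    (hθ : ContinuousOn θ W)
    (hθ0 : ∀ y ∈ Q, ∀ v : Fin k → F, (∀ i, v i ∈ tangentSubspace Q y) → LinearIndependent ℝ v →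
      θ y v ≠ 0) {O : Set (EuclideanSpace ℝ (Fin k))}
    {g : EuclideanSpace ℝ (Fin k) → F} {U : Set F} {H : F → EuclideanSpace ℝ (Fin k)}
    (h : IsLocalParam Q O g U H) {y : F} (hy : y ∈ Q ∩ U) :
    ∃ O g U H c, IsOrientedParam Q θ O g U H c ∧ y ∈ U := by
  have hcont := IsOrientedParam.continuousOn_pullCoeff h hθ hQW
  have hHy := h.mapsTo_inv hy
  have hne : pullCoeff g θ (H y) ≠ 0 :=
    hθ0 _ (h.mapsTo hHy).1 _ (fun i => h.mem_tangentSubspace hHy _) (h.linearIndependent hHy)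
  obtain ⟨c, hc, hcpos⟩ : ∃ c : ℝ, c * c = 1 ∧ 0 < c * pullCoeff g θ (H y) := by
    rcases lt_or_gt_of_ne hne with h1 | h1
    · exact ⟨-1, by norm_num, by linarith⟩
    · exact ⟨1, by norm_num, by linarith⟩
  have hopen : IsOpen (O ∩ (fun w => c * pullCoeff g θ w) ⁻¹' Ioi 0) :=
    (continuousOn_const.mul hcont).isOpen_inter_preimage h.isOpen_source isOpen_Ioi
  obtain ⟨U', -, hU', hyU⟩ := h.restrict hopen
  exact ⟨_, g, U', H, c, ⟨hU', hc, fun w hw => hw.2.2⟩, hyU y hy ⟨hHy, hcpos⟩⟩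

theorem continuousOn_extDeriv {W : Set F} (hW : IsOpen W) {γ : F → F [⋀^Fin k]→L[ℝ] ℝ}
    (hγ : ContDiffOn ℝ 1 γ W) : ContinuousOn (extDeriv γ) W := by
  have h1 : ContinuousOn (fderiv ℝ γ) W := hγ.continuousOn_fderiv_of_isOpen hW (by simp)
  exact (ContinuousAlternatingMap.alternatizeUncurryFinCLM ℝ F ℝ).continuous.comp_continuousOn h1

/-- **Stokes' theorem** in the form of a rigidity statement. On a submanifold `Q` oriented by a
nowhere vanishing form `θ`, an exact form `dΓ` with `Γ` compactly supported on `Q` cannot be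
nonnegative with respect to `θ` without vanishing. -/
theorem extDeriv_eq_zero_of_nonneg {W : Set F} (hW : IsOpen W) (hQW : Q ⊆ W)
    (hparam : ∀ y ∈ Q, ∃ (O : Set (EuclideanSpace ℝ (Fin (k + 1)))) (g : _ → F) (U : Set F)
      (H : F → _), IsLocalParam Q O g U H ∧ y ∈ U)
    {Γ : F → F [⋀^Fin k]→L[ℝ] ℝ} (hΓ : ContDiffOn ℝ 1 Γ W) {D : Set F} (hD : IsClosed D)
    (hΓD : ∀ y ∈ W, y ∉ D → Γ y = 0) (hK : IsCompact (Q ∩ D))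
    {θ : F → F [⋀^Fin (k + 1)]→L[ℝ] ℝ} (hθ : ContinuousOn θ W)
    (hθ0 : ∀ y ∈ Q, ∀ v : Fin (k + 1) → F, (∀ i, v i ∈ tangentSubspace Q y) →
      LinearIndependent ℝ v → θ y v ≠ 0)
    (hpos : ∀ y ∈ Q, ∀ v : Fin (k + 1) → F, (∀ i, v i ∈ tangentSubspace Q y) →
      0 ≤ extDeriv Γ y v * θ y v) {y₀ : F} (hy₀ : y₀ ∈ Q ∩ D) :
    ∃ v : Fin (k + 1) → F, (∀ i, v i ∈ tangentSubspace Q y₀) ∧ LinearIndependent ℝ v ∧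
      extDeriv Γ y₀ v = 0 := by
  -- finitely many oriented parametrizations, and a partition of unity
  have hor : ∀ y : F, ∃ (O : Set (EuclideanSpace ℝ (Fin (k + 1)))) (g : _ → F) (U : Set F)
      (H : F → _) (c : ℝ), y ∈ Q → IsOrientedParam Q θ O g U H c ∧ y ∈ U := by
    intro y
    by_cases hy : y ∈ Q
    · obtain ⟨O, g, U, H, h, hyU⟩ := hparam y hy
      obtain ⟨O, g, U, H, c, h⟩ := exists_isOrientedParam hQW hθ hθ0 h ⟨hy, hyU⟩
      exact ⟨O, g, U, H, c, fun _ => h⟩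
    · exact ⟨∅, fun _ => 0, ∅, fun _ => 0, 0, fun h => absurd h hy⟩
  choose O g U H c hP using hor
  obtain ⟨t, htK, ht⟩ := hK.elim_nhds_subcover U fun y hy =>
    (hP y hy.1).1.param.isOpen_target.mem_nhds (hP y hy.1).2
  have hPt : ∀ i : t, IsOrientedParam Q θ (O i) (g i) (U i) (H i) (c i) := fun i =>
    (hP i (htK i i.2).1).1
  have hUo : IsOpen (⋃ i : t, U i) := isOpen_iUnion fun i => (hPt i).param.isOpen_target
  have hKU : Q ∩ D ⊆ ⋃ i : t, U i := fun y hy => by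
    obtain ⟨i, hi, hyi⟩ := mem_iUnion₂.1 (ht hy)
    exact mem_iUnion.2 ⟨⟨i, hi⟩, hyi⟩
  obtain ⟨L, hL, hKL, hLU⟩ := exists_compact_between hK hUo hKU
  obtain ⟨f, hf⟩ := SmoothPartitionOfUnity.exists_isSubordinate 𝓘(ℝ, F) hL.isClosed
    (fun i : t => U i) (fun i => (hPt i).param.isOpen_target) hLU
  have hfs : ∀ i, ContDiff ℝ ∞ (f i) := fun i => (f i).contMDiff.contDiff
  have hf1 : ∀ y ∈ L, ∑ i, f i y = 1 := fun y hy => by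
    rw [← finsum_eq_sum_of_fintype]; exact f.sum_eq_one hy
  -- the pieces `f j • Γ`
  have hΓj : ∀ j, ContDiffOn ℝ 1 (fun y => f j y • Γ y) W := fun j =>
    ((hfs j).of_le (by simp)).contDiffOn.smul hΓ
  have hev0 : ∀ y ∈ Q, y ∉ D → Γ =ᶠ[𝓝 y] 0 := fun y hy hyD => by
    filter_upwards [hW.mem_nhds (hQW hy), hD.isOpen_compl.mem_nhds hyD] with z h1 h2
    exact hΓD z h1 h2
  have hd0 : ∀ y ∈ Q, y ∉ D → extDeriv Γ y = 0 := fun y hy hyD => by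
    rw [(hev0 y hy hyD).extDeriv_eq]; exact extDeriv_zero_form y
  have hdj0 : ∀ j, ∀ y ∈ Q, y ∉ D → extDeriv (fun y => f j y • Γ y) y = 0 := fun j y hy hyD => by
    have : (fun y => f j y • Γ y) =ᶠ[𝓝 y] 0 := by
      filter_upwards [hev0 y hy hyD] with z hz
      rw [hz]; simp
    rw [this.extDeriv_eq]; exact extDeriv_zero_form y
  have hdjU : ∀ j, ∀ y, y ∉ tsupport (f j) → extDeriv (fun y => f j y • Γ y) y = 0 :=
    fun j y hy => by
      have : (fun y => f j y • Γ y) =ᶠ[𝓝 y] 0 := by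
        filter_upwards [notMem_tsupport_iff_eventuallyEq.1 hy] with z hz
        rw [hz]; simp
      rw [this.extDeriv_eq]; exact extDeriv_zero_form y
  have hdsum : ∀ y ∈ Q, extDeriv Γ y = ∑ j, extDeriv (fun y => f j y • Γ y) y := by
    intro y hy
    by_cases hyD : y ∈ D
    · have h1 : Γ =ᶠ[𝓝 y] fun z => ∑ j, f j z • Γ z := by
        filter_upwards [mem_interior_iff_mem_nhds.1 (hKL ⟨hy, hyD⟩)] with z hz
        rw [← Finset.sum_smul, hf1 z hz, one_smul]
      rw [h1.extDeriv_eq, extDeriv, fderiv_fun_sum fun j _ =>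
        ((hΓj j).contDiffAt (hW.mem_nhds (hQW hy))).differentiableAt (by simp)]
      exact map_sum (ContinuousAlternatingMap.alternatizeUncurryFinCLM ℝ F ℝ) _ _
    · rw [hd0 y hy hyD, Finset.sum_eq_zero fun j _ => hdj0 j y hy hyD]
  -- compact sets carrying the pieces
  have hDj : ∀ j : t, IsCompact (Q ∩ D ∩ tsupport (f j)) ∧
      Q ∩ D ∩ tsupport (f j) ⊆ Q ∩ U j := fun j =>
    ⟨hK.inter_right (isClosed_tsupport _), fun y hy => ⟨hy.1.1, hf j hy.2⟩⟩
  have hηcont : ∀ j l : t, ContinuousOn (fun y => f l y • extDeriv (fun y => f j y • Γ y) y) W :=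
    fun j l => (hfs l).continuous.continuousOn.smul (continuousOn_extDeriv hW (hΓj j))
  have hzero : ∀ l : t, ∀ y, y ∉ tsupport (f l) → f l y = 0 := fun l y hy =>
    image_eq_zero_of_notMem_tsupport hy
  -- integrability of the pieces in the charts `l` and `j`
  have hint : ∀ j l : t, IntegrableOn
      (pullCoeff (g l) fun y => f l y • extDeriv (fun y => f j y • Γ y) y) (O l) := fun j l =>
    IsOrientedParam.integrableOn_pullCoeff (hPt l).param (hηcont j l) hQW (hDj l).1 (hDj l).2
      fun y hy hyD => by
        by_cases h1 : y ∈ D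
        · rw [hzero l y fun h2 => hyD ⟨⟨hy, h1⟩, h2⟩, zero_smul]
        · rw [hdj0 j y hy h1, smul_zero]
  have hint' : ∀ j l : t, IntegrableOn
      (pullCoeff (g j) fun y => f l y • extDeriv (fun y => f j y • Γ y) y) (O j) := fun j l =>
    IsOrientedParam.integrableOn_pullCoeff (hPt j).param (hηcont j l) hQW (hDj j).1 (hDj j).2
      fun y hy hyD => by
        by_cases h1 : y ∈ D
        · rw [hdjU j y fun h2 => hyD ⟨⟨hy, h1⟩, h2⟩, smul_zero]
        · rw [hdj0 j y hy h1, smul_zero]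
  -- the integral of `dΓ` over `Q`
  have hsum : ∑ l : t, ∫ w in O l, c l * pullCoeff (g l) (fun y => f l y • extDeriv Γ y) w = 0 := by
    have h1 : ∀ l : t, ∫ w in O l, c l * pullCoeff (g l) (fun y => f l y • extDeriv Γ y) w =
        ∑ j : t, ∫ w in O j,
          c j * pullCoeff (g j) (fun y => f l y • extDeriv (fun y => f j y • Γ y) y) w := by
      intro l
      have h2 : ∀ w ∈ O l, c l * pullCoeff (g l) (fun y => f l y • extDeriv Γ y) w =
          ∑ j : t, c l *
            pullCoeff (g l) (fun y => f l y • extDeriv (fun y => f j y • Γ y) y) w := by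
        intro w hw
        rw [← Finset.mul_sum]
        congr 1
        simp only [pullCoeff]
        rw [hdsum _ ((hPt l).param.mapsTo hw).1]
        simp [Finset.mul_sum]
      rw [setIntegral_congr_fun (hPt l).param.isOpen_source.measurableSet h2,
        integral_finsetSum _ fun j _ => (hint j l).const_mul _]
      refine Finset.sum_congr rfl fun j _ => (hPt l).integral_eq (hPt j) fun y hy hyU => ?_
      rcases hyU with h3 | h3
      · rw [hzero l y fun h4 => h3 (hf l h4), zero_smul]
      · rw [hdjU j y fun h4 => h3 (hf j h4), smul_zero]
    simp_rw [h1]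
    rw [Finset.sum_comm]
    refine Finset.sum_eq_zero fun j _ => ?_
    rw [← integral_finsetSum _ fun l _ => (hint' j l).const_mul _]
    have h2 : ∀ w ∈ O j, ∑ l : t,
        c j * pullCoeff (g j) (fun y => f l y • extDeriv (fun y => f j y • Γ y) y) w =
        c j * pullCoeff (g j) (extDeriv fun y => f j y • Γ y) w := by
      intro w hw
      have hwQ := ((hPt j).param.mapsTo hw).1
      rw [← Finset.mul_sum]
      congr 1
      simp only [pullCoeff, ContinuousAlternatingMap.smul_apply, smul_eq_mul]
      rw [← Finset.sum_mul]
      by_cases hwD : g j w ∈ D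
      · rw [hf1 _ (interior_subset (hKL ⟨hwQ, hwD⟩)), one_mul]
      · rw [hdj0 j _ hwQ hwD]
        simp
    rw [setIntegral_congr_fun (hPt j).param.isOpen_source.measurableSet h2, integral_const_mul,
      (hPt j).param.integral_extDeriv_eq_zero hW hQW (hΓj j) (hDj j).1 (hDj j).2, mul_zero]
    intro y hy hyD
    by_cases h1 : y ∈ D
    · rw [hzero j y fun h2 => hyD ⟨⟨hy, h1⟩, h2⟩, zero_smul]
    · rw [hΓD y (hQW hy) h1, smul_zero]
  have hnn : ∀ l : t, ∀ w ∈ O l,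
      0 ≤ c l * pullCoeff (g l) (fun y => f l y • extDeriv Γ y) w := by
    intro l w hw
    have h1 := hpos _ ((hPt l).param.mapsTo hw).1
      (fun a => fderiv ℝ (g l) w (EuclideanSpace.single a 1))
      (fun i => (hPt l).param.mem_tangentSubspace hw _)
    have h2 := (hPt l).pos w hw
    have h3 : 0 ≤ c l * pullCoeff (g l) (extDeriv Γ) w := by
      refine nonneg_of_mul_nonneg_left (b := c l * pullCoeff (g l) θ w) ?_ h2
      have : c l * pullCoeff (g l) (extDeriv Γ) w * (c l * pullCoeff (g l) θ w) =
        (c l * c l) * (pullCoeff (g l) (extDeriv Γ) w * pullCoeff (g l) θ w) := by ring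
      rw [this, (hPt l).sign, one_mul]
      exact h1
    have h4 : c l * pullCoeff (g l) (fun y => f l y • extDeriv Γ y) w =
        f l (g l w) * (c l * pullCoeff (g l) (extDeriv Γ) w) := by
      simp only [pullCoeff, ContinuousAlternatingMap.smul_apply, smul_eq_mul]; ring
    rw [h4]
    exact mul_nonneg (f.nonneg l _) h3
  obtain ⟨l, hl⟩ := f.exists_pos_of_mem (interior_subset (hKL hy₀))
  have hyU : y₀ ∈ U l := by
    by_contra h
    exact hl.ne' (hzero l y₀ fun h4 => h (hf l h4))
  have hl0 : ∫ w in O l, c l * pullCoeff (g l) (fun y => f l y • extDeriv Γ y) w = 0 :=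
    (Finset.sum_eq_zero_iff_of_nonneg fun l _ =>
      setIntegral_nonneg (hPt l).param.isOpen_source.measurableSet (hnn l)).1 hsum l
        (Finset.mem_univ l)
  have hcΓ : ContinuousOn (fun y => f l y • extDeriv Γ y) W :=
    (hfs l).continuous.continuousOn.smul (continuousOn_extDeriv hW hΓ)
  have hil : IntegrableOn (fun w => c l * pullCoeff (g l) (fun y => f l y • extDeriv Γ y) w)
      (O l) := by
    refine (IsOrientedParam.integrableOn_pullCoeff (hPt l).param hcΓ hQW (hDj l).1 (hDj l).2
      fun y hy hyD => ?_).const_mul _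
    by_cases h1 : y ∈ D
    · rw [hzero l y fun h2 => hyD ⟨⟨hy, h1⟩, h2⟩, zero_smul]
    · rw [hd0 y hy h1, smul_zero]
  have hae := (setIntegral_eq_zero_iff_of_nonneg_ae
    (ae_restrict_of_forall_mem (hPt l).param.isOpen_source.measurableSet (hnn l)) hil).1 hl0
  have heq := Measure.eqOn_open_of_ae_eq hae (hPt l).param.isOpen_source
    (continuousOn_const.mul (IsOrientedParam.continuousOn_pullCoeff (hPt l).param hcΓ hQW))
    continuousOn_const
  have hw : H l y₀ ∈ O l := (hPt l).param.mapsTo_inv ⟨hy₀.1, hyU⟩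
  have hgw : g l (H l y₀) = y₀ := (hPt l).param.rightInv ⟨hy₀.1, hyU⟩
  have h1 := heq hw
  simp only [pullCoeff, hgw, ContinuousAlternatingMap.smul_apply, smul_eq_mul, Pi.zero_apply,
    mul_eq_zero, hl.ne', false_or] at h1
  refine ⟨fun a => fderiv ℝ (g l) (H l y₀) (EuclideanSpace.single a 1), fun i => ?_,
    (hPt l).param.linearIndependent hw, h1.resolve_left fun h => ?_⟩
  · have := (hPt l).param.mem_tangentSubspace hw (EuclideanSpace.single i 1)
    rwa [hgw] at this
  · have := (hPt l).sign
    rw [h] at this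
    norm_num at this

end Stokes

end

noncomputable section

/-! ### Primitives of closed forms on a ball -/

section Poincare

open MeasureTheory

variable {F V : Type*} [NormedAddCommGroup F] [NormedSpace ℝ F] [FiniteDimensional ℝ F]
  [NormedAddCommGroup V] [NormedSpace ℝ V] [CompleteSpace V]

/-- Differentiation under the integral sign, for a continuously differentiable integrand. -/
theorem contDiffOn_intervalIntegral {U : Set F} (hU : IsOpen U) {f : F → ℝ → V}
    {f' : F → ℝ → F →L[ℝ] V} (hf : ContinuousOn (Function.uncurry f) (U ×ˢ Icc 0 1))
    (hf' : ContinuousOn (Function.uncurry f') (U ×ˢ Icc 0 1))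
    (hd : ∀ z ∈ U, ∀ t ∈ Icc (0 : ℝ) 1, HasFDerivAt (fun z => f z t) (f' z t) z) :
    (∀ z ∈ U, HasFDerivAt (fun z => ∫ t in 0..1, f z t) (∫ t in 0..1, f' z t) z) ∧
      ContDiffOn ℝ 1 (fun z => ∫ t in 0..1, f z t) U := by
  have hI : uIoc (0 : ℝ) 1 = Ioc 0 1 := uIoc_of_le zero_le_one
  have hIcc : uIcc (0 : ℝ) 1 = Icc 0 1 := uIcc_of_le zero_le_one
  have hc : ∀ z ∈ U, ContinuousOn (f z) (Icc 0 1) := fun z hz =>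
    hf.comp (by fun_prop : ContinuousOn (fun t : ℝ => (z, t)) (Icc 0 1)) fun t ht => ⟨hz, ht⟩
  have hc' : ∀ z ∈ U, ContinuousOn (f' z) (Icc 0 1) := fun z hz =>
    hf'.comp (by fun_prop : ContinuousOn (fun t : ℝ => (z, t)) (Icc 0 1)) fun t ht => ⟨hz, ht⟩
  have hm : ∀ z ∈ U, AEStronglyMeasurable (f z) (volume.restrict (uIoc 0 1)) := fun z hz => by
    rw [hI]
    exact ((hc z hz).mono Ioc_subset_Icc_self).aestronglyMeasurable measurableSet_Ioc
  have hm' : ∀ z ∈ U, AEStronglyMeasurable (f' z) (volume.restrict (uIoc 0 1)) := fun z hz => by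
    rw [hI]
    exact ((hc' z hz).mono Ioc_subset_Icc_self).aestronglyMeasurable measurableSet_Ioc
  have hb : ∀ z ∈ U, ∃ s ∈ 𝓝 z, s ⊆ U ∧ ∃ M : ℝ, ∀ y ∈ s, ∀ t ∈ Icc (0 : ℝ) 1, ‖f' y t‖ ≤ M := by
    intro z hz
    obtain ⟨s, hs, hsU, hsc⟩ := local_compact_nhds (hU.mem_nhds hz)
    obtain ⟨M, hM⟩ := (hsc.prod isCompact_Icc).exists_bound_of_continuousOn
      (hf'.mono (prod_mono hsU subset_rfl))
    exact ⟨s, hs, hsU, M, fun y hy t ht => hM (y, t) ⟨hy, ht⟩⟩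
  have hD : ∀ z ∈ U, HasFDerivAt (fun z => ∫ t in 0..1, f z t) (∫ t in 0..1, f' z t) z := by
    intro z hz
    obtain ⟨s, hs, hsU, M, hM⟩ := hb z hz
    refine intervalIntegral.hasFDerivAt_integral_of_dominated_of_fderiv_le (bound := fun _ => M) hs
      ?_ ?_ (hm' z hz) ?_ (by simp) ?_
    · filter_upwards [hU.mem_nhds hz] with y hy using hm y hy
    · exact ContinuousOn.intervalIntegrable (by rw [hIcc]; exact hc z hz)
    · exact ae_of_all _ fun t ht y hy => hM y hy t (by rw [hI] at ht; exact Ioc_subset_Icc_self ht)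
    · exact ae_of_all _ fun t ht y hy => hd y (hsU hy) t (by
        rw [hI] at ht; exact Ioc_subset_Icc_self ht)
  refine ⟨hD, ?_⟩
  have hcont : ContinuousOn (fun z => ∫ t in 0..1, f' z t) U := by
    intro z hz
    obtain ⟨s, hs, hsU, M, hM⟩ := hb z hz
    refine (intervalIntegral.continuousAt_of_dominated_interval (bound := fun _ => M) ?_ ?_
      (by simp) ?_).continuousWithinAt
    · filter_upwards [hU.mem_nhds hz] with y hy using hm' y hy
    · filter_upwards [hs] with y hy
      exact ae_of_all _ fun t ht => hM y hy t (by rw [hI] at ht; exact Ioc_subset_Icc_self ht)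
    · refine ae_of_all _ fun t ht => ?_
      rw [hI] at ht
      have h1 : ContinuousOn (fun y => f' y t) U :=
        hf'.comp (by fun_prop : ContinuousOn (fun y : F => (y, t)) U)
          fun y hy => ⟨hy, Ioc_subset_Icc_self ht⟩
      exact h1.continuousAt (hU.mem_nhds hz)
  have h1 := (contDiffOn_succ_iff_fderiv_of_isOpen (𝕜 := ℝ) (n := 0)
    (f := fun z => ∫ t in 0..1, f z t) hU).2
    ⟨fun z hz => (hD z hz).differentiableAt.differentiableWithinAt, by simp,
      contDiffOn_zero.2 (hcont.congr fun z hz => (hD z hz).fderiv)⟩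
  simpa using h1

variable {k : ℕ}

theorem map_cons_removeNth (f : F [⋀^Fin (k + 1)]→L[ℝ] ℝ) (v : Fin (k + 1) → F)
    (i : Fin (k + 1)) : f (Matrix.vecCons (v i) (i.removeNth v)) = (-1) ^ (i : ℕ) * f v := by
  have h := f.toAlternatingMap.neg_one_pow_smul_map_insertNth i (v i) (i.removeNth v)
  rw [Fin.insertNth_self_removeNth] at h
  simpa using h.symm

theorem removeNth_succ_vecCons {E : Type*} (z : E) (v : Fin (k + 1) → E) (i : Fin (k + 1)) :
    i.succ.removeNth (Matrix.vecCons z v : Fin (k + 2) → E) = Matrix.vecCons z (i.removeNth v) := by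
  ext j
  refine Fin.cases ?_ (fun j => ?_) j
  · simp [Fin.removeNth]
  · simp [Fin.removeNth]

/-- The radial homotopy integral, and its derivative as an integral. -/
theorem radial_integral {A A' : Type*} [NormedAddCommGroup A] [NormedSpace ℝ A]
    [NormedAddCommGroup A'] [NormedSpace ℝ A'] [CompleteSpace A'] {R : ℝ} {η : F → A}
    (hη : ContDiffOn ℝ 1 η (ball 0 R)) (cur : A →L[ℝ] F →L[ℝ] A') :
    ContDiffOn ℝ 1 (fun z => ∫ t in 0..1, t ^ k • cur (η (t • z)) z) (ball 0 R) ∧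
      ∀ z ∈ ball (0 : F) R, ∀ Λ : (F →L[ℝ] A') →L[ℝ] ℝ,
        IntervalIntegrable (fun t : ℝ => t ^ k * Λ (cur (η (t • z)) +
          t • (cur.flip z ∘L fderiv ℝ η (t • z)))) volume 0 1 ∧
        Λ (fderiv ℝ (fun z => ∫ t in 0..1, t ^ k • cur (η (t • z)) z) z) =
          ∫ t in 0..1, t ^ k * Λ (cur (η (t • z)) + t • (cur.flip z ∘L fderiv ℝ η (t • z))) := by
  have hball : ∀ z ∈ ball (0 : F) R, ∀ t ∈ Icc (0 : ℝ) 1, t • z ∈ ball (0 : F) R := by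
    intro z hz t ht
    rw [mem_ball_zero_iff] at hz ⊢
    rw [norm_smul, Real.norm_of_nonneg ht.1]
    exact (mul_le_of_le_one_left (norm_nonneg z) ht.2).trans_lt hz
  have hηd : ∀ z ∈ ball (0 : F) R, HasFDerivAt η (fderiv ℝ η z) z := fun z hz =>
    ((hη.contDiffAt (isOpen_ball.mem_nhds hz)).differentiableAt (by simp)).hasFDerivAt
  have hηc : ContinuousOn (fderiv ℝ η) (ball 0 R) :=
    hη.continuousOn_fderiv_of_isOpen isOpen_ball (by simp)
  set f : F → ℝ → A' := fun z t => t ^ k • cur (η (t • z)) z with hf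
  set f' : F → ℝ → F →L[ℝ] A' := fun z t =>
    t ^ k • (cur (η (t • z)) + t • (cur.flip z ∘L fderiv ℝ η (t • z))) with hf'
  have hmap : MapsTo (fun q : F × ℝ => q.2 • q.1) (ball 0 R ×ˢ Icc 0 1) (ball 0 R) :=
    fun q hq => hball q.1 hq.1 q.2 hq.2
  have hsm : ContinuousOn (fun q : F × ℝ => q.2 • q.1) (ball 0 R ×ˢ Icc 0 1) := by fun_prop
  have hc1 : ContinuousOn (fun q : F × ℝ => η (q.2 • q.1)) (ball 0 R ×ˢ Icc 0 1) :=
    hη.continuousOn.comp hsm hmap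
  have hc2 : ContinuousOn (fun q : F × ℝ => fderiv ℝ η (q.2 • q.1)) (ball 0 R ×ˢ Icc 0 1) :=
    hηc.comp hsm hmap
  have hc3 : ContinuousOn (fun q : F × ℝ => cur (η (q.2 • q.1))) (ball 0 R ×ˢ Icc 0 1) :=
    cur.continuous.comp_continuousOn hc1
  have hfc : ContinuousOn (Function.uncurry f) (ball 0 R ×ˢ Icc 0 1) :=
    (continuous_snd.pow k).continuousOn.smul (hc3.clm_apply continuousOn_fst)
  have hfc' : ContinuousOn (Function.uncurry f') (ball 0 R ×ˢ Icc 0 1) :=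
    (continuous_snd.pow k).continuousOn.smul (hc3.add (continuousOn_snd.smul
      ((cur.flip.continuous.comp continuous_fst).continuousOn.clm_comp hc2)))
  have hd : ∀ z ∈ ball (0 : F) R, ∀ t ∈ Icc (0 : ℝ) 1,
      HasFDerivAt (fun z => f z t) (f' z t) z := by
    intro z hz t ht
    have h1 : HasFDerivAt (fun z : F => t • z) (t • ContinuousLinearMap.id ℝ F) z :=
      (hasFDerivAt_id z).const_smul t
    have h2 := cur.hasFDerivAt.comp z ((hηd _ (hball z hz t ht)).comp z h1)
    have h3 := (h2.clm_apply (hasFDerivAt_id z)).const_smul (t ^ k)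
    exact h3.congr_fderiv (by ext w; simp [hf'])
  obtain ⟨hD, hC⟩ := contDiffOn_intervalIntegral isOpen_ball hfc hfc' hd
  refine ⟨hC, fun z hz Λ => ?_⟩
  have hIcc : uIcc (0 : ℝ) 1 = Icc 0 1 := uIcc_of_le zero_le_one
  have hint : IntervalIntegrable (f' z) volume 0 1 := ContinuousOn.intervalIntegrable (by
    rw [hIcc]
    exact hfc'.comp (by fun_prop : ContinuousOn (fun t : ℝ => (z, t)) (Icc 0 1))
      fun t ht => ⟨hz, ht⟩)
  have hΛ : (fun t : ℝ => t ^ k * Λ (cur (η (t • z)) + t • (cur.flip z ∘L fderiv ℝ η (t • z)))) =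
      fun t => Λ (f' z t) := by
    ext1 t
    rw [hf', map_smul, smul_eq_mul]
  rw [hΛ]
  refine ⟨?_, ?_⟩
  · rw [intervalIntegrable_iff] at hint ⊢
    exact Λ.integrable_comp hint
  · rw [ContinuousLinearMap.intervalIntegral_comp_comm Λ hint, ← (hD z hz).fderiv]

/-- The **Poincaré lemma** on a ball, by the radial homotopy. -/
theorem exists_primitive {R : ℝ} (hR : 0 < R) {η : F → F [⋀^Fin (k + 1)]→L[ℝ] ℝ}
    (hη : ContDiffOn ℝ 1 η (ball 0 R)) (hclosed : ∀ z ∈ ball (0 : F) R, extDeriv η z = 0) :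
    ∃ α : F → F [⋀^Fin k]→L[ℝ] ℝ, ContDiffOn ℝ 1 α (ball 0 R) ∧ α 0 = 0 ∧
      (∀ w v, fderiv ℝ α 0 w v = (k + 1 : ℝ)⁻¹ * η 0 (Matrix.vecCons w v)) ∧
      ∀ z ∈ ball (0 : F) R, extDeriv α z = η z := by
  have hball : ∀ z ∈ ball (0 : F) R, ∀ t ∈ Icc (0 : ℝ) 1, t • z ∈ ball (0 : F) R := by
    intro z hz t ht
    rw [mem_ball_zero_iff] at hz ⊢
    rw [norm_smul, Real.norm_of_nonneg ht.1]
    exact (mul_le_of_le_one_left (norm_nonneg z) ht.2).trans_lt hz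
  have hηd : ∀ z ∈ ball (0 : F) R, HasFDerivAt η (fderiv ℝ η z) z := fun z hz =>
    ((hη.contDiffAt (isOpen_ball.mem_nhds hz)).differentiableAt (by simp)).hasFDerivAt
  obtain ⟨hC, hΛint⟩ := radial_integral (k := k) hη
    (ContinuousAlternatingMap.curryLeftLI (𝕜 := ℝ) (E := F) (F := ℝ) (n := k)).toContinuousLinearMap
  have hcur : ∀ (f : F [⋀^Fin (k + 1)]→L[ℝ] ℝ) (a : F) (w : Fin k → F),
      (ContinuousAlternatingMap.curryLeftLI (𝕜 := ℝ) (E := F) (F := ℝ)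
        (n := k)).toContinuousLinearMap f a w = f (Matrix.vecCons a w) := fun _ _ _ => rfl
  refine ⟨_, hC, by simp, fun w v => ?_, fun z hz => ?_⟩
  · obtain ⟨-, hval⟩ := hΛint 0 (mem_ball_self hR)
      ((ContinuousAlternatingMap.apply ℝ F ℝ v).comp (ContinuousLinearMap.apply ℝ _ w))
    refine hval.trans ?_
    have h1 : ∀ t : ℝ, t ^ k * ((ContinuousAlternatingMap.apply ℝ F ℝ v).comp
        (ContinuousLinearMap.apply ℝ _ w))
        ((ContinuousAlternatingMap.curryLeftLI (𝕜 := ℝ) (E := F) (F := ℝ)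
          (n := k)).toContinuousLinearMap (η (t • (0 : F))) +
          t • ((ContinuousAlternatingMap.curryLeftLI (𝕜 := ℝ) (E := F) (F := ℝ)
          (n := k)).toContinuousLinearMap.flip 0 ∘L fderiv ℝ η (t • (0 : F)))) =
        t ^ k * η 0 (Matrix.vecCons w v) := fun t => by
      rw [map_zero, ContinuousLinearMap.zero_comp, smul_zero, smul_zero, add_zero]
      rfl
    refine (intervalIntegral.integral_congr fun t _ => h1 t).trans ?_
    rw [intervalIntegral.integral_mul_const, integral_pow]
    simp
  ext v
  have hIcc : uIcc (0 : ℝ) 1 = Icc 0 1 := uIcc_of_le zero_le_one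
  obtain ⟨hint, hval⟩ := hΛint z hz ((ContinuousAlternatingMap.apply ℝ F ℝ v).comp
      (ContinuousAlternatingMap.alternatizeUncurryFinCLM ℝ F ℝ))
  have h1 := hval
  change extDeriv _ z v = _ at h1
  rw [h1]
  have key : ∀ t ∈ Icc (0 : ℝ) 1, HasDerivAt (fun t : ℝ => t ^ (k + 1) * η (t • z) v)
      (t ^ k * ((ContinuousAlternatingMap.apply ℝ F ℝ v).comp
        (ContinuousAlternatingMap.alternatizeUncurryFinCLM ℝ F ℝ))
        ((ContinuousAlternatingMap.curryLeftLI (𝕜 := ℝ) (E := F) (F := ℝ)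
          (n := k)).toContinuousLinearMap (η (t • z)) +
          t • ((ContinuousAlternatingMap.curryLeftLI (𝕜 := ℝ) (E := F) (F := ℝ)
          (n := k)).toContinuousLinearMap.flip z ∘L fderiv ℝ η (t • z)))) t := by
    intro t ht
    -- closedness of `η`, evaluated on `(z, v)`
    have h2 := DFunLike.congr_fun (hclosed _ (hball z hz t ht)) (Matrix.vecCons z v)
    have h3 : fderiv ℝ η (t • z) z v = ∑ i : Fin (k + 1), (-1 : ℝ) ^ (i : ℕ) *
        fderiv ℝ η (t • z) (v i) (Matrix.vecCons z (i.removeNth v)) := by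
      rw [extDeriv, ContinuousAlternatingMap.alternatizeUncurryFin_apply, Fin.sum_univ_succ] at h2
      simp only [removeNth_succ_vecCons] at h2
      simp only [Fin.val_zero, pow_zero, one_smul, Matrix.cons_val_zero, Fin.removeNth_zero,
        Fin.val_succ, Matrix.cons_val_succ, pow_succ] at h2
      rw [← sub_eq_zero, sub_eq_add_neg, ← Finset.sum_neg_distrib]
      simpa using h2
    have h2' : HasDerivAt (fun t : ℝ => t • z) z t := by
      simpa using (hasDerivAt_id t).smul_const z
    have h3' := (hηd _ (hball z hz t ht)).comp_hasDerivAt t h2'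
    have h4 : HasDerivAt (fun t : ℝ => η (t • z) v) (fderiv ℝ η (t • z) z v) t :=
      (ContinuousAlternatingMap.apply ℝ F ℝ v).hasFDerivAt.comp_hasDerivAt t h3'
    refine ((hasDerivAt_pow (k + 1) t).mul h4).congr_deriv (Eq.symm ?_)
    have h5 : ((ContinuousAlternatingMap.apply ℝ F ℝ v).comp
        (ContinuousAlternatingMap.alternatizeUncurryFinCLM ℝ F ℝ))
        ((ContinuousAlternatingMap.curryLeftLI (𝕜 := ℝ) (E := F) (F := ℝ)
          (n := k)).toContinuousLinearMap (η (t • z)) +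
          t • ((ContinuousAlternatingMap.curryLeftLI (𝕜 := ℝ) (E := F) (F := ℝ)
          (n := k)).toContinuousLinearMap.flip z ∘L fderiv ℝ η (t • z))) =
        ∑ i : Fin (k + 1), ((-1 : ℝ) ^ (i : ℕ) * η (t • z) (Matrix.vecCons (v i) (i.removeNth v)) +
          t * ((-1 : ℝ) ^ (i : ℕ) *
            fderiv ℝ η (t • z) (v i) (Matrix.vecCons z (i.removeNth v)))) := by
      change ContinuousAlternatingMap.alternatizeUncurryFin _ v = _
      rw [ContinuousAlternatingMap.alternatizeUncurryFin_apply]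
      refine Finset.sum_congr rfl fun i _ => ?_
      rw [_root_.add_apply, _root_.smul_apply,
        ContinuousLinearMap.comp_apply, ContinuousLinearMap.flip_apply,
        ContinuousAlternatingMap.add_apply, ContinuousAlternatingMap.smul_apply, hcur, hcur,
        smul_eq_mul, zsmul_eq_mul]
      push_cast
      ring
    have h6 : ∀ i : Fin (k + 1),
        (-1 : ℝ) ^ (i : ℕ) * η (t • z) (Matrix.vecCons (v i) (i.removeNth v)) =
          η (t • z) v := fun i => by
      rw [map_cons_removeNth, ← mul_assoc, ← mul_pow]
      norm_num
    refine (congrArg (t ^ k * ·) h5).trans ?_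
    simp_rw [h6]
    rw [Finset.sum_add_distrib, ← Finset.mul_sum, ← h3]
    simp
    ring
  rw [intervalIntegral.integral_eq_sub_of_hasDerivAt (fun t ht => key t (hIcc ▸ ht)) hint]
  simp

end Poincare

end

noncomputable section

/-! ### A calibrated submanifold of a punctured ball reaches the boundary sphere -/

section AlternatingAlgebra

variable {F : Type*} [NormedAddCommGroup F] [InnerProductSpace ℝ F] {k : ℕ}

theorem extDeriv_fun_smul_apply {f : F → ℝ} {γ : F → F [⋀^Fin k]→L[ℝ] ℝ} {y : F}
    (hf : DifferentiableAt ℝ f y) (hγ : DifferentiableAt ℝ γ y) (v : Fin (k + 1) → F) :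
    extDeriv (fun z => f z • γ z) y v = f y * extDeriv γ y v +
      ∑ i : Fin (k + 1), (-1 : ℝ) ^ (i : ℕ) * (fderiv ℝ f y (v i) * γ y (i.removeNth v)) := by
  have h := (hf.hasFDerivAt.smul hγ.hasFDerivAt).fderiv
  have h' : fderiv ℝ (fun z => f z • γ z) y =
    f y • fderiv ℝ γ y + (fderiv ℝ f y).smulRight (γ y) := h
  rw [extDeriv, extDeriv, h', ContinuousAlternatingMap.alternatizeUncurryFin_apply,
    ContinuousAlternatingMap.alternatizeUncurryFin_apply, Finset.mul_sum, ← Finset.sum_add_distrib]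
  refine Finset.sum_congr rfl fun i _ => ?_
  simp
  ring

/-- Contraction of a form with the linear vector field `J`. -/
theorem exists_contraction {U : Set F} (hU : IsOpen U) {η : F → F [⋀^Fin (k + 1)]→L[ℝ] ℝ}
    (hη : ContDiffOn ℝ 1 η U) (J : F →L[ℝ] F) :
    ∃ β : F → F [⋀^Fin k]→L[ℝ] ℝ, ContDiffOn ℝ 1 β U ∧
      (∀ y v, β y v = η y (Matrix.vecCons (J y) v)) ∧
      ∀ y ∈ U, ∀ w v, fderiv ℝ β y w v =
        fderiv ℝ η y w (Matrix.vecCons (J y) v) + η y (Matrix.vecCons (J w) v) := by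
  have key : ∀ {A A' : Type _} [NormedAddCommGroup A] [NormedSpace ℝ A]
      [NormedAddCommGroup A'] [NormedSpace ℝ A'] (cur : A →L[ℝ] F →L[ℝ] A') {η : F → A},
      ContDiffOn ℝ 1 η U → ContDiffOn ℝ 1 (fun y => cur (η y) (J y)) U ∧
        ∀ y ∈ U, ∀ w, fderiv ℝ (fun y => cur (η y) (J y)) y w =
          cur (fderiv ℝ η y w) (J y) + cur (η y) (J w) := by
    intro A A' _ _ _ _ cur η hη
    refine ⟨(cur.contDiff.comp_contDiffOn hη).clm_apply J.contDiff.contDiffOn, fun y hy w => ?_⟩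
    have h1 := ((hη.contDiffAt (hU.mem_nhds hy)).differentiableAt (by simp)).hasFDerivAt
    have h2 := (cur.hasFDerivAt.comp y h1).clm_apply J.hasFDerivAt
    rw [HasFDerivAt.fderiv (f := fun y => cur (η y) (J y)) h2]
    simp [add_comm]
  obtain ⟨h1, h2⟩ := key (ContinuousAlternatingMap.curryLeftLI (𝕜 := ℝ) (E := F) (F := ℝ)
    (n := k)).toContinuousLinearMap hη
  refine ⟨_, h1, fun _ _ => rfl, fun y hy w v => ?_⟩
  exact DFunLike.congr_fun (h2 y hy w) v

/-- In top degree, the sign of a product of two alternating forms can be tested on orthonormal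
bases. -/
theorem mul_nonneg_of_orthonormal [FiniteDimensional ℝ F] {T : Submodule ℝ F}
    (hT : Module.finrank ℝ T = k) {f g : F [⋀^Fin k]→L[ℝ] ℝ}
    (h : ∀ b : Fin k → F, Orthonormal ℝ b → (∀ i, b i ∈ T) → 0 ≤ f b * g b)
    (v : Fin k → F) (hv : ∀ i, v i ∈ T) : 0 ≤ f v * g v := by
  let e : OrthonormalBasis (Fin k) ℝ T := (stdOrthonormalBasis ℝ T).reindex (finCongr hT)
  have key : ∀ f : F [⋀^Fin k]→L[ℝ] ℝ,
      f v = f (fun i => (e i : F)) * e.toBasis.det fun i => ⟨v i, hv i⟩ := by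
    intro f
    have h1 := AlternatingMap.eq_smul_basis_det e.toBasis
      (f.toAlternatingMap.compLinearMap T.subtype)
    have h2 := DFunLike.congr_fun h1 fun i => ⟨v i, hv i⟩
    have h3 : (f.toAlternatingMap.compLinearMap T.subtype) e.toBasis = f fun i => (e i : F) := by
      simp [AlternatingMap.compLinearMap_apply]
    rw [h3] at h2
    exact h2
  have h4 := h (fun i => (e i : F)) (e.orthonormal.comp_linearIsometry T.subtypeₗᵢ)
    fun i => (e i).2
  rw [key f, key g]
  have : ∀ a b d : ℝ, a * d * (b * d) = a * b * (d * d) := fun a b d => by ring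
  rw [this]
  exact mul_nonneg h4 (mul_self_nonneg _)

theorem abs_apply_le_of_orthonormal (f : F [⋀^Fin k]→L[ℝ] ℝ) {v : Fin k → F}
    (hv : Orthonormal ℝ v) : |f v| ≤ ‖f‖ := by
  have := f.le_opNorm v
  simpa [hv.1] using this

theorem abs_apply_removeNth_le (f : F [⋀^Fin k]→L[ℝ] ℝ) {v : Fin (k + 1) → F}
    (hv : Orthonormal ℝ v) (i : Fin (k + 1)) : |f (i.removeNth v)| ≤ ‖f‖ := by
  have := f.le_opNorm (i.removeNth v)
  simpa [Fin.removeNth, hv.1] using this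

end AlternatingAlgebra

theorem deriv_smoothTransition_nonneg (x : ℝ) : 0 ≤ deriv Real.smoothTransition x :=
  Real.smoothTransition.monotone.deriv_nonneg

theorem deriv_smoothTransition_of_nonpos {x : ℝ} (hx : x ≤ 0) :
    deriv Real.smoothTransition x = 0 :=
  IsLocalMin.deriv_eq_zero (Eventually.of_forall fun z => by
    rw [Real.smoothTransition.zero_of_nonpos hx]; exact Real.smoothTransition.nonneg z)

theorem deriv_smoothTransition_of_one_le {x : ℝ} (hx : 1 ≤ x) :
    deriv Real.smoothTransition x = 0 :=
  IsLocalMax.deriv_eq_zero (Eventually.of_forall fun z => by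
    rw [Real.smoothTransition.one_of_one_le hx]; exact Real.smoothTransition.le_one z)

theorem exists_deriv_smoothTransition_le : ∃ K > 0, ∀ x, deriv Real.smoothTransition x ≤ K := by
  have hc : Continuous (deriv Real.smoothTransition) :=
    Real.smoothTransition.contDiff.continuous_deriv (n := 1) le_rfl
  obtain ⟨K, hK⟩ := isCompact_Icc.exists_bound_of_continuousOn (hc.continuousOn (s := Icc 0 1))
  refine ⟨max K 1, by positivity, fun x => ?_⟩
  rcases le_total x 0 with h0 | h0
  · rw [deriv_smoothTransition_of_nonpos h0]; positivity
  rcases le_total 1 x with h1 | h1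
  · rw [deriv_smoothTransition_of_one_le h1]; positivity
  · exact (le_abs_self _).trans ((hK x ⟨h0, h1⟩).trans (le_max_left _ _))

section Cutoff

variable {F : Type*} [NormedAddCommGroup F] [InnerProductSpace ℝ F]

/-- A radial cutoff function: `0` for `a|y|² ≤ 1` and `1` for `a|y|² ≥ 2`. -/
def radialCutoff (a : ℝ) (y : F) : ℝ := Real.smoothTransition (a * ‖y‖ ^ 2 - 1)

theorem contDiff_radialCutoff (a : ℝ) : ContDiff ℝ 1 (radialCutoff a : F → ℝ) :=
  Real.smoothTransition.contDiff.comp ((contDiff_const.mul (contDiff_norm_sq ℝ)).sub contDiff_const)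

theorem fderiv_radialCutoff (a : ℝ) (y w : F) : fderiv ℝ (radialCutoff a : F → ℝ) y w =
    2 * a * deriv Real.smoothTransition (a * ‖y‖ ^ 2 - 1) * inner ℝ y w := by
  have h1 : HasFDerivAt (fun y : F => a * ‖y‖ ^ 2 - 1) (a • (2 • (innerSL ℝ y))) y :=
    (((hasStrictFDerivAt_norm_sq y).hasFDerivAt.const_mul a).sub_const 1)
  have h2 : HasDerivAt Real.smoothTransition (deriv Real.smoothTransition (a * ‖y‖ ^ 2 - 1))
      (a * ‖y‖ ^ 2 - 1) :=
    ((Real.smoothTransition.contDiff (n := 1)).differentiable (by simp) _).hasDerivAt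
  have h3 := h2.comp_hasFDerivAt y h1
  rw [HasFDerivAt.fderiv (f := (radialCutoff a : F → ℝ)) h3]
  simp
  ring

end Cutoff

end

noncomputable section

section Calibrated

variable {F : Type*} [NormedAddCommGroup F] [InnerProductSpace ℝ F] [FiniteDimensional ℝ F]
  {k : ℕ}

theorem IsLocalParam.finrank_tangentSubspace {N : Set F} {O : Set (EuclideanSpace ℝ (Fin k))}
    {g : EuclideanSpace ℝ (Fin k) → F} {U : Set F} {H : F → EuclideanSpace ℝ (Fin k)}
    (h : IsLocalParam N O g U H) {y : F} (hy : y ∈ N ∩ U) :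
    Module.finrank ℝ (tangentSubspace N y) = k := by
  have hO := h.mapsTo_inv hy
  have h1 : tangentSubspace N y = LinearMap.range (fderiv ℝ g (H y)).toLinearMap := by
    ext v
    have := h.tangentSubspace_eq hO (v := v)
    rw [h.rightInv hy] at this
    exact this
  rw [h1, LinearMap.finrank_range_of_inj (h.fderiv_injective hO)]
  simp

/-- The potentials used for the comparison near the centre: `β = ι_{Jz} ηI` and
`κ = α - β / (k + 1)`, with `α` a primitive of `ηR`. -/
theorem exists_potentials {R : ℝ} (hR : 0 < R) {J : F →L[ℝ] F}
    {ηR ηI : F → F [⋀^Fin (k + 1)]→L[ℝ] ℝ} (hηR : ContDiffOn ℝ 1 ηR (ball 0 R))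
    (hηI : ContDiffOn ℝ 1 ηI (ball 0 R)) (hclosed : ∀ z ∈ ball (0 : F) R, extDeriv ηR z = 0)
    (h0 : ∀ z v, ηI 0 (Matrix.vecCons (J z) v) = ηR 0 (Matrix.vecCons z v)) :
    ∃ β κ : F → F [⋀^Fin k]→L[ℝ] ℝ, ContDiffOn ℝ 1 β (ball 0 R) ∧ ContDiffOn ℝ 1 κ (ball 0 R) ∧
      (∀ y v, β y v = ηI y (Matrix.vecCons (J y) v)) ∧
      (∀ y ∈ ball (0 : F) R, ∀ v,
        (k + 1 : ℝ)⁻¹ * extDeriv β y v + extDeriv κ y v = ηR y v) ∧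
      (∀ ε > 0, ∀ᶠ y in 𝓝 0, ‖κ y‖ ≤ ε * ‖y‖) ∧
      ∀ ε > 0, ∀ᶠ y in 𝓝 0, ‖extDeriv β y - (k + 1 : ℝ) • ηR y‖ ≤ ε := by
  obtain ⟨α, hα, hα0, hα', hαd⟩ := exists_primitive hR hηR hclosed
  obtain ⟨β, hβ, hβv, hβ'⟩ := exists_contraction isOpen_ball hηI J
  have h0R : (0 : F) ∈ ball (0 : F) R := mem_ball_self hR
  have hk : (k + 1 : ℝ) ≠ 0 := by positivity
  have hαD : ∀ y ∈ ball (0 : F) R, DifferentiableAt ℝ α y := fun y hy =>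
    (hα.contDiffAt (isOpen_ball.mem_nhds hy)).differentiableAt (by simp)
  have hβD : ∀ y ∈ ball (0 : F) R, DifferentiableAt ℝ β y := fun y hy =>
    (hβ.contDiffAt (isOpen_ball.mem_nhds hy)).differentiableAt (by simp)
  have hβ0 : β 0 = 0 := by
    ext v
    rw [hβv, map_zero]
    exact (ηI 0).map_coord_zero 0 rfl
  have hβ0' : ∀ w v, fderiv ℝ β 0 w v = ηR 0 (Matrix.vecCons w v) := by
    intro w v
    rw [hβ' 0 h0R, map_zero, h0, (fderiv ℝ ηI 0 w).map_coord_zero 0 rfl, zero_add]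
  have hsub : ∀ y ∈ ball (0 : F) R, HasFDerivAt (fun y => α y - (k + 1 : ℝ)⁻¹ • β y)
      (fderiv ℝ α y - (k + 1 : ℝ)⁻¹ • fderiv ℝ β y) y := fun y hy =>
    (hαD y hy).hasFDerivAt.sub ((hβD y hy).hasFDerivAt.fun_const_smul (k + 1 : ℝ)⁻¹)
  refine ⟨β, fun y => α y - (k + 1 : ℝ)⁻¹ • β y, hβ, hα.sub (hβ.const_smul _), hβv, ?_, ?_, ?_⟩
  · intro y hy v
    have h1 : extDeriv (fun y => α y - (k + 1 : ℝ)⁻¹ • β y) y =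
        extDeriv α y - (k + 1 : ℝ)⁻¹ • extDeriv β y := by
      rw [extDeriv, extDeriv, extDeriv, (hsub y hy).fderiv]
      exact ((ContinuousAlternatingMap.alternatizeUncurryFinCLM ℝ F ℝ).map_sub _ _).trans
        (congrArg _ ((ContinuousAlternatingMap.alternatizeUncurryFinCLM ℝ F ℝ).map_smul _ _))
    rw [h1, hαd y hy]
    simp
  · intro ε hε
    have h1 : fderiv ℝ α 0 - (k + 1 : ℝ)⁻¹ • fderiv ℝ β 0 = 0 := by
      ext w v
      change fderiv ℝ α 0 w v - (k + 1 : ℝ)⁻¹ * fderiv ℝ β 0 w v = 0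
      rw [hα', hβ0', sub_self]
    have h2 := hsub 0 h0R
    rw [h1] at h2
    have h3 := h2.isLittleO.bound hε
    filter_upwards [h3] with y hy
    simpa [hα0, hβ0] using hy
  · intro ε hε
    have h1 : ContinuousAt (fun y => extDeriv β y - (k + 1 : ℝ) • ηR y) 0 :=
      ((continuousOn_extDeriv isOpen_ball hβ).sub
        (hηR.continuousOn.const_smul (k + 1 : ℝ))).continuousAt (ball_mem_nhds _ hR)
    have h2 : extDeriv β 0 - (k + 1 : ℝ) • ηR 0 = 0 := by
      ext v
      have h3 : extDeriv β 0 v = ∑ i : Fin (k + 1), ηR 0 v := by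
        rw [extDeriv, ContinuousAlternatingMap.alternatizeUncurryFin_apply]
        refine Finset.sum_congr rfl fun i _ => ?_
        rw [hβ0', map_cons_removeNth, zsmul_eq_mul, ← mul_assoc]
        push_cast
        rw [← mul_pow]
        norm_num
      change extDeriv β 0 v - (k + 1 : ℝ) * ηR 0 v = 0
      rw [h3]
      simp
    have h3 := h1.norm.eventually (ge_mem_nhds (show ‖extDeriv β 0 - (k + 1 : ℝ) • ηR 0‖ < ε by
      rw [h2, norm_zero]; exact hε))
    exact h3

/-- Let `Q` be a submanifold of a punctured ball on which `ηI` vanishes, such that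
`d(|z|²/2) ∧ ι_{Jz} ηI` is nonnegative with respect to `ηR`. Then `Q ∪ {0}` is not compact: if it
were, then `ι_{Jz} ηI / (k + 1)` cut off near `0` could be interpolated with a primitive of `ηR` to
an exact form on `Q` with compact support that is nonnegative and nonzero. -/
theorem not_isCompact_of_calibrated {R : ℝ} {Q : Set F} (hQR : Q ⊆ ball 0 R)
    (hQ0 : (0 : F) ∉ Q) (hQne : Q.Nonempty) (hQc : ∀ ε > 0, IsCompact (Q \ ball 0 ε))
    (hparam : ∀ y ∈ Q, ∃ (O : Set (EuclideanSpace ℝ (Fin (k + 1)))) (g : _ → F) (U : Set F)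
      (H : F → _), IsLocalParam Q O g U H ∧ y ∈ U)
    {J : F →L[ℝ] F} {ηR ηI : F → F [⋀^Fin (k + 1)]→L[ℝ] ℝ} (hηR : ContDiffOn ℝ 1 ηR (ball 0 R))
    (hηI : ContDiffOn ℝ 1 ηI (ball 0 R)) (hclosed : ∀ z ∈ ball (0 : F) R, extDeriv ηR z = 0)
    (h0 : ∀ z v, ηI 0 (Matrix.vecCons (J z) v) = ηR 0 (Matrix.vecCons z v))
    {c : ℝ} (hc : 0 < c) (hlow : ∀ y ∈ Q, ∀ v : Fin (k + 1) → F, Orthonormal ℝ v →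
      (∀ i, v i ∈ tangentSubspace Q y) → c ≤ |ηR 0 v| + |ηI 0 v|)
    (hIm : ∀ y ∈ Q, ∀ v : Fin (k + 1) → F, (∀ i, v i ∈ tangentSubspace Q y) → ηI y v = 0)
    (hne : ∀ y ∈ Q, ∀ v : Fin (k + 1) → F, (∀ i, v i ∈ tangentSubspace Q y) →
      LinearIndependent ℝ v → ηR y v ≠ 0)
    (hpos : ∀ y ∈ Q, ∀ v : Fin (k + 1) → F, (∀ i, v i ∈ tangentSubspace Q y) →
      LinearIndependent ℝ v →
      0 ≤ (∑ i : Fin (k + 1), (-1 : ℝ) ^ (i : ℕ) *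
        (inner ℝ y (v i) * ηI y (Matrix.vecCons (J y) (i.removeNth v)))) * ηR y v) : False := by
  obtain ⟨y₀, hy₀⟩ := hQne
  have hy₀n : 0 < ‖y₀‖ := norm_pos_iff.2 fun h => hQ0 (h ▸ hy₀)
  have hR : 0 < R := by
    have := hQR hy₀
    rw [mem_ball_zero_iff] at this
    exact hy₀n.trans this
  obtain ⟨β, κ, hβ, hκ, hβv, hd, hκs, hβs⟩ := exists_potentials hR hηR hηI hclosed h0
  obtain ⟨K, hK, hT⟩ := exists_deriv_smoothTransition_le
  -- `ε B = c / 4` bounds all the error terms, while `c / 2` is a lower bound for `|ηR|` on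
  -- orthonormal frames of `Q` near `0`
  set B : ℝ := 1 + 4 * K * (k + 1) with hB
  have hB1 : 1 ≤ B := by rw [hB]; have : 0 ≤ 4 * K * (k + 1 : ℝ) := by positivity
                         linarith
  set ε : ℝ := c / (4 * B) with hε
  have hεp : 0 < ε := by positivity
  have hεB : ε * B = c / 4 := by rw [hε]; field_simp
  have hεc : ε ≤ c / 4 := by nlinarith
  have hk : (0 : ℝ) < k + 1 := by positivity
  have h0R : ball (0 : F) R ∈ 𝓝 0 := ball_mem_nhds _ hR
  have hcR : ∀ᶠ y in 𝓝 (0 : F), ‖ηR 0 - ηR y‖ ≤ ε :=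
    (continuousAt_const.sub (hηR.continuousOn.continuousAt h0R)).norm.eventually
      (ge_mem_nhds (by simpa using hεp))
  have hcI : ∀ᶠ y in 𝓝 (0 : F), ‖ηI 0 - ηI y‖ ≤ ε :=
    (continuousAt_const.sub (hηI.continuousOn.continuousAt h0R)).norm.eventually
      (ge_mem_nhds (by simpa using hεp))
  obtain ⟨δ, hδ, hδs⟩ := Metric.eventually_nhds_iff_ball.1
    (((hcR.and hcI).and (hκs ε hεp)).and (hβs ε hεp))
  obtain ⟨t, ht, htδ, hty⟩ : ∃ t : ℝ, 0 < t ∧ t < δ ^ 2 ∧ t < ‖y₀‖ ^ 2 := by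
    obtain ⟨t, h1, h2⟩ := exists_between (show 0 < min (δ ^ 2) (‖y₀‖ ^ 2) by positivity)
    exact ⟨t, h1, h2.trans_le (min_le_left _ _), h2.trans_le (min_le_right _ _)⟩
  -- `ζ` rises from `0` to `1` for `t / 8 ≤ |y|² ≤ t / 4`, and `χ` for `t / 2 ≤ |y|² ≤ t`; thus `Γ`
  -- vanishes near `0`, is a function times `β` up to `|y|² = t / 2`, and is a primitive of `ηR`
  -- beyond `|y|² = t`
  set ζ : F → ℝ := radialCutoff (8 / t) with hζ
  set χ : F → ℝ := radialCutoff (2 / t) with hχ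
  set Γ : F → F [⋀^Fin k]→L[ℝ] ℝ := fun y => ((k + 1 : ℝ)⁻¹ * ζ y) • β y + χ y • κ y with hΓ
  have hΓs : ContDiffOn ℝ 1 Γ (ball 0 R) :=
    ((contDiff_const.mul (contDiff_radialCutoff _)).contDiffOn.smul hβ).add
      ((contDiff_radialCutoff _).contDiffOn.smul hκ)
  set W : (F → F [⋀^Fin k]→L[ℝ] ℝ) → F → (Fin (k + 1) → F) → ℝ := fun γ y v =>
    ∑ i : Fin (k + 1), (-1 : ℝ) ^ (i : ℕ) * (inner ℝ y (v i) * γ y (i.removeNth v)) with hW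
  have hcut : ∀ (a b : ℝ) (γ : F → F [⋀^Fin k]→L[ℝ] ℝ), ContDiffOn ℝ 1 γ (ball 0 R) →
      ∀ y ∈ ball (0 : F) R, ∀ v, extDeriv (fun z => (b * radialCutoff a z) • γ z) y v =
        b * radialCutoff a y * extDeriv γ y v +
          b * (2 * a * deriv Real.smoothTransition (a * ‖y‖ ^ 2 - 1)) * W γ y v := by
    intro a b γ hγ y hy v
    have h1 := (((contDiff_radialCutoff a : ContDiff ℝ 1 (radialCutoff a : F → ℝ))).differentiable
      (by simp) y)
    rw [extDeriv_fun_smul_apply (h1.const_mul b)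
      ((hγ.contDiffAt (isOpen_ball.mem_nhds hy)).differentiableAt (by simp)), hW]
    congr 1
    simp only
    rw [Finset.mul_sum]
    refine Finset.sum_congr rfl fun i _ => ?_
    rw [fderiv_const_mul h1]
    change _ * ((b * fderiv ℝ (radialCutoff a) y (v i)) * _) = _
    rw [fderiv_radialCutoff]
    ring
  have hdΓ : ∀ y ∈ ball (0 : F) R, ∀ v, extDeriv Γ y v =
      (k + 1 : ℝ)⁻¹ * ζ y * extDeriv β y v + χ y * extDeriv κ y v +
        (k + 1 : ℝ)⁻¹ * (2 * (8 / t) * deriv Real.smoothTransition (8 / t * ‖y‖ ^ 2 - 1)) *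
          W β y v +
        2 * (2 / t) * deriv Real.smoothTransition (2 / t * ‖y‖ ^ 2 - 1) * W κ y v := by
    intro y hy v
    have h1 := hcut (8 / t) (k + 1 : ℝ)⁻¹ β hβ y hy v
    have h2 := hcut (2 / t) 1 κ hκ y hy v
    have h3 : DifferentiableAt ℝ (fun y => ((k + 1 : ℝ)⁻¹ * ζ y) • β y) y :=
      (((contDiff_const.mul (contDiff_radialCutoff _)).contDiffOn.smul hβ).contDiffAt
        (isOpen_ball.mem_nhds hy)).differentiableAt (by simp)
    have h4 : DifferentiableAt ℝ (fun y => χ y • κ y) y :=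
      (((contDiff_radialCutoff _).contDiffOn.smul hκ).contDiffAt
        (isOpen_ball.mem_nhds hy)).differentiableAt (by simp)
    simp only [one_mul] at h2
    rw [hΓ, extDeriv_fun_add h3 h4]
    change extDeriv (fun y => ((k + 1 : ℝ)⁻¹ * ζ y) • β y) y v +
      extDeriv (fun y => χ y • κ y) y v = _
    rw [h1, h2]
    ring
  -- beyond radius `√t`, the form `dΓ` is `ηR`
  have hfar : ∀ y ∈ Q, t < ‖y‖ ^ 2 → ∀ v, extDeriv Γ y v = ηR y v := by
    intro y hy hty v
    have h2 : 1 ≤ 2 / t * ‖y‖ ^ 2 - 1 := by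
      have : 2 ≤ 2 / t * ‖y‖ ^ 2 := by
        rw [div_mul_eq_mul_div, le_div_iff₀ ht]; linarith
      linarith
    have h8 : 1 ≤ 8 / t * ‖y‖ ^ 2 - 1 := by
      have : 2 ≤ 8 / t * ‖y‖ ^ 2 := by
        rw [div_mul_eq_mul_div, le_div_iff₀ ht]; linarith
      linarith
    rw [hdΓ y (hQR hy), deriv_smoothTransition_of_one_le h2, deriv_smoothTransition_of_one_le h8,
      hζ, hχ, radialCutoff, radialCutoff, Real.smoothTransition.one_of_one_le h2,
      Real.smoothTransition.one_of_one_le h8, ← hd y (hQR hy)]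
    ring
  -- the term with `dζ` has the right sign, without any smallness
  have hβW : ∀ y ∈ Q, ∀ v : Fin (k + 1) → F, (∀ i, v i ∈ tangentSubspace Q y) →
      LinearIndependent ℝ v → 0 ≤ W β y v * ηR y v := by
    intro y hy v hv hvi
    have := hpos y hy v hv hvi
    simp_rw [← hβv] at this
    exact this
  have hnonneg : ∀ y ∈ Q, ∀ v : Fin (k + 1) → F, (∀ i, v i ∈ tangentSubspace Q y) →
      0 ≤ extDeriv Γ y v * ηR y v := by
    intro y hy v hv
    have hyR := hQR hy
    rcases lt_or_ge t (‖y‖ ^ 2) with hyt | hyt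
    · rw [hfar y hy hyt]
      exact mul_self_nonneg _
    obtain ⟨O, g, U, H, hp, hyU⟩ := hparam y hy
    have hrank := hp.finrank_tangentSubspace ⟨hy, hyU⟩
    refine mul_nonneg_of_orthonormal hrank (fun b hb hbT => ?_) v hv
    have hyδ : y ∈ ball (0 : F) δ := by
      rw [mem_ball_zero_iff]
      exact lt_of_pow_lt_pow_left₀ 2 hδ.le (hyt.trans_lt htδ)
    obtain ⟨⟨⟨hR1, hI1⟩, hκ1⟩, hβ1⟩ := hδs y hyδ
    set θ := ηR y b with hθ
    -- the calibration inequality at `0` persists up to a small error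
    have hθc : c / 2 ≤ |θ| := by
      have h1 := hlow y hy b hb hbT
      have h2 := (abs_apply_le_of_orthonormal (ηR 0 - ηR y) hb).trans hR1
      have h3 := (abs_apply_le_of_orthonormal (ηI 0 - ηI y) hb).trans hI1
      rw [ContinuousAlternatingMap.sub_apply] at h2 h3
      rw [hIm y hy b hbT, sub_zero] at h3
      have h4 : |ηR 0 b| ≤ |ηR 0 b - θ| + |θ| := by
        have := abs_add_le (ηR 0 b - θ) θ
        rwa [sub_add_cancel] at this
      linarith
    have hE : |extDeriv β y b - (k + 1) * θ| ≤ ε :=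
      (abs_apply_le_of_orthonormal (extDeriv β y - (k + 1 : ℝ) • ηR y) hb).trans hβ1
    have hgood : ∀ D : ℝ, |D| ≤ c / 2 → 0 ≤ (θ + D) * θ := by
      intro D hD
      have h1 : |D * θ| ≤ |θ| * |θ| := by
        rw [abs_mul]; exact mul_le_mul_of_nonneg_right (hD.trans hθc) (abs_nonneg _)
      rw [abs_mul_abs_self] at h1
      have := neg_abs_le (D * θ)
      linarith [add_mul θ D θ]
    have hkE : |(k + 1 : ℝ)⁻¹ * (extDeriv β y b - (k + 1) * θ)| ≤ ε := by
      rw [abs_mul, abs_of_pos (inv_pos.2 hk)]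
      exact (mul_le_of_le_one_left (abs_nonneg _) (inv_le_one_of_one_le₀ (by linarith))).trans hE
    have hβe : (k + 1 : ℝ)⁻¹ * extDeriv β y b =
        θ + (k + 1 : ℝ)⁻¹ * (extDeriv β y b - (k + 1) * θ) := by field_simp; ring
    have hTn := deriv_smoothTransition_nonneg
    rw [hdΓ y hyR]
    -- where `ζ` varies `χ` vanishes, and where `χ` varies `ζ = 1`
    rcases lt_or_ge (‖y‖ ^ 2) (t / 2) with hyt2 | hyt2
    · have h2 : 2 / t * ‖y‖ ^ 2 - 1 ≤ 0 := by
        have : 2 / t * ‖y‖ ^ 2 ≤ 1 := by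
          rw [div_mul_eq_mul_div, div_le_one ht]; linarith
        linarith
      rw [deriv_smoothTransition_of_nonpos h2, hχ, radialCutoff,
        Real.smoothTransition.zero_of_nonpos h2, add_mul, add_mul, add_mul, mul_assoc (_ * _) _ θ,
        mul_assoc (_ * _) _ θ]
      have h5 := hβW y hy b hbT hb.linearIndependent
      have h6 : 0 ≤ ζ y * (((k + 1 : ℝ)⁻¹ * extDeriv β y b) * θ) := by
        refine mul_nonneg (Real.smoothTransition.nonneg _) ?_
        rw [hβe]
        exact hgood _ (by linarith)
      have h7 : 0 ≤ (k + 1 : ℝ)⁻¹ * (2 * (8 / t) *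
          deriv Real.smoothTransition (8 / t * ‖y‖ ^ 2 - 1)) * (W β y b * θ) :=
        mul_nonneg (mul_nonneg (inv_nonneg.2 hk.le) (mul_nonneg (by positivity) (hTn _))) h5
      have h8 : (k + 1 : ℝ)⁻¹ * ζ y * (extDeriv β y b * θ) =
        ζ y * (((k + 1 : ℝ)⁻¹ * extDeriv β y b) * θ) := by ring
      rw [h8]
      linarith
    · have h8 : 1 ≤ 8 / t * ‖y‖ ^ 2 - 1 := by
        have : 2 ≤ 8 / t * ‖y‖ ^ 2 := by
          rw [div_mul_eq_mul_div, le_div_iff₀ ht]; linarith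
        linarith
      have hκe : extDeriv κ y b = θ - (k + 1 : ℝ)⁻¹ * extDeriv β y b := by
        rw [hθ, ← hd y hyR]; ring
      -- the term with `dχ`, of size `|κ| / |y|`, is small since `κ` vanishes to second order at `0`
      have hWκ : |W κ y b| ≤ (k + 1) * (ε * t) := by
        rw [hW]
        refine (Finset.abs_sum_le_sum_abs _ _).trans ?_
        refine (Finset.sum_le_card_nsmul _ _ (ε * t) fun i _ => ?_).trans (by simp)
        rw [abs_mul, abs_mul, abs_pow, abs_neg, abs_one, one_pow, one_mul]
        have h1 : |inner ℝ y (b i)| ≤ ‖y‖ := by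
          simpa [hb.1] using abs_real_inner_le_norm y (b i)
        have h2 := (abs_apply_removeNth_le (κ y) hb i).trans hκ1
        calc |inner ℝ y (b i)| * |κ y (i.removeNth b)| ≤ ‖y‖ * (ε * ‖y‖) :=
              mul_le_mul h1 h2 (abs_nonneg _) (norm_nonneg _)
          _ = ε * ‖y‖ ^ 2 := by ring
          _ ≤ ε * t := mul_le_mul_of_nonneg_left hyt hεp.le
      have hTK := hT (2 / t * ‖y‖ ^ 2 - 1)
      have h9 : |2 * (2 / t) * deriv Real.smoothTransition (2 / t * ‖y‖ ^ 2 - 1) * W κ y b| ≤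
          4 * K * (k + 1) * ε := by
        rw [abs_mul, abs_of_nonneg (mul_nonneg (by positivity) (hTn _))]
        calc 2 * (2 / t) * deriv Real.smoothTransition (2 / t * ‖y‖ ^ 2 - 1) * |W κ y b|
            ≤ 2 * (2 / t) * K * ((k + 1) * (ε * t)) := by gcongr
          _ = 4 * K * (k + 1) * ε := by field_simp; ring
      have hχ0 : 0 ≤ χ y := Real.smoothTransition.nonneg _
      have hχ1 : χ y ≤ 1 := Real.smoothTransition.le_one _
      have h10 : |(1 - χ y) * ((k + 1 : ℝ)⁻¹ * (extDeriv β y b - (k + 1) * θ))| ≤ ε := by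
        rw [abs_mul, abs_of_nonneg (by linarith)]
        exact (mul_le_of_le_one_left (abs_nonneg _) (by linarith)).trans hkE
      rw [deriv_smoothTransition_of_one_le h8]
      have hζ1 : ζ y = 1 := Real.smoothTransition.one_of_one_le h8
      have h11 := hgood ((1 - χ y) * ((k + 1 : ℝ)⁻¹ * (extDeriv β y b - (k + 1) * θ)) +
        2 * (2 / t) * deriv Real.smoothTransition (2 / t * ‖y‖ ^ 2 - 1) * W κ y b) (by
          refine (abs_add_le _ _).trans ((add_le_add h10 h9).trans ?_)
          have : ε + 4 * K * (k + 1) * ε = ε * B := by rw [hB]; ring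
          linarith)
      convert h11 using 2
      rw [hκe, hζ1]
      linear_combination (1 - χ y) * θ * inv_mul_cancel₀ hk.ne'
  have hball : IsOpen (ball (0 : F) R) := isOpen_ball
  obtain ⟨v, hv, hvi, hv0⟩ := extDeriv_eq_zero_of_nonneg (Q := Q) hball hQR hparam hΓs
    (D := {y | t / 8 ≤ ‖y‖ ^ 2}) (isClosed_le continuous_const (by fun_prop))
    (fun y _ hy => by
      have hy' : ‖y‖ ^ 2 < t / 8 := not_le.1 hy
      have h2 : 2 / t * ‖y‖ ^ 2 - 1 ≤ 0 := by
        have : 2 / t * ‖y‖ ^ 2 ≤ 1 := by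
          rw [div_mul_eq_mul_div, div_le_one ht]; linarith
        linarith
      have h8 : 8 / t * ‖y‖ ^ 2 - 1 ≤ 0 := by
        have : 8 / t * ‖y‖ ^ 2 ≤ 1 := by
          rw [div_mul_eq_mul_div, div_le_one ht]; linarith
        linarith
      simp only [hΓ, hζ, hχ, radialCutoff]
      rw [Real.smoothTransition.zero_of_nonpos h2, Real.smoothTransition.zero_of_nonpos h8]
      simp)
    (by
      have h1 := hQc (√(t / 8)) (by positivity)
      have h2 : Q ∩ {y | t / 8 ≤ ‖y‖ ^ 2} = Q \ ball 0 √(t / 8) := by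
        ext y
        simp only [mem_inter_iff, Set.mem_ofPred_eq, Set.mem_sdiff, mem_ball_zero_iff, not_lt,
          Real.sqrt_le_left (norm_nonneg y)]
      rw [h2]
      exact h1)
    hηR.continuousOn hne hnonneg (y₀ := y₀) ⟨hy₀, by
      change t / 8 ≤ ‖y₀‖ ^ 2
      linarith⟩
  rw [hfar y₀ hy₀ hty] at hv0
  exact hne y₀ hy₀ v hv hvi hv0

end Calibrated

end

noncomputable section

/-! ### Regularity and closedness of holomorphic forms -/

section Holomorphic

/-- A holomorphic function of several variables is continuously differentiable: by Cauchy's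
estimate on complex lines, the differential inherits the uniform continuity of the function. -/
theorem contDiffOn_one_of_differentiableOn_complex {E V : Type*} [NormedAddCommGroup E]
    [NormedSpace ℂ E] [FiniteDimensional ℂ E] [NormedSpace ℝ E] [IsScalarTower ℝ ℂ E]
    [NormedAddCommGroup V] [NormedSpace ℂ V] [NormedSpace ℝ V] [IsScalarTower ℝ ℂ V]
    {f : E → V} {U : Set E} (hU : IsOpen U) (hf : DifferentiableOn ℂ f U) :
    ContDiffOn ℝ 1 f U := by
  have : ProperSpace E := FiniteDimensional.proper ℂ E
  have hD : ∀ z ∈ U, HasFDerivAt f (fderiv ℂ f z) z := fun z hz =>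
    (hf.differentiableAt (hU.mem_nhds hz)).hasFDerivAt
  have hDR : ∀ z ∈ U, HasFDerivAt f ((fderiv ℂ f z).restrictScalars ℝ) z := fun z hz =>
    (hD z hz).restrictScalars ℝ
  have hcont : ContinuousOn (fderiv ℝ f) U := by
    intro z₀ hz₀
    refine ContinuousAt.continuousWithinAt ?_
    obtain ⟨r', hr', hr'U⟩ := Metric.nhds_basis_closedBall.mem_iff.1 (hU.mem_nhds hz₀)
    set r := r' / 2 with hr
    have hrp : 0 < r := by positivity
    have huc := (isCompact_closedBall z₀ r').uniformContinuousOn_of_continuous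
      (hf.continuousOn.mono hr'U)
    rw [Metric.uniformContinuousOn_iff] at huc
    rw [Metric.continuousAt_iff']
    intro ε hε
    obtain ⟨δ, hδ, hδs⟩ := huc (ε / 2 * r) (by positivity)
    filter_upwards [ball_mem_nhds z₀ hδ, ball_mem_nhds z₀ hrp] with z hzδ hzr
    have hzU : z ∈ U := hr'U
      (closedBall_subset_closedBall (by linarith) (ball_subset_closedBall hzr))
    rw [dist_eq_norm]
    refine lt_of_le_of_lt (b := ε / 2) ?_ (by linarith)
    refine ContinuousLinearMap.opNorm_le_of_unit_norm (by positivity) fun w hw => ?_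
    rw [(hDR z hzU).fderiv, (hDR z₀ hz₀).fderiv]
    have hmem : ∀ x, dist x z₀ ≤ r → ∀ ζ : ℂ, ‖ζ‖ ≤ r → x + ζ • w ∈ closedBall z₀ r' := by
      intro x hx ζ hζ
      rw [mem_closedBall]
      calc dist (x + ζ • w) z₀ ≤ dist (x + ζ • w) x + dist x z₀ := dist_triangle _ _ _
        _ ≤ r + r := by
            refine add_le_add ?_ hx
            rw [dist_eq_norm, add_sub_cancel_left, norm_smul, hw, mul_one]
            exact hζ
        _ = r' := by rw [hr]; ring
    have hline : ∀ x, dist x z₀ ≤ r → ∀ ζ : ℂ, ‖ζ‖ ≤ r →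
        HasDerivAt (fun ζ : ℂ => f (x + ζ • w)) (fderiv ℂ f (x + ζ • w) w) ζ := by
      intro x hx ζ hζ
      have h1 : HasDerivAt (fun ζ : ℂ => x + ζ • w) w ζ := by
        simpa using ((hasDerivAt_id ζ).smul_const w).const_add x
      exact (hD _ (hr'U (hmem x hx ζ hζ))).comp_hasDerivAt ζ h1
    have hz₀r : dist z₀ z₀ ≤ r := by rw [dist_self]; exact hrp.le
    have hzr' : dist z z₀ ≤ r := (mem_ball.1 hzr).le
    have hg : ∀ ζ : ℂ, ‖ζ‖ ≤ r → HasDerivAt (fun ζ : ℂ => f (z + ζ • w) - f (z₀ + ζ • w))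
        (fderiv ℂ f (z + ζ • w) w - fderiv ℂ f (z₀ + ζ • w) w) ζ := fun ζ hζ =>
      (hline z hzr' ζ hζ).sub (hline z₀ hz₀r ζ hζ)
    have hdc : DiffContOnCl ℂ (fun ζ : ℂ => f (z + ζ • w) - f (z₀ + ζ • w)) (ball 0 r) := by
      refine DifferentiableOn.diffContOnCl fun ζ hζ => ?_
      refine (hg ζ ?_).differentiableAt.differentiableWithinAt
      have := closure_ball_subset_closedBall hζ
      rwa [mem_closedBall_zero_iff] at this
    -- Cauchy's estimate on a disc of radius `r` in the direction `w`
    have hest := Complex.norm_deriv_le_of_forall_mem_sphere_norm_le hrp hdc (C := ε / 2 * r) (by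
      intro ζ hζ
      have hζr : ‖ζ‖ ≤ r := by
        rw [mem_sphere_zero_iff_norm] at hζ; exact hζ.le
      rw [← dist_eq_norm]
      refine (hδs _ (hmem z hzr' ζ hζr) _ (hmem z₀ hz₀r ζ hζr) ?_).le
      rw [dist_add_right]
      exact hzδ)
    rw [(hg 0 (by simpa using hrp.le)).deriv, mul_div_cancel_right₀ _ hrp.ne'] at hest
    simpa using hest
  have h1 := (contDiffOn_succ_iff_fderiv_of_isOpen (𝕜 := ℝ) (n := 0) (f := f) hU).2
    ⟨fun z hz => (hDR z hz).differentiableAt.differentiableWithinAt, by simp,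
      contDiffOn_zero.2 hcont⟩
  simpa using h1

variable {E : Type*} [NormedAddCommGroup E] [NormedSpace ℂ E] [FiniteDimensional ℂ E]
  [NormedSpace ℝ E] [IsScalarTower ℝ ℂ E] {k : ℕ}

/-- A real-linear functional of a complex form, as a real form. -/
def realForm (L : ℂ →L[ℝ] ℝ) (f : E [⋀^Fin k]→L[ℂ] ℂ) : E [⋀^Fin k]→L[ℝ] ℝ :=
  L.compContinuousAlternatingMap (f.restrictScalars ℝ)

theorem contDiffOn_realForm (L : ℂ →L[ℝ] ℝ) {G : E → E [⋀^Fin k]→L[ℂ] ℂ} {U : Set E}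
    (hU : IsOpen U) (hG : DifferentiableOn ℂ G U) :
    ContDiffOn ℝ 1 (fun z => realForm L (G z)) U := by
  let Ψ : (E [⋀^Fin k]→L[ℂ] ℂ) →L[ℝ] E [⋀^Fin k]→L[ℝ] ℝ :=
    (ContinuousLinearMap.compContinuousAlternatingMapCLM ℝ E ℂ ℝ (Fin k) L).comp
      (ContinuousAlternatingMap.restrictScalarsCLM ℝ)
  exact Ψ.contDiff.comp_contDiffOn (contDiffOn_one_of_differentiableOn_complex hU hG)

/-- A holomorphic form of top degree is closed. -/
theorem extDeriv_realForm_eq_zero (L : ℂ →L[ℝ] ℝ) (hk : Module.finrank ℂ E = k)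
    {G : E → E [⋀^Fin k]→L[ℂ] ℂ} {z : E} (hG : DifferentiableAt ℂ G z) :
    extDeriv (fun z => realForm L (G z)) z = 0 := by
  have h1 := (((ContinuousLinearMap.compContinuousAlternatingMapCLM ℝ E ℂ ℝ (Fin k) L).comp
    (ContinuousAlternatingMap.restrictScalarsCLM ℝ)).hasFDerivAt).comp z
      (hG.hasFDerivAt.restrictScalars ℝ)
  have h2 : ∀ w v, fderiv ℝ (fun z => realForm L (G z)) z w v = L (fderiv ℂ G z w v) :=
    fun w v => by
      rw [HasFDerivAt.fderiv (f := fun z => realForm L (G z)) h1]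
      rfl
  ext v
  rw [extDeriv, ContinuousAlternatingMap.alternatizeUncurryFin_apply]
  simp_rw [h2]
  have h3 : ∑ i : Fin (k + 1), (-1 : ℤ) ^ (i : ℕ) • L (fderiv ℂ G z (v i) (i.removeNth v)) =
      L (ContinuousAlternatingMap.alternatizeUncurryFin (fderiv ℂ G z) v) := by
    rw [ContinuousAlternatingMap.alternatizeUncurryFin_apply, map_sum]
    exact Finset.sum_congr rfl fun i _ => (map_zsmul L _ _).symm
  have h4 : ContinuousAlternatingMap.alternatizeUncurryFin (fderiv ℂ G z) v = 0 := by
    refine (ContinuousAlternatingMap.alternatizeUncurryFin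
      (fderiv ℂ G z)).toAlternatingMap.map_linearDependent v fun h => ?_
    have := h.fintype_card_le_finrank
    rw [hk, Fintype.card_fin] at this
    omega
  rw [h3, h4, map_zero]
  rfl

end Holomorphic

end

noncomputable section

/-- Complex and real derivatives agree as maps. -/
theorem HasFDerivAt.eq_real_of_complex {E : Type*} [NormedAddCommGroup E] [NormedSpace ℂ E]
    [NormedSpace ℝ E] [IsScalarTower ℝ ℂ E] {f : E → E} {A : E →L[ℂ] E} {B : E →L[ℝ] E} {z : E}
    (hA : HasFDerivAt f A z) (hB : HasFDerivAt f B z) (v : E) : B v = A v :=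
  DFunLike.congr_fun (hB.unique (hA.restrictScalars ℝ)) v

section DarbouxForms

variable {m : ℕ} {M : Type*} [TopologicalSpace M] [T2Space M] [CompactSpace M]
    [ChartedSpace (CSpace m) M] [IsManifold 𝓘(ℂ, CSpace m) ω M] [IsManifold 𝓘(ℝ, CSpace m) ∞ M]

/-- The real derivative of a holomorphic chart. -/
theorem mfderiv_real_chart_symm {e : OpenPartialHomeomorph M (CSpace m)}
    (he : e ∈ atlas (CSpace m) M) {z : CSpace m} (hz : z ∈ e.target) (v : CSpace m) :
    (mfderiv 𝓘(ℝ, CSpace m) 𝓘(ℝ, CSpace m) e.symm z v : CSpace m) =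
      (mfderiv 𝓘(ℂ, CSpace m) 𝓘(ℂ, CSpace m) e.symm z v : CSpace m) := by
  have : IsManifold 𝓘(ℂ, CSpace m) 1 M := IsManifold.of_le (n := ω) (by simp)
  have : IsManifold 𝓘(ℝ, CSpace m) 1 M := IsManifold.of_le (n := ∞) (by simp)
  have h1 := (mdifferentiableAt_atlas_symm (I := 𝓘(ℂ, CSpace m)) he hz).hasMFDerivAt.2
  have h2 := (mdifferentiableAt_atlas_symm (I := 𝓘(ℝ, CSpace m)) he hz).hasMFDerivAt.2
  rw [modelWithCornersSelf_coe, range_id] at h1 h2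
  have h1' : HasFDerivAt (fun w => chartAt (CSpace m) (e.symm z) (e.symm w))
      (mfderiv 𝓘(ℂ, CSpace m) 𝓘(ℂ, CSpace m) e.symm z : CSpace m →L[ℂ] CSpace m) z :=
    hasFDerivWithinAt_univ.1 h1
  have h2' : HasFDerivAt (fun w => chartAt (CSpace m) (e.symm z) (e.symm w))
      (mfderiv 𝓘(ℝ, CSpace m) 𝓘(ℝ, CSpace m) e.symm z : CSpace m →L[ℝ] CSpace m) z :=
    hasFDerivWithinAt_univ.1 h2
  exact h1'.eq_real_of_complex h2' v

variable (Y : AlmostCalabiYau m M)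

/-- The pullback of `L ∘ Ω` by a map `Υ : ℂ^m → M`, for a real-linear functional `L` on `ℂ`. -/
def AlmostCalabiYau.pullVol (L : ℂ →L[ℝ] ℝ) (Υ : CSpace m → M) (y : CSpace m) :
    CSpace m [⋀^Fin m]→L[ℝ] ℝ :=
  (realForm L (E := CSpace m) (Y.vol (Υ y))).compContinuousLinearMap
    (mfderiv 𝓘(ℝ, CSpace m) 𝓘(ℝ, CSpace m) Υ y : CSpace m →L[ℝ] CSpace m)

theorem AlmostCalabiYau.pullVol_apply (L : ℂ →L[ℝ] ℝ) (Υ : CSpace m → M) (y : CSpace m)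
    (v : Fin m → CSpace m) : Y.pullVol L Υ y v =
      L (Y.volReal (Υ y) fun i => mfderiv 𝓘(ℝ, CSpace m) 𝓘(ℝ, CSpace m) Υ y (v i)) := rfl

variable {Y}

/-- The pullback of `Ω` in terms of its representation in a holomorphic chart. -/
theorem AlmostCalabiYau.pullVol_eventuallyEq (L : ℂ →L[ℝ] ℝ) {Υ : CSpace m → M} {s : Set (CSpace m)}
    (hs : IsOpen s) (hΥ : ContMDiffOn 𝓘(ℝ, CSpace m) 𝓘(ℝ, CSpace m) ∞ Υ s) {y₀ : CSpace m}
    (hy₀ : y₀ ∈ s) :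
    Y.pullVol L Υ =ᶠ[𝓝 y₀] fun y => (realForm L (chartVol Y.vol (chartAt (CSpace m) (Υ y₀))
      (chartAt (CSpace m) (Υ y₀) (Υ y)))).compContinuousLinearMap
        (fderiv ℝ (fun z => chartAt (CSpace m) (Υ y₀) (Υ z)) y) := by
  set e := chartAt (CSpace m) (Υ y₀) with he
  have : IsManifold 𝓘(ℝ, CSpace m) 1 M := IsManifold.of_le (n := ∞) (by simp)
  have heat : e ∈ atlas (CSpace m) M := chart_mem_atlas _ _
  have hso : IsOpen (s ∩ Υ ⁻¹' e.source) := hΥ.continuousOn.isOpen_inter_preimage hs e.open_source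
  filter_upwards [hso.mem_nhds ⟨hy₀, mem_chart_source _ _⟩] with y hy
  have hΥy : MDifferentiableAt 𝓘(ℝ, CSpace m) 𝓘(ℝ, CSpace m) Υ y :=
    (hΥ.contMDiffAt (hs.mem_nhds hy.1)).mdifferentiableAt (by simp)
  have hey : MDifferentiableAt 𝓘(ℝ, CSpace m) 𝓘(ℝ, CSpace m) e (Υ y) :=
    mdifferentiableAt_atlas heat hy.2
  have hΦ : MDifferentiableAt 𝓘(ℝ, CSpace m) 𝓘(ℝ, CSpace m) (fun z => e (Υ z)) y :=
    hey.comp y hΥy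
  have hsymm : MDifferentiableAt 𝓘(ℝ, CSpace m) 𝓘(ℝ, CSpace m) e.symm (e (Υ y)) :=
    mdifferentiableAt_atlas_symm heat (e.map_source hy.2)
  have h1 : (fun z => e.symm (e (Υ z))) =ᶠ[𝓝 y] Υ := by
    filter_upwards [hso.mem_nhds hy] with z hz using e.left_inv hz.2
  have h2 : ∀ v : CSpace m, (mfderiv 𝓘(ℝ, CSpace m) 𝓘(ℝ, CSpace m) Υ y v : CSpace m) =
      (mfderiv 𝓘(ℂ, CSpace m) 𝓘(ℂ, CSpace m) e.symm (e (Υ y))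
        (fderiv ℝ (fun z => e (Υ z)) y v) : CSpace m) := by
    intro v
    rw [← mfderiv_real_chart_symm heat (e.map_source hy.2)]
    have h3 := hsymm.hasMFDerivAt.comp y hΦ.hasMFDerivAt
    have h4 := (h3.congr_of_eventuallyEq h1.symm).mfderiv
    rw [mfderiv_eq_fderiv] at h4
    exact DFunLike.congr_fun h4 v
  have h5 : ∀ x x' : M, x = x' → ∀ w : Fin m → CSpace m, (Y.vol x w : ℂ) = Y.vol x' w := by
    rintro x _ rfl w; rfl
  ext v
  change L (Y.vol (Υ y) fun i => mfderiv 𝓘(ℝ, CSpace m) 𝓘(ℝ, CSpace m) Υ y (v i)) =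
    L (Y.vol (e.symm (e (Υ y))) fun i => mfderiv 𝓘(ℂ, CSpace m) 𝓘(ℂ, CSpace m) e.symm (e (Υ y))
        (fderiv ℝ (fun z => e (Υ z)) y (v i)))
  refine congrArg L ?_
  refine (h5 _ _ (e.left_inv hy.2).symm _).trans ?_
  exact congrArg (Y.vol (e.symm (e (Υ y)))) (funext fun i => h2 (v i))

/-- The pullbacks of the real and imaginary parts of `Ω` are closed `C¹` forms. -/
theorem AlmostCalabiYau.pullVol_regular (L : ℂ →L[ℝ] ℝ) {Υ : CSpace m → M} {s : Set (CSpace m)}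
    (hs : IsOpen s) (hΥ : ContMDiffOn 𝓘(ℝ, CSpace m) 𝓘(ℝ, CSpace m) ∞ Υ s) :
    ContDiffOn ℝ 1 (Y.pullVol L Υ) s ∧ ∀ y ∈ s, extDeriv (Y.pullVol L Υ) y = 0 := by
  have key : ∀ y₀ ∈ s, ContDiffAt ℝ 1 (Y.pullVol L Υ) y₀ ∧ extDeriv (Y.pullVol L Υ) y₀ = 0 := by
    intro y₀ hy₀
    have hev := Y.pullVol_eventuallyEq L hs hΥ hy₀
    set e := chartAt (CSpace m) (Υ y₀) with he
    have heat : e ∈ atlas (CSpace m) M := chart_mem_atlas _ _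
    have hΦ : ContDiffAt ℝ ∞ (fun z => e (Υ z)) y₀ := by
      rw [← contMDiffAt_iff_contDiffAt]
      exact (contMDiffAt_of_mem_maximalAtlas (IsManifold.chart_mem_maximalAtlas _)
        (mem_chart_source _ _)).comp y₀ (hΥ.contMDiffAt (hs.mem_nhds hy₀))
    have hmem : e (Υ y₀) ∈ e.target := e.map_source (mem_chart_source _ _)
    have hG := contDiffOn_realForm L e.open_target (Y.vol_holomorphic e heat)
    have hGat := hG.contDiffAt (e.open_target.mem_nhds hmem)
    constructor
    · refine ContDiffAt.congr_of_eventuallyEq ?_ hev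
      have h1 : ContDiffAt ℝ 1 (fun y => realForm L (chartVol Y.vol e (e (Υ y)))) y₀ :=
        ContDiffAt.comp (g := fun z => realForm L (chartVol Y.vol e z))
          (f := fun z => e (Υ z)) y₀ hGat (hΦ.of_le (show (1 : ℕ∞ω) ≤ ∞ by simp))
      have h2 : ContDiffAt ℝ 1 (fderiv ℝ (fun z => e (Υ z))) y₀ :=
        (hΦ.fderiv_right (m := ∞) (by simp)).of_le (by simp)
      exact ContDiffWithinAt.continuousAlternatingMap_compContinuousLinearMap h1 h2
    · have hGd : DifferentiableAt ℝ (fun z => realForm L (chartVol Y.vol e z)) (e (Υ y₀)) :=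
        hGat.differentiableAt (by simp)
      rw [hev.extDeriv_eq, extDeriv_pullback (r := ∞) (f := fun z => e (Υ z)) hGd hΦ
        (by rw [minSmoothness_of_isRCLikeNormedField]
            exact WithTop.coe_le_coe.2 (le_top (a := (2 : ℕ∞)))),
        extDeriv_realForm_eq_zero L (by simp)
          ((Y.vol_holomorphic e heat).differentiableAt (e.open_target.mem_nhds hmem))]
      rfl
  exact ⟨fun y hy => (key y hy).1.contDiffWithinAt, fun y hy => (key y hy).2⟩

end DarbouxForms

end

noncomputable section

/-! ### Linear algebra of Lagrangian subspaces -/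

section Lagrangian

variable {V : Type*} [AddCommGroup V] [Module ℂ V] [Module ℝ V] [IsScalarTower ℝ ℂ V]

theorem complex_smul_eq (c : ℂ) (e : V) : c • e = c.re • e + Complex.I • (c.im • e) := by
  rw [← algebraMap_smul ℂ c.re e, ← algebraMap_smul ℂ c.im e, smul_smul, ← add_smul]
  congr 1
  rw [mul_comm]
  exact (Complex.re_add_im c).symm

/-- A real-linearly independent Lagrangian family for a symplectic form that tames the complex
structure is complex-linearly independent. -/
theorem linearIndependent_complex_of_lagrangian {ι : Type*} [Fintype ι] {w : V →ₗ[ℝ] V →ₗ[ℝ] ℝ}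
    (hpos : ∀ u, u ≠ 0 → 0 < w u (Complex.I • u)) {e : ι → V} (he : LinearIndependent ℝ e)
    (hlag : ∀ i j, w (e i) (e j) = 0) : LinearIndependent ℂ e := by
  rw [Fintype.linearIndependent_iff] at he ⊢
  intro c hc
  set A := ∑ i, (c i).re • e i with hA
  set B := ∑ i, (c i).im • e i with hB
  have h1 : A + Complex.I • B = 0 := by
    rw [← hc, hA, hB, Finset.smul_sum, ← Finset.sum_add_distrib]
    refine Finset.sum_congr rfl fun i _ => ?_
    exact (complex_smul_eq _ _).symm
  have hBA : w B A = 0 := by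
    rw [hA, hB]
    simp [map_sum, LinearMap.sum_apply, hlag]
  have hB0 : B = 0 := by
    by_contra h
    have h2 := hpos B h
    have h3 : w B (A + Complex.I • B) = 0 := by rw [h1, map_zero]
    rw [map_add, hBA, zero_add] at h3
    exact h2.ne' h3
  have hA0 : A = 0 := by rwa [hB0, smul_zero, add_zero] at h1
  intro i
  exact Complex.ext (he _ hA0 i) (he _ hB0 i)

variable {k : ℕ} {w : V →ₗ[ℝ] V →ₗ[ℝ] ℝ} {Om : V [⋀^Fin (k + 1)]→ₗ[ℂ] ℂ} {e : Fin (k + 1) → V}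

theorem alternating_ne_zero_of_linearIndependent (hk : Module.finrank ℂ V = k + 1) (hOm : Om ≠ 0)
    (he : LinearIndependent ℂ e) : Om e ≠ 0 := by
  have : FiniteDimensional ℂ V := Module.finite_of_finrank_pos (by omega)
  let b := basisOfLinearIndependentOfCardEqFinrank he (by simp [hk])
  have hb : ⇑b = e := coe_basisOfLinearIndependentOfCardEqFinrank _ _
  intro h0
  have h1 := AlternatingMap.eq_smul_basis_det b Om
  rw [hb, h0, zero_smul] at h1
  exact hOm h1

/-- If `Im Ω` vanishes on a Lagrangian subspace with basis `e`, then the form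
`w(·, u) ∧ ι_u Im Ω` on it is a nonnegative multiple of `Re Ω`. -/
theorem sum_mul_im_mul_re_nonneg (hk : Module.finrank ℂ V = k + 1)
    (hpos : ∀ u, u ≠ 0 → 0 < w u (Complex.I • u)) (he : LinearIndependent ℝ e)
    (hlag : ∀ i j, w (e i) (e j) = 0) (him : (Om e).im = 0) (u : V) :
    0 ≤ (∑ i : Fin (k + 1), (-1 : ℝ) ^ (i : ℕ) *
      (w (e i) u * (Om (Matrix.vecCons u (i.removeNth e))).im)) * (Om e).re := by
  have : FiniteDimensional ℂ V := Module.finite_of_finrank_pos (by omega)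
  have hli := linearIndependent_complex_of_lagrangian hpos he hlag
  let b := basisOfLinearIndependentOfCardEqFinrank hli (by simp [hk])
  have hb : ⇑b = e := coe_basisOfLinearIndependentOfCardEqFinrank _ _
  set c : Fin (k + 1) → ℂ := fun i => b.repr u i with hc
  have hu : u = ∑ i, c i • e i := by
    rw [← hb]; exact (b.sum_repr u).symm
  -- `A` lies in the Lagrangian subspace, so only the component `I • B` of `u` contributes
  set A := ∑ i, (c i).re • e i with hA
  set B := ∑ i, (c i).im • e i with hB
  have h1 : u = A + Complex.I • B := by
    rw [hu, hA, hB, Finset.smul_sum, ← Finset.sum_add_distrib]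
    refine Finset.sum_congr rfl fun i _ => ?_
    exact complex_smul_eq _ _
  have hw : ∀ i, w (e i) u = w (e i) (Complex.I • B) := by
    intro i
    rw [h1, map_add, hA]
    simp [map_sum, hlag]
  -- Cramer's rule
  have hcr : ∀ i : Fin (k + 1), Om (Matrix.vecCons u (i.removeNth e)) =
      (-1) ^ (i : ℕ) * (c i * Om e) := by
    intro i
    have h2 := Om.neg_one_pow_smul_map_insertNth i u (i.removeNth e)
    have h3 : Om (i.insertNth u (i.removeNth e)) = c i * Om e := by
      have h4 : (i.insertNth u (i.removeNth e) : Fin (k + 1) → V) = Function.update e i u := by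
        rw [Fin.insertNth_removeNth]
      rw [h4, hu, Om.map_update_sum]
      rw [Finset.sum_eq_single i]
      · rw [Om.map_update_smul, Function.update_eq_self, smul_eq_mul]
      · intro j _ hj
        rw [Om.map_update_smul, Om.map_update_self _ hj.symm, smul_zero]
      · simp
    rw [h3] at h2
    have h5 : Om (Matrix.vecCons u (i.removeNth e)) = (-1) ^ (i : ℕ) • (c i * Om e) := by
      rw [h2]
    rw [h5]
    simp
  have him' : ∀ i : Fin (k + 1), (Om (Matrix.vecCons u (i.removeNth e))).im =
      (-1) ^ (i : ℕ) * ((c i).im * (Om e).re) := by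
    intro i
    rw [hcr]
    have h2 : ((-1 : ℂ) ^ (i : ℕ)) = (((-1 : ℝ) ^ (i : ℕ) : ℝ) : ℂ) := by push_cast; rfl
    rw [h2, Complex.im_ofReal_mul, Complex.mul_im, him]
    ring
  have hwB : ∀ D, ∑ i, (c i).im * w (e i) D = w B D := by
    intro D
    conv_rhs => rw [hB, map_sum, LinearMap.sum_apply]
    exact Finset.sum_congr rfl fun i _ => by rw [map_smul, LinearMap.smul_apply, smul_eq_mul]
  have hsum : ∑ i : Fin (k + 1), (-1 : ℝ) ^ (i : ℕ) *
      (w (e i) u * (Om (Matrix.vecCons u (i.removeNth e))).im) =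
        w B (Complex.I • B) * (Om e).re := by
    rw [← hwB, Finset.sum_mul]
    refine Finset.sum_congr rfl fun i _ => ?_
    rw [him', hw]
    have h3 : ((-1 : ℝ) ^ (i : ℕ)) * (-1) ^ (i : ℕ) = 1 := by rw [← mul_pow]; norm_num
    linear_combination (w (e i) (Complex.I • B) * (c i).im * (Om e).re) * h3
  rw [hsum, mul_assoc]
  refine mul_nonneg ?_ (mul_self_nonneg _)
  rcases eq_or_ne B 0 with h | h
  · rw [h, map_zero, LinearMap.zero_apply]
  · exact (hpos B h).le

end Lagrangian

end

noncomputable section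

/-! ### Special Lagrangian submanifolds of a punctured Darboux ball -/

section StandardForms

variable {m : ℕ}

/-- The metric is `g'(u, y) = ω'(u, I y)`. -/
theorem stdOmega_I_smul (u y : CSpace m) : stdOmega u (Complex.I • y) = inner ℝ y u := by
  simp [stdOmega, PiLp.inner_apply, Complex.inner]

theorem stdVol_vecCons_smul {k : ℕ} (a : ℂ) (z : CSpace (k + 1)) (v : Fin k → CSpace (k + 1)) :
    stdVol (Matrix.vecCons (a • z) v) = a * stdVol (Matrix.vecCons z v) := by
  have h : (Matrix.of fun i j => (Matrix.vecCons (a • z) v : Fin (k + 1) → CSpace (k + 1)) i j) =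
      Matrix.updateRow (Matrix.of fun i j => (Matrix.vecCons z v : Fin (k + 1) → _) i j) 0
        (a • fun j => z j) := by
    ext i j
    refine Fin.cases ?_ (fun i => ?_) i
    · simp
    · simp [Matrix.updateRow_ne]
  rw [stdVol, h, Matrix.det_updateRow_smul, stdVol]
  congr 2
  ext i j
  refine Fin.cases ?_ (fun i => ?_) i
  · simp
  · simp [Matrix.updateRow_ne]

/-- A real-orthonormal Lagrangian frame is unitary. -/
theorem norm_stdVol_of_lagrangian {v : Fin m → CSpace m} (hv : Orthonormal ℝ v)
    (hlag : ∀ i j, stdOmega (v i) (v j) = 0) : ‖stdVol v‖ = 1 := by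
  set A : Matrix (Fin m) (Fin m) ℂ := Matrix.of fun i j => v i j with hA
  have h1 : A * A.conjTranspose = 1 := by
    ext i j
    have h2 : inner ℝ (v j) (v i) = if j = i then (1 : ℝ) else 0 := orthonormal_iff_ite.1 hv j i
    have h3 := hlag i j
    rw [Matrix.mul_apply]
    apply Complex.ext
    · rw [Complex.re_sum]
      have : ∑ l, (A i l * A.conjTranspose l j).re = inner ℝ (v j) (v i) := by
        simp [hA, PiLp.inner_apply, Complex.inner]
      rw [this, h2, Matrix.one_apply]
      by_cases h : i = j <;> simp [h, eq_comm]
    · rw [Complex.im_sum]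
      have : ∑ l, (A i l * A.conjTranspose l j).im = - stdOmega (v i) (v j) := by
        rw [stdOmega, ← Finset.sum_neg_distrib]
        refine Finset.sum_congr rfl fun l _ => ?_
        simp [hA]
        ring
      rw [this, h3, Matrix.one_apply]
      by_cases h : i = j <;> simp [h]
  have h2 := congrArg Matrix.det h1
  rw [Matrix.det_mul, Matrix.det_conjTranspose, Matrix.det_one] at h2
  have h3 := congrArg norm h2
  rw [norm_mul, norm_star, norm_one] at h3
  have h4 : ‖stdVol v‖ = ‖A.det‖ := rfl
  rw [h4]
  nlinarith [norm_nonneg A.det]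

theorem exists_bilinear {E : Type*} [NormedAddCommGroup E] [NormedSpace ℝ E]
    (f : E [⋀^Fin 2]→L[ℝ] ℝ) : ∃ w : E →ₗ[ℝ] E →ₗ[ℝ] ℝ, ∀ u v, w u v = f ![u, v] := by
  have hswap : ∀ u v, f ![u, v] = - f ![v, u] := fun u v => by
    have h := f.toAlternatingMap.map_swap ![v, u] (show (0 : Fin 2) ≠ 1 by decide)
    have h2 : (![v, u] : Fin 2 → E) ∘ Equiv.swap 0 1 = ![u, v] := by
      ext i; fin_cases i <;> simp
    rw [h2] at h
    exact h
  have hadd : ∀ u u' v, f ![u + u', v] = f ![u, v] + f ![u', v] := fun u u' v =>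
    f.toAlternatingMap.map_vecCons_add ![v] u u'
  have hsmul : ∀ (a : ℝ) u v, f ![a • u, v] = a • f ![u, v] := fun a u v =>
    f.toAlternatingMap.map_vecCons_smul ![v] a u
  exact ⟨LinearMap.mk₂ ℝ (fun u v => f ![u, v]) hadd hsmul
    (fun u v v' => by rw [hswap, hadd, hswap v, hswap v']; ring)
    (fun a u v => by rw [hswap, hsmul, hswap v]; simp), fun _ _ => rfl⟩

end StandardForms

section NoClosedEnd

variable {m : ℕ} {M : Type*} [TopologicalSpace M] [T2Space M] [CompactSpace M]
    [ChartedSpace (CSpace m) M] [IsManifold 𝓘(ℂ, CSpace m) ω M] [IsManifold 𝓘(ℝ, CSpace m) ∞ M]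
  {Y : AlmostCalabiYau m M} {x : M} {υ : CSpace m ≃L[ℝ] TangentSpace 𝓘(ℝ, CSpace m) x} {R : ℝ}
  {Υ : CSpace m → M}

/-- A Darboux embedding mapping `Q` into `N` maps tangent spaces of `Q` into those of `N`. -/
theorem AlmostCalabiYau.IsDarbouxEmbedding.mfderiv_mem_submanifoldTangent
    (h : Y.IsDarbouxEmbedding x υ R Υ) {Q : Set (CSpace m)} {N : Set M} (hQN : MapsTo Υ Q N)
    {y : CSpace m} (hy : y ∈ ball (0 : CSpace m) R) {u : CSpace m} (hu : u ∈ tangentSubspace Q y) :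
    mfderiv 𝓘(ℝ, CSpace m) 𝓘(ℝ, CSpace m) Υ y u ∈
      submanifoldTangent (F := CSpace m) N (Υ y) := by
  have hc : ContMDiffAt 𝓘(ℝ, CSpace m) 𝓘(ℝ, CSpace m) ∞ Υ y :=
    h.smooth.contMDiffAt (isOpen_ball.mem_nhds hy)
  have hn : Υ ⁻¹' (chartAt (CSpace m) (Υ y)).source ∈ 𝓝 y :=
    hc.continuousAt ((chartAt (CSpace m) (Υ y)).open_source.mem_nhds (mem_chart_source _ _))
  rw [← tangentSubspace_inter_nhds hn] at hu
  have hmaps : MapsTo (fun z => chartAt (CSpace m) (Υ y) (Υ z))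
      (Q ∩ Υ ⁻¹' (chartAt (CSpace m) (Υ y)).source)
      (chartAt (CSpace m) (Υ y) '' (N ∩ (chartAt (CSpace m) (Υ y)).source)) :=
    fun z hz => ⟨Υ z, ⟨hQN hz.1, hz.2⟩, rfl⟩
  exact tangentSubspace_map (hasFDerivAt_chart_comp hc).hasFDerivWithinAt hmaps hu

theorem AlmostCalabiYau.pullVol_zero (h : Y.IsDarbouxEmbedding x υ R Υ) {ψ : M → ℝ}
    (hid : Y.IsIdentification ψ x υ) (L : ℂ →L[ℝ] ℝ) (v : Fin m → CSpace m) :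
    Y.pullVol L Υ 0 v = L (((ψ x ^ m : ℝ) : ℂ) * stdVol v) := by
  have h5 : ∀ x x' : M, x = x' → ∀ w : Fin m → CSpace m, (Y.vol x w : ℂ) = Y.vol x' w := by
    rintro x _ rfl w; rfl
  rw [Y.pullVol_apply, ← hid.2 v]
  refine congrArg L ((h5 _ _ h.map_zero _).trans ?_)
  exact congrArg (Y.vol x) (funext fun i => h.deriv_zero (v i))

/-- A special Lagrangian submanifold of a punctured Darboux ball cannot be closed up to a compact
set by adding the centre. -/
theorem AlmostCalabiYau.IsDarbouxEmbedding.not_isCompact_of_isSLFold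
    (h : Y.IsDarbouxEmbedding x υ R Υ) (hm : 0 < m) {ψ : M → ℝ} (hψ : 0 < ψ x)
    (hid : Y.IsIdentification ψ x υ) {N : Set M} (hN : Y.IsSLFold N) {Q : Set (CSpace m)}
    (hQR : Q ⊆ ball 0 R) (hQ0 : (0 : CSpace m) ∉ Q) (hQne : Q.Nonempty)
    (hQc : ∀ ε > 0, IsCompact (Q \ ball 0 ε))
    (hparam : ∀ y ∈ Q, ∃ (O : Set (EuclideanSpace ℝ (Fin m))) (g : _ → CSpace m)
      (U : Set (CSpace m)) (H : CSpace m → _), IsLocalParam Q O g U H ∧ y ∈ U)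
    (hQN : MapsTo Υ Q N) : False := by
  obtain ⟨k, rfl⟩ : ∃ k, m = k + 1 := ⟨m - 1, by omega⟩
  set D : CSpace (k + 1) → CSpace (k + 1) →L[ℝ] CSpace (k + 1) := fun y =>
    mfderiv 𝓘(ℝ, CSpace (k + 1)) 𝓘(ℝ, CSpace (k + 1)) Υ y with hD
  have hDinj : ∀ y ∈ ball (0 : CSpace (k + 1)) R, Function.Injective (D y) := h.immersion
  have hw : ∀ y, ∃ w : CSpace (k + 1) →ₗ[ℝ] CSpace (k + 1) →ₗ[ℝ] ℝ,
      ∀ u v : CSpace (k + 1), w u v = (Y.kahler (Υ y) ![u, v] : ℝ) := fun y =>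
    exists_bilinear (E := CSpace (k + 1)) (Y.kahler (Υ y))
  choose w hw using hw
  have hwD : ∀ y ∈ ball (0 : CSpace (k + 1)) R, ∀ u v, w y (D y u) (D y v) = stdOmega u v :=
    fun y hy u v => (hw y _ _).trans (h.symplectic y hy u v)
  have hwpos : ∀ y, ∀ u, u ≠ 0 → 0 < w y u (Complex.I • u) := fun y u hu => by
    rw [hw]
    exact Y.kahler_pos (Υ y) u hu
  have htan : ∀ y ∈ Q, ∀ u ∈ tangentSubspace Q y, (D y u : CSpace (k + 1)) ∈
      submanifoldTangent (F := CSpace (k + 1)) N (Υ y) := fun y hy u hu =>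
    h.mfderiv_mem_submanifoldTangent hQN (hQR hy) hu
  have hlag : ∀ y ∈ Q, ∀ u ∈ tangentSubspace Q y, ∀ v ∈ tangentSubspace Q y,
      w y (D y u) (D y v) = 0 := fun y hy u hu v hv =>
    (hw y _ _).trans ((hN.2 _ (hQN hy)).1 _ (htan y hy u hu) _ (htan y hy v hv))
  have hA : ∀ y, ∃ A : CSpace (k + 1) [⋀^Fin (k + 1)]→ₗ[ℂ] ℂ, A ≠ 0 ∧
      ∀ v : Fin (k + 1) → CSpace (k + 1), A v = Y.volReal (Υ y) v := fun y =>
    ⟨(Y.vol (Υ y)).toAlternatingMap, fun h0 => Y.vol_ne_zero (Υ y)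
      (ContinuousAlternatingMap.toAlternatingMap_injective h0), fun _ => rfl⟩
  choose A hA0 hA using hA
  have hOm : ∀ y (v : Fin (k + 1) → CSpace (k + 1)) (L : ℂ →L[ℝ] ℝ), Y.pullVol L Υ y v =
      L (A y fun i => D y (v i)) := fun y v L => congrArg L (hA y _).symm
  have hIm : ∀ y ∈ Q, ∀ v : Fin (k + 1) → CSpace (k + 1), (∀ i, v i ∈ tangentSubspace Q y) →
      (A y fun i => D y (v i)).im = 0 := fun y hy v hv => by
    rw [hA]
    exact (hN.2 _ (hQN hy)).2 _ fun i => htan y hy _ (hv i)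
  have hli : ∀ y ∈ Q, ∀ v : Fin (k + 1) → CSpace (k + 1), LinearIndependent ℝ v →
      LinearIndependent ℝ fun i => D y (v i) := fun y hy v hv =>
    hv.map' (D y : CSpace (k + 1) →ₗ[ℝ] CSpace (k + 1)) (LinearMap.ker_eq_bot.2 (hDinj y (hQR hy)))
  have hrank : Module.finrank ℂ (CSpace (k + 1)) = k + 1 := by simp
  obtain ⟨hR1, hR2⟩ := AlmostCalabiYau.pullVol_regular (Y := Y) Complex.reCLM isOpen_ball h.smooth
  obtain ⟨hI1, -⟩ := AlmostCalabiYau.pullVol_regular (Y := Y) Complex.imCLM isOpen_ball h.smooth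
  -- the Liouville contraction `ι_{Iz} Im Ω / m` serves as the model primitive of `Re Ω` near
  -- `0`; its sign on `Q` away from `0` is `sum_mul_im_mul_re_nonneg` for `u = dΥ (I y)`
  refine not_isCompact_of_calibrated hQR hQ0 hQne hQc hparam
    (J := Complex.I • ContinuousLinearMap.id ℝ (CSpace (k + 1)))
    (ηR := Y.pullVol Complex.reCLM Υ) (ηI := Y.pullVol Complex.imCLM Υ) hR1 hI1 hR2
    (c := ψ x ^ (k + 1)) ?_ (by positivity) ?_ ?_ ?_ ?_
  · intro z v
    rw [AlmostCalabiYau.pullVol_zero h hid, AlmostCalabiYau.pullVol_zero h hid]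
    change ((_ : ℂ) * stdVol (Matrix.vecCons (Complex.I • z) v)).im = _
    rw [stdVol_vecCons_smul]
    simp
    ring
  · intro y hy v hv hvT
    rw [AlmostCalabiYau.pullVol_zero h hid, AlmostCalabiYau.pullVol_zero h hid]
    have h1 := norm_stdVol_of_lagrangian hv fun i j => by
      rw [← hwD y (hQR hy)]
      exact hlag y hy _ (hvT i) _ (hvT j)
    have h2 := Complex.norm_le_abs_re_add_abs_im (((ψ x ^ (k + 1) : ℝ) : ℂ) * stdVol v)
    rw [norm_mul, h1, mul_one, Complex.norm_real, Real.norm_of_nonneg (by positivity)] at h2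
    exact h2
  · intro y hy v hv
    rw [hOm]
    exact hIm y hy v hv
  · intro y hy v hv hvi h0
    rw [hOm] at h0
    have h1 := alternating_ne_zero_of_linearIndependent hrank (hA0 y)
      (linearIndependent_complex_of_lagrangian (hwpos y) (hli y hy v hvi)
        fun i j => hlag y hy _ (hv i) _ (hv j))
    exact h1 (Complex.ext h0 (hIm y hy v hv))
  · intro y hy v hv hvi
    have h1 := sum_mul_im_mul_re_nonneg hrank (hwpos y) (hli y hy v hvi)
      (fun i j => hlag y hy _ (hv i) _ (hv j)) (hIm y hy v hv) (D y (Complex.I • y))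
    have h2 : ∀ i, w y (D y (v i)) (D y (Complex.I • y)) = inner ℝ y (v i) := fun i => by
      rw [hwD y (hQR hy), stdOmega_I_smul]
    have h3 : ∀ i : Fin (k + 1), Y.pullVol Complex.imCLM Υ y
        (Matrix.vecCons ((Complex.I • ContinuousLinearMap.id ℝ (CSpace (k + 1))) y)
          (i.removeNth v)) =
        (A y (Matrix.vecCons (D y (Complex.I • y)) (i.removeNth fun i => D y (v i)))).im := by
      intro i
      rw [hOm]
      refine congrArg Complex.im (congrArg (A y) (funext fun j => ?_))
      refine Fin.cases ?_ (fun j => ?_) j <;> rfl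
    rw [hOm]
    simp only [h3, ← h2]
    exact h1

end NoClosedEnd

end

noncomputable section

/-! ### A conical end has no second end at the singular point -/

section Transport

/-- Transport of a parametrization by a diffeomorphism `Ψ : N ∩ W → Q` with inverse `Θ`. -/
theorem IsLocalParam.transport {F : Type*} [NormedAddCommGroup F] [NormedSpace ℝ F] {k : ℕ}
    {N : Set F} {O : Set (EuclideanSpace ℝ (Fin k))} {g : EuclideanSpace ℝ (Fin k) → F}
    {U : Set F} {H : F → EuclideanSpace ℝ (Fin k)} (h : IsLocalParam N O g U H)
    (hH : ContDiffOn ℝ ∞ H U) {W Q : Set F} (hW : IsOpen W) {Ψ Θ : F → F}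
    (hΨ : ContDiffOn ℝ ∞ Ψ (N ∩ W)) (hΘ : ContDiffOn ℝ ∞ Θ Q) (hΨQ : MapsTo Ψ (N ∩ W) Q)
    (hΘN : MapsTo Θ Q (N ∩ W)) (hΘΨ : ∀ p ∈ N ∩ W, Θ (Ψ p) = p) (hΨΘ : ∀ y ∈ Q, Ψ (Θ y) = y)
    {y : F} (hy : y ∈ Q) (hyU : Θ y ∈ U) :
    ∃ (O' : Set (EuclideanSpace ℝ (Fin k))) (g' : EuclideanSpace ℝ (Fin k) → F) (U' : Set F)
      (H' : F → EuclideanSpace ℝ (Fin k)), IsLocalParam Q O' g' U' H' ∧ y ∈ U' := by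
  obtain ⟨U', hU', hUe⟩ := (_root_.continuousOn_iff'.1 hΘ.continuousOn) U h.isOpen_target
  have hmem : ∀ z ∈ Q, Θ z ∈ U ↔ z ∈ U' := fun z hz =>
    ⟨fun hv => (hUe.subset ⟨hv, hz⟩).1, fun hu => (hUe.symm.subset ⟨hu, hz⟩).1⟩
  refine ⟨O ∩ g ⁻¹' W, Ψ ∘ g, U', H ∘ Θ, ⟨?_, hU', ?_, ?_, ?_, ?_, ?_, ?_⟩, (hmem y hy).1 hyU⟩
  · exact h.smooth.continuousOn.isOpen_inter_preimage h.isOpen_source hW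
  · exact hΨ.comp (h.smooth.mono inter_subset_left) fun w hw => ⟨(h.mapsTo hw.1).1, hw.2⟩
  · exact hH.comp (hΘ.mono inter_subset_left) fun z hz => (hmem z hz.1).2 hz.2
  · intro w hw
    have h1 : g w ∈ N ∩ W := ⟨(h.mapsTo hw.1).1, hw.2⟩
    refine ⟨hΨQ h1, (hmem _ (hΨQ h1)).1 ?_⟩
    rw [hΘΨ _ h1]
    exact (h.mapsTo hw.1).2
  · intro z hz
    have h1 : Θ z ∈ N ∩ U := ⟨(hΘN hz.1).1, (hmem z hz.1).2 hz.2⟩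
    refine ⟨h.mapsTo_inv h1, ?_⟩
    simp only [Function.comp, mem_preimage]
    rw [h.rightInv h1]
    exact (hΘN hz.1).2
  · intro w hw
    have h1 : g w ∈ N ∩ W := ⟨(h.mapsTo hw.1).1, hw.2⟩
    simp only [Function.comp]
    rw [hΘΨ _ h1]
    exact h.leftInv hw.1
  · intro z hz
    have h1 : Θ z ∈ N ∩ U := ⟨(hΘN hz.1).1, (hmem z hz.1).2 hz.2⟩
    simp only [Function.comp]
    rw [h.rightInv h1]
    exact hΨΘ z hz.1

variable {m : ℕ} {C : Set (CSpace m)}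

/-- The image of an open part of the cylinder `Σ × (0, R')` under an embedding is a submanifold. -/
theorem IsSLCone.exists_localParam_image (hC : IsSLCone C) {R' : ℝ}
    {φ : CSpace m × ℝ → CSpace m} (hφ : ContDiffOn ℝ ∞ φ (link C ×ˢ Ioo 0 R'))
    {G : Set (CSpace m)} (hG : IsOpen G) {T : CSpace m → CSpace m × ℝ}
    (hT : ∀ q ∈ link C ×ˢ Ioo 0 R', T (φ q) = q)
    (hTs : ContDiffOn ℝ ∞ T (φ '' ((link C ∩ G) ×ˢ Ioo 0 R'))) {y : CSpace m}
    (hy : y ∈ φ '' ((link C ∩ G) ×ˢ Ioo 0 R')) :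
    ∃ (O : Set (EuclideanSpace ℝ (Fin m))) (g : EuclideanSpace ℝ (Fin m) → CSpace m)
      (U : Set (CSpace m)) (H : CSpace m → EuclideanSpace ℝ (Fin m)),
      IsLocalParam (φ '' ((link C ∩ G) ×ˢ Ioo 0 R')) O g U H ∧ y ∈ U := by
  have hpc : ContinuousOn (polar : CSpace m → CSpace m × ℝ) {0}ᶜ := fun p hp =>
    (contDiffAt_polar hp).continuousAt.continuousWithinAt
  have hsub : (link C ∩ G) ×ˢ Ioo 0 R' ⊆ link C ×ˢ Ioo 0 R' :=
    prod_mono inter_subset_left subset_rfl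
  set W : Set (CSpace m) := {0}ᶜ ∩ polar ⁻¹' (G ×ˢ Iio R') with hW
  have hWo : IsOpen W := hpc.isOpen_inter_preimage isOpen_compl_singleton (hG.prod isOpen_Iio)
  have hpol : MapsTo polar ((C \ {0}) ∩ W) ((link C ∩ G) ×ˢ Ioo 0 R') := fun p hp =>
    ⟨⟨hC.polar_mem hp.1, hp.2.2.1⟩, norm_pos_iff.2 hp.1.2, hp.2.2.2⟩
  have hcone : ∀ q ∈ (link C ∩ G) ×ˢ Ioo 0 R', q.2 • q.1 ∈ (C \ {0}) ∩ W := by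
    intro q hq
    have h1 := hC.smul_link_mem hq.1.1 hq.2.1
    refine ⟨h1, h1.2, ?_⟩
    rw [mem_preimage, polar_of_norm_one (IsSLCone.norm_of_mem_link hq.1.1) hq.2.1]
    exact ⟨hq.1.2, hq.2.2⟩
  have hTq : ∀ y ∈ φ '' ((link C ∩ G) ×ˢ Ioo 0 R'), T y ∈ (link C ∩ G) ×ˢ Ioo 0 R' ∧
      φ (T y) = y := by
    rintro _ ⟨q, hq, rfl⟩
    rw [hT q (hsub hq)]
    exact ⟨hq, rfl⟩
  have hmem := hcone _ (hTq y hy).1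
  obtain ⟨O, g, U, H, hp, hH, hyU⟩ := hC.slFold.1.exists_localParam hmem.1
  refine hp.transport hH hWo (Ψ := φ ∘ polar) (Θ := fun y => (T y).2 • (T y).1) ?_ ?_ ?_ ?_ ?_ ?_
    hy hyU
  · exact hφ.comp (fun p hp => (contDiffAt_polar hp.1.2).contDiffWithinAt) fun p hp =>
      hsub (hpol hp)
  · exact (contDiff_snd.comp_contDiffOn hTs).smul (contDiff_fst.comp_contDiffOn hTs)
  · exact fun p hp => ⟨_, hpol hp, rfl⟩
  · exact fun z hz => hcone _ (hTq z hz).1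
  · intro p hp
    simp only [Function.comp]
    rw [hT _ (hsub (hpol hp)), polar_smul hp.1.2]
  · intro z hz
    have h1 := (hTq z hz).1
    simp only [Function.comp]
    rw [polar_of_norm_one (IsSLCone.norm_of_mem_link h1.1.1) h1.2.1]
    exact (hTq z hz).2

/-- A conically decaying map tends to `0` as `r → 0`, uniformly on the link. -/
theorem ConicalDecay.exists_norm_lt {μ R' : ℝ} (hμ : 2 < μ) {φ : CSpace m × ℝ → CSpace m}
    (h : ConicalDecay (link C) μ R' φ) {η : ℝ} (hη : 0 < η) :
    ∃ δ > 0, ∀ σ ∈ link C, ∀ r ∈ Ioo 0 R', r < δ → ‖φ (σ, r)‖ < η := by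
  obtain ⟨c, hc, ε, hε, hcε⟩ := h
  refine ⟨min ε (min 1 (η / (1 + c))), by positivity, fun σ hσ r hr hrδ => ?_⟩
  rw [lt_min_iff, lt_min_iff] at hrδ
  have h1 := (hcε σ hσ r hr hrδ.1).1
  have h2 : r ^ (μ - 1) ≤ r := by
    have := Real.rpow_le_rpow_of_exponent_ge hr.1 hrδ.2.1.le (show (1 : ℝ) ≤ μ - 1 by linarith)
    rwa [Real.rpow_one] at this
  have h3 := hrδ.2.2
  rw [lt_div_iff₀ (by positivity)] at h3
  calc ‖φ (σ, r)‖ = ‖(φ (σ, r) - r • σ) + r • σ‖ := by rw [sub_add_cancel]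
    _ ≤ ‖φ (σ, r) - r • σ‖ + ‖r • σ‖ := norm_add_le _ _
    _ ≤ c * r + r := by
        rw [IsSLCone.norm_smul_link hσ hr.1]
        exact add_le_add (h1.trans (mul_le_mul_of_nonneg_left h2 hc.le)) le_rfl
    _ < η := by linarith

end Transport

section Ends

variable {F : Type*} [NormedAddCommGroup F]

/-- Let `φ : L × (0, R') → F ∖ {0}` be an embedding of a cylinder tending to `0` at `r = 0`, whose
image is closed near `0` in `F ∖ {0}`. Either `φ` tends to `0` only at the end `r = 0`, or on a
part of the cylinder it tends to `0` at both ends. -/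
theorem closed_end_or_exists_double_end {L : Set F} (hL : IsCompact L) {R' : ℝ} (hR' : 0 < R')
    {φ : F × ℝ → F} (hφ : ContinuousOn φ (L ×ˢ Ioo 0 R'))
    (hφ0 : ∀ q ∈ L ×ˢ Ioo 0 R', φ q ≠ 0)
    (hsmall : ∀ η > 0, ∃ δ > 0, ∀ σ ∈ L, ∀ r ∈ Ioo 0 R', r < δ → ‖φ (σ, r)‖ < η)
    {T : F → F × ℝ} (hT : ∀ q ∈ L ×ˢ Ioo 0 R', T (φ q) = q)
    (hTc : ContinuousOn T (φ '' (L ×ˢ Ioo 0 R'))) {s : ℝ} (hs : 0 < s)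
    (hK : ∀ a, 0 < a → a ≤ s → IsCompact {z ∈ φ '' (L ×ˢ Ioo 0 R') | a ≤ ‖z‖ ∧ ‖z‖ ≤ s}) :
    (∀ ε > 0, ∃ a > 0, ∀ σ ∈ L, ∀ r ∈ Ioo 0 R', ‖φ (σ, r)‖ < a → r < ε) ∨
      ∃ G : Set F, IsOpen G ∧ (L ∩ G).Nonempty ∧
        ∀ ε > 0, IsCompact (φ '' ((L ∩ G) ×ˢ Ioo 0 R') \ ball 0 ε) := by
  -- for `r ≥ ρ` the image does not meet the sphere of radius `s`
  obtain ⟨ρ, hρ, hρs⟩ : ∃ ρ ∈ Ioo 0 R', ∀ σ ∈ L, ∀ r ∈ Ico ρ R', ‖φ (σ, r)‖ ≠ s := by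
    have hc : IsCompact ((fun z => (T z).2) '' {z ∈ φ '' (L ×ˢ Ioo 0 R') | s ≤ ‖z‖ ∧ ‖z‖ ≤ s}) :=
      (hK s hs le_rfl).image_of_continuousOn
        ((continuous_snd.comp_continuousOn hTc).mono fun z hz => hz.1)
    have hsub : (fun z => (T z).2) '' {z ∈ φ '' (L ×ˢ Ioo 0 R') | s ≤ ‖z‖ ∧ ‖z‖ ≤ s} ⊆
        Ioo 0 R' := by
      rintro _ ⟨z, ⟨⟨q, hq, rfl⟩, -⟩, rfl⟩
      simp only
      rw [hT q hq]
      exact hq.2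
    obtain ⟨r₁, hr₁, hr₁s⟩ : ∃ r₁ < R', ∀ r ∈ (fun z => (T z).2) ''
        {z ∈ φ '' (L ×ˢ Ioo 0 R') | s ≤ ‖z‖ ∧ ‖z‖ ≤ s}, r ≤ r₁ := by
      rcases ((fun z => (T z).2) ''
        {z ∈ φ '' (L ×ˢ Ioo 0 R') | s ≤ ‖z‖ ∧ ‖z‖ ≤ s}).eq_empty_or_nonempty with he | hne
      · exact ⟨0, hR', fun r hr => by rw [he] at hr; exact absurd hr (notMem_empty r)⟩
      · obtain ⟨r₁, hr₁, hmax⟩ := hc.exists_isGreatest hne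
        exact ⟨r₁, (hsub hr₁).2, hmax⟩
    obtain ⟨ρ, hρ1, hρ2⟩ := exists_between (max_lt hr₁ hR')
    refine ⟨ρ, ⟨(le_max_right _ _).trans_lt hρ1, hρ2⟩, fun σ hσ r hr hrs => ?_⟩
    have hρ0 : 0 < ρ := (le_max_right _ _).trans_lt hρ1
    have hq : (σ, r) ∈ L ×ˢ Ioo 0 R' := ⟨hσ, hρ0.trans_le hr.1, hr.2⟩
    have := hr₁s r ⟨φ (σ, r), ⟨⟨_, hq, rfl⟩, hrs.ge, hrs.le⟩, by simp only; rw [hT _ hq]⟩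
    exact absurd (((le_max_left _ _).trans_lt hρ1).trans_le hr.1) (not_lt.2 this)
  have hslice : ContinuousOn (fun σ => φ (σ, ρ)) L :=
    hφ.comp (by fun_prop) fun σ hσ => ⟨hσ, hρ⟩
  -- whether the image lies inside the sphere does not depend on `r ≥ ρ`
  have hconst : ∀ σ ∈ L, ∀ r ∈ Ico ρ R', ‖φ (σ, r)‖ < s → ∀ r' ∈ Ico ρ R', ‖φ (σ, r')‖ < s := by
    intro σ hσ r hr hrs r' hr'
    by_contra hcon
    have hcon' : s < ‖φ (σ, r')‖ := lt_of_le_of_ne (not_lt.1 hcon) (hρs σ hσ r' hr').symm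
    have hcσ : ContinuousOn (fun r => ‖φ (σ, r)‖) (Ico ρ R') :=
      (hφ.comp (by fun_prop) fun r hr => ⟨hσ, hρ.1.trans_le hr.1, hr.2⟩).norm
    obtain ⟨r'', hr'', he⟩ := isPreconnected_Ico.intermediate_value hr hr' hcσ ⟨hrs.le, hcon'.le⟩
    exact hρs σ hσ r'' hr'' he
  have hρm : ρ ∈ Ico ρ R' := ⟨le_rfl, hρ.2⟩
  obtain ⟨G, hG, hGe⟩ := (_root_.continuousOn_iff'.1 hslice.norm) (Iio s) isOpen_Iio
  have hGmem : ∀ σ ∈ L, ‖φ (σ, ρ)‖ < s ↔ σ ∈ G := fun σ hσ =>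
    ⟨fun h => (hGe.subset ⟨h, hσ⟩).1, fun h => (hGe.symm.subset ⟨h, hσ⟩).1⟩
  -- `G` consists of the rays whose far end lies inside the sphere of radius `s`
  rcases (L ∩ G).eq_empty_or_nonempty with he | hne
  · left
    intro ε hε
    have hLc : IsCompact (L ×ˢ Icc ε ρ) := hL.prod isCompact_Icc
    have hLs : L ×ˢ Icc ε ρ ⊆ L ×ˢ Ioo 0 R' := fun q hq =>
      ⟨hq.1, hε.trans_le hq.2.1, hq.2.2.trans_lt hρ.2⟩
    obtain ⟨a, ha, has⟩ : ∃ a > 0, ∀ q ∈ L ×ˢ Icc ε ρ, a ≤ ‖φ q‖ := by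
      rcases (L ×ˢ Icc ε ρ).eq_empty_or_nonempty with he | hne
      · exact ⟨1, one_pos, by simp [he]⟩
      · obtain ⟨q, hq, hmin⟩ := hLc.exists_isMinOn hne (hφ.mono hLs).norm
        exact ⟨‖φ q‖, norm_pos_iff.2 (hφ0 q (hLs hq)), fun q' hq' => hmin hq'⟩
    refine ⟨min a s, lt_min ha hs, fun σ hσ r hr hra => ?_⟩
    rw [lt_min_iff] at hra
    by_contra hcon
    rcases le_or_gt r ρ with hrρ | hrρ
    · exact absurd hra.1 (not_lt.2 (has (σ, r) ⟨hσ, not_lt.1 hcon, hrρ⟩))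
    · have h1 := hconst σ hσ r ⟨hrρ.le, hr.2⟩ hra.2 ρ hρm
      have h2 : σ ∈ L ∩ G := ⟨hσ, (hGmem σ hσ).1 h1⟩
      rw [he] at h2
      exact h2
  · right
    refine ⟨G, hG, hne, ?_⟩
    have hA : IsCompact (L ∩ G) := by
      obtain ⟨G', hG', hGe'⟩ := (_root_.continuousOn_iff_isClosed.1 hslice.norm) (Iic s)
        isClosed_Iic
      have : L ∩ G = L ∩ G' := by
        ext σ
        constructor
        · rintro ⟨hσ, hσG⟩
          exact ⟨hσ, (hGe'.subset ⟨((hGmem σ hσ).2 hσG).le, hσ⟩).1⟩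
        · rintro ⟨hσ, hσG⟩
          have h1 : ‖φ (σ, ρ)‖ ≤ s := (hGe'.symm.subset ⟨hσG, hσ⟩).1
          exact ⟨hσ, (hGmem σ hσ).1 (lt_of_le_of_ne h1 (hρs σ hσ ρ hρm))⟩
      rw [this]
      exact hL.inter_right hG'
    have key : ∀ ε, 0 < ε → ε ≤ s → IsCompact (φ '' ((L ∩ G) ×ˢ Ioo 0 R') \ ball 0 ε) := by
      intro ε hε hεs
      obtain ⟨δ, hδ, hδs⟩ := hsmall ε hε
      have h1 : IsCompact (φ '' ((L ∩ G) ×ˢ Icc δ ρ)) :=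
        (hA.prod isCompact_Icc).image_of_continuousOn (hφ.mono fun q hq =>
          ⟨hq.1.1, hδ.trans_le hq.2.1, hq.2.2.trans_lt hρ.2⟩)
      have hTcK : ContinuousOn (fun z => (T z).2)
          {z ∈ φ '' (L ×ˢ Ioo 0 R') | ε ≤ ‖z‖ ∧ ‖z‖ ≤ s} :=
        (continuous_snd.comp_continuousOn hTc).mono fun z hz => hz.1
      obtain ⟨V, hV, hVe⟩ := (_root_.continuousOn_iff_isClosed.1 hTcK) (Ici ρ) isClosed_Ici
      have h2 := (hK ε hε hεs).inter_left hV
      have h3 : φ '' ((L ∩ G) ×ˢ Ioo 0 R') \ ball 0 ε =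
          (φ '' ((L ∩ G) ×ˢ Icc δ ρ) ∪
            V ∩ {z ∈ φ '' (L ×ˢ Ioo 0 R') | ε ≤ ‖z‖ ∧ ‖z‖ ≤ s}) \ ball 0 ε := by
        ext z
        simp only [Set.mem_sdiff, mem_ball_zero_iff, not_lt, and_congr_left_iff]
        intro hzε
        constructor
        · rintro ⟨⟨σ, r⟩, ⟨⟨hσ, hσG⟩, hr⟩, rfl⟩
          have hδr : δ ≤ r := by
            by_contra h
            exact absurd (hδs σ hσ r hr (not_le.1 h)) (not_lt.2 hzε)
          rcases le_or_gt r ρ with hrρ | hrρ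
          · exact Or.inl ⟨(σ, r), ⟨⟨hσ, hσG⟩, hδr, hrρ⟩, rfl⟩
          · have h4 := hconst σ hσ ρ hρm ((hGmem σ hσ).2 hσG) r ⟨hrρ.le, hr.2⟩
            have h5 : φ (σ, r) ∈ {z ∈ φ '' (L ×ˢ Ioo 0 R') | ε ≤ ‖z‖ ∧ ‖z‖ ≤ s} :=
              ⟨⟨_, ⟨hσ, hr⟩, rfl⟩, hzε, h4.le⟩
            refine Or.inr (hVe.subset ⟨?_, h5⟩)
            rw [mem_preimage, hT _ ⟨hσ, hr⟩]
            exact hrρ.le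
        · rintro (⟨q, hq, rfl⟩ | hz)
          · exact ⟨q, ⟨hq.1, hδ.trans_le hq.2.1, hq.2.2.trans_lt hρ.2⟩, rfl⟩
          · have h4 := hVe.symm.subset hz
            obtain ⟨⟨⟨σ, r⟩, ⟨hσ, hr⟩, rfl⟩, -, hzs⟩ := hz.2
            have h5 : ρ ≤ r := by
              have := h4.1
              rw [mem_preimage, hT _ ⟨hσ, hr⟩] at this
              exact this
            have h6 : ‖φ (σ, r)‖ < s := lt_of_le_of_ne hzs (hρs σ hσ r ⟨h5, hr.2⟩)
            exact ⟨(σ, r), ⟨⟨hσ, (hGmem σ hσ).1 (hconst σ hσ r ⟨h5, hr.2⟩ h6 ρ hρm)⟩, hr⟩, rfl⟩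
      rw [h3]
      exact (h1.union h2).diff isOpen_ball
    intro ε hε
    have h1 := (key (min ε s) (lt_min hε hs) (min_le_right _ _)).diff
      (isOpen_ball (x := 0) (ε := ε))
    have h2 : (φ '' ((L ∩ G) ×ˢ Ioo 0 R') \ ball 0 (min ε s)) \ ball 0 ε =
        φ '' ((L ∩ G) ×ˢ Ioo 0 R') \ ball 0 ε := by
      rw [Set.sdiff_sdiff,
        union_eq_self_of_subset_left (ball_subset_ball (min_le_left _ _))]
    rwa [h2] at h1

end Ends

end

noncomputable section

section ConicalEnd

variable {m : ℕ} {M : Type*} [TopologicalSpace M] [T2Space M] [CompactSpace M]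
    [ChartedSpace (CSpace m) M] [IsManifold 𝓘(ℂ, CSpace m) ω M] [IsManifold 𝓘(ℝ, CSpace m) ∞ M]
  {Y : AlmostCalabiYau m M} {n : ℕ} {X : Set M} {x : Fin n → M}
  {υ : ∀ i, CSpace m ≃L[ℝ] TangentSpace 𝓘(ℝ, CSpace m) (x i)}
  {C : Fin n → Set (CSpace m)} {μ : Fin n → ℝ} {R R' : ℝ} {Υ : Fin n → CSpace m → M}
  {φ : Fin n → CSpace m × ℝ → CSpace m} {S : Fin n → Set M}

theorem IsConicalParametrization.mem_of_mem
    (h : IsConicalParametrization X x C μ R Υ R' φ S) {i : Fin n}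
    {q : CSpace m × ℝ} (hq : q ∈ link (C i) ×ˢ Ioo 0 R') : Υ i (φ i q) ∈ X \ range x := by
  obtain ⟨U, -, hU⟩ := h.isOpen i
  have := (h.diffeo i).1.mapsTo hq
  rw [hU] at this
  exact this.1

/-- Near `x i`, the set `X ∖ {x i}` is contained in `S i`. -/
theorem IsConicalParametrization.exists_nhds_subset
    (h : IsConicalParametrization X x C μ R Υ R' φ S) (hR' : 0 < R')
    (hx : Function.Injective x) (hC : ∀ i, IsSLCone (C i)) {i : Fin n}
    (hμ : 2 < μ i) (hR : 0 < R) (hΥ : Y.IsDarbouxEmbedding (x i) (υ i) R (Υ i)) :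
    ∃ V ∈ 𝓝 (x i), ∀ y ∈ X ∩ V, y ≠ x i → y ∈ S i := by
  obtain ⟨K, hKX, hK, hKS⟩ := h.exists_compact
  have hcl : x i ∈ closure (S i) := by
    rw [mem_closure_iff_nhds]
    intro t ht
    have hc := (hΥ.smooth.contMDiffAt (ball_mem_nhds _ hR)).continuousAt
    rw [← hΥ.map_zero] at ht
    obtain ⟨η, hη, hηt⟩ := Metric.mem_nhds_iff.1 (hc.preimage_mem_nhds ht)
    obtain ⟨δ, hδ, hδs⟩ := (h.decay i).exists_norm_lt hμ hη
    obtain ⟨σ, hσ⟩ := (hC i).link_nonempty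
    obtain ⟨r, hr0, hr⟩ := exists_between (lt_min hδ hR')
    rw [lt_min_iff] at hr
    exact ⟨Υ i (φ i (σ, r)), hηt (mem_ball_zero_iff.2 (hδs σ hσ r ⟨hr0, hr.2⟩ hr.1)),
      (h.diffeo i).1.mapsTo (x := (σ, r)) ⟨hσ, hr0, hr.2⟩⟩
  have hF : IsClosed (K ∪ (⋃ j : {j // j ≠ i}, closure (S j)) ∪
      range fun j : {j // j ≠ i} => x j) :=
    (hK.isClosed.union (isClosed_iUnion_of_finite fun j => isClosed_closure)).union
      (finite_range _).isClosed
  refine ⟨_, hF.isOpen_compl.mem_nhds ?_, ?_⟩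
  · rintro ((hi | hi) | ⟨⟨j, hj⟩, hji⟩)
    · exact (hKX hi).2 (mem_range_self i)
    · obtain ⟨⟨j, hj⟩, hji⟩ := mem_iUnion.1 hi
      exact disjoint_left.1 (h.disjoint_closure hj) hji hcl
    · exact hj (hx hji)
  · rintro y ⟨hyX, hyV⟩ hyi
    have hyx : y ∉ range x := by
      rintro ⟨j, rfl⟩
      exact hyV (Or.inr ⟨⟨j, fun hj => hyi (by rw [hj])⟩, rfl⟩)
    have h1 : y ∈ (X \ range x) \ K := ⟨⟨hyX, hyx⟩, fun hyK => hyV (Or.inl (Or.inl hyK))⟩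
    rw [hKS] at h1
    obtain ⟨j, hj⟩ := mem_iUnion.1 h1
    by_cases hji : j = i
    · exact hji ▸ hj
    · exact (hyV (Or.inl (Or.inr (mem_iUnion.2 ⟨⟨j, hji⟩, subset_closure hj⟩)))).elim

/-- Near `x i`, the set `X` is the end `r < ε` of the conical parametrization. A priori the opposite
end `r → R'` could approach `x i` as well; then a part of `X` would be a compact special Lagrangian
fold with two singular ends at `x i`, which is impossible. -/
theorem IsConicalParametrization.exists_nhds_end
    (h : IsConicalParametrization X x C μ R Υ R' φ S) (hR' : 0 < R') (hm : 0 < m)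
    (hXc : IsCompact X) (hXS : Y.IsSLFold (X \ range x))
    (hx : Function.Injective x) (hC : ∀ i, IsSLCone (C i)) {i : Fin n}
    (hμ : 2 < μ i) (hR : 0 < R) (hΥ : Y.IsDarbouxEmbedding (x i) (υ i) R (Υ i)) {ψ : M → ℝ}
    (hψ : 0 < ψ (x i)) (hid : Y.IsIdentification ψ (x i) (υ i)) {ε : ℝ} (hε : 0 < ε) :
    ∃ V ∈ 𝓝 (x i), ∀ y ∈ (X \ range x) ∩ V, ∃ σ ∈ link (C i),
      ∃ r ∈ Ioo 0 R', r < ε ∧ y = Υ i (φ i (σ, r)) := by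
  obtain ⟨V, hV, hVS⟩ := h.exists_nhds_subset hR' hx hC hμ hR hΥ
  have hc := (hΥ.smooth.contMDiffAt (ball_mem_nhds _ hR)).continuousAt
  have hV' := hV
  rw [← hΥ.map_zero] at hV'
  obtain ⟨η, hη, hηV⟩ := Metric.mem_nhds_iff.1 (hc.preimage_mem_nhds hV')
  obtain ⟨s, hs, hsη⟩ := exists_between (lt_min hη hR)
  rw [lt_min_iff] at hsη
  have hsR : closedBall (0 : CSpace m) s ⊆ ball 0 R := closedBall_subset_ball hsη.2
  have hsV : ∀ z ∈ closedBall (0 : CSpace m) s, Υ i z ∈ V := fun z hz =>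
    hηV (closedBall_subset_ball hsη.1 hz)
  have hφ0 : ∀ q ∈ link (C i) ×ˢ Ioo 0 R', φ i q ≠ 0 := by
    intro q hq h0
    have := h.mem_of_mem hq
    rw [h0, hΥ.map_zero] at this
    exact this.2 (mem_range_self i)
  have hS : ∀ z ∈ closedBall (0 : CSpace m) s, z ≠ 0 → Υ i z ∈ X →
      z ∈ φ i '' (link (C i) ×ˢ Ioo 0 R') := by
    intro z hz hz0 hzX
    have h1 : Υ i z ≠ x i := fun he => hz0 (hΥ.injOn (hsR hz) (mem_ball_self hR)
      (he.trans hΥ.map_zero.symm))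
    obtain ⟨q, hq, hqz⟩ := (h.diffeo i).1.surjOn (hVS _ ⟨hzX, hsV z hz⟩ h1)
    exact ⟨q, hq, hΥ.injOn (h.mapsTo i hq) (hsR hz) hqz⟩
  obtain ⟨T', hT', hT's⟩ := (h.diffeo i).2.2
  have hT : ∀ q ∈ link (C i) ×ˢ Ioo 0 R', T' (Υ i (φ i q)) = q := fun q hq => hT'.1 hq
  have hTs : ContDiffOn ℝ ∞ (fun z => T' (Υ i z)) (φ i '' (link (C i) ×ˢ Ioo 0 R')) := by
    rw [← contMDiffOn_iff_contDiffOn]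
    refine hT's.comp (hΥ.smooth.mono ?_) ?_
    · rintro _ ⟨q, hq, rfl⟩
      exact h.mapsTo i hq
    · rintro _ ⟨q, hq, rfl⟩
      exact (h.diffeo i).1.mapsTo hq
  have hK : ∀ a, 0 < a → a ≤ s →
      IsCompact {z ∈ φ i '' (link (C i) ×ˢ Ioo 0 R') | a ≤ ‖z‖ ∧ ‖z‖ ≤ s} := by
    intro a ha has
    obtain ⟨A, hA, hAe⟩ := (_root_.continuousOn_iff_isClosed.1 (hΥ.smooth.continuousOn.mono hsR)) X
      hXc.isClosed
    have he : {z ∈ φ i '' (link (C i) ×ˢ Ioo 0 R') | a ≤ ‖z‖ ∧ ‖z‖ ≤ s} =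
        (closedBall 0 s ∩ A) \ ball 0 a := by
      ext z
      constructor
      · rintro ⟨⟨q, hq, rfl⟩, h1, h2⟩
        have h3 : φ i q ∈ closedBall 0 s := mem_closedBall_zero_iff.2 h2
        exact ⟨⟨h3, (hAe.subset ⟨(h.mem_of_mem hq).1, h3⟩).1⟩,
          fun h4 => absurd (mem_ball_zero_iff.1 h4) (not_lt.2 h1)⟩
      · rintro ⟨⟨h1, h2⟩, h3⟩
        have h4 : a ≤ ‖z‖ := not_lt.1 fun h4 => h3 (mem_ball_zero_iff.2 h4)
        exact ⟨hS z h1 (norm_pos_iff.1 (ha.trans_le h4)) (hAe.symm.subset ⟨h2, h1⟩).1, h4,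
          mem_closedBall_zero_iff.1 h1⟩
    rw [he]
    exact ((isCompact_closedBall _ _).inter_right hA).diff isOpen_ball
  rcases closed_end_or_exists_double_end (hC i).isCompact_link hR' (h.smooth i).continuousOn hφ0
    (fun η hη => (h.decay i).exists_norm_lt hμ hη) hT hTs.continuousOn hs hK with hl | hr
  · obtain ⟨a, ha, has⟩ := hl ε hε
    have hb : ball (0 : CSpace m) (min a s) ⊆ closedBall 0 s :=
      (ball_subset_ball (min_le_right _ _)).trans ball_subset_closedBall
    refine ⟨Υ i '' ball 0 (min a s), (hΥ.isOpen_image isOpen_ball (hb.trans hsR)).mem_nhds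
      ⟨0, mem_ball_self (lt_min ha hs), hΥ.map_zero⟩, ?_⟩
    rintro _ ⟨hyX, z, hz, rfl⟩
    have hz0 : z ≠ 0 := by
      rintro rfl
      rw [hΥ.map_zero] at hyX
      exact hyX.2 (mem_range_self i)
    obtain ⟨⟨σ, r⟩, hq, rfl⟩ := hS z (hb hz) hz0 hyX.1
    exact ⟨σ, hq.1, r, hq.2, has σ hq.1 r hq.2
      ((mem_ball_zero_iff.1 hz).trans_le (min_le_left _ _)), rfl⟩
  · obtain ⟨G, hG, ⟨σ, hσ⟩, hGc⟩ := hr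
    have hsub : (link (C i) ∩ G) ×ˢ Ioo 0 R' ⊆ link (C i) ×ˢ Ioo 0 R' :=
      prod_mono inter_subset_left subset_rfl
    refine (hΥ.not_isCompact_of_isSLFold hm hψ hid hXS
      (Q := φ i '' ((link (C i) ∩ G) ×ˢ Ioo 0 R')) ?_ ?_
      ⟨_, (σ, R' / 2), ⟨hσ, half_pos hR', half_lt_self hR'⟩, rfl⟩ hGc (fun y hy => ?_) ?_).elim
    · rintro _ ⟨q, hq, rfl⟩
      exact h.mapsTo i (hsub hq)
    · rintro ⟨q, hq, hq0⟩
      exact hφ0 q (hsub hq) hq0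
    · exact (hC i).exists_localParam_image (h.smooth i) hG hT (hTs.mono (image_mono hsub)) hy
    · rintro _ ⟨q, hq, rfl⟩
      exact h.mem_of_mem (hsub hq)

end ConicalEnd

end

/-! ### Existence and uniqueness of the normal parametrization -/

theorem theorem4p1 {m : ℕ} (hm : 2 < m) {M : Type*} [TopologicalSpace M] [T2Space M]
    [CompactSpace M] [ChartedSpace (CSpace m) M] [IsManifold 𝓘(ℂ, CSpace m) ω M]
    (Y : AlmostCalabiYau m M) (ψ : M → ℝ) (hψ : Y.IsConformalFactor ψ)
    {n : ℕ} (X : Set M) (x : Fin n → M)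
    (υ : ∀ i, CSpace m ≃L[ℝ] TangentSpace 𝓘(ℝ, CSpace m) (x i))
    (C : Fin n → Set (CSpace m)) (μ : Fin n → ℝ)
    (hX : Y.HasConicalSingularities ψ X x υ C μ)
    (R : ℝ) (hR : 0 < R) (Υ : Fin n → CSpace m → M)
    (hΥ : ∀ i, Y.IsDarbouxEmbedding (x i) (υ i) R (Υ i)) :
    ∃ R₀ ∈ Ioc 0 R, ∀ R' ∈ Ioc 0 R₀,
      ∃ (φ : Fin n → CSpace m × ℝ → CSpace m) (S : Fin n → Set M),
        (IsConicalParametrization X x C μ R Υ R' φ S ∧ ∀ i, IsNormalToCone (C i) R' (φ i)) ∧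
        ∀ (φ' : Fin n → CSpace m × ℝ → CSpace m) (S' : Fin n → Set M),
          IsConicalParametrization X x C μ R Υ R' φ' S' →
          (∀ i, IsNormalToCone (C i) R' (φ' i)) →
          ∀ i, EqOn (φ' i) (φ i) (link (C i) ×ˢ Ioo 0 R') ∧ S' i = S i := by
  have : IsManifold 𝓘(ℝ, CSpace m) ∞ M := isManifold_real_of_complex
  obtain ⟨R₁, hR₁, Υ₁, hΥ₁, R₁', hR₁', φ₁, S₁, hφ₁⟩ := hX.exists_param
  refine exists_unique_normal_parametrization hX.compact hX.injective hX.cone hX.rate_mem hR hΥ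
    hR₁ hR₁'.1 hΥ₁ hφ₁ fun i ε hε => ?_
  exact hφ₁.exists_nhds_end hR₁'.1 (by omega) hX.compact hX.slFold hX.injective hX.cone
    (hX.rate_mem i).1 hR₁ (hΥ₁ i) (hψ.1 (x i)) (hX.identification i) hε
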